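/- Let $k$ be a field of characteristic zero, $X$ a smooth $k$-scheme of pure dimension $2n$ with a symplectic form $\omega$ and associated Poisson bivector $P$, and $j\colon Y\hookrightarrow X$ a smooth closed Lagrangian subscheme (of pure dimension $n$) with ideal $I$. Let $\mathcal{O}_h$ be a deformation quantization of $\mathcal{O}_X$: a sheaf of $k[[h]]$-algebras with a reduction homomorphism to $\mathcal{O}_X$, locally isomorphic to $\mathcal{O}_X[[h]]$ as a sheaf of $k[[h]]$-modules over $\mathcal{O}_X$, with $a*b\equiv ab+\frac12 hP(da,db)$ modulo $h^2$. Let $E$ be a vector bundle of rank $r\ge 1$ on $Y$. A Picard algebroid on $Y$ is a Lie algebroid $\mathcal{L}$ with an exact sequence $0\to\mathcal{O}_Y\to\mathcal{L}\to T_Y\to 0$ in which $1\in\mathcal{O}_Y$ is central. Its class $c(\mathcal{L})\in H^2_F(Y)=H^2(Y,0\to\Omega^1_Y\to\Omega^2_Y\to\cdots)$ is given by the differences and the curvatures of local $\mathcal{O}_Y$-linear splittings of $\mathcal{L}\to T_Y$. The combination $\lambda_1\mathcal{L}_1+\lambda_2\mathcal{L}_2$ is the Picard algebroid with a morphism of Lie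 algebroids $s_{\lambda_1,\lambda_2}\colon\mathcal{L}_1\times_{T_Y}\mathcal{L}_2\to\lambda_1\mathcal{L}_1+\lambda_2\mathcal{L}_2$ which is $(a_1,a_2)\mapsto\lambda_1a_1+\lambda_2a_2$ on functions. For a vector bundle $M$ let $\mathcal{L}(M)$ be its Atiyah algebroid (first order differential operators with scalar symbol). An $\mathcal{L}$-module structure on $M$ is a morphism of Lie algebroids $\mathcal{L}\to\mathcal{L}(M)$ under which functions act by multiplication. Put $c_1(K_Y)=c(\mathcal{L}(K_Y))$. Let $I_h\subset\mathcal{O}_h$ be the preimage of $I$. Let $\mathcal{L}(\mathcal{O}_h)=I_h/(I_h*I_h)$, with the bracket induced by $\frac1h(a*b-b*a)$, the anchor $x\mapsto\frac1h[x,\cdot\,]$, the embedding $\mathcal{O}_Y\simeq h\mathcal{O}_h/hI_h$, and the $\mathcal{O}_Y$-action induced by $\frac12(f*x+x*f)$; let $\mathcal{L}^+(\mathcal{O}_h)=\mathcal{L}(\mathcal{O}_h)+\frac12\mathcal{L}(K_Y)$. Let $\omega_1\in H^2_F(X)$ be the first order class of $\mathcal{O}_h$: if $s_i\colon\mathcal{O}_X\to\mathcal{O}_h$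 are the local sections given by local trivializations, with $\frac1h[s_i(a),s_i(b)]\equiv s_i(P(da,db))+h\,\omega_1^{(i)}(X_a,X_b)$ and $s_j(a)\equiv s_i(a)+hA_{ij}(X_a)$ modulo $h^2$, where $X_a=P(da,\cdot)$, then $\omega_1$ is the class of the cocycle $(\omega_1^{(i)},A_{ij})$. Then: 1. $\mathcal{L}(\mathcal{O}_h)$ is a well-defined Picard algebroid, and $\mathcal{L}^+(\mathcal{O}_h)$ exists. 2. Let $\mathcal{E}_2$ be a flat deformation quantization of $E$ modulo $h^2$, that is, a sheaf of $\mathcal{O}_h/h^2$-modules, flat over $k[h]/h^2$, with $\mathcal{E}_2/h\mathcal{E}_2\simeq j_*E$. If $\mathcal{E}_2$ extends to a flat deformation quantization modulo $h^3$, then there is a unique $\mathcal{L}^+(\mathcal{O}_h)$-module structure on $E$ for which, for every local section $x$ of $I_h$ with class $[x]\in\mathcal{L}(\mathcal{O}_h)$ and image $\bar x\in T_Y$, the section $s_{1,\frac12}([x],l(\bar x))$ acts on $E\simeq\mathcal{E}_2/h\mathcal{E}_2$ as the map $x\colon\mathcal{E}_2/h\mathcal{E}_2\to h\mathcal{E}_2\simeq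 E$; here $l$ is the Lie derivative on $K_Y$. 3. The classes $\omega_1$, $c(\mathcal{L}(\mathcal{O}_h))$, $c_1(K_Y)$ and $c(\mathcal{L}^+(\mathcal{O}_h))$ are well defined, $c(\mathcal{L}(\mathcal{O}_h))=j^*\omega_1$, and $c(\mathcal{L}^+(\mathcal{O}_h))=\frac12c_1(K_Y)+j^*\omega_1$ in $H^2_F(Y)$. 4. For an arbitrary vector bundle $E$ of rank $r\ge1$ on $Y$, sending a module structure $\gamma\colon\mathcal{L}^+(\mathcal{O}_h)\to\mathcal{L}(E)$ to its compositions with $\mathcal{L}(E)\to\mathcal{L}(\det E)$ and $\mathcal{L}(E)\to\mathcal{L}(\mathbb{P}(E))$ is a bijection from the set of $\mathcal{L}^+(\mathcal{O}_h)$-module structures on $E$ to the set of pairs consisting of an isomorphism of Lie algebroids $\mathcal{L}^+(\mathcal{O}_h)\simeq\mathcal{L}(\det E)$ with $f\mapsto rf$ on functions, and a flat connection $T_Y\to\mathcal{L}(\mathbb{P}(E))$ on the $PGL(r)$-bundle $\mathbb{P}(E)$ associated to $E$. -/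

import Mathlib

open CategoryTheory AlgebraicGeometry Opposite TopologicalSpace

universe u

noncomputable section

namespace LagQuant

/-! ### Presheaves of modules on a scheme, section by section -/

section Basic

variable {Y : Scheme.{u}}

/-- Restriction of functions. -/
def rs {U V : Y.Opens} (h : V ≤ U) : Γ(Y, U) →+* Γ(Y, V) :=
  (Y.presheaf.map (homOfLE h).op).hom

theorem rs_id {U : Y.Opens} (h : U ≤ U) (f : Γ(Y, U)) : rs h f = f := by
  simp [rs]

theorem rs_rs {U V W : Y.Opens} (h : V ≤ U) (h' : W ≤ V) (f : Γ(Y, U)) :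
    rs h' (rs h f) = rs (h'.trans h) f := by
  have : (homOfLE (h'.trans h)).op = (homOfLE h).op ≫ (homOfLE h').op := rfl
  simp [rs, this]

/-- The opens contained in `U`. -/
abbrev Below (U : Y.Opens) := {V : Y.Opens // V ≤ U}

/-- An open below `V`, regarded as an open below the larger open `U`. -/
abbrev Below.up {U V : Y.Opens} (h : V ≤ U) (W : Below V) : Below U := ⟨W.1, W.2.trans h⟩

/-- The largest open below `U`. -/
abbrev Below.self (U : Y.Opens) : Below U := ⟨U, le_rfl⟩

variable (Y) in
/-- A presheaf of `𝒪_Y`-modules. -/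
structure ModPresheaf where
  Sec : Y.Opens → Type u
  [grp : ∀ U, AddCommGroup (Sec U)]
  [mod : ∀ U, Module Γ(Y, U) (Sec U)]
  res : ∀ {U V : Y.Opens}, V ≤ U → Sec U →+ Sec V
  res_id : ∀ {U : Y.Opens} (h : U ≤ U) (m : Sec U), res h m = m
  res_res : ∀ {U V W : Y.Opens} (h : V ≤ U) (h' : W ≤ V) (m : Sec U),
    res h' (res h m) = res (h'.trans h) m
  res_smul : ∀ {U V : Y.Opens} (h : V ≤ U) (f : Γ(Y, U)) (m : Sec U),
    res h (f • m) = rs h f • res h m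

attribute [instance] ModPresheaf.grp ModPresheaf.mod

/-- The sheaf axiom. -/
def ModPresheaf.IsSheaf (M : ModPresheaf Y) : Prop :=
  ∀ (I : Type u) (U : I → Y.Opens) (s : ∀ i, M.Sec (U i)),
    (∀ i j, M.res (inf_le_left : U i ⊓ U j ≤ U i) (s i) =
      M.res (inf_le_right : U i ⊓ U j ≤ U j) (s j)) →
    ∃! t : M.Sec (⨆ i, U i), ∀ i, M.res (le_iSup U i) t = s i

/-- The presheaf of modules underlying a sheaf of `𝒪_Y`-modules. -/
def ModPresheaf.of (E : Y.Modules) : ModPresheaf Y where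
  Sec U := Γ(E, U)
  res h := (E.presheaf.map (homOfLE h).op).hom
  res_id {U} h m := by
    have : (homOfLE h).op = 𝟙 (op U) := rfl
    rw [this]; simp
  res_res h h' m := by
    have : (homOfLE (h'.trans h)).op = (homOfLE h).op ≫ (homOfLE h').op := rfl
    rw [this]; simp
  res_smul h f m := E.map_smul (homOfLE h) f m

/-- `E` is a vector bundle of rank `r`: locally it has a frame of `r` sections, that is, sections
whose restrictions to every smaller open form a basis. -/
def IsVectorBundle (E : Y.Modules) (r : ℕ) : Prop :=
  ∀ y : Y, ∃ U : Y.Opens, y ∈ U ∧ ∃ b : Fin r → (ModPresheaf.of E).Sec U,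
    ∀ (V : Y.Opens) (h : V ≤ U),
      LinearIndependent Γ(Y, V) (fun i => (ModPresheaf.of E).res h (b i)) ∧
      Submodule.span Γ(Y, V) (Set.range fun i => (ModPresheaf.of E).res h (b i)) = ⊤

/-- The presheaf of alternating `p`-linear forms on `M` with values in `𝒪_Y`. A section over `U`
is a family of alternating forms on `M(V)`, for `V ⊆ U`, compatible with restriction. -/
def altSec (p : ℕ) (M : ModPresheaf Y) (U : Y.Opens) :
    AddSubgroup (∀ V : Below U, M.Sec V.1 [⋀^Fin p]→ₗ[Γ(Y, V.1)] Γ(Y, V.1)) where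
  carrier := {α | ∀ (V W : Below U) (h : W.1 ≤ V.1) (m : Fin p → M.Sec V.1),
    rs h (α V m) = α W (fun i => M.res h (m i))}
  zero_mem' := by intro V W h m; simp
  add_mem' := by intro α β hα hβ V W h m; simp [hα V W h m, hβ V W h m]
  neg_mem' := by intro α hα V W h m; simp [hα V W h m]

instance (p : ℕ) (M : ModPresheaf Y) (U : Y.Opens) : Module Γ(Y, U) (altSec p M U) where
  smul f α := ⟨fun V => rs V.2 f • α.1 V, by
    intro V W h m
    simp [α.2 V W h m, rs_rs]⟩
  one_smul α := Subtype.ext (funext fun V => by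
    change rs V.2 1 • α.1 V = α.1 V; simp)
  mul_smul f g α := Subtype.ext (funext fun V => by
    change rs V.2 (f * g) • α.1 V = rs V.2 f • rs V.2 g • α.1 V; simp [mul_smul])
  smul_zero f := Subtype.ext (funext fun V => by
    change rs V.2 f • (0 : M.Sec V.1 [⋀^Fin p]→ₗ[Γ(Y, V.1)] Γ(Y, V.1)) = 0; simp)
  smul_add f α β := Subtype.ext (funext fun V => by
    change rs V.2 f • (α.1 V + β.1 V) = rs V.2 f • α.1 V + rs V.2 f • β.1 V; simp)
  add_smul f g α := Subtype.ext (funext fun V => by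
    change rs V.2 (f + g) • α.1 V = rs V.2 f • α.1 V + rs V.2 g • α.1 V; simp [add_smul])
  zero_smul α := Subtype.ext (funext fun V => by
    change rs V.2 0 • α.1 V = 0; simp)

def alt (p : ℕ) (M : ModPresheaf Y) : ModPresheaf Y where
  Sec U := altSec p M U
  res h :=
    { toFun := fun α => ⟨fun V => α.1 (V.up h), fun V W h' m => α.2 (V.up h) (W.up h) h' m⟩
      map_zero' := rfl
      map_add' := fun _ _ => rfl }
  res_id _ _ := rfl
  res_res _ _ _ := rfl
  res_smul h f α := Subtype.ext (funext fun V => by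
    change rs (V.up h).2 f • α.1 (V.up h) = rs V.2 (rs h f) • α.1 (V.up h)
    rw [rs_rs])

/-- The sheaf `End(M)`. A section over `U` is a family of linear endomorphisms of `M(V)`, for
`V ⊆ U`, compatible with restriction. -/
def endSec (M : ModPresheaf Y) (U : Y.Opens) :
    AddSubgroup (∀ V : Below U, M.Sec V.1 →ₗ[Γ(Y, V.1)] M.Sec V.1) where
  carrier := {a | ∀ (V W : Below U) (h : W.1 ≤ V.1) (m : M.Sec V.1),
    M.res h (a V m) = a W (M.res h m)}
  zero_mem' := by intro V W h m; simp
  add_mem' := by intro α β hα hβ V W h m; simp [hα V W h m, hβ V W h m]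
  neg_mem' := by intro α hα V W h m; simp [hα V W h m]

instance (M : ModPresheaf Y) (U : Y.Opens) : Module Γ(Y, U) (endSec M U) where
  smul f α := ⟨fun V => rs V.2 f • α.1 V, by
    intro V W h m
    simp [α.2 V W h m, rs_rs, M.res_smul]⟩
  one_smul α := Subtype.ext (funext fun V => by
    change rs V.2 1 • α.1 V = α.1 V; simp)
  mul_smul f g α := Subtype.ext (funext fun V => by
    change rs V.2 (f * g) • α.1 V = rs V.2 f • rs V.2 g • α.1 V; simp [mul_smul])
  smul_zero f := Subtype.ext (funext fun V => by
    change rs V.2 f • (0 : M.Sec V.1 →ₗ[Γ(Y, V.1)] M.Sec V.1) = 0; simp)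
  smul_add f α β := Subtype.ext (funext fun V => by
    change rs V.2 f • (α.1 V + β.1 V) = rs V.2 f • α.1 V + rs V.2 f • β.1 V; simp)
  add_smul f g α := Subtype.ext (funext fun V => by
    change rs V.2 (f + g) • α.1 V = rs V.2 f • α.1 V + rs V.2 g • α.1 V; simp [add_smul])
  zero_smul α := Subtype.ext (funext fun V => by
    change rs V.2 0 • α.1 V = 0; simp)

def endMod (M : ModPresheaf Y) : ModPresheaf Y where
  Sec U := endSec M U
  res h :=
    { toFun := fun α => ⟨fun V => α.1 (V.up h), fun V W h' m => α.2 (V.up h) (W.up h) h' m⟩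
      map_zero' := rfl
      map_add' := fun _ _ => rfl }
  res_id _ _ := rfl
  res_res _ _ _ := rfl
  res_smul h f α := Subtype.ext (funext fun V => by
    change rs (V.up h).2 f • α.1 (V.up h) = rs V.2 (rs h f) • α.1 (V.up h)
    rw [rs_rs])

/-- Composition of endomorphisms. -/
def endMul {M : ModPresheaf Y} {U : Y.Opens} (a b : (endMod M).Sec U) : (endMod M).Sec U :=
  ⟨fun V => (a.1 V).comp (b.1 V), fun V W h m => by
    simp only [LinearMap.comp_apply]
    rw [a.2 V W h, b.2 V W h]⟩

end Basic

/-! ### Vector fields and the tangent sheaf -/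

section Tangent

variable (k : Type u) [Field k]

/-- The constants `k → 𝒪_Y(U)` of a `k`-scheme. -/
def cst {Y : Scheme.{u}} [Y.Over (Spec (.of k))] (U : Y.Opens) : k →+* Γ(Y, U) :=
  ((Scheme.ΓSpecIso (.of k)).inv ≫ (Y ↘ Spec (.of k)).appTop ≫
    Y.presheaf.map (homOfLE le_top).op).hom

theorem rs_cst {Y : Scheme.{u}} [Y.Over (Spec (.of k))] {U V : Y.Opens} (h : V ≤ U) (c : k) :
    rs h (cst k U c) = cst k V c := by
  have : (homOfLE (le_top : V ≤ ⊤)).op = (homOfLE (le_top : U ≤ ⊤)).op ≫ (homOfLE h).op := rfl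
  simp [rs, cst, this]

variable {Y : Scheme.{u}} [Y.Over (Spec (.of k))]

/-- The sections over `U` of the tangent sheaf `T_Y`: the `k`-derivations of the sheaf `𝒪_U`. -/
def vfSec (U : Y.Opens) : AddSubgroup (∀ V : Below U, Γ(Y, V.1) →+ Γ(Y, V.1)) where
  carrier := {ξ | (∀ V a b, ξ V (a * b) = a * ξ V b + ξ V a * b) ∧
    (∀ V c, ξ V (cst k V.1 c) = 0) ∧
    ∀ (V W : Below U) (h : W.1 ≤ V.1) a, rs h (ξ V a) = ξ W (rs h a)}
  zero_mem' := by simp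
  add_mem' := by
    rintro ξ η ⟨h1, h2, h3⟩ ⟨g1, g2, g3⟩
    refine ⟨fun V a b => ?_, fun V c => ?_, fun V W h a => ?_⟩
    · simp only [Pi.add_apply, AddMonoidHom.add_apply, h1, g1]; ring
    · simp [h2, g2]
    · simp [h3 V W h, g3 V W h]
  neg_mem' := by
    rintro ξ ⟨h1, h2, h3⟩
    refine ⟨fun V a b => ?_, fun V c => ?_, fun V W h a => ?_⟩
    · simp only [Pi.neg_apply, AddMonoidHom.neg_apply, h1]; ring
    · simp [h2]
    · simp [h3 V W h]

abbrev VF (U : Y.Opens) : Type u := vfSec k U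

variable {k}

/-- The derivative of a function along a vector field. -/
def VF.app {U : Y.Opens} (ξ : VF k U) (f : Γ(Y, U)) : Γ(Y, U) := ξ.1 (Below.self U) f

theorem VF.ext {U : Y.Opens} {ξ η : VF k U} (h : ∀ V a, ξ.1 V a = η.1 V a) : ξ = η :=
  Subtype.ext (funext fun V => AddMonoidHom.ext (h V))

instance (U : Y.Opens) : Module Γ(Y, U) (VF k U) where
  smul f ξ := ⟨fun V => (AddMonoidHom.mulLeft (rs V.2 f)).comp (ξ.1 V), by
    refine ⟨fun V a b => ?_, fun V c => ?_, fun V W h a => ?_⟩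
    · simp only [AddMonoidHom.comp_apply, AddMonoidHom.coe_mulLeft, ξ.2.1]; ring
    · simp [ξ.2.2.1]
    · simp [ξ.2.2.2 V W h, rs_rs]⟩
  one_smul ξ := VF.ext fun V a => by change rs V.2 1 * ξ.1 V a = ξ.1 V a; simp
  mul_smul f g ξ := VF.ext fun V a => by
    change rs V.2 (f * g) * ξ.1 V a = rs V.2 f * (rs V.2 g * ξ.1 V a); simp [mul_assoc]
  smul_zero f := VF.ext fun V a => by change rs V.2 f * (0 : Γ(Y, V.1)) = 0; simp
  smul_add f ξ η := VF.ext fun V a => by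
    change rs V.2 f * (ξ.1 V a + η.1 V a) = rs V.2 f * ξ.1 V a + rs V.2 f * η.1 V a; ring
  add_smul f g ξ := VF.ext fun V a => by
    change rs V.2 (f + g) * ξ.1 V a = rs V.2 f * ξ.1 V a + rs V.2 g * ξ.1 V a
    rw [map_add]; ring
  zero_smul ξ := VF.ext fun V a => by change rs V.2 0 * ξ.1 V a = 0; simp

theorem VF.smul_val {U : Y.Opens} (f : Γ(Y, U)) (ξ : VF k U) (V : Below U) (a : Γ(Y, V.1)) :
    (f • ξ).1 V a = rs V.2 f * ξ.1 V a := rfl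

theorem VF.add_val {U : Y.Opens} (ξ η : VF k U) (V : Below U) (a : Γ(Y, V.1)) :
    (ξ + η).1 V a = ξ.1 V a + η.1 V a := rfl

/-- Restriction of vector fields. -/
def VF.res {U V : Y.Opens} (h : V ≤ U) : VF k U →+ VF k V where
  toFun ξ := ⟨fun W => ξ.1 (W.up h), fun W => ξ.2.1 (W.up h), fun W => ξ.2.2.1 (W.up h),
    fun W W' h' => ξ.2.2.2 (W.up h) (W'.up h) h'⟩
  map_zero' := rfl
  map_add' _ _ := rfl

/-- The commutator of vector fields. -/
def VF.comm {U : Y.Opens} (ξ η : VF k U) : VF k U :=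
  ⟨fun V => (ξ.1 V).comp (η.1 V) - (η.1 V).comp (ξ.1 V), by
    refine ⟨fun V a b => ?_, fun V c => ?_, fun V W h a => ?_⟩
    · simp only [AddMonoidHom.sub_apply, AddMonoidHom.comp_apply, ξ.2.1, η.2.1, map_add]; ring
    · simp [ξ.2.2.1, η.2.2.1]
    · simp [ξ.2.2.2 V W h, η.2.2.2 V W h]⟩

theorem VF.comm_val {U : Y.Opens} (ξ η : VF k U) (V : Below U) (a : Γ(Y, V.1)) :
    (ξ.comm η).1 V a = ξ.1 V (η.1 V a) - η.1 V (ξ.1 V a) := rfl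

def VF.bracket (U : Y.Opens) : VF k U →+ VF k U →+ VF k U :=
  AddMonoidHom.mk' (fun ξ => AddMonoidHom.mk' (fun η => ξ.comm η) (fun η η' => VF.ext fun V a => by
      simp only [VF.comm_val, VF.add_val, map_add]; ring))
    (fun ξ ξ' => AddMonoidHom.ext fun η => VF.ext fun V a => by
      change (VF.comm (ξ + ξ') η).1 V a = (VF.comm ξ η + VF.comm ξ' η).1 V a
      simp only [VF.comm_val, VF.add_val, map_add]; ring)

variable (k Y) in
/-- The tangent sheaf as a presheaf of modules. -/
def tangentMod : ModPresheaf Y where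
  Sec U := VF k U
  res h := VF.res h
  res_id _ _ := rfl
  res_res _ _ _ := rfl
  res_smul h f ξ := VF.ext fun V a => by
    change rs (V.up h).2 f * ξ.1 (V.up h) a = rs V.2 (rs h f) * ξ.1 (V.up h) a
    rw [rs_rs]

end Tangent

/-! ### Lie algebroids -/

section Algebroids

variable (k : Type u) [Field k] (Y : Scheme.{u}) [Y.Over (Spec (.of k))]

/-- A Lie algebroid on `Y`, up to the sheaf axiom, which is `ModPresheaf.IsSheaf`: the Picard
algebroids below are required to satisfy it, and the algebroids that are constructed explicitly
satisfy it since their sections are families of local operators. -/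
structure LieAlgebroid extends ModPresheaf Y where
  anchor : ∀ U, Sec U →ₗ[Γ(Y, U)] VF k U
  anchor_res : ∀ {U V : Y.Opens} (h : V ≤ U) (x : Sec U),
    anchor V (res h x) = VF.res h (anchor U x)
  bracket : ∀ U, Sec U →+ Sec U →+ Sec U
  bracket_res : ∀ {U V : Y.Opens} (h : V ≤ U) (x y : Sec U),
    res h (bracket U x y) = bracket V (res h x) (res h y)
  bracket_self : ∀ U (x : Sec U), bracket U x x = 0
  jacobi : ∀ U (x y z : Sec U),
    bracket U x (bracket U y z) = bracket U (bracket U x y) z + bracket U y (bracket U x z)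
  leibniz : ∀ U (x : Sec U) (f : Γ(Y, U)) (y : Sec U),
    bracket U x (f • y) = f • bracket U x y + (anchor U x).app f • y
  anchor_bracket : ∀ U (x y : Sec U),
    anchor U (bracket U x y) = (anchor U x).comm (anchor U y)

/-- A Lie algebroid with a morphism `𝒪_Y → L` into the kernel of the anchor whose value at `1` is
central. -/
structure UnitalAlgebroid extends LieAlgebroid k Y where
  unit : ∀ U, Γ(Y, U) →ₗ[Γ(Y, U)] Sec U
  unit_res : ∀ {U V : Y.Opens} (h : V ≤ U) (f : Γ(Y, U)), res h (unit U f) = unit V (rs h f)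
  anchor_unit : ∀ U (f : Γ(Y, U)), anchor U (unit U f) = 0
  bracket_unit : ∀ U (x : Sec U) (f : Γ(Y, U)),
    bracket U x (unit U f) = unit U ((anchor U x).app f)

variable {k Y}

/-- `L` is a Picard algebroid: it is a sheaf and `0 → 𝒪_Y → L → T_Y → 0` is exact. -/
structure UnitalAlgebroid.IsPicard (L : UnitalAlgebroid k Y) : Prop where
  isSheaf : L.toModPresheaf.IsSheaf
  injective : ∀ U, Function.Injective (L.unit U)
  exact : ∀ U (x : L.Sec U), L.anchor U x = 0 → ∃ f, L.unit U f = x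
  surjective : ∀ U (ξ : VF k U), ∀ y ∈ U, ∃ (V : Y.Opens) (h : V ≤ U), y ∈ V ∧
    ∃ x : L.Sec V, L.anchor V x = VF.res h ξ

/-- Morphisms of Lie algebroids (over the identity of `T_Y`). -/
structure LieAlgebroid.Hom (L L' : LieAlgebroid k Y) where
  app : ∀ U, L.Sec U →ₗ[Γ(Y, U)] L'.Sec U
  app_res : ∀ {U V : Y.Opens} (h : V ≤ U) (x : L.Sec U), app V (L.res h x) = L'.res h (app U x)
  anchor_app : ∀ U (x : L.Sec U), L'.anchor U (app U x) = L.anchor U x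
  app_bracket : ∀ U (x y : L.Sec U), app U (L.bracket U x y) = L'.bracket U (app U x) (app U y)

variable (k Y) in
/-- The tangent sheaf as a Lie algebroid. -/
def tangent : LieAlgebroid k Y where
  toModPresheaf := tangentMod k Y
  anchor _ := LinearMap.id
  anchor_res _ _ := rfl
  bracket U := VF.bracket U
  bracket_res _ _ _ := rfl
  bracket_self U ξ := VF.ext fun V a => sub_self _
  jacobi U ξ η ζ := VF.ext fun V a => by
    change ξ.1 V (η.1 V (ζ.1 V a) - ζ.1 V (η.1 V a)) - (η.1 V (ζ.1 V (ξ.1 V a)) -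
      ζ.1 V (η.1 V (ξ.1 V a))) = (ξ.1 V (η.1 V (ζ.1 V a)) - η.1 V (ξ.1 V (ζ.1 V a)) -
      ζ.1 V (ξ.1 V (η.1 V a) - η.1 V (ξ.1 V a))) + (η.1 V (ξ.1 V (ζ.1 V a) - ζ.1 V (ξ.1 V a)) -
      (ξ.1 V (ζ.1 V (η.1 V a)) - ζ.1 V (ξ.1 V (η.1 V a))))
    simp only [map_sub]; ring
  leibniz U ξ f η := VF.ext fun V a => by
    change ξ.1 V (rs V.2 f * η.1 V a) - rs V.2 f * η.1 V (ξ.1 V a) =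
      rs V.2 f * (ξ.1 V (η.1 V a) - η.1 V (ξ.1 V a)) + rs V.2 (VF.app ξ f) * η.1 V a
    have h : rs V.2 (VF.app ξ f) = ξ.1 V (rs V.2 f) := ξ.2.2.2 (Below.self U) V V.2 f
    rw [ξ.2.1, h]; ring
  anchor_bracket _ _ _ := rfl

/-! ### Atiyah algebroids -/

variable (k) in
/-- The sections over `U` of the Atiyah algebroid `L(M)`: pairs of a vector field `ξ` on `U` and an
additive endomorphism `D` of the sheaf `M|_U` with `D(fm) = f D(m) + ξ(f) m`. -/
def atSec (M : ModPresheaf Y) (U : Y.Opens) :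
    AddSubgroup ((∀ V : Below U, M.Sec V.1 →+ M.Sec V.1) × VF k U) where
  carrier := {D | (∀ V f m, D.1 V (f • m) = f • D.1 V m + D.2.1 V f • m) ∧
    ∀ (V W : Below U) (h : W.1 ≤ V.1) m, M.res h (D.1 V m) = D.1 W (M.res h m)}
  zero_mem' := by
    refine ⟨fun V f m => ?_, fun V W h m => ?_⟩
    · change (0 : M.Sec V.1) = f • 0 + (0 : Γ(Y, V.1)) • m; simp
    · change M.res h 0 = 0; simp
  add_mem' := by
    rintro D D' ⟨h1, h2⟩ ⟨g1, g2⟩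
    refine ⟨fun V f m => ?_, fun V W h m => ?_⟩
    · change D.1 V (f • m) + D'.1 V (f • m) = f • (D.1 V m + D'.1 V m) +
        (D.2.1 V f + D'.2.1 V f) • m
      rw [h1, g1, smul_add, add_smul]; abel
    · change M.res h (D.1 V m + D'.1 V m) = D.1 W (M.res h m) + D'.1 W (M.res h m)
      rw [map_add, h2 V W h, g2 V W h]
  neg_mem' := by
    rintro D ⟨h1, h2⟩
    refine ⟨fun V f m => ?_, fun V W h m => ?_⟩
    · change -D.1 V (f • m) = f • (-D.1 V m) + (-D.2.1 V f) • m
      rw [h1, smul_neg, neg_smul]; abel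
    · change M.res h (-D.1 V m) = -D.1 W (M.res h m)
      rw [map_neg, h2 V W h]

variable (k) in
abbrev At (M : ModPresheaf Y) (U : Y.Opens) : Type u := atSec k M U

section At

variable {M : ModPresheaf Y} {U : Y.Opens}

/-- The operator `D` of a section of `L(M)`, on sections over `V`. -/
def At.op (D : At k M U) (V : Below U) : M.Sec V.1 →+ M.Sec V.1 := D.1.1 V

/-- The vector field of a section of `L(M)`. -/
def At.vf (D : At k M U) : VF k U := D.1.2

/-- The action of a section of `L(M)` over `U` on a section of `M` over `U`. -/
def At.act (D : At k M U) (m : M.Sec U) : M.Sec U := D.op (Below.self U) m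

theorem At.op_smul (D : At k M U) (V : Below U) (f : Γ(Y, V.1)) (m : M.Sec V.1) :
    D.op V (f • m) = f • D.op V m + D.vf.1 V f • m := D.2.1 V f m

theorem At.op_res (D : At k M U) (V W : Below U) (h : W.1 ≤ V.1) (m : M.Sec V.1) :
    M.res h (D.op V m) = D.op W (M.res h m) := D.2.2 V W h m

theorem At.ext {D D' : At k M U} (h : ∀ V m, D.op V m = D'.op V m) (h' : D.vf = D'.vf) : D = D' :=
  Subtype.ext (Prod.ext (funext fun V => AddMonoidHom.ext (h V)) h')

theorem At.add_op (D D' : At k M U) (V : Below U) (m : M.Sec V.1) :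
    (D + D').op V m = D.op V m + D'.op V m := rfl

theorem At.add_vf (D D' : At k M U) : (D + D').vf = D.vf + D'.vf := rfl

instance : Module Γ(Y, U) (At k M U) where
  smul f D := ⟨(fun V => (DistribSMul.toAddMonoidHom _ (rs V.2 f)).comp (D.op V), f • D.vf), by
    refine ⟨fun V g m => ?_, fun V W h m => ?_⟩
    · change rs V.2 f • D.op V (g • m) = g • rs V.2 f • D.op V m + (rs V.2 f * D.vf.1 V g) • m
      rw [D.op_smul, smul_add, smul_comm, mul_smul]
    · change M.res h (rs V.2 f • D.op V m) = rs W.2 f • D.op W (M.res h m)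
      rw [M.res_smul, rs_rs, D.op_res V W h]⟩
  one_smul D := At.ext (fun V m => by change rs V.2 1 • D.op V m = D.op V m; simp)
    (one_smul _ D.vf)
  mul_smul f g D := At.ext (fun V m => by
    change rs V.2 (f * g) • D.op V m = rs V.2 f • rs V.2 g • D.op V m; simp [mul_smul])
    (mul_smul f g D.vf)
  smul_zero f := At.ext (fun V m => by change rs V.2 f • (0 : M.Sec V.1) = 0; simp)
    (smul_zero f)
  smul_add f D D' := At.ext (fun V m => by
    change rs V.2 f • (D.op V m + D'.op V m) = rs V.2 f • D.op V m + rs V.2 f • D'.op V m; simp)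
    (smul_add f D.vf D'.vf)
  add_smul f g D := At.ext (fun V m => by
    change rs V.2 (f + g) • D.op V m = rs V.2 f • D.op V m + rs V.2 g • D.op V m
    rw [map_add, add_smul]) (add_smul f g D.vf)
  zero_smul D := At.ext (fun V m => by change rs V.2 0 • D.op V m = 0; simp) (zero_smul Γ(Y, U) D.vf)

theorem At.smul_op (f : Γ(Y, U)) (D : At k M U) (V : Below U) (m : M.Sec V.1) :
    (f • D).op V m = rs V.2 f • D.op V m := rfl

theorem At.smul_vf (f : Γ(Y, U)) (D : At k M U) : (f • D).vf = f • D.vf := rfl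

/-- The commutator in the Atiyah algebroid. -/
def At.comm (D D' : At k M U) : At k M U :=
  ⟨(fun V => (D.op V).comp (D'.op V) - (D'.op V).comp (D.op V), D.vf.comm D'.vf), by
    refine ⟨fun V f m => ?_, fun V W h m => ?_⟩
    · change D.op V (D'.op V (f • m)) - D'.op V (D.op V (f • m)) =
        f • (D.op V (D'.op V m) - D'.op V (D.op V m)) +
          (D.vf.1 V (D'.vf.1 V f) - D'.vf.1 V (D.vf.1 V f)) • m
      simp only [D.op_smul, D'.op_smul, map_add, smul_sub, sub_smul]; abel
    · change M.res h (D.op V (D'.op V m) - D'.op V (D.op V m)) =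
        D.op W (D'.op W (M.res h m)) - D'.op W (D.op W (M.res h m))
      rw [map_sub, D.op_res V W h, D'.op_res V W h, D'.op_res V W h, D.op_res V W h]⟩

theorem At.comm_op (D D' : At k M U) (V : Below U) (m : M.Sec V.1) :
    (D.comm D').op V m = D.op V (D'.op V m) - D'.op V (D.op V m) := rfl

theorem At.comm_vf (D D' : At k M U) : (D.comm D').vf = D.vf.comm D'.vf := rfl

/-- Restriction of sections of the Atiyah algebroid. -/
def At.res {V : Y.Opens} (h : V ≤ U) : At k M U →+ At k M V where
  toFun D := ⟨(fun W => D.op (W.up h), VF.res h D.vf), fun W => D.2.1 (W.up h),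
    fun W W' h' => D.2.2 (W.up h) (W'.up h) h'⟩
  map_zero' := rfl
  map_add' _ _ := rfl

variable (k M U) in
def At.bracket : At k M U →+ At k M U →+ At k M U :=
  AddMonoidHom.mk' (fun D => AddMonoidHom.mk' (fun D' => D.comm D') (fun D₁ D₂ => At.ext
      (fun V m => by simp only [At.comm_op, At.add_op, map_add]; abel)
      (map_add (VF.bracket U D.vf) D₁.vf D₂.vf)))
    (fun D₁ D₂ => AddMonoidHom.ext fun D => At.ext
      (fun V m => by
        change (At.comm (D₁ + D₂) D).op V m = (At.comm D₁ D + At.comm D₂ D).op V m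
        simp only [At.comm_op, At.add_op, map_add]; abel)
      (DFunLike.congr_fun (map_add (VF.bracket U) D₁.vf D₂.vf) D.vf))

/-- Multiplication by a function, as a section of the Atiyah algebroid. -/
def At.scalar (f : Γ(Y, U)) : At k M U :=
  ⟨(fun V => DistribSMul.toAddMonoidHom _ (rs V.2 f), 0), by
    refine ⟨fun V g m => ?_, fun V W h m => ?_⟩
    · change rs V.2 f • g • m = g • rs V.2 f • m + (0 : Γ(Y, V.1)) • m
      rw [zero_smul, add_zero, smul_comm]
    · change M.res h (rs V.2 f • m) = rs W.2 f • M.res h m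
      rw [M.res_smul, rs_rs]⟩

end At

variable (k) in
/-- The Atiyah algebroid `L(M)`, with the functions acting by multiplication. -/
def atiyah (M : ModPresheaf Y) : UnitalAlgebroid k Y where
  Sec U := At k M U
  res h := At.res h
  res_id _ _ := rfl
  res_res _ _ _ := rfl
  res_smul h f D := At.ext (fun V m => by
    change rs (V.up h).2 f • D.op (V.up h) m = rs V.2 (rs h f) • D.op (V.up h) m
    rw [rs_rs]) ((tangentMod k Y).res_smul h f D.vf)
  anchor U := { toFun := At.vf, map_add' := fun _ _ => rfl, map_smul' := fun _ _ => rfl }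
  anchor_res _ _ := rfl
  bracket U := At.bracket k M U
  bracket_res _ _ _ := rfl
  bracket_self U D := At.ext (fun V m => sub_self _) ((tangent k Y).bracket_self U D.vf)
  jacobi U D D' D'' := At.ext
    (fun V m => by
      change (D.comm (D'.comm D'')).op V m = ((D.comm D').comm D'' + D'.comm (D.comm D'')).op V m
      simp only [At.comm_op, At.add_op, map_sub]; abel)
    ((tangent k Y).jacobi U D.vf D'.vf D''.vf)
  leibniz U D f D' := At.ext
    (fun V m => by
      change (At.comm D (f • D')).op V m = (f • At.comm D D' + VF.app D.vf f • D').op V m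
      have h : rs V.2 (VF.app D.vf f) = D.vf.1 V (rs V.2 f) := D.vf.2.2.2 (Below.self U) V V.2 f
      simp only [At.comm_op, At.add_op, At.smul_op, At.op_smul, h, smul_sub]; abel)
    ((tangent k Y).leibniz U D.vf f D'.vf)
  anchor_bracket _ _ _ := rfl
  unit U :=
    { toFun := At.scalar
      map_add' := fun f g => At.ext (fun V m => by
        change rs V.2 (f + g) • m = rs V.2 f • m + rs V.2 g • m
        rw [map_add, add_smul]) (add_zero (0 : VF k U)).symm
      map_smul' := fun f g => At.ext (fun V m => by
        change rs V.2 (f * g) • m = rs V.2 f • rs V.2 g • m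
        rw [map_mul, mul_smul]) (smul_zero f).symm }
  unit_res h f := At.ext (fun V m => by
    change rs (V.up h).2 f • m = rs V.2 (rs h f) • m
    rw [rs_rs]) rfl
  anchor_unit _ _ := rfl
  bracket_unit U D f := At.ext
    (fun V m => by
      change D.op V (rs V.2 f • m) - rs V.2 f • D.op V m = rs V.2 (VF.app D.vf f) • m
      have h : rs V.2 (VF.app D.vf f) = D.vf.1 V (rs V.2 f) := D.vf.2.2.2 (Below.self U) V V.2 f
      rw [D.op_smul, h]; abel)
    (map_zero (VF.bracket U D.vf))

/-- The Atiyah algebroid of the `PGL(r)`-bundle `P(E)`, which is the bundle of algebra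
isomorphisms `Mat_r(𝒪) ≅ End(E)`: its sections over `U` are the sections `(δ, ξ)` of the Atiyah
algebroid of the vector bundle `End(E)` for which `δ` is a derivation of the sheaf of algebras
`End(E)|_U`. -/
def patSec (M : ModPresheaf Y) (U : Y.Opens) : AddSubgroup (At k (endMod M) U) where
  carrier := {δ | ∀ V a b, δ.op V (endMul a b) = endMul (δ.op V a) b + endMul a (δ.op V b)}
  zero_mem' := by
    intro V a b
    refine Subtype.ext (funext fun W => LinearMap.ext fun m => ?_)
    change (0 : M.Sec W.1) = 0 + a.1 W 0
    simp
  add_mem' := by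
    intro δ δ' h h' V a b
    rw [At.add_op, h, h', At.add_op, At.add_op]
    refine Subtype.ext (funext fun W => LinearMap.ext fun m => ?_)
    change ((δ.op V a).1 W (b.1 W m) + a.1 W ((δ.op V b).1 W m)) +
      ((δ'.op V a).1 W (b.1 W m) + a.1 W ((δ'.op V b).1 W m)) =
      ((δ.op V a).1 W (b.1 W m) + (δ'.op V a).1 W (b.1 W m)) +
      a.1 W ((δ.op V b).1 W m + (δ'.op V b).1 W m)
    rw [map_add]; abel
  neg_mem' := by
    intro δ h V a b
    have e : ∀ c, (-δ).op V c = -(δ.op V c) := fun _ => rfl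
    rw [e, e, e, h]
    refine Subtype.ext (funext fun W => LinearMap.ext fun m => ?_)
    change -((δ.op V a).1 W (b.1 W m) + a.1 W ((δ.op V b).1 W m)) =
      -((δ.op V a).1 W (b.1 W m)) + a.1 W (-((δ.op V b).1 W m))
    rw [map_neg]; abel

instance (M : ModPresheaf Y) (U : Y.Opens) : Module Γ(Y, U) (patSec (k := k) M U) where
  smul f δ := ⟨f • δ.1, by
    intro V a b
    rw [At.smul_op, δ.2 V a b]
    refine Subtype.ext (funext fun W => LinearMap.ext fun m => ?_)
    change rs W.2 (rs V.2 f) • ((δ.1.op V a).1 W (b.1 W m) + a.1 W ((δ.1.op V b).1 W m)) =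
      rs W.2 (rs V.2 f) • (δ.1.op V a).1 W (b.1 W m) +
        a.1 W (rs W.2 (rs V.2 f) • (δ.1.op V b).1 W m)
    rw [map_smul, smul_add]⟩
  one_smul δ := Subtype.ext (one_smul Γ(Y, U) δ.1)
  mul_smul f g δ := Subtype.ext (mul_smul f g δ.1)
  smul_zero f := Subtype.ext (smul_zero f)
  smul_add f δ δ' := Subtype.ext (smul_add f δ.1 δ'.1)
  add_smul f g δ := Subtype.ext (add_smul f g δ.1)
  zero_smul δ := Subtype.ext (zero_smul Γ(Y, U) δ.1)

theorem patSec_comm {M : ModPresheaf Y} {U : Y.Opens} (δ δ' : patSec (k := k) M U) :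
    δ.1.comm δ'.1 ∈ patSec (k := k) M U := by
  intro V a b
  simp only [At.comm_op, δ.2 V, δ'.2 V, map_add]
  refine Subtype.ext (funext fun W => LinearMap.ext fun m => ?_)
  set A := δ.1.op V
  set B := δ'.1.op V
  change (((A (B a)).1 W (b.1 W m) + (B a).1 W ((A b).1 W m)) +
      ((A a).1 W ((B b).1 W m) + a.1 W ((A (B b)).1 W m))) -
      (((B (A a)).1 W (b.1 W m) + (A a).1 W ((B b).1 W m)) +
      ((B a).1 W ((A b).1 W m) + a.1 W ((B (A b)).1 W m))) =
      ((A (B a)).1 W (b.1 W m) - (B (A a)).1 W (b.1 W m)) +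
      a.1 W ((A (B b)).1 W m - (B (A b)).1 W m)
  rw [map_sub]; abel

variable (k) in
/-- The Atiyah algebroid of the `PGL(r)`-bundle `P(E)`, as a Lie algebroid. -/
def projAtiyah (M : ModPresheaf Y) : LieAlgebroid k Y where
  Sec U := patSec (k := k) M U
  res h :=
    { toFun := fun δ => ⟨At.res h δ.1, fun V a b => δ.2 (V.up h) a b⟩
      map_zero' := rfl
      map_add' := fun _ _ => rfl }
  res_id _ _ := rfl
  res_res _ _ _ := rfl
  res_smul h f δ := Subtype.ext ((atiyah k (endMod M)).res_smul h f δ.1)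
  anchor _ := { toFun := fun δ => δ.1.vf, map_add' := fun _ _ => rfl, map_smul' := fun _ _ => rfl }
  anchor_res _ _ := rfl
  bracket _ := AddMonoidHom.mk' (fun δ => AddMonoidHom.mk'
      (fun δ' => ⟨δ.1.comm δ'.1, patSec_comm δ δ'⟩)
      (fun δ₁ δ₂ => Subtype.ext (map_add (At.bracket k (endMod M) _ δ.1) δ₁.1 δ₂.1)))
    (fun δ₁ δ₂ => AddMonoidHom.ext fun δ => Subtype.ext
      (DFunLike.congr_fun (map_add (At.bracket k (endMod M) _) δ₁.1 δ₂.1) δ.1))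
  bracket_res _ _ _ := rfl
  bracket_self U δ := Subtype.ext ((atiyah k (endMod M)).bracket_self U δ.1)
  jacobi U δ δ' δ'' := Subtype.ext ((atiyah k (endMod M)).jacobi U δ.1 δ'.1 δ''.1)
  leibniz U δ f δ' := Subtype.ext ((atiyah k (endMod M)).leibniz U δ.1 f δ'.1)
  anchor_bracket _ _ _ := rfl

/-- The operator `a ↦ D a - a D` on endomorphisms. -/
def endAct {M : ModPresheaf Y} {U : Y.Opens} (D : At k M U) (V : Below U) (a : endSec M V.1) :
    endSec M V.1 :=
  ⟨fun W =>
    { toFun := fun m => D.op (W.up V.2) (a.1 W m) - a.1 W (D.op (W.up V.2) m)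
      map_add' := fun m m' => by simp only [map_add]; abel
      map_smul' := fun f m => by
        simp only [map_smul, At.op_smul, map_add, RingHom.id_apply, smul_sub]; abel },
    fun W W' h m => by
      change M.res h (D.op (W.up V.2) (a.1 W m) - a.1 W (D.op (W.up V.2) m)) =
        D.op (W'.up V.2) (a.1 W' (M.res h m)) - a.1 W' (D.op (W'.up V.2) (M.res h m))
      rw [map_sub, D.op_res (W.up V.2) (W'.up V.2) h, a.2 W W' h, a.2 W W' h,
        D.op_res (W.up V.2) (W'.up V.2) h]⟩

/-- The map `L(E) → L(P(E))` sending `D` to the derivation `a ↦ D a - a D` of `End(E)`. -/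
def toProj {M : ModPresheaf Y} {U : Y.Opens} (D : At k M U) : (projAtiyah k M).Sec U :=
  ⟨⟨(fun V =>
      { toFun := endAct D V
        map_zero' := Subtype.ext (funext fun W => LinearMap.ext fun m => by
          change D.op (W.up V.2) 0 - 0 = 0
          simp)
        map_add' := fun a b => Subtype.ext (funext fun W => LinearMap.ext fun m => by
          change D.op (W.up V.2) (a.1 W m + b.1 W m) -
              (a.1 W (D.op (W.up V.2) m) + b.1 W (D.op (W.up V.2) m)) =
            (D.op (W.up V.2) (a.1 W m) - a.1 W (D.op (W.up V.2) m)) +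
              (D.op (W.up V.2) (b.1 W m) - b.1 W (D.op (W.up V.2) m))
          rw [map_add]; abel) }, D.vf), by
    refine ⟨fun V f a => ?_, fun V W h a => rfl⟩
    refine Subtype.ext (funext fun W => LinearMap.ext fun m => ?_)
    change D.op (W.up V.2) (rs W.2 f • a.1 W m) - rs W.2 f • a.1 W (D.op (W.up V.2) m) =
      rs W.2 f • (D.op (W.up V.2) (a.1 W m) - a.1 W (D.op (W.up V.2) m)) +
        rs W.2 (D.vf.1 V f) • a.1 W m
    rw [D.op_smul, D.vf.2.2.2 V (W.up V.2) W.2, smul_sub]; abel⟩, by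
    intro V a b
    refine Subtype.ext (funext fun W => LinearMap.ext fun m => ?_)
    change D.op (W.up V.2) (a.1 W (b.1 W m)) - a.1 W (b.1 W (D.op (W.up V.2) m)) =
      (D.op (W.up V.2) (a.1 W (b.1 W m)) - a.1 W (D.op (W.up V.2) (b.1 W m))) +
        a.1 W (D.op (W.up V.2) (b.1 W m) - b.1 W (D.op (W.up V.2) m))
    rw [map_sub]; abel⟩

/-! ### Determinants, the canonical bundle, traces and Lie derivatives -/

/-- If `D` is an additive endomorphism of a module `M` with symbol the derivation `ξ` of `R`, the
induced operator on an alternating form: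
`(Dα)(m₁, …, m_p) = ξ(α(m₁, …, m_p)) - ∑ᵢ α(m₁, …, D mᵢ, …, m_p)`. -/
def altDeriv {R M : Type u} [CommRing R] [AddCommGroup M] [Module R M] {p : ℕ}
    (ξ : R →+ R) (hξ : ∀ a b, ξ (a * b) = a * ξ b + ξ a * b)
    (D : M →+ M) (hD : ∀ (f : R) m, D (f • m) = f • D m + ξ f • m)
    (α : M [⋀^Fin p]→ₗ[R] R) : M [⋀^Fin p]→ₗ[R] R where
  toFun m := ξ (α m) - ∑ i, α (Function.update m i (D (m i)))
  map_update_add' := by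
    intro _ m i x y
    obtain rfl := Subsingleton.elim ‹DecidableEq (Fin p)› (instDecidableEqFin p)
    rw [α.map_update_add, map_add]
    have key : ∀ j, α (Function.update (Function.update m i (x + y)) j
        (D (Function.update m i (x + y) j))) =
        α (Function.update (Function.update m i x) j (D (Function.update m i x j))) +
        α (Function.update (Function.update m i y) j (D (Function.update m i y j))) := by
      intro j
      by_cases h : j = i
      · subst h; simp
      · simp only [Function.update_of_ne h, Function.update_comm (Ne.symm h), α.map_update_add]
    simp only [key, Finset.sum_add_distrib]; abel
  map_update_smul' := by
    intro _ m i c x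
    obtain rfl := Subsingleton.elim ‹DecidableEq (Fin p)› (instDecidableEqFin p)
    rw [α.map_update_smul, smul_eq_mul, hξ]
    have key : ∀ j, α (Function.update (Function.update m i (c • x)) j
        (D (Function.update m i (c • x) j))) =
        c * α (Function.update (Function.update m i x) j (D (Function.update m i x j))) +
        if j = i then ξ c * α (Function.update m i x) else 0 := by
      intro j
      by_cases h : j = i
      · subst h; simp [hD]
      · simp only [Function.update_of_ne h, Function.update_comm (Ne.symm h), α.map_update_smul,
          smul_eq_mul, if_neg h, add_zero]
    simp only [key, Finset.sum_add_distrib, Finset.sum_ite_eq', Finset.mem_univ, if_true,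
      ← Finset.mul_sum, smul_eq_mul]
    ring
  map_eq_zero_of_eq' := by
    intro m i j hm hij
    rw [α.map_eq_zero_of_eq m hm hij, map_zero, zero_sub, neg_eq_zero]
    rw [← Finset.sum_subset (Finset.subset_univ {i, j}), Finset.sum_pair hij]
    · have : Function.update m j (D (m j)) =
          (Function.update m i (D (m i))) ∘ Equiv.swap i j := by
        funext l
        by_cases h1 : l = i
        · subst h1; simp [Function.update_of_ne hij, Function.update_of_ne hij.symm, hm]
        · by_cases h2 : l = j
          · subst h2; simp [hm]
          · simp [Equiv.swap_apply_of_ne_of_ne h1 h2, Function.update_of_ne h1,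
              Function.update_of_ne h2]
      rw [this, α.map_swap _ hij, add_neg_cancel]
    · intro l _ hl
      simp only [Finset.mem_insert, Finset.mem_singleton, not_or] at hl
      refine α.map_eq_zero_of_eq _ ?_ hij
      rw [Function.update_of_ne (Ne.symm hl.1), Function.update_of_ne (Ne.symm hl.2), hm]

/-- The operator induced by a section of `L(M)` on the alternating `p`-forms on `M`. -/
def altOp (p : ℕ) {M : ModPresheaf Y} {U : Y.Opens} (D : At k M U) (V : Below U)
    (α : altSec p M V.1) : altSec p M V.1 :=
  ⟨fun W => altDeriv (D.vf.1 (W.up V.2)) (D.vf.2.1 (W.up V.2))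
      (D.op (W.up V.2)) (D.op_smul (W.up V.2)) (α.1 W),
    fun W W' h m => by
      change rs h (D.vf.1 (W.up V.2) (α.1 W m) -
          ∑ i, α.1 W (Function.update m i (D.op (W.up V.2) (m i)))) =
        D.vf.1 (W'.up V.2) (α.1 W' fun i => M.res h (m i)) -
          ∑ i, α.1 W' (Function.update (fun i => M.res h (m i)) i
            (D.op (W'.up V.2) (M.res h (m i))))
      rw [map_sub, map_sum, D.vf.2.2.2 (W.up V.2) (W'.up V.2) h, α.2 W W' h]
      congr 1
      refine Finset.sum_congr rfl fun i _ => ?_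
      rw [α.2 W W' h]
      congr 1
      funext l
      by_cases hl : l = i
      · subst hl; simp [D.op_res (W.up V.2) (W'.up V.2) h]
      · simp [Function.update_of_ne hl]⟩

/-- The action of `L(M)` on the alternating `p`-forms on `M`. -/
def altAct (p : ℕ) {M : ModPresheaf Y} {U : Y.Opens} (D : At k M U) : At k (alt p M) U :=
  ⟨(fun V =>
    { toFun := altOp p D V
      map_zero' := Subtype.ext (funext fun W => AlternatingMap.ext fun m => by
        change D.vf.1 (W.up V.2) 0 - ∑ i : Fin p, (0 : Γ(Y, W.1)) = 0
        simp)
      map_add' := fun α β => Subtype.ext (funext fun W => AlternatingMap.ext fun m => by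
        change D.vf.1 (W.up V.2) (α.1 W m + β.1 W m) -
            ∑ i, (α.1 W (Function.update m i (D.op (W.up V.2) (m i))) +
              β.1 W (Function.update m i (D.op (W.up V.2) (m i)))) =
          (D.vf.1 (W.up V.2) (α.1 W m) -
            ∑ i, α.1 W (Function.update m i (D.op (W.up V.2) (m i)))) +
          (D.vf.1 (W.up V.2) (β.1 W m) -
            ∑ i, β.1 W (Function.update m i (D.op (W.up V.2) (m i))))
        rw [map_add, Finset.sum_add_distrib]; ring) }, D.vf), by
    refine ⟨fun V f α => ?_, fun V W h α => rfl⟩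
    refine Subtype.ext (funext fun W => AlternatingMap.ext fun m => ?_)
    change D.vf.1 (W.up V.2) (rs W.2 f * α.1 W m) -
        ∑ i, rs W.2 f * α.1 W (Function.update m i (D.op (W.up V.2) (m i))) =
      rs W.2 f * (D.vf.1 (W.up V.2) (α.1 W m) -
        ∑ i, α.1 W (Function.update m i (D.op (W.up V.2) (m i)))) +
      rs W.2 (D.vf.1 V f) * α.1 W m
    rw [D.vf.2.1, D.vf.2.2.2 V (W.up V.2) W.2, ← Finset.mul_sum]; ring⟩

/-- The determinant of a vector bundle of rank `r`: the dual of the line bundle of alternating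
`r`-forms. -/
def det (r : ℕ) (M : ModPresheaf Y) : ModPresheaf Y := alt 1 (alt r M)

/-- The trace map `L(E) → L(det E)`: the action of `D` on the dual of the alternating `r`-forms. It
is the operator `e₁ ∧ … ∧ e_r ↦ ∑ᵢ e₁ ∧ … ∧ D eᵢ ∧ … ∧ e_r`. -/
def toDet (r : ℕ) {M : ModPresheaf Y} {U : Y.Opens} (D : At k M U) : At k (det r M) U :=
  altAct 1 (altAct r D)

variable (k Y) in
/-- The sheaf of differential `p`-forms. -/
def forms (p : ℕ) : ModPresheaf Y := alt p (tangentMod k Y)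

/-- The canonical bundle `K_Y` of a smooth `Y` of dimension `n` is `forms k Y n`; this is the Lie
derivative `l : T_Y → L(K_Y)`. -/
def lieDer (n : ℕ) {U : Y.Opens} (ξ : VF k U) : At k (forms k Y n) U :=
  altAct n (M := tangentMod k Y) ⟨(fun V => VF.bracket V.1 (VF.res V.2 ξ), ξ), by
    refine ⟨fun V f η => ?_, fun V W h η => rfl⟩
    have := (tangent k Y).leibniz V.1 (VF.res V.2 ξ) f η
    exact this⟩

/-! ### Linear combinations of Picard algebroids -/

/-- The fibre product `L₁ ×_{T_Y} L₂`. -/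
def fibSec (L₁ L₂ : LieAlgebroid k Y) (U : Y.Opens) :
    Submodule Γ(Y, U) (L₁.Sec U × L₂.Sec U) where
  carrier := {x | L₁.anchor U x.1 = L₂.anchor U x.2}
  zero_mem' := by simp
  add_mem' := by
    intro x y (hx : _ = _) (hy : _ = _)
    change L₁.anchor U (x.1 + y.1) = L₂.anchor U (x.2 + y.2)
    rw [map_add, map_add, hx, hy]
  smul_mem' := by
    intro f x (hx : _ = _)
    change L₁.anchor U (f • x.1) = L₂.anchor U (f • x.2)
    rw [map_smul, map_smul, hx]

def fibProd (L₁ L₂ : LieAlgebroid k Y) : LieAlgebroid k Y where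
  Sec U := fibSec L₁ L₂ U
  res h :=
    { toFun := fun x => ⟨(L₁.res h x.1.1, L₂.res h x.1.2), by
        change L₁.anchor _ _ = L₂.anchor _ _
        rw [L₁.anchor_res, L₂.anchor_res]; exact congrArg _ x.2⟩
      map_zero' := Subtype.ext (Prod.ext (map_zero _) (map_zero _))
      map_add' := fun _ _ => Subtype.ext (Prod.ext (map_add _ _ _) (map_add _ _ _)) }
  res_id h x := Subtype.ext (Prod.ext (L₁.res_id h x.1.1) (L₂.res_id h x.1.2))
  res_res h h' x := Subtype.ext (Prod.ext (L₁.res_res h h' x.1.1) (L₂.res_res h h' x.1.2))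
  res_smul h f x := Subtype.ext (Prod.ext (L₁.res_smul h f x.1.1) (L₂.res_smul h f x.1.2))
  anchor U := (L₁.anchor U).comp ((LinearMap.fst _ _ _).comp (fibSec L₁ L₂ U).subtype)
  anchor_res h x := L₁.anchor_res h x.1.1
  bracket U := AddMonoidHom.mk' (fun x => AddMonoidHom.mk'
      (fun y => ⟨(L₁.bracket U x.1.1 y.1.1, L₂.bracket U x.1.2 y.1.2), by
        change L₁.anchor U _ = L₂.anchor U _
        have hx : L₁.anchor U x.1.1 = L₂.anchor U x.1.2 := x.2
        have hy : L₁.anchor U y.1.1 = L₂.anchor U y.1.2 := y.2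
        rw [L₁.anchor_bracket, L₂.anchor_bracket, hx, hy]⟩)
      (fun y z => Subtype.ext (Prod.ext (map_add (L₁.bracket U x.1.1) _ _)
        (map_add (L₂.bracket U x.1.2) _ _))))
    (fun x y => AddMonoidHom.ext fun z => Subtype.ext (Prod.ext
      (DFunLike.congr_fun (map_add (L₁.bracket U) x.1.1 y.1.1) z.1.1)
      (DFunLike.congr_fun (map_add (L₂.bracket U) x.1.2 y.1.2) z.1.2)))
  bracket_res h x y := Subtype.ext (Prod.ext (L₁.bracket_res h _ _) (L₂.bracket_res h _ _))
  bracket_self U x := Subtype.ext (Prod.ext (L₁.bracket_self U _) (L₂.bracket_self U _))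
  jacobi U x y z := Subtype.ext (Prod.ext (L₁.jacobi U _ _ _) (L₂.jacobi U _ _ _))
  leibniz U x f y := Subtype.ext (Prod.ext (L₁.leibniz U _ _ _) (by
    have hx : L₁.anchor U x.1.1 = L₂.anchor U x.1.2 := x.2
    change L₂.bracket U x.1.2 (f • y.1.2) =
      f • L₂.bracket U x.1.2 y.1.2 + (L₁.anchor U x.1.1).app f • y.1.2
    rw [hx]; exact L₂.leibniz U _ _ _))
  anchor_bracket U x y := L₁.anchor_bracket U _ _

/-- The linear combination `λ₁ L₁ + λ₂ L₂` of Picard algebroids: a Picard algebroid `alg` with a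
morphism `s : L₁ ×_{T_Y} L₂ → alg` of Lie algebroids which is `(a₁, a₂) ↦ λ₁ a₁ + λ₂ a₂` on
functions (and the identity on `T_Y`). It is unique up to a unique isomorphism. -/
structure Combination (c₁ c₂ : k) (L₁ L₂ : UnitalAlgebroid k Y) where
  alg : UnitalAlgebroid k Y
  isPicard : alg.IsPicard
  s : LieAlgebroid.Hom (fibProd L₁.toLieAlgebroid L₂.toLieAlgebroid) alg.toLieAlgebroid
  s_unit : ∀ U (a₁ a₂ : Γ(Y, U)),
    s.app U ⟨(L₁.unit U a₁, L₂.unit U a₂), (L₁.anchor_unit U a₁).trans (L₂.anchor_unit U a₂).symm⟩ =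
      alg.unit U (cst k U c₁ * a₁ + cst k U c₂ * a₂)

/-! ### Modules over a Picard algebroid, and the data they are compared with -/

/-- A structure of an `L`-module on `M`: a morphism of Lie algebroids `L → L(M)` under which
functions act by multiplication. -/
structure ModuleStructure (L : UnitalAlgebroid k Y) (M : ModPresheaf Y) where
  hom : LieAlgebroid.Hom L.toLieAlgebroid (atiyah k M).toLieAlgebroid
  hom_unit : ∀ U f, hom.app U (L.unit U f) = (atiyah k M).unit U f

/-- An isomorphism of Lie algebroids `L ≃ L(det E)` which is `f ↦ r f` on functions. -/
structure DetIso (L : UnitalAlgebroid k Y) (r : ℕ) (M : ModPresheaf Y) where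
  hom : LieAlgebroid.Hom L.toLieAlgebroid (atiyah k (det r M)).toLieAlgebroid
  bijective : ∀ U, Function.Bijective (hom.app U)
  hom_unit : ∀ U f, hom.app U (L.unit U f) = (atiyah k (det r M)).unit U (r * f)

variable (k) in
/-- A flat algebraic connection on the `PGL(r)`-bundle `P(E)`: an `𝒪_Y`-linear splitting of the
anchor of its Atiyah algebroid which preserves the brackets. -/
abbrev FlatProjConnection (M : ModPresheaf Y) : Type u :=
  LieAlgebroid.Hom (tangent k Y) (projAtiyah k M)

end Algebroids

/-! ### The truncated de Rham cohomology `H²_F` and characteristic classes -/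

section Cohomology

variable (k : Type u) [Field k] (Y : Scheme.{u}) [Y.Over (Spec (.of k))]

variable {k Y}

/-- The value of a `p`-form on vector fields. -/
def formAt {p : ℕ} {U : Y.Opens} (α : (forms k Y p).Sec U) (V : Below U) (ξ : Fin p → VF k V.1) :
    Γ(Y, V.1) := α.1 V ξ

/-- The relation `ω = dA` between a 1-form `A` and a 2-form `ω`. -/
def IsExtD {U : Y.Opens} (A : (forms k Y 1).Sec U) (ω : (forms k Y 2).Sec U) : Prop :=
  ∀ (V : Below U) (ξ η : VF k V.1),
    formAt ω V ![ξ, η] = ξ.app (formAt A V ![η]) - η.app (formAt A V ![ξ]) - formAt A V ![ξ.comm η]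

/-- The relation `dω = 0` for a 2-form `ω`. -/
def IsClosedForm {U : Y.Opens} (ω : (forms k Y 2).Sec U) : Prop :=
  ∀ (V : Below U) (ξ η ζ : VF k V.1),
    ξ.app (formAt ω V ![η, ζ]) - η.app (formAt ω V ![ξ, ζ]) + ζ.app (formAt ω V ![ξ, η])
      - formAt ω V ![ξ.comm η, ζ] + formAt ω V ![ξ.comm ζ, η] - formAt ω V ![η.comm ζ, ξ] = 0

variable (k Y) in
/-- A Čech 2-cocycle, on some open cover, with values in the complex
`0 → Ω¹ → Ω² → Ω³ → …` (with `Ω¹` in degree 1). -/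
structure Cocycle where
  I : Type u
  U : I → Y.Opens
  cover : ∀ y : Y, ∃ i, y ∈ U i
  form : ∀ i, (forms k Y 2).Sec (U i)
  trans : ∀ i j, (forms k Y 1).Sec (U i ⊓ U j)
  closed : ∀ i, IsClosedForm (form i)
  d_trans : ∀ i j, IsExtD (trans i j)
    ((forms k Y 2).res inf_le_right (form j) - (forms k Y 2).res inf_le_left (form i))
  trans_trans : ∀ i j l,
    (forms k Y 1).res (inf_le_left : U i ⊓ U j ⊓ U l ≤ U i ⊓ U j) (trans i j) +
      (forms k Y 1).res (inf_le_inf_right _ inf_le_right : U i ⊓ U j ⊓ U l ≤ U j ⊓ U l)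
        (trans j l) =
      (forms k Y 1).res (inf_le_inf_right _ inf_le_left : U i ⊓ U j ⊓ U l ≤ U i ⊓ U l) (trans i l)

/-- Two Čech 2-cocycles, possibly on different covers, define the same cohomology class: together
they extend to a cocycle on the union of the two covers. -/
def Cohomologous (z w : Cocycle k Y) : Prop :=
  ∃ C : ∀ i j, (forms k Y 1).Sec (z.U i ⊓ w.U j),
    (∀ i j, IsExtD (C i j)
      ((forms k Y 2).res inf_le_right (w.form j) - (forms k Y 2).res inf_le_left (z.form i))) ∧
    (∀ i i' j,
      (forms k Y 1).res (inf_le_left : z.U i ⊓ z.U i' ⊓ w.U j ≤ z.U i ⊓ z.U i') (z.trans i i') +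
        (forms k Y 1).res (inf_le_inf_right _ inf_le_right :
          z.U i ⊓ z.U i' ⊓ w.U j ≤ z.U i' ⊓ w.U j) (C i' j) =
        (forms k Y 1).res (inf_le_inf_right _ inf_le_left :
          z.U i ⊓ z.U i' ⊓ w.U j ≤ z.U i ⊓ w.U j) (C i j)) ∧
    (∀ i j j',
      (forms k Y 1).res (inf_le_left : z.U i ⊓ w.U j ⊓ w.U j' ≤ z.U i ⊓ w.U j) (C i j) +
        (forms k Y 1).res (inf_le_inf_right _ inf_le_right :
          z.U i ⊓ w.U j ⊓ w.U j' ≤ w.U j ⊓ w.U j') (w.trans j j') =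
        (forms k Y 1).res (inf_le_inf_right _ inf_le_left :
          z.U i ⊓ w.U j ⊓ w.U j' ≤ z.U i ⊓ w.U j') (C i j'))

variable (k Y) in
/-- The truncated de Rham cohomology `H²_F(Y) = H²(Y, 0 → Ω¹ → Ω² → …)`, as Čech cohomology (the
colimit over all open covers; in this degree of a complex that starts in degree 1 it agrees with
the hypercohomology). -/
def H2F : Type (u + 1) := Quot (Cohomologous (k := k) (Y := Y))

def H2F.mk (z : Cocycle k Y) : H2F k Y := Quot.mk _ z

theorem form_add {p : ℕ} {U : Y.Opens} (α β : (forms k Y p).Sec U) (V : Below U)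
    (ξ : Fin p → VF k V.1) : formAt (α + β) V ξ = formAt α V ξ + formAt β V ξ := rfl

theorem form_smul {p : ℕ} {U : Y.Opens} (f : Γ(Y, U)) (α : (forms k Y p).Sec U) (V : Below U)
    (ξ : Fin p → VF k V.1) : formAt (f • α) V ξ = rs V.2 f * formAt α V ξ := rfl

theorem VF.app_add {U : Y.Opens} (ξ : VF k U) (f g : Γ(Y, U)) :
    ξ.app (f + g) = ξ.app f + ξ.app g := map_add _ _ _

theorem VF.app_cst_mul {U : Y.Opens} (ξ : VF k U) (c : k) (f : Γ(Y, U)) :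
    ξ.app (cst k U c * f) = cst k U c * ξ.app f := by
  have h1 := ξ.2.1 (Below.self U) (cst k U c) f
  have h2 := ξ.2.2.1 (Below.self U) c
  rw [h2, zero_mul, add_zero] at h1
  exact h1

theorem IsExtD.add {U : Y.Opens} {A B : (forms k Y 1).Sec U} {ω θ : (forms k Y 2).Sec U}
    (h : IsExtD A ω) (h' : IsExtD B θ) : IsExtD (A + B) (ω + θ) := by
  intro V ξ η
  simp only [form_add, VF.app_add]
  rw [h V ξ η, h' V ξ η]; ring

theorem IsExtD.smul {U : Y.Opens} (c : k) {A : (forms k Y 1).Sec U} {ω : (forms k Y 2).Sec U}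
    (h : IsExtD A ω) : IsExtD (cst k U c • A) (cst k U c • ω) := by
  intro V ξ η
  simp only [form_smul, rs_cst, VF.app_cst_mul]
  rw [h V ξ η]; ring

theorem IsExtD.res {U V : Y.Opens} (hV : V ≤ U) {A : (forms k Y 1).Sec U}
    {ω : (forms k Y 2).Sec U} (h : IsExtD A ω) :
    IsExtD ((forms k Y 1).res hV A) ((forms k Y 2).res hV ω) :=
  fun W ξ η => h (W.up hV) ξ η

theorem IsClosedForm.add {U : Y.Opens} {ω θ : (forms k Y 2).Sec U}
    (h : IsClosedForm ω) (h' : IsClosedForm θ) : IsClosedForm (ω + θ) := by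
  intro V ξ η ζ
  simp only [form_add, VF.app_add]
  linear_combination h V ξ η ζ + h' V ξ η ζ

theorem IsClosedForm.smul {U : Y.Opens} (c : k) {ω : (forms k Y 2).Sec U}
    (h : IsClosedForm ω) : IsClosedForm (cst k U c • ω) := by
  intro V ξ η ζ
  simp only [form_smul, rs_cst, VF.app_cst_mul]
  linear_combination cst k V.1 c * h V ξ η ζ

theorem IsClosedForm.res {U V : Y.Opens} (hV : V ≤ U) {ω : (forms k Y 2).Sec U}
    (h : IsClosedForm ω) : IsClosedForm ((forms k Y 2).res hV ω) :=
  fun W ξ η ζ => h (W.up hV) ξ η ζ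

theorem inf₄_left (a b c d : Y.Opens) : a ⊓ b ⊓ (c ⊓ d) ≤ a ⊓ c :=
  inf_le_inf inf_le_left inf_le_left

theorem inf₄_right (a b c d : Y.Opens) : a ⊓ b ⊓ (c ⊓ d) ≤ b ⊓ d :=
  inf_le_inf inf_le_right inf_le_right

theorem inf₆_left (a b c d e f : Y.Opens) : a ⊓ b ⊓ (c ⊓ d) ⊓ (e ⊓ f) ≤ a ⊓ c ⊓ e :=
  inf_le_inf (inf_le_inf inf_le_left inf_le_left) inf_le_left

theorem inf₆_right (a b c d e f : Y.Opens) : a ⊓ b ⊓ (c ⊓ d) ⊓ (e ⊓ f) ≤ b ⊓ d ⊓ f :=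
  inf_le_inf (inf_le_inf inf_le_right inf_le_right) inf_le_right

theorem isExtD_add {P R P' R' : Y.Opens} {α : (forms k Y 2).Sec P} {α' : (forms k Y 2).Sec P'}
    {β : (forms k Y 2).Sec R} {β' : (forms k Y 2).Sec R'}
    {A : (forms k Y 1).Sec (P ⊓ P')} {B : (forms k Y 1).Sec (R ⊓ R')}
    (hA : IsExtD A ((forms k Y 2).res inf_le_right α' - (forms k Y 2).res inf_le_left α))
    (hB : IsExtD B ((forms k Y 2).res inf_le_right β' - (forms k Y 2).res inf_le_left β)) :
    IsExtD ((forms k Y 1).res (inf₄_left P R P' R') A + (forms k Y 1).res (inf₄_right P R P' R') B)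
      ((forms k Y 2).res (inf_le_right : P ⊓ R ⊓ (P' ⊓ R') ≤ P' ⊓ R')
          ((forms k Y 2).res inf_le_left α' + (forms k Y 2).res inf_le_right β') -
        (forms k Y 2).res inf_le_left
          ((forms k Y 2).res inf_le_left α + (forms k Y 2).res inf_le_right β)) := by
  have h := (hA.res (inf₄_left P R P' R')).add (hB.res (inf₄_right P R P' R'))
  simp only [map_sub, map_add, ModPresheaf.res_res] at h ⊢
  convert h using 1
  abel

theorem trans_add {P R P' R' P'' R'' : Y.Opens}
    {A : (forms k Y 1).Sec (P ⊓ P')} {A' : (forms k Y 1).Sec (P' ⊓ P'')}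
    {A'' : (forms k Y 1).Sec (P ⊓ P'')}
    (hA : (forms k Y 1).res (inf_le_left : P ⊓ P' ⊓ P'' ≤ P ⊓ P') A +
      (forms k Y 1).res (inf_le_inf_right _ inf_le_right) A' =
      (forms k Y 1).res (inf_le_inf_right _ inf_le_left) A'')
    {B : (forms k Y 1).Sec (R ⊓ R')} {B' : (forms k Y 1).Sec (R' ⊓ R'')}
    {B'' : (forms k Y 1).Sec (R ⊓ R'')}
    (hB : (forms k Y 1).res (inf_le_left : R ⊓ R' ⊓ R'' ≤ R ⊓ R') B +
      (forms k Y 1).res (inf_le_inf_right _ inf_le_right) B' =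
      (forms k Y 1).res (inf_le_inf_right _ inf_le_left) B'') :
    (forms k Y 1).res (inf_le_left : P ⊓ R ⊓ (P' ⊓ R') ⊓ (P'' ⊓ R'') ≤ P ⊓ R ⊓ (P' ⊓ R'))
        ((forms k Y 1).res (inf₄_left P R P' R') A + (forms k Y 1).res (inf₄_right P R P' R') B) +
      (forms k Y 1).res (inf_le_inf_right _ inf_le_right)
        ((forms k Y 1).res (inf₄_left P' R' P'' R'') A' +
          (forms k Y 1).res (inf₄_right P' R' P'' R'') B') =
      (forms k Y 1).res (inf_le_inf_right _ inf_le_left)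
        ((forms k Y 1).res (inf₄_left P R P'' R'') A'' +
          (forms k Y 1).res (inf₄_right P R P'' R'') B'') := by
  have h1 := congrArg ((forms k Y 1).res (inf₆_left P R P' R' P'' R'')) hA
  have h2 := congrArg ((forms k Y 1).res (inf₆_right P R P' R' P'' R'')) hB
  simp only [map_add, ModPresheaf.res_res] at h1 h2 ⊢
  rw [← h1, ← h2]
  abel

theorem isExtD_smul (c : k) {P P' : Y.Opens} {α : (forms k Y 2).Sec P} {α' : (forms k Y 2).Sec P'}
    {A : (forms k Y 1).Sec (P ⊓ P')}
    (hA : IsExtD A ((forms k Y 2).res inf_le_right α' - (forms k Y 2).res inf_le_left α)) :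
    IsExtD (cst k (P ⊓ P') c • A) ((forms k Y 2).res inf_le_right (cst k P' c • α') -
      (forms k Y 2).res inf_le_left (cst k P c • α)) := by
  have h := hA.smul c
  simpa only [smul_sub, ModPresheaf.res_smul, rs_cst] using h

theorem trans_smul (c : k) {P P' P'' : Y.Opens}
    {A : (forms k Y 1).Sec (P ⊓ P')} {A' : (forms k Y 1).Sec (P' ⊓ P'')}
    {A'' : (forms k Y 1).Sec (P ⊓ P'')}
    (hA : (forms k Y 1).res (inf_le_left : P ⊓ P' ⊓ P'' ≤ P ⊓ P') A +
      (forms k Y 1).res (inf_le_inf_right _ inf_le_right) A' =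
      (forms k Y 1).res (inf_le_inf_right _ inf_le_left) A'') :
    (forms k Y 1).res (inf_le_left : P ⊓ P' ⊓ P'' ≤ P ⊓ P') (cst k (P ⊓ P') c • A) +
      (forms k Y 1).res (inf_le_inf_right _ inf_le_right) (cst k (P' ⊓ P'') c • A') =
      (forms k Y 1).res (inf_le_inf_right _ inf_le_left) (cst k (P ⊓ P'') c • A'') := by
  have h := congrArg (fun a => cst k (P ⊓ P' ⊓ P'') c • a) hA
  simpa only [smul_add, ModPresheaf.res_smul, rs_cst] using h

/-- The sum of two cocycles, on the common refinement of their covers. -/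
def Cocycle.add (z w : Cocycle k Y) : Cocycle k Y where
  I := z.I × w.I
  U i := z.U i.1 ⊓ w.U i.2
  cover y := by
    obtain ⟨i, hi⟩ := z.cover y
    obtain ⟨j, hj⟩ := w.cover y
    exact ⟨(i, j), hi, hj⟩
  form i := (forms k Y 2).res inf_le_left (z.form i.1) + (forms k Y 2).res inf_le_right (w.form i.2)
  trans i j := (forms k Y 1).res (inf₄_left _ _ _ _) (z.trans i.1 j.1) +
    (forms k Y 1).res (inf₄_right _ _ _ _) (w.trans i.2 j.2)
  closed i := ((z.closed i.1).res inf_le_left).add ((w.closed i.2).res inf_le_right)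
  d_trans i j := isExtD_add (z.d_trans i.1 j.1) (w.d_trans i.2 j.2)
  trans_trans i j l := trans_add (z.trans_trans i.1 j.1 l.1) (w.trans_trans i.2 j.2 l.2)

/-- Scalar multiples of cocycles. -/
def Cocycle.smul (c : k) (z : Cocycle k Y) : Cocycle k Y where
  I := z.I
  U := z.U
  cover := z.cover
  form i := cst k (z.U i) c • z.form i
  trans i j := cst k (z.U i ⊓ z.U j) c • z.trans i j
  closed i := (z.closed i).smul c
  d_trans i j := isExtD_smul c (z.d_trans i j)
  trans_trans i j l := trans_smul c (z.trans_trans i j l)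

theorem Cohomologous.smul (c : k) {z w : Cocycle k Y} (h : Cohomologous z w) :
    Cohomologous (z.smul c) (w.smul c) := by
  obtain ⟨C, h1, h2, h3⟩ := h
  refine ⟨fun (i : z.I) (j : w.I) => cst k (z.U i ⊓ w.U j) c • C i j, ?_, ?_, ?_⟩
  · intro i j
    have := isExtD_smul c (h1 i j)
    exact this
  · intro i i' j
    have := trans_smul c (h2 i i' j)
    exact this
  · intro i j j'
    have := trans_smul c (h3 i j j')
    exact this

theorem Cohomologous.add_right {z w : Cocycle k Y} (t : Cocycle k Y) (h : Cohomologous z w) :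
    Cohomologous (z.add t) (w.add t) := by
  obtain ⟨C, h1, h2, h3⟩ := h
  refine ⟨fun (i : z.I × t.I) (j : w.I × t.I) =>
    (forms k Y 1).res (inf₄_left (z.U i.1) (t.U i.2) (w.U j.1) (t.U j.2)) (C i.1 j.1) +
    (forms k Y 1).res (inf₄_right (z.U i.1) (t.U i.2) (w.U j.1) (t.U j.2)) (t.trans i.2 j.2),
    ?_, ?_, ?_⟩
  · rintro ⟨i, a⟩ ⟨j, b⟩
    have := isExtD_add (h1 i j) (t.d_trans a b)
    exact this
  · rintro ⟨i, a⟩ ⟨i', a'⟩ ⟨j, b⟩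
    have := trans_add (h2 i i' j) (t.trans_trans a a' b)
    exact this
  · rintro ⟨i, a⟩ ⟨j, b⟩ ⟨j', b'⟩
    have := trans_add (h3 i j j') (t.trans_trans a b b')
    exact this

theorem Cohomologous.add_left {z w : Cocycle k Y} (t : Cocycle k Y) (h : Cohomologous z w) :
    Cohomologous (t.add z) (t.add w) := by
  obtain ⟨C, h1, h2, h3⟩ := h
  refine ⟨fun (i : t.I × z.I) (j : t.I × w.I) =>
    (forms k Y 1).res (inf₄_left (t.U i.1) (z.U i.2) (t.U j.1) (w.U j.2)) (t.trans i.1 j.1) +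
    (forms k Y 1).res (inf₄_right (t.U i.1) (z.U i.2) (t.U j.1) (w.U j.2)) (C i.2 j.2),
    ?_, ?_, ?_⟩
  · rintro ⟨a, i⟩ ⟨b, j⟩
    have := isExtD_add (t.d_trans a b) (h1 i j)
    exact this
  · rintro ⟨a, i⟩ ⟨a', i'⟩ ⟨b, j⟩
    have := trans_add (t.trans_trans a a' b) (h2 i i' j)
    exact this
  · rintro ⟨a, i⟩ ⟨b, j⟩ ⟨b', j'⟩
    have := trans_add (t.trans_trans a b b') (h3 i j j')
    exact this

instance : Add (H2F k Y) :=
  ⟨Quot.map₂ Cocycle.add (fun t _ _ h => h.add_left t) (fun _ _ t h => h.add_right t)⟩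

instance : SMul k (H2F k Y) := ⟨fun c => Quot.map (Cocycle.smul c) (fun _ _ h => h.smul c)⟩

/-- An `𝒪`-linear splitting of the anchor of `L` over `U`. -/
structure Splitting (L : UnitalAlgebroid k Y) (U : Y.Opens) where
  app : ∀ V : Below U, VF k V.1 →ₗ[Γ(Y, V.1)] L.Sec V.1
  app_res : ∀ (V W : Below U) (h : W.1 ≤ V.1) ξ, app W (VF.res h ξ) = L.res h (app V ξ)
  anchor_app : ∀ V ξ, L.anchor V.1 (app V ξ) = ξ

/-- The cocycle `z` comes from local splittings `sᵢ` of `L`: its 2-forms are their curvatures, and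
its 1-forms are the differences `s_j - s_i`. -/
def Represents (L : UnitalAlgebroid k Y) (z : Cocycle k Y) : Prop :=
  ∃ s : ∀ i, Splitting L (z.U i),
    (∀ i (V : Below (z.U i)) (ξ η : VF k V.1), L.unit V.1 (formAt (z.form i) V ![ξ, η]) =
      L.bracket V.1 ((s i).app V ξ) ((s i).app V η) - (s i).app V (ξ.comm η)) ∧
    (∀ i j (V : Below (z.U i ⊓ z.U j)) (ξ : VF k V.1), L.unit V.1 (formAt (z.trans i j) V ![ξ]) =
      (s j).app (V.up inf_le_right) ξ - (s i).app (V.up inf_le_left) ξ)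

/-- `c` is the characteristic class of `L` in `H²_F(Y)`. -/
def HasClass (L : UnitalAlgebroid k Y) (c : H2F k Y) : Prop :=
  ∃ z, Represents L z ∧ H2F.mk z = c

end Cohomology

/-! ### Symplectic forms and deformation quantizations -/

section Quantization

variable (k : Type u) [Field k] (X : Scheme.{u}) [X.Over (Spec (.of k))]

variable {k X}

/-- The differential of a function. -/
def dFun {U : X.Opens} (f : Γ(X, U)) : (forms k X 1).Sec U :=
  ⟨fun V => AlternatingMap.ofSubsingleton Γ(X, V.1) (VF k V.1) Γ(X, V.1) (0 : Fin 1)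
      { toFun := fun ξ => ξ.app (rs V.2 f)
        map_add' := fun _ _ => rfl
        map_smul' := fun g ξ => by
          change rs (Below.self V.1).2 g * ξ.app (rs V.2 f) = g * ξ.app (rs V.2 f)
          rw [rs_id] },
    fun V W h ξ => by
      change rs h ((ξ 0).1 (Below.self V.1) (rs V.2 f)) =
        (ξ 0).1 ((Below.self W.1).up h) (rs W.2 f)
      rw [(ξ 0).2.2.2 (Below.self V.1) ((Below.self W.1).up h) h, rs_rs]⟩

/-- The contraction of a 2-form with a vector field. -/
def contract {U : X.Opens} (ω : (forms k X 2).Sec U) (v : VF k U) : (forms k X 1).Sec U :=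
  ⟨fun V => (ω.1 V).curryLeft (VF.res V.2 v), fun V W h ξ => by
    change rs h (ω.1 V (Matrix.vecCons (VF.res V.2 v) ξ)) =
      ω.1 W (Matrix.vecCons (VF.res W.2 v) fun i => VF.res h (ξ i))
    refine (ω.2 V W h _).trans ?_
    congr 1
    funext i
    refine Fin.cases ?_ (fun i => ?_) i
    · rfl
    · rfl⟩

variable (k X) in
/-- A symplectic form: a closed 2-form for which `v ↦ ω(v, ·)` is an isomorphism `T_X ≃ Ω¹_X`. -/
structure SymplecticForm where
  form : (forms k X 2).Sec ⊤
  closed : IsClosedForm form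
  nondegenerate : ∀ U : X.Opens,
    Function.Bijective (contract ((forms k X 2).res (le_top : U ≤ ⊤) form))

namespace SymplecticForm

variable (ω : SymplecticForm k X) {U : X.Opens}

/-- The vector field `v_f` with `ω(v_f, ·) = df`. -/
def sharp (f : Γ(X, U)) : VF k U :=
  Function.surjInv (ω.nondegenerate U).2 (dFun f)

/-- `P(df, dg)` for the bivector `P` that corresponds to `ω` under the isomorphism
`v ↦ ω(v, ·)`. -/
def poisson (f g : Γ(X, U)) : Γ(X, U) := formAt ω.form ⟨U, le_top⟩ ![ω.sharp f, ω.sharp g]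

/-- The vector field `P(df, ·)`. -/
def ham (f : Γ(X, U)) : VF k U := -ω.sharp f

end SymplecticForm

variable (k X) in
/-- A sheaf of `k[[h]]`-algebras on `X` with a homomorphism to `𝒪_X` (reduction modulo `h`). -/
structure QuantData where
  sheaf : TopCat.Sheaf RingCat.{u} X
  scal : PowerSeries k →+* sheaf.obj.obj (op ⊤)
  scal_comm : ∀ (U : X.Opens) p (x : sheaf.obj.obj (op U)),
    (sheaf.obj.map (homOfLE (le_top : U ≤ ⊤)).op).hom (scal p) * x =
      x * (sheaf.obj.map (homOfLE (le_top : U ≤ ⊤)).op).hom (scal p)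
  red : ∀ U : X.Opens, sheaf.obj.obj (op U) →+* Γ(X, U)
  red_res : ∀ {U V : X.Opens} (h : V ≤ U) x,
    red V ((sheaf.obj.map (homOfLE h).op).hom x) = rs h (red U x)
  red_scal : ∀ p, red ⊤ (scal p) = cst k ⊤ (PowerSeries.constantCoeff p)

namespace QuantData

variable (Q : QuantData k X)

abbrev Sec (U : X.Opens) : Type u := Q.sheaf.obj.obj (op U)

/-- Restriction of sections. -/
def res {U V : X.Opens} (h : V ≤ U) : Q.Sec U →+* Q.Sec V :=
  (Q.sheaf.obj.map (homOfLE h).op).hom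

/-- The image of a power series in the sections over `U`. -/
def scalar (U : X.Opens) : PowerSeries k →+* Q.Sec U := (Q.res le_top).comp Q.scal

/-- The parameter `h`. -/
def hbar (U : X.Opens) : Q.Sec U := Q.scalar U PowerSeries.X

end QuantData

/-- A local isomorphism `η : 𝒪_h ≅ 𝒪_X[[h]]` over `U` of sheaves of `k[[h]]`-modules, compatible
with the reductions modulo `h`, for which `a * b ≡ ab + (1/2) h P(da, db)` modulo `h²`. -/
structure LocalTriv (Q : QuantData k X) (ω : SymplecticForm k X) (U : X.Opens) where
  η : ∀ V : Below U, Q.Sec V.1 ≃+ PowerSeries Γ(X, V.1)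
  η_res : ∀ (V W : Below U) (h : W.1 ≤ V.1) x,
    η W (Q.res h x) = PowerSeries.map (rs h) (η V x)
  η_scalar : ∀ V p x, η V (Q.scalar V.1 p * x) = PowerSeries.map (cst k V.1) p * η V x
  η_red : ∀ V x, PowerSeries.constantCoeff (η V x) = Q.red V.1 x
  η_mul : ∀ (V : Below U) (a b : Γ(X, V.1)),
    PowerSeries.coeff 1 (η V ((η V).symm (PowerSeries.C a) * (η V).symm (PowerSeries.C b))) =
      cst k V.1 (1 / 2) * ω.poisson a b

/-- A deformation quantization `𝒪_h` of `𝒪_X` which agrees with `ω`. -/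
structure DefQuant (ω : SymplecticForm k X) extends QuantData k X where
  locallyTrivial : ∀ x : X, ∃ U : X.Opens, x ∈ U ∧ Nonempty (LocalTriv toQuantData ω U)

/-- `c` is the class `ω₁` of `𝒪_h` in `H²_F(X)`. For local isomorphisms `ηᵢ : 𝒪_h ≅ 𝒪_X[[h]]` and
`sᵢ(a) = ηᵢ⁻¹(a)` one has `(1/h)[sᵢ(a), sᵢ(b)] = sᵢ(P(da, db)) + h κᵢ(a, b)` and
`s_j(a) = sᵢ(a) + h D_{ij}(a)` modulo `h²`; the class is that of the cocycle of the 2-forms `ωᵢ` and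
1-forms `A_{ij}` with `ωᵢ(X_a, X_b) = κᵢ(a, b)` and `A_{ij}(X_a) = D_{ij}(a)`, where
`X_a = P(da, ·)`. -/
def DefQuant.HasFirstClass {ω : SymplecticForm k X} (Q : DefQuant ω) (c : H2F k X) : Prop :=
  ∃ (z : Cocycle k X) (t : ∀ i, LocalTriv Q.toQuantData ω (z.U i)),
    (∀ i (V : Below (z.U i)) (a b : Γ(X, V.1)),
      formAt (z.form i) V ![ω.ham a, ω.ham b] =
        PowerSeries.coeff 2 ((t i).η V
          (((t i).η V).symm (PowerSeries.C a) * ((t i).η V).symm (PowerSeries.C b) -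
            ((t i).η V).symm (PowerSeries.C b) * ((t i).η V).symm (PowerSeries.C a)))) ∧
    (∀ i j (V : Below (z.U i ⊓ z.U j)) (a : Γ(X, V.1)),
      formAt (z.trans i j) V ![ω.ham a] =
        PowerSeries.coeff 1 ((t i).η (V.up inf_le_left)
          (((t j).η (V.up inf_le_right)).symm (PowerSeries.C a)))) ∧
    H2F.mk z = c

/-! ### The Lagrangian subvariety -/

variable {Y : Scheme.{u}} [Y.Over (Spec (.of k))] (j : Y ⟶ X)

/-- The pull-back of functions. -/
def jres {U : X.Opens} {V : Y.Opens} (h : V ≤ j ⁻¹ᵁ U) : Γ(X, U) →+* Γ(Y, V) :=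
  (j.appLE U V h).hom

/-- A vector field on `V ⊆ X` and a vector field on `V' ⊆ Y` are `j`-related. -/
def Related {V : X.Opens} {V' : Y.Opens} (ξ : VF k V) (ξ' : VF k V') : Prop :=
  ∀ (W : Below V) (W' : Below V') (h : W'.1 ≤ j ⁻¹ᵁ W.1) (f : Γ(X, W.1)),
    jres j h (ξ.1 W f) = ξ'.1 W' (jres j h f)

/-- `β = j^* α`, for a closed immersion `j` of smooth schemes, where vector fields on `Y` are
locally related to vector fields on `X`. -/
def IsPullbackForm {p : ℕ} {U : X.Opens} {U' : Y.Opens} (α : (forms k X p).Sec U)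
    (β : (forms k Y p).Sec U') : Prop :=
  ∀ (V : Below U) (V' : Below U') (h : V'.1 ≤ j ⁻¹ᵁ V.1) (ξ : Fin p → VF k V.1)
    (ξ' : Fin p → VF k V'.1), (∀ i, Related j (ξ i) (ξ' i)) →
    jres j h (formAt α V ξ) = formAt β V' ξ'

/-- `d = j^* c` in the truncated de Rham cohomology: the classes are represented by cocycles `z`
and `w` such that the forms of `w` are pulled back from those of `z`. -/
def IsPullbackClass (c : H2F k X) (d : H2F k Y) : Prop :=
  ∃ (z : Cocycle k X) (w : Cocycle k Y) (e : w.I → z.I), H2F.mk z = c ∧ H2F.mk w = d ∧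
    (∀ i, w.U i ≤ j ⁻¹ᵁ z.U (e i)) ∧
    (∀ i, IsPullbackForm j (z.form (e i)) (w.form i)) ∧
    (∀ i i', IsPullbackForm j (z.trans (e i) (e i')) (w.trans i i'))

/-- `Y` is isotropic: `j^* ω = 0`. -/
def IsIsotropic (ω : SymplecticForm k X) : Prop :=
  IsPullbackForm j ω.form (0 : (forms k Y 2).Sec ⊤)

/-- The preimage `I_h ⊆ 𝒪_h` of the ideal `I ⊆ 𝒪_X` of `Y`. -/
def QuantData.ideal (Q : QuantData k X) (U : X.Opens) : Ideal (Q.Sec U) :=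
  RingHom.ker ((jres j (le_refl (j ⁻¹ᵁ U))).comp (Q.red U))

/-- The sections of `I_h * I_h`, before sheafification. -/
def QuantData.idealSq (Q : QuantData k X) (U : X.Opens) : AddSubgroup (Q.Sec U) :=
  AddSubgroup.closure {z | ∃ a ∈ Q.ideal j U, ∃ b ∈ Q.ideal j U, z = a * b}

/-- Inverse images of opens are monotone. -/
theorem preimage_le {U V : X.Opens} (h : V ≤ U) : j ⁻¹ᵁ V ≤ j ⁻¹ᵁ U := fun _ hx => h hx

/-- The algebroid `L(𝒪_h)`: the quotient sheaf `I_h / (I_h * I_h)`, regarded as a sheaf on `Y`. The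
first group of fields says that `q` is the quotient map from `I_h`, the second one describes the
structure: the bracket descends from `(1/h)(a * b - b * a)`, the action of functions from the
symmetrized product `(1/2)(f * x + x * f)`, the anchor is `x ↦ (1/h)[x, ·]`, and `𝒪_Y` is embedded
as `h 𝒪_h / h I_h`. All this determines `L(𝒪_h)` up to a unique isomorphism. -/
structure TorAlgebroid (Q : QuantData k X) where
  alg : UnitalAlgebroid k Y
  isSheaf : alg.toModPresheaf.IsSheaf
  q : ∀ U : X.Opens, Q.ideal j U →+ alg.Sec (j ⁻¹ᵁ U)
  q_res : ∀ {U V : X.Opens} (h : V ≤ U) (x : Q.ideal j U) (y : Q.ideal j V),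
    y.1 = Q.res h x.1 → q V y = alg.res (preimage_le j h) (q U x)
  q_surjective : ∀ (W : Y.Opens) (l : alg.Sec W), ∀ y ∈ W,
    ∃ (U : X.Opens) (h : j ⁻¹ᵁ U ≤ W), y ∈ j ⁻¹ᵁ U ∧ ∃ x, q U x = alg.res h l
  q_eq_zero : ∀ (U : X.Opens) (x : Q.ideal j U), q U x = 0 ↔
    ∀ y ∈ U, ∃ (V : X.Opens) (h : V ≤ U), y ∈ V ∧ Q.res h x.1 ∈ Q.idealSq j V
  q_bracket : ∀ (U : X.Opens) (x y z : Q.ideal j U), Q.hbar U * z.1 = x.1 * y.1 - y.1 * x.1 →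
    alg.bracket _ (q U x) (q U y) = q U z
  q_smul : ∀ (U : X.Opens) (f : Q.Sec U) (x y : Q.ideal j U),
    y.1 = Q.scalar U (PowerSeries.C (1 / 2)) * (f * x.1 + x.1 * f) →
    jres j le_rfl (Q.red U f) • q U x = q U y
  q_anchor : ∀ (U : X.Opens) (x : Q.ideal j U) (f g : Q.Sec U),
    Q.hbar U * g = x.1 * f - f * x.1 →
    (alg.anchor _ (q U x)).app (jres j le_rfl (Q.red U f)) = jres j le_rfl (Q.red U g)
  q_unit : ∀ (U : X.Opens) (f : Q.Sec U) (x : Q.ideal j U), x.1 = Q.hbar U * f →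
    alg.unit _ (jres j le_rfl (Q.red U f)) = q U x

/-! ### Quantizations of a vector bundle modulo powers of `h` -/

variable {j}

/-- Restriction of sections of a sheaf of `𝒪_h`-modules. -/
def fres {Q : QuantData k X} (F : SheafOfModules.{u} Q.sheaf) {U V : X.Opens} (h : V ≤ U)
    (e : F.val.obj (op U)) : F.val.obj (op V) := F.val.map (homOfLE h).op e

variable (j) in
/-- A flat deformation quantization of `E` modulo `h^m`: a sheaf `F` of `𝒪_h/h^m`-modules, flat over
`k[h]/h^m`, with an isomorphism `F/hF ≅ j_* E`. A module `M` over `k[h]/h^m` is flat if and only if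
`Tor₁(k, M) = 0`, that is, if and only if the kernel of `h` on `M` is `h^(m-1) M`. -/
structure QuantModule (Q : QuantData k X) (E : Y.Modules) (m : ℕ) where
  F : SheafOfModules.{u} Q.sheaf
  torsion : ∀ (U : X.Opens) (e : F.val.obj (op U)), Q.hbar U ^ m • e = 0
  flat : ∀ (U : X.Opens) (e : F.val.obj (op U)), Q.hbar U • e = 0 → ∀ x ∈ U,
    ∃ (V : X.Opens) (h : V ≤ U), x ∈ V ∧ ∃ e', fres F h e = Q.hbar V ^ (m - 1) • e'
  red : ∀ U : X.Opens, F.val.obj (op U) →+ (ModPresheaf.of E).Sec (j ⁻¹ᵁ U)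
  red_res : ∀ {U V : X.Opens} (h : V ≤ U) (e : F.val.obj (op U)),
    red V (fres F h e) = (ModPresheaf.of E).res (preimage_le j h) (red U e)
  red_smul : ∀ (U : X.Opens) (a : Q.Sec U) (e : F.val.obj (op U)),
    red U (a • e) = jres j le_rfl (Q.red U a) • red U e
  red_surjective : ∀ (U : X.Opens) (e : (ModPresheaf.of E).Sec (j ⁻¹ᵁ U)), ∀ x ∈ U,
    ∃ (V : X.Opens) (h : V ≤ U), x ∈ V ∧
      ∃ e', red V e' = (ModPresheaf.of E).res (preimage_le j h) e
  red_eq_zero : ∀ (U : X.Opens) (e : F.val.obj (op U)), red U e = 0 ↔ ∀ x ∈ U,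
    ∃ (V : X.Opens) (h : V ≤ U), x ∈ V ∧ ∃ e', fres F h e = Q.hbar V • e'

/-- `F'` is an extension modulo `h^m'` of the quantization `F` modulo `h^m`: there is an isomorphism
`F'/h^m F' ≅ F` compatible with the reductions to `E`. -/
def QuantModule.IsExtension {Q : QuantData k X} {E : Y.Modules} {m m' : ℕ}
    (F : QuantModule j Q E m) (F' : QuantModule j Q E m') : Prop :=
  ∃ τ : SheafOfModules.Hom F'.F F.F,
    (∀ (U : X.Opens) (e : F'.F.val.obj (op U)), F.red U (τ.val.app (op U) e) = F'.red U e) ∧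
    (∀ (U : X.Opens) (e : F.F.val.obj (op U)), ∀ x ∈ U, ∃ (V : X.Opens) (h : V ≤ U), x ∈ V ∧
      ∃ e', τ.val.app (op V) e' = fres F.F h e) ∧
    (∀ (U : X.Opens) (e : F'.F.val.obj (op U)), τ.val.app (op U) e = 0 ↔ ∀ x ∈ U,
      ∃ (V : X.Opens) (h : V ≤ U), x ∈ V ∧ ∃ e', fres F'.F h e = Q.hbar V ^ m • e')

/-- The algebroid `L⁺(𝒪_h) = L(𝒪_h) + (1/2) L(K_Y)` on `Y` of dimension `n`. -/
abbrev PlusAlgebroid (n : ℕ) {Q : QuantData k X} (T : TorAlgebroid j Q) : Type (u + 1) :=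
  Combination 1 (1 / 2 : k) T.alg (atiyah k (forms k Y n))

/-- The `L⁺(𝒪_h)`-module structure `γ⁺` on `E` is induced by the quantization `F` modulo `h²`: for
`x ∈ I_h` with image `x̄ ∈ T_Y`, the section `s(x, l(x̄))` of `L⁺(𝒪_h)` acts on
`E ≅ F/hF` as `x : F/hF → hF ≅ E`. -/
def IsInduced {n : ℕ} {Q : QuantData k X} {T : TorAlgebroid j Q} {P : PlusAlgebroid n T}
    {E : Y.Modules} (F : QuantModule j Q E 2)
    (γ : ModuleStructure P.alg (ModPresheaf.of E)) : Prop :=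
  ∀ (U : X.Opens) (x : Q.ideal j U) (e e' : F.F.val.obj (op U)), x.1 • e = Q.hbar U • e' →
    At.act (γ.hom.app (j ⁻¹ᵁ U) (P.s.app (j ⁻¹ᵁ U)
      ⟨(T.q U x, lieDer n (T.alg.anchor _ (T.q U x))), rfl⟩)) (F.red U e) = F.red U e'

end Quantization

end LagQuant

end

noncomputable section

namespace LagQuant

/-! ### Coordinates on algebras -/

section CoordAlgebra

open KaehlerDifferential TensorProduct

/-- `δ` is a derivation along `ψ : A → B`, trivial on the constants `φ : k → A`. -/
def IsDer {k A B : Type u} [CommRing k] [CommRing A] [CommRing B] (φ : k →+* A) (ψ : A →+* B)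
    (δ : A →+ B) : Prop :=
  (∀ a b, δ (a * b) = ψ a * δ b + δ a * ψ b) ∧ ∀ c, δ (φ c) = 0

/-- The differentials of the `xᵢ` form a basis of the Kähler differentials. -/
def IsCoord {k A : Type u} [CommRing k] [CommRing A] (φ : k →+* A) {m : ℕ} (x : Fin m → A) : Prop :=
  letI := φ.toAlgebra
  LinearIndependent A (fun i => D k A (x i)) ∧
    (⊤ : Submodule A (Ω[A⁄k])) ≤ Submodule.span A (Set.range fun i => D k A (x i))

/-- A derivation along `ψ` as a derivation in the sense of Mathlib. -/
def IsDer.toDerivation {k A B : Type u} [CommRing k] [CommRing A] [CommRing B] [Algebra k A]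
    [Algebra A B] [Algebra k B] [IsScalarTower k A B] {δ : A →+ B}
    (h : IsDer (algebraMap k A) (algebraMap A B) δ) : Derivation k A B where
  toFun := δ
  map_add' := δ.map_add
  map_smul' c a := by
    rw [Algebra.smul_def, h.1, h.2, zero_mul, add_zero, RingHom.id_apply,
      ← IsScalarTower.algebraMap_apply, Algebra.smul_def]
  map_one_eq_zero' := by
    have := h.2 1
    rw [map_one] at this
    exact this
  leibniz' a b := by
    change δ (a * b) = a • δ b + b • δ a
    rw [h.1, Algebra.smul_def, Algebra.smul_def]; ring

theorem IsDer.of_derivation {k A B : Type u} [CommRing k] [CommRing A] [CommRing B] [Algebra k A]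
    [Algebra A B] [Algebra k B] [IsScalarTower k A B] (d : Derivation k A B) :
    IsDer (algebraMap k A) (algebraMap A B) (d : A →+ B) :=
  ⟨fun a b => by
    change d (a * b) = _ * d b + d a * _
    rw [d.leibniz, Algebra.smul_def, Algebra.smul_def]; ring,
   fun c => d.map_algebraMap c⟩

theorem IsCoord.existsUnique_der {k A B : Type u} [CommRing k] [CommRing A] [CommRing B]
    {φ : k →+* A} {m : ℕ} {x : Fin m → A} (hx : IsCoord φ x) (ψ : A →+* B) (c : Fin m → B) :
    ∃! δ : A →+ B, IsDer φ ψ δ ∧ ∀ i, δ (x i) = c i := by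
  let := φ.toAlgebra
  let := ψ.toAlgebra
  let := (ψ.comp φ).toAlgebra
  have : IsScalarTower k A B := IsScalarTower.of_algebraMap_eq fun _ => rfl
  let b := Module.Basis.mk hx.1 hx.2
  have hb : ∀ i, b i = D k A (x i) := fun i => Module.Basis.mk_apply _ _ _
  refine ⟨((b.constr ℤ c).compDer (D k A) : Derivation k A B), ⟨IsDer.of_derivation _, fun i => ?_⟩,
    ?_⟩
  · change (b.constr ℤ c) (D k A (x i)) = c i
    rw [← hb, Module.Basis.constr_basis]
  · rintro δ ⟨h1, h2⟩
    have h1' : IsDer (algebraMap k A) (algebraMap A B) δ := h1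
    ext a
    change h1'.toDerivation a = (b.constr ℤ c) (D k A a)
    rw [← Derivation.liftKaehlerDifferential_comp_D h1'.toDerivation]
    congr 1
    refine b.ext fun i => ?_
    rw [Module.Basis.constr_basis, hb, Derivation.liftKaehlerDifferential_comp_D]
    exact h2 i

theorem IsCoord.ext {k A B : Type u} [CommRing k] [CommRing A] [CommRing B]
    {φ : k →+* A} {m : ℕ} {x : Fin m → A} (hx : IsCoord φ x) {ψ : A →+* B} {δ δ' : A →+ B}
    (h : IsDer φ ψ δ) (h' : IsDer φ ψ δ') (e : ∀ i, δ (x i) = δ' (x i)) : δ = δ' :=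
  (hx.existsUnique_der ψ fun i => δ' (x i)).unique ⟨h, e⟩ ⟨h', fun _ => rfl⟩

/-- The derivation along `ψ` with prescribed values on the coordinates. -/
def IsCoord.der {k A B : Type u} [CommRing k] [CommRing A] [CommRing B]
    {φ : k →+* A} {m : ℕ} {x : Fin m → A} (hx : IsCoord φ x) (ψ : A →+* B) (c : Fin m → B) :
    A →+ B := (hx.existsUnique_der ψ c).choose

theorem IsCoord.isDer_der {k A B : Type u} [CommRing k] [CommRing A] [CommRing B]
    {φ : k →+* A} {m : ℕ} {x : Fin m → A} (hx : IsCoord φ x) (ψ : A →+* B) (c : Fin m → B) :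
    IsDer φ ψ (hx.der ψ c) := (hx.existsUnique_der ψ c).choose_spec.1.1

theorem IsCoord.der_apply {k A B : Type u} [CommRing k] [CommRing A] [CommRing B]
    {φ : k →+* A} {m : ℕ} {x : Fin m → A} (hx : IsCoord φ x) (ψ : A →+* B) (c : Fin m → B) (i) :
    hx.der ψ c (x i) = c i := (hx.existsUnique_der ψ c).choose_spec.1.2 i

theorem IsCoord.of_formallyEtale {k A B : Type u} [CommRing k] [CommRing A] [CommRing B]
    {φ : k →+* A} {m : ℕ} {x : Fin m → A} (hx : IsCoord φ x) (ψ : A →+* B) (h : ψ.FormallyEtale) :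
    IsCoord (ψ.comp φ) (fun i => ψ (x i)) := by
  let := φ.toAlgebra
  let := ψ.toAlgebra
  let := (ψ.comp φ).toAlgebra
  have : IsScalarTower k A B := IsScalarTower.of_algebraMap_eq fun _ => rfl
  have : Algebra.FormallyEtale A B := h
  let b := Module.Basis.mk hx.1 hx.2
  have hb : ∀ i, b i = D k A (x i) := fun i => Module.Basis.mk_apply _ _ _
  let b' := (b.baseChange B).map (tensorKaehlerEquivOfFormallyEtale k A B)
  have hb' : ⇑b' = fun i => D k B (ψ (x i)) := by
    funext i
    change tensorKaehlerEquivOfFormallyEtale k A B ((b.baseChange B) i) = D k B (algebraMap A B (x i))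
    rw [Module.Basis.baseChange_apply, hb, tensorKaehlerEquivOfFormallyEtale_apply,
      mapBaseChange_tmul, one_smul, map_D]
  exact ⟨hb' ▸ b'.linearIndependent, hb' ▸ b'.span_eq.ge⟩

theorem exists_isCoord_of_standardSmooth {k A : Type u} [CommRing k] [CommRing A] {φ : k →+* A}
    {m : ℕ} (h : φ.IsStandardSmoothOfRelativeDimension m) : ∃ x : Fin m → A, IsCoord φ x := by
  let := φ.toAlgebra
  have : Algebra.IsStandardSmoothOfRelativeDimension m k A := h
  obtain ⟨ι, σ, hσ, hι, P, hP⟩ := this.out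
  have := Fintype.ofFinite ι
  classical
  have hcard : Nat.card ((Set.range P.map)ᶜ : Set ι) = m := by
    have := Fintype.ofFinite σ
    rw [← hP, Nat.card_eq_fintype_card, Fintype.card_compl_set, Algebra.Presentation.dimension, Nat.card_eq_fintype_card, Nat.card_eq_fintype_card, Set.card_range_of_injective P.map_inj]
  let e : ((Set.range P.map)ᶜ : Set ι) ≃ Fin m := Finite.equivFinOfCardEq hcard
  let b := P.basisKaehler.reindex e
  have hb : ⇑b = fun i => D k A (P.val (e.symm i).1) := by
    funext i
    rw [Module.Basis.reindex_apply, Algebra.SubmersivePresentation.basisKaehler_apply]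
  exact ⟨fun i => P.val (e.symm i).1, hb ▸ b.linearIndependent, hb ▸ b.span_eq.ge⟩

/-- A family of functions killed by all derivations of the quotient, regarded as a differential
restricted to the quotient, is the differential of a function in the ideal. -/
theorem IsCoord.exists_conormal {k A B : Type u} [CommRing k] [CommRing A] [CommRing B]
    {φ : k →+* A} {m n : ℕ} {x : Fin m → A} {ψ : A →+* B}
    (hψ : Function.Surjective ψ) {t : Fin n → B} (ht : IsCoord (ψ.comp φ) t) (c : Fin m → B)
    (h : ∀ δ : B →+ B, IsDer (ψ.comp φ) (RingHom.id B) δ → ∑ i, c i * δ (ψ (x i)) = 0) :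
    ∃ f : A, ψ f = 0 ∧ ∀ δ : A →+ B, IsDer φ ψ δ → δ f = ∑ i, c i * δ (x i) := by
  let := φ.toAlgebra
  let := ψ.toAlgebra
  let := (ψ.comp φ).toAlgebra
  have : IsScalarTower k A B := IsScalarTower.of_algebraMap_eq fun _ => rfl
  let b := Module.Basis.mk ht.1 ht.2
  let α : B ⊗[A] Ω[A⁄k] := ∑ i, c i ⊗ₜ D k A (x i)
  have hα : mapBaseChange k A B α = 0 := by
    refine b.ext_elem fun l => ?_
    have h1 := h ((b.coord l).compDer (D k B) : Derivation k B B) (IsDer.of_derivation _)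
    have h2 : mapBaseChange k A B α = ∑ i, c i • D k B (ψ (x i)) := by
      simp only [α, map_sum, mapBaseChange_tmul, map_D]
      rfl
    rw [h2, map_zero, Finsupp.zero_apply, ← Module.Basis.coord_apply, map_sum]
    simp only [map_smul]
    exact h1
  obtain ⟨f, hf⟩ := (exact_kerCotangentToTensor_mapBaseChange k A B hψ α).1 hα
  obtain ⟨f, rfl⟩ := Ideal.toCotangent_surjective _ f
  refine ⟨f.1, f.2, fun δ hδ => ?_⟩
  have hδ' : IsDer (algebraMap k A) (algebraMap A B) δ := hδ
  let ev : B ⊗[A] Ω[A⁄k] →ₗ[A] B :=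
    TensorProduct.lift ((LinearMap.mul A B).compl₂ hδ'.toDerivation.liftKaehlerDifferential)
  have ev_apply : ∀ (b : B) a, ev (b ⊗ₜ D k A a) = b * δ a := fun b a => by
    simp only [ev, TensorProduct.lift.tmul, LinearMap.compl₂_apply, LinearMap.mul_apply',
      Derivation.liftKaehlerDifferential_comp_D]
    rfl
  have h3 := congrArg ev hf
  rw [kerCotangentToTensor_toCotangent, ev_apply, one_mul, map_sum] at h3
  rw [h3]
  exact Finset.sum_congr rfl fun i _ => ev_apply _ _

theorem IsCoord.mem_sq {k A B : Type u} [CommRing k] [CommRing A] [CommRing B]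
    {φ : k →+* A} {m : ℕ} {x : Fin m → A} (hx : IsCoord φ x) {ψ : A →+* B}
    (hψ : Function.Surjective ψ) (hA : φ.FormallySmooth) (hB : (ψ.comp φ).FormallySmooth) {f : A}
    (hf : ψ f = 0) (h : ∀ δ : A →+ B, IsDer φ ψ δ → δ f = 0) : f ∈ RingHom.ker ψ ^ 2 := by
  let := φ.toAlgebra
  let := ψ.toAlgebra
  let := (ψ.comp φ).toAlgebra
  have : IsScalarTower k A B := IsScalarTower.of_algebraMap_eq fun _ => rfl
  have : Algebra.FormallySmooth k A := hA
  have : Algebra.FormallySmooth k B := hB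
  let b := (Module.Basis.mk hx.1 hx.2).baseChange B
  obtain ⟨l, hl⟩ := (Algebra.FormallySmooth.iff_split_injection (R := k) (P := A) (A := B) hψ).1 hB
  let f' : RingHom.ker (algebraMap A B) := ⟨f, hf⟩
  have h1 : kerCotangentToTensor k A B (Ideal.toCotangent _ f') = 0 := by
    rw [kerCotangentToTensor_toCotangent]
    refine b.ext_elem fun i => ?_
    let g : Ω[A⁄k] →ₗ[A] B := ((b.coord i).restrictScalars A).comp (TensorProduct.mk A B (Ω[A⁄k]) 1)
    have h2 := h (g.compDer (D k A) : Derivation k A B) (IsDer.of_derivation _)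
    rw [map_zero, Finsupp.zero_apply, ← Module.Basis.coord_apply]
    exact h2
  have h2 := LinearMap.congr_fun hl (Ideal.toCotangent _ f')
  rw [LinearMap.comp_apply, h1, map_zero] at h2
  have h3 := (Ideal.toCotangent_eq_zero _ f').1 h2.symm
  exact h3

end CoordAlgebra

/-! ### Gluing -/

section Glue

variable {Y : Scheme.{u}}

/-- Sections that agree locally are equal. -/
def ModPresheaf.IsSep (M : ModPresheaf Y) : Prop :=
  ∀ (U : Y.Opens) (s t : M.Sec U),
    (∀ y ∈ U, ∃ (V : Y.Opens) (h : V ≤ U), y ∈ V ∧ M.res h s = M.res h t) → s = t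

theorem ModPresheaf.IsSheaf.existsUnique_glue {M : ModPresheaf Y} (hM : M.IsSheaf) {U : Y.Opens}
    (R : ∀ V : Y.Opens, V ≤ U → M.Sec V → Prop)
    (hex : ∀ y ∈ U, ∃ (V : Y.Opens) (h : V ≤ U), y ∈ V ∧ ∃ s, R V h s)
    (hun : ∀ (V : Y.Opens) (h : V ≤ U) (s : M.Sec V) (V' : Y.Opens) (h' : V' ≤ U) (s' : M.Sec V'),
      R V h s → R V' h' s' →
        M.res (inf_le_left : V ⊓ V' ≤ V) s = M.res (inf_le_right : V ⊓ V' ≤ V') s') :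
    ∃! t : M.Sec U, ∀ (V : Y.Opens) (h : V ≤ U) (s : M.Sec V), R V h s → M.res h t = s := by
  let I := {p : Σ V : Y.Opens, M.Sec V // ∃ h : p.1 ≤ U, R p.1 h p.2}
  have hU : (⨆ i : I, i.1.1) = U := by
    refine le_antisymm (iSup_le fun i => i.2.choose) fun y hy => ?_
    obtain ⟨V, h, hyV, s, hs⟩ := hex y hy
    exact Opens.mem_iSup.2 ⟨⟨⟨V, s⟩, h, hs⟩, hyV⟩
  obtain ⟨t, ht, htu⟩ := hM I (fun i => i.1.1) (fun i => i.1.2) fun i i' =>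
    hun _ i.2.choose _ _ i'.2.choose _ i.2.choose_spec i'.2.choose_spec
  refine ⟨M.res hU.ge t, fun V h s hs => ?_, fun t' ht' => ?_⟩
  · have := ht ⟨⟨V, s⟩, h, hs⟩
    rw [M.res_res]; exact this
  · rw [← htu (M.res hU.le t') fun i => by
      rw [M.res_res]; exact ht' _ i.2.choose _ i.2.choose_spec]
    rw [M.res_res, M.res_id]

theorem ModPresheaf.IsSheaf.isSep {M : ModPresheaf Y} (hM : M.IsSheaf) : M.IsSep := by
  intro U s t h
  refine (hM.existsUnique_glue (fun V h r => M.res h s = r ∧ M.res h t = r) ?_ ?_).unique ?_ ?_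
  · intro y hy
    obtain ⟨V, hV, hyV, e⟩ := h y hy
    exact ⟨V, hV, hyV, _, e, rfl⟩
  · rintro V h s' V' h' t' ⟨rfl, _⟩ ⟨rfl, _⟩
    rw [M.res_res, M.res_res]
  · exact fun V h r hr => hr.1
  · exact fun V h r hr => hr.2

/-- Separatedness and existence of gluings give a sheaf. -/
theorem ModPresheaf.IsSheaf.of_sep {M : ModPresheaf Y} (hM : M.IsSep)
    (h : ∀ (I : Type u) (U : I → Y.Opens) (s : ∀ i, M.Sec (U i)),
      (∀ i j, M.res (inf_le_left : U i ⊓ U j ≤ U i) (s i) =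
        M.res (inf_le_right : U i ⊓ U j ≤ U j) (s j)) →
      ∃ t : M.Sec (⨆ i, U i), ∀ i, M.res (le_iSup U i) t = s i) : M.IsSheaf := by
  intro I U s hs
  obtain ⟨t, ht⟩ := h I U s hs
  refine ⟨t, ht, fun t' ht' => hM _ _ _ fun y hy => ?_⟩
  obtain ⟨i, hi⟩ := Opens.mem_iSup.1 hy
  exact ⟨U i, le_iSup U i, hi, (ht' i).trans (ht i).symm⟩

variable (Y) in
/-- The structure sheaf. -/
def funMod : ModPresheaf Y where
  Sec U := Γ(Y, U)
  res h := (rs h).toAddMonoidHom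
  res_id h f := rs_id h f
  res_res h h' f := rs_rs h h' f
  res_smul h f m := map_mul (rs h) f m

theorem funMod_isSheaf : (funMod Y).IsSheaf := by
  intro I U s hs
  obtain ⟨t, ht, htu⟩ := Y.sheaf.existsUnique_gluing U s (fun i j => hs i j)
  exact ⟨t, ht, htu⟩

theorem of_isSheaf (E : Y.Modules) : (ModPresheaf.of E).IsSheaf := by
  intro I U s hs
  obtain ⟨t, ht, htu⟩ := TopCat.Sheaf.existsUnique_gluing (⟨E.presheaf, E.isSheaf⟩) U s
    (fun i j => hs i j)
  exact ⟨t, ht, htu⟩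

theorem rs_ext {U : Y.Opens} {f g : Γ(Y, U)}
    (h : ∀ y ∈ U, ∃ (V : Y.Opens) (h : V ≤ U), y ∈ V ∧ rs h f = rs h g) : f = g :=
  funMod_isSheaf.isSep U f g h

theorem existsUnique_fun {U : Y.Opens} (R : ∀ V : Y.Opens, V ≤ U → Γ(Y, V) → Prop)
    (hex : ∀ y ∈ U, ∃ (V : Y.Opens) (h : V ≤ U), y ∈ V ∧ ∃ s, R V h s)
    (hun : ∀ (V : Y.Opens) (h : V ≤ U) (s : Γ(Y, V)) (V' : Y.Opens) (h' : V' ≤ U) (s' : Γ(Y, V')),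
      R V h s → R V' h' s' →
        rs (inf_le_left : V ⊓ V' ≤ V) s = rs (inf_le_right : V ⊓ V' ≤ V') s') :
    ∃! t : Γ(Y, U), ∀ (V : Y.Opens) (h : V ≤ U) (s : Γ(Y, V)), R V h s → rs h t = s :=
  funMod_isSheaf.existsUnique_glue R hex hun

theorem exists_affine {U : Y.Opens} {y : Y} (hy : y ∈ U) :
    ∃ V : Y.Opens, V ≤ U ∧ y ∈ V ∧ IsAffineOpen V := by
  obtain ⟨_, ⟨V, hV, rfl⟩, hyV, hVU⟩ := Y.isBasis_affineOpens.exists_subset_of_mem_open hy U.2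
  exact ⟨V, hVU, hyV, hV⟩

end Glue

/-! ### Coordinates on open subschemes -/

section Coord

variable (k : Type u) [Field k] {Y : Scheme.{u}} [Y.Over (Spec (.of k))]

/-- Coordinates on an affine open subscheme. -/
structure IsCoordOn (U : Y.Opens) {m : ℕ} (x : Fin m → Γ(Y, U)) : Prop where
  affine : IsAffineOpen U
  coord : IsCoord (cst k U) x

variable {k}

theorem rs_formallyEtale {U V : Y.Opens} (h : V ≤ U) (hU : IsAffineOpen U) (hV : IsAffineOpen V) :
    (rs h).FormallyEtale := by
  have h1 : RingHom.Etale ((𝟙 Y : Y ⟶ Y).appLE U V h).hom :=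
    HasRingHomProperty.appLE @Etale (𝟙 Y) inferInstance ⟨U, hU⟩ ⟨V, hV⟩ h
  have h2 : (𝟙 Y : Y ⟶ Y).appLE U V h = Y.presheaf.map (homOfLE h).op := by
    simp only [Scheme.Hom.appLE]
    exact Category.id_comp _
  rw [h2] at h1
  exact h1.formallyEtale

theorem IsCoordOn.restrict {U V : Y.Opens} {m : ℕ} {x : Fin m → Γ(Y, U)} (hx : IsCoordOn k U x)
    (h : V ≤ U) (hV : IsAffineOpen V) : IsCoordOn k V fun i => rs h (x i) := by
  refine ⟨hV, ?_⟩
  have h1 := hx.coord.of_formallyEtale (rs h) (rs_formallyEtale h hx.affine hV)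
  have h2 : (rs h).comp (cst k U) = cst k V := RingHom.ext fun c => rs_cst k h c
  rwa [h2] at h1

theorem VF.isDer {U : Y.Opens} (ξ : VF k U) (V : Below U) :
    IsDer (cst k V.1) (RingHom.id _) (ξ.1 V) :=
  ⟨fun a b => ξ.2.1 V a b, fun c => ξ.2.2.1 V c⟩

theorem IsCoordOn.vf_injective {U W : Y.Opens} {m : ℕ} {x : Fin m → Γ(Y, U)}
    (hx : IsCoordOn k U x) (h : W ≤ U) {ξ η : VF k W}
    (e : ∀ i, ξ.app (rs h (x i)) = η.app (rs h (x i))) : ξ = η := by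
  refine VF.ext fun V a => rs_ext fun y hy => ?_
  obtain ⟨V', hV', hyV', hA⟩ := exists_affine hy
  refine ⟨V', hV', hyV', ?_⟩
  rw [ξ.2.2.2 V ⟨V', hV'.trans V.2⟩ hV', η.2.2.2 V ⟨V', hV'.trans V.2⟩ hV']
  have key : ξ.1 ⟨V', hV'.trans V.2⟩ = η.1 ⟨V', hV'.trans V.2⟩ := by
    refine (hx.restrict ((hV'.trans V.2).trans h) hA).coord.ext (ξ.isDer ⟨V', hV'.trans V.2⟩)
      (η.isDer ⟨V', hV'.trans V.2⟩) fun i => ?_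
    have h1 := ξ.2.2.2 (Below.self W) ⟨V', hV'.trans V.2⟩ (hV'.trans V.2) (rs h (x i))
    have h2 := η.2.2.2 (Below.self W) ⟨V', hV'.trans V.2⟩ (hV'.trans V.2) (rs h (x i))
    have h3 := congrArg (rs (hV'.trans V.2)) (e i)
    have h4 := rs_rs h (hV'.trans V.2) (x i)
    exact (congrArg (ξ.1 ⟨V', hV'.trans V.2⟩) h4).symm.trans (h1.symm.trans (h3.trans (h2.trans
      (congrArg (η.1 ⟨V', hV'.trans V.2⟩) h4))))
  rw [key]

theorem IsCoordOn.exists_vf {U W : Y.Opens} {m : ℕ} {x : Fin m → Γ(Y, U)}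
    (hx : IsCoordOn k U x) (h : W ≤ U) (c : Fin m → Γ(Y, W)) :
    ∃ ξ : VF k W, ∀ i, ξ.app (rs h (x i)) = c i := by
  have hc : ∀ (V : Y.Opens) (hV : V ≤ W) (_ : IsAffineOpen V), ∃ δ : Γ(Y, V) →+ Γ(Y, V),
      IsDer (cst k V) (RingHom.id _) δ ∧ ∀ i, δ (rs (hV.trans h) (x i)) = rs hV (c i) :=
    fun V hV hA => ⟨_, IsCoord.isDer_der (hx.restrict (hV.trans h) hA).coord _ _,
      IsCoord.der_apply _ _ _⟩
  choose δ hδ hδx using hc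
  have hres : ∀ V hV hA V' hV' hA' (hh : V' ≤ V) a,
      rs hh (δ V hV hA a) = δ V' hV' hA' (rs hh a) := by
    intro V hV hA V' hV' hA' hh a
    refine DFunLike.congr_fun (f := (rs hh).toAddMonoidHom.comp (δ V hV hA))
      (g := (δ V' hV' hA').comp (rs hh).toAddMonoidHom)
      ((hx.restrict (hV.trans h) hA).coord.ext (ψ := rs hh) ⟨fun a b => ?_, fun c => ?_⟩
        ⟨fun a b => ?_, fun c => ?_⟩ fun i => ?_) a
    · change rs hh (δ V hV hA (a * b)) = rs hh a * rs hh (δ V hV hA b) + rs hh (δ V hV hA a) * rs hh b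
      rw [(hδ V hV hA).1, map_add, map_mul, map_mul]; rfl
    · change rs hh (δ V hV hA _) = 0
      rw [(hδ V hV hA).2, map_zero]
    · change δ V' hV' hA' (rs hh (a * b)) =
        rs hh a * δ V' hV' hA' (rs hh b) + δ V' hV' hA' (rs hh a) * rs hh b
      rw [map_mul, (hδ V' hV' hA').1]; rfl
    · change δ V' hV' hA' (rs hh _) = 0
      rw [rs_cst, (hδ V' hV' hA').2]
    · change rs hh (δ V hV hA (rs _ (x i))) = δ V' hV' hA' (rs hh (rs _ (x i)))
      rw [hδx _ _ hA, rs_rs, rs_rs, hδx _ _ hA']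
  have hex : ∀ (V : Below W) (a : Γ(Y, V.1)), ∃! t : Γ(Y, V.1), ∀ (V' : Y.Opens) (hV' : V' ≤ V.1) s,
      (∃ hA, s = δ V' (hV'.trans V.2) hA (rs hV' a)) → rs hV' t = s := by
    intro V a
    refine existsUnique_fun _ (fun y hy => ?_) ?_
    · obtain ⟨V', hV', hyV', hA⟩ := exists_affine hy
      exact ⟨V', hV', hyV', _, hA, rfl⟩
    · rintro V₁ h₁ _ V₂ h₂ _ ⟨hA₁, rfl⟩ ⟨hA₂, rfl⟩
      refine rs_ext fun y hy => ?_
      obtain ⟨V', hV', hyV', hA⟩ := exists_affine hy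
      refine ⟨V', hV', hyV', ?_⟩
      rw [rs_rs, rs_rs, hres _ _ hA₁ V' ((hV'.trans (inf_le_left.trans h₁)).trans V.2) hA,
        hres _ _ hA₂ V' ((hV'.trans (inf_le_left.trans h₁)).trans V.2) hA, rs_rs, rs_rs]
  choose D hD _ using hex
  have hD' : ∀ (V : Below W) (a : Γ(Y, V.1)) V' (hV' : V' ≤ V.1) hA,
      rs hV' (D V a) = δ V' (hV'.trans V.2) hA (rs hV' a) := fun V a V' hV' hA =>
    hD V a V' hV' _ ⟨hA, rfl⟩
  have hext : ∀ (V : Below W) (s t : Γ(Y, V.1)),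
      (∀ V' (hV' : V' ≤ V.1), IsAffineOpen V' → rs hV' s = rs hV' t) → s = t := by
    intro V s t hst
    refine rs_ext fun y hy => ?_
    obtain ⟨V', hV', hyV', hA⟩ := exists_affine hy
    exact ⟨V', hV', hyV', hst V' hV' hA⟩
  refine ⟨⟨fun V => AddMonoidHom.mk' (D V) fun a b => ?_, ?_, ?_, ?_⟩, fun i => ?_⟩
  · refine hext V _ _ fun V' hV' hA => ?_
    rw [map_add, hD' V _ V' hV' hA, hD' V _ V' hV' hA, hD' V _ V' hV' hA, map_add, map_add]
  · intro V a b
    refine hext V _ _ fun V' hV' hA => ?_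
    change rs hV' (D V (a * b)) = rs hV' (a * D V b + D V a * b)
    rw [map_add, map_mul, map_mul, hD' V _ V' hV' hA, hD' V _ V' hV' hA, hD' V _ V' hV' hA, map_mul,
      (hδ _ _ hA).1]; rfl
  · intro V c
    refine hext V _ _ fun V' hV' hA => ?_
    change rs hV' (D V _) = _
    rw [hD' V _ V' hV' hA, rs_cst, (hδ _ _ hA).2, map_zero]
  · intro V V' hh a
    refine hext V' _ _ fun V'' hV'' hA => ?_
    change rs hV'' (rs hh (D V a)) = rs hV'' (D V' (rs hh a))
    rw [rs_rs, hD' V _ V'' (hV''.trans hh) hA, hD' V' _ V'' hV'' hA, rs_rs]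
  · refine hext (Below.self W) _ _ fun V' hV' hA => ?_
    change rs hV' (D _ _) = _
    rw [hD' (Below.self W) _ V' hV' hA, rs_rs, hδx _ _ hA]

/-- The vector field with prescribed values on the coordinates. -/
def IsCoordOn.vf {U W : Y.Opens} {m : ℕ} {x : Fin m → Γ(Y, U)}
    (hx : IsCoordOn k U x) (h : W ≤ U) (c : Fin m → Γ(Y, W)) : VF k W := (hx.exists_vf h c).choose

theorem IsCoordOn.vf_app {U W : Y.Opens} {m : ℕ} {x : Fin m → Γ(Y, U)}
    (hx : IsCoordOn k U x) (h : W ≤ U) (c : Fin m → Γ(Y, W)) (i : Fin m) :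
    (hx.vf h c).app (rs h (x i)) = c i := (hx.exists_vf h c).choose_spec i

theorem VF.res_app {U V : Y.Opens} (h : V ≤ U) (ξ : VF k U) (f : Γ(Y, U)) :
    (VF.res h ξ).app (rs h f) = rs h (ξ.app f) :=
  (ξ.2.2.2 (Below.self U) ⟨V, h⟩ h f).symm

theorem VF.val_res {U : Y.Opens} (ξ : VF k U) (V : Below U) (f : Γ(Y, V.1)) :
    ξ.1 V f = (VF.res V.2 ξ).app f := rfl

theorem VF.app_mul {U : Y.Opens} (ξ : VF k U) (f g : Γ(Y, U)) :
    ξ.app (f * g) = f * ξ.app g + ξ.app f * g := ξ.2.1 (Below.self U) f g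

theorem VF.smul_app {U : Y.Opens} (ξ : VF k U) (f g : Γ(Y, U)) :
    (f • ξ).app g = f * ξ.app g := by
  change rs _ f * ξ.app g = _
  rw [rs_id]

theorem VF.add_app {U : Y.Opens} (ξ η : VF k U) (g : Γ(Y, U)) :
    (ξ + η).app g = ξ.app g + η.app g := rfl

theorem VF.neg_app {U : Y.Opens} (ξ : VF k U) (g : Γ(Y, U)) : (-ξ).app g = -ξ.app g := rfl

theorem VF.zero_app {U : Y.Opens} (g : Γ(Y, U)) : (0 : VF k U).app g = 0 := rfl

theorem VF.comm_app {U : Y.Opens} (ξ η : VF k U) (g : Γ(Y, U)) :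
    (ξ.comm η).app g = ξ.app (η.app g) - η.app (ξ.app g) := rfl

theorem VF.app_cst {U : Y.Opens} (ξ : VF k U) (c : k) : ξ.app (cst k U c) = 0 := ξ.2.2.1 (Below.self U) c

theorem VF.app_sub {U : Y.Opens} (ξ : VF k U) (f g : Γ(Y, U)) :
    ξ.app (f - g) = ξ.app f - ξ.app g := map_sub _ _ _

theorem VF.app_neg {U : Y.Opens} (ξ : VF k U) (f : Γ(Y, U)) : ξ.app (-f) = -ξ.app f :=
  map_neg _ _

theorem VF.app_zero {U : Y.Opens} (ξ : VF k U) : ξ.app (0 : Γ(Y, U)) = 0 := map_zero _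

theorem VF.sum_app {U : Y.Opens} {ι : Type*} (s : Finset ι) (ξ : ι → VF k U) (g : Γ(Y, U)) :
    (∑ i ∈ s, ξ i).app g = ∑ i ∈ s, (ξ i).app g := by
  classical
  induction s using Finset.induction_on with
  | empty => simp [VF.zero_app]
  | insert a s ha ih => rw [Finset.sum_insert ha, Finset.sum_insert ha, VF.add_app, ih]

/-- The coordinate vector fields. -/
def IsCoordOn.partial {U : Y.Opens} {m : ℕ} {x : Fin m → Γ(Y, U)} (hx : IsCoordOn k U x)
    (i : Fin m) : VF k U := hx.vf le_rfl (Pi.single i 1)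

theorem IsCoordOn.partial_app {U : Y.Opens} {m : ℕ} {x : Fin m → Γ(Y, U)} (hx : IsCoordOn k U x)
    (i l : Fin m) : (hx.partial i).app (x l) = if l = i then 1 else 0 := by
  have := hx.vf_app le_rfl (Pi.single i 1) l
  rw [rs_id] at this
  rw [IsCoordOn.partial, this, Pi.single_apply]

theorem IsCoordOn.eq_sum {U W : Y.Opens} {m : ℕ} {x : Fin m → Γ(Y, U)} (hx : IsCoordOn k U x)
    (h : W ≤ U) (ξ : VF k W) :
    ξ = ∑ i, ξ.app (rs h (x i)) • VF.res h (hx.partial i) := by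
  refine hx.vf_injective h fun l => ?_
  simp only [VF.sum_app, VF.smul_app, VF.res_app, hx.partial_app]
  simp

theorem IsCoordOn.app_eq_sum {U W : Y.Opens} {m : ℕ} {x : Fin m → Γ(Y, U)} (hx : IsCoordOn k U x)
    (h : W ≤ U) (ξ : VF k W) (f : Γ(Y, W)) :
    ξ.app f = ∑ i, ξ.app (rs h (x i)) * (VF.res h (hx.partial i)).app f := by
  conv_lhs => rw [hx.eq_sum h ξ]
  simp only [VF.sum_app, VF.smul_app]

theorem spec_eq_top {U : (Spec (.of k)).Opens} {x : Spec (.of k)} (hx : x ∈ U) : U = ⊤ := by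
  refine top_le_iff.1 fun y _ => ?_
  have : y = x := Subsingleton.elim (α := PrimeSpectrum k) _ _
  rwa [this]

theorem exists_isCoordOn (n : ℕ) [hs : SmoothOfRelativeDimension n (Y ↘ Spec (.of k))] {U : Y.Opens}
    {y : Y} (hy : y ∈ U) : ∃ V : Y.Opens, V ≤ U ∧ y ∈ V ∧ ∃ x : Fin n → Γ(Y, V), IsCoordOn k V x := by
  obtain ⟨S, hS, V, hV, hyV, e, h⟩ := hs.exists_isStandardSmoothOfRelativeDimension y
  obtain rfl := spec_eq_top (e hyV)
  have h1 : (cst k V).IsStandardSmoothOfRelativeDimension n := by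
    have h2 : cst k V = ((Y ↘ Spec (.of k)).appLE ⊤ V e).hom.comp
        (Scheme.ΓSpecIso (.of k)).inv.hom := by
      rw [cst, ← CommRingCat.hom_comp]
      rfl
    rw [h2]
    exact RingHom.isStandardSmoothOfRelativeDimension_respectsIso.2 _
      ((Scheme.ΓSpecIso (.of k)).symm.commRingCatIsoToRingEquiv) h
  obtain ⟨x, hx⟩ := exists_isCoord_of_standardSmooth h1
  obtain ⟨W, hW, hyW, hA⟩ := exists_affine (U := U ⊓ V) ⟨hy, hyV⟩
  exact ⟨W, hW.trans inf_le_left, hyW, _,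
    IsCoordOn.restrict ⟨hV, hx⟩ (hW.trans inf_le_right) hA⟩

theorem cst_formallySmooth [hs : Smooth (Y ↘ Spec (.of k))] {V : Y.Opens} (hV : IsAffineOpen V) :
    (cst k V).FormallySmooth := by
  have h := hs.smooth_appLE (isAffineOpen_top (Spec (.of k))) hV le_top
  have h2 : cst k V = ((Y ↘ Spec (.of k)).appLE ⊤ V le_top).hom.comp
      (Scheme.ΓSpecIso (.of k)).inv.hom := by
    rw [cst, ← CommRingCat.hom_comp]
    rfl
  rw [h2]
  exact RingHom.FormallySmooth.respectsIso.2 _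
    ((Scheme.ΓSpecIso (.of k)).symm.commRingCatIsoToRingEquiv) h.formallySmooth

end Coord

/-! ### Differential forms of degree one and two -/

section Forms

section

variable {R M : Type u} [CommRing R] [AddCommGroup M] [Module R M]

theorem update_one {M : Type u} (x y : M) : Function.update ![x] 0 y = ![y] := by
  funext i
  fin_cases i
  rfl

theorem update_two {M : Type u} (x x' y : M) : Function.update ![x, y] 0 x' = ![x', y] := by
  funext i
  fin_cases i <;> rfl

theorem alternating1_add (A : M [⋀^Fin 1]→ₗ[R] R) (x y : M) : A ![x + y] = A ![x] + A ![y] := by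
  have h := A.map_update_add ![0] 0 x y
  rwa [update_one, update_one, update_one] at h

theorem alternating1_smul (A : M [⋀^Fin 1]→ₗ[R] R) (f : R) (x : M) : A ![f • x] = f * A ![x] := by
  have h := A.map_update_smul ![0] 0 f x
  rwa [update_one, update_one] at h

theorem alternating2_add (A : M [⋀^Fin 2]→ₗ[R] R) (x x' y : M) :
    A ![x + x', y] = A ![x, y] + A ![x', y] := by
  have h := A.map_update_add ![0, y] 0 x x'
  rwa [update_two, update_two, update_two] at h

theorem alternating2_smul (A : M [⋀^Fin 2]→ₗ[R] R) (f : R) (x y : M) :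
    A ![f • x, y] = f * A ![x, y] := by
  have h := A.map_update_smul ![0, y] 0 f x
  rwa [update_two, update_two] at h

theorem alternating2_swap (A : M [⋀^Fin 2]→ₗ[R] R) (x y : M) : A ![x, y] = -A ![y, x] := by
  have := A.map_swap ![y, x] (i := 0) (j := 1) (by decide)
  rw [← this]
  congr 1
  funext i
  fin_cases i <;> simp

/-- The alternating map of two arguments given by an alternating bilinear function. -/
def mkAlternating2 (F : M → M → R) (hadd : ∀ x x' y, F (x + x') y = F x y + F x' y)
    (hsmul : ∀ f x y, F (f • x) y = f * F x y) (hself : ∀ x, F x x = 0)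
    (hswap : ∀ x y, F x y = - F y x) : M [⋀^Fin 2]→ₗ[R] R where
  toFun v := F (v 0) (v 1)
  map_update_add' := by
    intro _ v i x y
    obtain rfl := Subsingleton.elim ‹DecidableEq (Fin 2)› (instDecidableEqFin 2)
    fin_cases i
    · simpa using hadd x y (v 1)
    · have h : F (v 0) (x + y) = F (v 0) x + F (v 0) y := by
        rw [hswap, hadd, hswap (v 0) x, hswap (v 0) y]; ring
      simpa using h
  map_update_smul' := by
    intro _ v i f x
    obtain rfl := Subsingleton.elim ‹DecidableEq (Fin 2)› (instDecidableEqFin 2)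
    fin_cases i
    · simpa using hsmul f x (v 1)
    · have h : F (v 0) (f • x) = f * F (v 0) x := by
        rw [hswap, hsmul, hswap (v 0) x]; ring
      simpa using h
  map_eq_zero_of_eq' := by
    intro v i i' hv hi
    have h01 : v 0 = v 1 := by
      fin_cases i <;> fin_cases i'
      · exact absurd rfl hi
      · exact hv
      · exact hv.symm
      · exact absurd rfl hi
    rw [h01, hself]

end

variable {k : Type u} [Field k] {Y : Scheme.{u}} [Y.Over (Spec (.of k))]

theorem form1_add {U : Y.Opens} (A : (forms k Y 1).Sec U) (V : Below U) (ξ η : VF k V.1) :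
    formAt A V ![ξ + η] = formAt A V ![ξ] + formAt A V ![η] := alternating1_add (A.1 V) ξ η

theorem form1_smul {U : Y.Opens} (A : (forms k Y 1).Sec U) (V : Below U) (f : Γ(Y, V.1))
    (ξ : VF k V.1) : formAt A V ![f • ξ] = f * formAt A V ![ξ] := alternating1_smul (A.1 V) f ξ

theorem form2_add_left {U : Y.Opens} (α : (forms k Y 2).Sec U) (V : Below U) (ξ ξ' η : VF k V.1) :
    formAt α V ![ξ + ξ', η] = formAt α V ![ξ, η] + formAt α V ![ξ', η] :=
  alternating2_add (α.1 V) ξ ξ' η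

theorem form2_smul_left {U : Y.Opens} (α : (forms k Y 2).Sec U) (V : Below U) (f : Γ(Y, V.1))
    (ξ η : VF k V.1) : formAt α V ![f • ξ, η] = f * formAt α V ![ξ, η] :=
  alternating2_smul (α.1 V) f ξ η

theorem form2_swap {U : Y.Opens} (α : (forms k Y 2).Sec U) (V : Below U) (ξ η : VF k V.1) :
    formAt α V ![ξ, η] = -formAt α V ![η, ξ] := alternating2_swap (α.1 V) ξ η

theorem form2_self {U : Y.Opens} (α : (forms k Y 2).Sec U) (V : Below U) (ξ : VF k V.1) :
    formAt α V ![ξ, ξ] = 0 :=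
  (α.1 V).map_eq_zero_of_eq ![ξ, ξ] (i := 0) (j := 1) rfl (by decide)

theorem form2_add_right {U : Y.Opens} (α : (forms k Y 2).Sec U) (V : Below U) (ξ η η' : VF k V.1) :
    formAt α V ![ξ, η + η'] = formAt α V ![ξ, η] + formAt α V ![ξ, η'] := by
  rw [form2_swap, form2_add_left, form2_swap α V η, form2_swap α V η']; ring

theorem form2_smul_right {U : Y.Opens} (α : (forms k Y 2).Sec U) (V : Below U) (f : Γ(Y, V.1))
    (ξ η : VF k V.1) : formAt α V ![ξ, f • η] = f * formAt α V ![ξ, η] := by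
  rw [form2_swap, form2_smul_left, form2_swap α V η]; ring

theorem form1_res {U : Y.Opens} (A : (forms k Y 1).Sec U) (V W : Below U) (h : W.1 ≤ V.1)
    (ξ : VF k V.1) : rs h (formAt A V ![ξ]) = formAt A W ![VF.res h ξ] := by
  refine (A.2 V W h _).trans ?_
  rw [formAt]
  congr 1
  funext i
  fin_cases i
  rfl

theorem form2_res {U : Y.Opens} (α : (forms k Y 2).Sec U) (V W : Below U) (h : W.1 ≤ V.1)
    (ξ η : VF k V.1) :
    rs h (formAt α V ![ξ, η]) = formAt α W ![VF.res h ξ, VF.res h η] := by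
  refine (α.2 V W h _).trans ?_
  rw [formAt]
  congr 1
  funext i
  fin_cases i <;> rfl

theorem form1_ext {U : Y.Opens} {A B : (forms k Y 1).Sec U}
    (h : ∀ (V : Below U) (ξ : VF k V.1), formAt A V ![ξ] = formAt B V ![ξ]) : A = B := by
  refine Subtype.ext (funext fun V => AlternatingMap.ext fun v => ?_)
  have := h V (v 0)
  have e : v = ![v 0] := by funext i; fin_cases i; rfl
  rw [e]
  exact this

theorem form_sub {p : ℕ} {U : Y.Opens} (α β : (forms k Y p).Sec U) (V : Below U)
    (ξ : Fin p → VF k V.1) : formAt (α - β) V ξ = formAt α V ξ - formAt β V ξ := by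
  have h : α - β + β = α := sub_add_cancel α β
  have := form_add (α - β) β V ξ
  rw [h] at this
  rw [this]; ring

theorem form_res {p : ℕ} {U U' : Y.Opens} (h : U' ≤ U) (α : (forms k Y p).Sec U) (V : Below U')
    (ξ : Fin p → VF k V.1) : formAt ((forms k Y p).res h α) V ξ = formAt α (V.up h) ξ := rfl

/-- A 1-form from a compatible family of linear maps. -/
def mkForm1 {U : Y.Opens} (F : ∀ V : Below U, VF k V.1 →ₗ[Γ(Y, V.1)] Γ(Y, V.1))
    (hF : ∀ (V W : Below U) (h : W.1 ≤ V.1) ξ, rs h (F V ξ) = F W (VF.res h ξ)) :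
    (forms k Y 1).Sec U :=
  ⟨fun V => AlternatingMap.ofSubsingleton Γ(Y, V.1) (VF k V.1) Γ(Y, V.1) (0 : Fin 1) (F V),
    fun V W h ξ => hF V W h (ξ 0)⟩

theorem mkForm1_apply {U : Y.Opens} (F : ∀ V : Below U, VF k V.1 →ₗ[Γ(Y, V.1)] Γ(Y, V.1))
    (hF : ∀ (V W : Below U) (h : W.1 ≤ V.1) ξ, rs h (F V ξ) = F W (VF.res h ξ)) (V : Below U)
    (ξ : VF k V.1) : formAt (mkForm1 F hF) V ![ξ] = F V ξ := rfl

/-- A 2-form from a compatible family of alternating bilinear maps. -/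
theorem exists_form2 {U : Y.Opens} (F : ∀ V : Below U, VF k V.1 → VF k V.1 → Γ(Y, V.1))
    (hadd : ∀ V ξ ξ' η, F V (ξ + ξ') η = F V ξ η + F V ξ' η)
    (hsmul : ∀ V f ξ η, F V (f • ξ) η = f * F V ξ η)
    (hself : ∀ V ξ, F V ξ ξ = 0) (hswap : ∀ V ξ η, F V ξ η = - F V η ξ)
    (hF : ∀ (V W : Below U) (h : W.1 ≤ V.1) ξ η,
      rs h (F V ξ η) = F W (VF.res h ξ) (VF.res h η)) :
    ∃ α : (forms k Y 2).Sec U, ∀ V ξ η, formAt α V ![ξ, η] = F V ξ η := by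
  exact ⟨⟨fun V => mkAlternating2 (M := VF k V.1) (F V) (hadd V) (hsmul V) (hself V) (hswap V),
    fun V W h ξ => hF V W h (ξ 0) (ξ 1)⟩, fun V ξ η => rfl⟩

end Forms

/-! ### Characteristic classes of extensions with local splittings -/

section Class

variable {k : Type u} [Field k] {Y : Scheme.{u}} [Y.Over (Spec (.of k))]

theorem LieAlgebroid.bracket_swap (L : LieAlgebroid k Y) {U : Y.Opens} (x y : L.Sec U) :
    L.bracket U x y = -L.bracket U y x := by
  have h := L.bracket_self U (x + y)
  simp only [map_add, AddMonoidHom.add_apply, L.bracket_self, zero_add, add_zero] at h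
  exact eq_neg_of_add_eq_zero_left ((add_comm _ _).trans h)

theorem LieAlgebroid.smul_bracket (L : LieAlgebroid k Y) {U : Y.Opens} (f : Γ(Y, U))
    (x y : L.Sec U) :
    L.bracket U (f • x) y = f • L.bracket U x y - (L.anchor U y).app f • x := by
  rw [L.bracket_swap, L.leibniz, L.bracket_swap y x, smul_neg]; abel

/-- Restriction of splittings. -/
def Splitting.res {L : UnitalAlgebroid k Y} {U U' : Y.Opens} (s : Splitting L U) (h : U' ≤ U) :
    Splitting L U' where
  app V := s.app (V.up h)
  app_res V W hh ξ := s.app_res (V.up h) (W.up h) hh ξ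
  anchor_app V ξ := s.anchor_app (V.up h) ξ

variable {L : UnitalAlgebroid k Y}

theorem Splitting.exists_curvature (hinj : ∀ U, Function.Injective (L.unit U))
    (hex : ∀ U (x : L.Sec U), L.anchor U x = 0 → ∃ f, L.unit U f = x) {U : Y.Opens} (s : Splitting L U) :
    ∃ α : (forms k Y 2).Sec U, ∀ (V : Below U) (ξ η : VF k V.1),
      L.unit V.1 (formAt α V ![ξ, η]) =
        L.bracket V.1 (s.app V ξ) (s.app V η) - s.app V (ξ.comm η) := by
  have h1 : ∀ (V : Below U) (ξ η : VF k V.1), ∃ f, L.unit V.1 f =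
      L.bracket V.1 (s.app V ξ) (s.app V η) - s.app V (ξ.comm η) := fun V ξ η => hex _ _ (by
    rw [map_sub, L.anchor_bracket, s.anchor_app, s.anchor_app, s.anchor_app, sub_self])
  choose F hF using h1
  have hswapc : ∀ {V : Y.Opens} (ξ η : VF k V), ξ.comm η = -η.comm ξ := fun ξ η =>
    (tangent k Y).bracket_swap ξ η
  refine (exists_form2 F (fun V ξ ξ' η => hinj _ ?_) (fun V f ξ η => hinj _ ?_)
    (fun V ξ => hinj _ ?_) (fun V ξ η => hinj _ ?_) (fun V W h ξ η => hinj _ ?_)).imp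
    fun α hα V ξ η => by rw [hα, hF]
  · have : (ξ + ξ').comm η = ξ.comm η + ξ'.comm η :=
      DFunLike.congr_fun (map_add (VF.bracket V.1) ξ ξ') η
    rw [map_add, hF, hF, hF, map_add, map_add, AddMonoidHom.add_apply, this, map_add]; abel
  · have : (f • ξ).comm η = f • ξ.comm η - η.app f • ξ := (tangent k Y).smul_bracket f ξ η
    rw [hF, ← smul_eq_mul, (L.unit V.1).map_smul, hF, this, (s.app V).map_smul, (s.app V).map_sub,
      (s.app V).map_smul, (s.app V).map_smul, L.smul_bracket, s.anchor_app, smul_sub]; abel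
  · have : ξ.comm ξ = 0 := (tangent k Y).bracket_self V.1 ξ
    rw [hF, map_zero, L.bracket_self, this, map_zero, sub_self]
  · rw [map_neg, hF, hF, L.bracket_swap, hswapc ξ η, map_neg]; abel
  · have : (VF.res h ξ).comm (VF.res h η) = VF.res h (ξ.comm η) := rfl
    rw [← L.unit_res, hF, hF, map_sub, L.bracket_res, s.app_res V W h, s.app_res V W h, this,
      s.app_res V W h]

theorem Splitting.curvature_closed (hinj : ∀ U, Function.Injective (L.unit U))
    {U : Y.Opens} (s : Splitting L U) {α : (forms k Y 2).Sec U}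
    (hα : ∀ (V : Below U) (ξ η : VF k V.1), L.unit V.1 (formAt α V ![ξ, η]) =
        L.bracket V.1 (s.app V ξ) (s.app V η) - s.app V (ξ.comm η)) : IsClosedForm α := by
  intro V ξ η ζ
  refine hinj _ ?_
  have hu : ∀ (ξ : VF k V.1) f, L.unit V.1 (ξ.app f) = L.bracket V.1 (s.app V ξ) (L.unit V.1 f) :=
    fun ξ f => by rw [L.bracket_unit, s.anchor_app]
  have hj := L.jacobi V.1 (s.app V ξ) (s.app V η) (s.app V ζ)
  have hjt : ξ.comm (η.comm ζ) = (ξ.comm η).comm ζ + η.comm (ξ.comm ζ) :=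
    (tangent k Y).jacobi V.1 ξ η ζ
  have hswapc : ∀ {V : Y.Opens} (ξ η : VF k V), ξ.comm η = -η.comm ξ := fun ξ η =>
    (tangent k Y).bracket_swap ξ η
  simp only [map_zero, map_add, map_sub, hu, hα]
  rw [hswapc (η.comm ζ) ξ, hswapc (ξ.comm ζ) η, hjt, L.bracket_swap (s.app V (η.comm ζ)),
    L.bracket_swap (s.app V (ξ.comm ζ)), hj, L.bracket_swap (s.app V ζ) (L.bracket _ _ _),
    L.bracket_swap (s.app V (ξ.comm η)) (s.app V ζ)]
  simp only [map_add, map_neg]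
  abel

theorem Splitting.exists_difference (hinj : ∀ U, Function.Injective (L.unit U))
    (hex : ∀ U (x : L.Sec U), L.anchor U x = 0 → ∃ f, L.unit U f = x) {U : Y.Opens} (s t : Splitting L U) :
    ∃ A : (forms k Y 1).Sec U, ∀ (V : Below U) (ξ : VF k V.1),
      L.unit V.1 (formAt A V ![ξ]) = t.app V ξ - s.app V ξ := by
  have h1 : ∀ (V : Below U) (ξ : VF k V.1), ∃ f, L.unit V.1 f = t.app V ξ - s.app V ξ :=
    fun V ξ => hex _ _ (by rw [map_sub, t.anchor_app, s.anchor_app, sub_self])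
  choose F hF using h1
  let G : ∀ V : Below U, VF k V.1 →ₗ[Γ(Y, V.1)] Γ(Y, V.1) := fun V =>
    { toFun := F V
      map_add' := fun ξ η => hinj _ (by rw [map_add, hF, hF, hF, map_add, map_add]; abel)
      map_smul' := fun f ξ => hinj _ (by
        rw [map_smul, hF, hF, map_smul, map_smul, RingHom.id_apply, smul_sub]) }
  refine ⟨mkForm1 G fun V W h ξ => hinj _ ?_, fun V ξ => ?_⟩
  · change L.unit _ (rs h (F V ξ)) = L.unit _ (F W (VF.res h ξ))
    rw [← L.unit_res, hF, hF, map_sub, s.app_res V W h, t.app_res V W h]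
  · rw [mkForm1_apply]; exact hF V ξ

theorem Splitting.isExtD (hinj : ∀ U, Function.Injective (L.unit U))
    {U : Y.Opens} (s t : Splitting L U) {α β : (forms k Y 2).Sec U}
    {A : (forms k Y 1).Sec U}
    (hα : ∀ (V : Below U) (ξ η : VF k V.1), L.unit V.1 (formAt α V ![ξ, η]) =
        L.bracket V.1 (s.app V ξ) (s.app V η) - s.app V (ξ.comm η))
    (hβ : ∀ (V : Below U) (ξ η : VF k V.1), L.unit V.1 (formAt β V ![ξ, η]) =
        L.bracket V.1 (t.app V ξ) (t.app V η) - t.app V (ξ.comm η))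
    (hA : ∀ (V : Below U) (ξ : VF k V.1), L.unit V.1 (formAt A V ![ξ]) = t.app V ξ - s.app V ξ) :
    IsExtD A (β - α) := by
  intro V ξ η
  refine hinj _ ?_
  have hu : ∀ (ξ : VF k V.1) f, L.unit V.1 (ξ.app f) = L.bracket V.1 (s.app V ξ) (L.unit V.1 f) :=
    fun ξ f => by rw [L.bracket_unit, s.anchor_app]
  have hz : ∀ f g, L.bracket V.1 (L.unit V.1 f) (L.unit V.1 g) = 0 := fun f g => by
    rw [L.bracket_unit, L.anchor_unit]
    exact map_zero _
  have ht : ∀ ξ, t.app V ξ = s.app V ξ + L.unit V.1 (formAt A V ![ξ]) := fun ξ => by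
    rw [hA]; abel
  rw [form_sub, map_sub, hα, hβ, ht, ht, ht, map_sub, map_sub, hu, hu,
    L.bracket_swap (s.app V η) (L.unit _ _)]
  simp only [map_add, AddMonoidHom.add_apply, hz]
  abel

theorem Represents.cohomologous {z w : Cocycle k Y}
    (hinj : ∀ U, Function.Injective (L.unit U))
    (hex : ∀ U (x : L.Sec U), L.anchor U x = 0 → ∃ f, L.unit U f = x)
    (hz : Represents L z) (hw : Represents L w) : Cohomologous z w := by
  obtain ⟨s, hs1, hs2⟩ := hz
  obtain ⟨t, ht1, ht2⟩ := hw
  choose C hC using fun i j => Splitting.exists_difference hinj hex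
    ((s i).res (inf_le_left : z.U i ⊓ w.U j ≤ z.U i)) ((t j).res (inf_le_right : z.U i ⊓ w.U j ≤ w.U j))
  refine ⟨C, fun i j => ?_, fun i i' j => ?_, fun i j j' => ?_⟩
  · exact Splitting.isExtD hinj ((s i).res inf_le_left) ((t j).res inf_le_right)
      (fun V ξ η => hs1 i (V.up inf_le_left) ξ η)
      (fun V ξ η => ht1 j (V.up inf_le_right) ξ η) (hC i j)
  · refine form1_ext fun V ξ => hinj _ ?_
    rw [form_add, map_add, form_res, form_res, form_res]
    have h1 := hs2 i i' (V.up inf_le_left) ξ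
    have h2 := hC i' j (V.up (inf_le_inf_right _ inf_le_right)) ξ
    have h3 := hC i j (V.up (inf_le_inf_right _ inf_le_left)) ξ
    refine (congrArg₂ _ h1 h2).trans (Eq.trans ?_ h3.symm)
    dsimp only [Splitting.res]
    abel
  · refine form1_ext fun V ξ => hinj _ ?_
    rw [form_add, map_add, form_res, form_res, form_res]
    have h1 := hC i j (V.up inf_le_left) ξ
    have h2 := ht2 j j' (V.up (inf_le_inf_right _ inf_le_right)) ξ
    have h3 := hC i j' (V.up (inf_le_inf_right _ inf_le_left)) ξ
    refine (congrArg₂ _ h1 h2).trans (Eq.trans ?_ h3.symm)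
    dsimp only [Splitting.res]
    abel

theorem Represents.hasClass_iff {z : Cocycle k Y}
    (hinj : ∀ U, Function.Injective (L.unit U))
    (hex : ∀ U (x : L.Sec U), L.anchor U x = 0 → ∃ f, L.unit U f = x)
    (hz : Represents L z) (c : H2F k Y) : HasClass L c ↔ c = H2F.mk z := by
  constructor
  · rintro ⟨w, hw, rfl⟩
    exact Quot.sound (hw.cohomologous hinj hex hz)
  · rintro rfl
    exact ⟨z, hz, rfl⟩

theorem exists_represents (hinj : ∀ U, Function.Injective (L.unit U))
    (hex : ∀ U (x : L.Sec U), L.anchor U x = 0 → ∃ f, L.unit U f = x)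
    (hs : ∀ y : Y, ∃ U : Y.Opens, y ∈ U ∧ Nonempty (Splitting L U)) :
    ∃ z : Cocycle k Y, Represents L z := by
  choose U hU s using hs
  replace s := fun y => (s y).some
  choose α hα using fun y => Splitting.exists_curvature hinj hex (s y)
  choose A hA using fun y y' => Splitting.exists_difference hinj hex
    ((s y).res (inf_le_left : U y ⊓ U y' ≤ U y)) ((s y').res (inf_le_right : U y ⊓ U y' ≤ U y'))
  refine ⟨⟨Y, U, fun y => ⟨y, hU y⟩, α, A, fun y => Splitting.curvature_closed hinj (s y) (hα y),
    fun y y' => ?_, fun i j l => ?_⟩, s, hα, hA⟩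
  · exact Splitting.isExtD hinj ((s y).res inf_le_left) ((s y').res inf_le_right)
      (fun V ξ η => hα y (V.up inf_le_left) ξ η)
      (fun V ξ η => hα y' (V.up inf_le_right) ξ η) (hA y y')
  · refine form1_ext fun V ξ => hinj _ ?_
    rw [form_add, map_add, form_res, form_res, form_res]
    have h1 := hA i j (V.up inf_le_left) ξ
    have h2 := hA j l (V.up (inf_le_inf_right _ inf_le_right)) ξ
    have h3 := hA i l (V.up (inf_le_inf_right _ inf_le_left)) ξ
    refine (congrArg₂ _ h1 h2).trans (Eq.trans ?_ h3.symm)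
    dsimp only [Splitting.res]
    abel

end Class

/-! ### Morphisms of Lie algebroids given by local relations -/

section LocalHom

variable {k : Type u} [Field k] {Y : Scheme.{u}} [Y.Over (Spec (.of k))]

theorem exists_hom_of_local {L L' : LieAlgebroid k Y} (hL' : L'.toModPresheaf.IsSheaf)
    (R : ∀ W : Y.Opens, L.Sec W → L'.Sec W → Prop)
    (hres : ∀ {W V : Y.Opens} (h : V ≤ W) x x', R W x x' → R V (L.res h x) (L'.res h x'))
    (hex : ∀ (W : Y.Opens) (x : L.Sec W), ∀ y ∈ W, ∃ (V : Y.Opens) (h : V ≤ W), y ∈ V ∧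
      ∃ x', R V (L.res h x) x')
    (hun : ∀ (W : Y.Opens) x x' x'', R W x x' → R W x x'' → x' = x'')
    (hadd : ∀ (W : Y.Opens) x x' z z', R W x x' → R W z z' → ∀ y ∈ W,
      ∃ (V : Y.Opens) (h : V ≤ W), y ∈ V ∧ R V (L.res h (x + z)) (L'.res h (x' + z')))
    (hsmul : ∀ (W : Y.Opens) (f : Γ(Y, W)) x x', R W x x' → ∀ y ∈ W,
      ∃ (V : Y.Opens) (h : V ≤ W), y ∈ V ∧ R V (L.res h (f • x)) (L'.res h (f • x')))
    (hbr : ∀ (W : Y.Opens) x x' z z', R W x x' → R W z z' → ∀ y ∈ W,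
      ∃ (V : Y.Opens) (h : V ≤ W), y ∈ V ∧
        R V (L.res h (L.bracket W x z)) (L'.res h (L'.bracket W x' z')))
    (hanchor : ∀ (W : Y.Opens) x x', R W x x' → L'.anchor W x' = L.anchor W x)
    (htan : (tangentMod k Y).IsSep) :
    ∃ φ : LieAlgebroid.Hom L L', ∀ (W : Y.Opens) x x',
      (∀ y ∈ W, ∃ (V : Y.Opens) (h : V ≤ W), y ∈ V ∧ R V (L.res h x) (L'.res h x')) →
        φ.app W x = x' := by
  have h1 : ∀ (W : Y.Opens) (x : L.Sec W), ∃! t : L'.Sec W, ∀ (V : Y.Opens) (h : V ≤ W) s,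
      R V (L.res h x) s → L'.res h t = s := fun W x => by
    refine hL'.existsUnique_glue (fun V h s => R V (L.res h x) s) (hex W x) ?_
    intro V h s V' h' s' r r'
    have e1 := hres (inf_le_left : V ⊓ V' ≤ V) _ _ r
    have e2 := hres (inf_le_right : V ⊓ V' ≤ V') _ _ r'
    rw [L.res_res] at e1 e2
    exact hun _ _ _ _ e1 e2
  choose φ hφ hφu using h1
  have key : ∀ (W : Y.Opens) x x',
      (∀ y ∈ W, ∃ (V : Y.Opens) (h : V ≤ W), y ∈ V ∧ R V (L.res h x) (L'.res h x')) →
        φ W x = x' := by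
    intro W x x' hx
    refine hL'.isSep _ _ _ fun y hy => ?_
    obtain ⟨V, h, hyV, r⟩ := hx y hy
    exact ⟨V, h, hyV, hφ W x V h _ r⟩
  have loc : ∀ (W : Y.Opens) (x : L.Sec W), ∀ y ∈ W, ∃ (V : Y.Opens) (h : V ≤ W), y ∈ V ∧
      R V (L.res h x) (L'.res h (φ W x)) := by
    intro W x y hy
    obtain ⟨V, h, hyV, x', r⟩ := hex W x y hy
    exact ⟨V, h, hyV, by rwa [hφ W x V h x' r]⟩
  have loc2 : ∀ (W : Y.Opens) (x z : L.Sec W), ∀ y ∈ W, ∃ (V : Y.Opens) (h : V ≤ W), y ∈ V ∧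
      R V (L.res h x) (L'.res h (φ W x)) ∧ R V (L.res h z) (L'.res h (φ W z)) := by
    intro W x z y hy
    obtain ⟨V, h, hyV, r⟩ := loc W x y hy
    obtain ⟨V', h', hyV', r'⟩ := loc W z y hy
    refine ⟨V ⊓ V', inf_le_left.trans h, ⟨hyV, hyV'⟩, ?_, ?_⟩
    · have := hres (inf_le_left : V ⊓ V' ≤ V) _ _ r
      rwa [L.res_res, L'.res_res] at this
    · have := hres (inf_le_right : V ⊓ V' ≤ V') _ _ r'
      rwa [L.res_res, L'.res_res] at this
  refine ⟨⟨fun W => 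
    { toFun := φ W
      map_add' := fun x z => key _ _ _ fun y hy => ?_
      map_smul' := fun f x => key _ _ _ fun y hy => ?_ }, fun {U V} h x => key _ _ _ fun y hy => ?_,
      fun W x => htan _ _ _ fun y hy => ?_, fun W x z => key _ _ _ fun y hy => ?_⟩, key⟩
  · obtain ⟨V, h, hyV, r, r'⟩ := loc2 W x z y hy
    obtain ⟨V', h', hyV', r''⟩ := hadd _ _ _ _ _ r r' y hyV
    refine ⟨V', h'.trans h, hyV', ?_⟩
    rwa [map_add, map_add, L.res_res, L.res_res, L'.res_res, L'.res_res, ← map_add,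
      ← map_add] at r''
  · obtain ⟨V, h, hyV, r⟩ := loc W x y hy
    obtain ⟨V', h', hyV', r''⟩ := hsmul _ (rs h f) _ _ r y hyV
    refine ⟨V', h'.trans h, hyV', ?_⟩
    rwa [← L.res_smul, ← L'.res_smul, L.res_res, L'.res_res] at r''
  · obtain ⟨V', h', hyV', r⟩ := loc U x y (h hy)
    refine ⟨V ⊓ V', inf_le_left, ⟨hy, hyV'⟩, ?_⟩
    have := hres (inf_le_right : V ⊓ V' ≤ V') _ _ r
    change R _ (L.res _ (L.res h x)) (L'.res _ (L'.res h (φ U x)))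
    rwa [L.res_res, L'.res_res] at this ⊢
  · obtain ⟨V, h, hyV, r⟩ := loc W x y hy
    refine ⟨V, h, hyV, ?_⟩
    change VF.res h (L'.anchor W (φ W x)) = VF.res h (L.anchor W x)
    rw [← L'.anchor_res, ← L.anchor_res]
    exact hanchor _ _ _ r
  · obtain ⟨V, h, hyV, r, r'⟩ := loc2 W x z y hy
    obtain ⟨V', h', hyV', r''⟩ := hbr _ _ _ _ _ r r' y hyV
    refine ⟨V', h'.trans h, hyV', ?_⟩
    change R _ (L.res _ (L.bracket W x z)) (L'.res _ (L'.bracket W (φ W x) (φ W z)))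
    rwa [← L.bracket_res, ← L'.bracket_res, L.res_res, L'.res_res] at r''

end LocalHom

/-! ### Gluing of families -/

section Family

variable {k : Type u} [Field k] {Y : Scheme.{u}} [Y.Over (Spec (.of k))]

theorem ModPresheaf.IsSheaf.existsUnique_family {M : ModPresheaf Y} (hM : M.IsSheaf) {I : Type u}
    {U : I → Y.Opens} {V : Y.Opens} (hV : V ≤ ⨆ i, U i)
    (s : ∀ (i : I) (V' : Y.Opens), V' ≤ V → V' ≤ U i → M.Sec V')
    (hres : ∀ i V' hV' hU' V'' (hh : V'' ≤ V'), M.res hh (s i V' hV' hU') =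
      s i V'' (hh.trans hV') (hh.trans hU'))
    (hij : ∀ i i' V' hV' hU' hU'', s i V' hV' hU' = s i' V' hV' hU'') :
    ∃! t : M.Sec V, ∀ i V' hV' hU', M.res hV' t = s i V' hV' hU' := by
  obtain ⟨t, ht, htu⟩ := hM.existsUnique_glue (U := V)
    (fun V' hV' r => ∃ i hU', r = s i V' hV' hU') (fun y hy => by
      obtain ⟨i, hi⟩ := Opens.mem_iSup.1 (hV hy)
      exact ⟨V ⊓ U i, inf_le_left, ⟨hy, hi⟩, _, i, inf_le_right, rfl⟩) (by
      rintro V₁ h₁ _ V₂ h₂ _ ⟨i, hi, rfl⟩ ⟨i', hi', rfl⟩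
      rw [hres, hres]
      exact hij _ _ _ _ _ _)
  refine ⟨t, fun i V' hV' hU' => ht V' hV' _ ⟨i, hU', rfl⟩, fun t' ht' => htu _ ?_⟩
  rintro V' hV' _ ⟨i, hU', rfl⟩
  exact ht' i V' hV' hU'

theorem tangentMod_isSep : (tangentMod k Y).IsSep := by
  intro U ξ η h
  refine VF.ext fun V a => rs_ext fun y hy => ?_
  obtain ⟨V', hV', hyV', e⟩ := h y (V.2 hy)
  refine ⟨V.1 ⊓ V', inf_le_left, ⟨hy, hyV'⟩, ?_⟩
  have e1 := congrArg (fun ζ : VF k V' => ζ.1 ⟨V.1 ⊓ V', inf_le_right⟩ (rs inf_le_left a)) e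
  exact (ξ.2.2.2 V ⟨V.1 ⊓ V', inf_le_left.trans V.2⟩ inf_le_left a).trans
    (e1.trans (η.2.2.2 V ⟨V.1 ⊓ V', inf_le_left.trans V.2⟩ inf_le_left a).symm)

theorem tangentMod_isSheaf : (tangentMod k Y).IsSheaf := by
  refine ModPresheaf.IsSheaf.of_sep tangentMod_isSep fun I U ξ hξ => ?_
  have hij : ∀ i i' (V : Y.Opens) (h : V ≤ U i) (h' : V ≤ U i') (a : Γ(Y, V)),
      (ξ i).1 ⟨V, h⟩ a = (ξ i').1 ⟨V, h'⟩ a := fun i i' V h h' a =>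
    congrArg (fun ζ : VF k (U i ⊓ U i') => ζ.1 ⟨V, le_inf h h'⟩ a) (hξ i i')
  have hD : ∀ (V : Below (⨆ i, U i)) (a : Γ(Y, V.1)), ∃! t : Γ(Y, V.1),
      ∀ i V' (hV' : V' ≤ V.1) (hU' : V' ≤ U i), rs hV' t = (ξ i).1 ⟨V', hU'⟩ (rs hV' a) := by
    intro V a
    refine funMod_isSheaf.existsUnique_family V.2
      (fun i V' hV' hU' => (ξ i).1 ⟨V', hU'⟩ (rs hV' a)) ?_ ?_
    · intro i V' hV' hU' V'' hh
      refine ((ξ i).2.2.2 ⟨V', hU'⟩ ⟨V'', hh.trans hU'⟩ hh _).trans ?_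
      rw [rs_rs]
    · intro i i' V' hV' hU' hU''
      exact hij i i' V' hU' hU'' _
  choose D hD hDu using hD
  have ext : ∀ (V : Below (⨆ i, U i)) (s t : Γ(Y, V.1)),
      (∀ i V' (hV' : V' ≤ V.1) (_ : V' ≤ U i), rs hV' s = rs hV' t) → s = t := by
    intro V s t h
    refine rs_ext fun y hy => ?_
    obtain ⟨i, hi⟩ := Opens.mem_iSup.1 (V.2 hy)
    exact ⟨V.1 ⊓ U i, inf_le_left, ⟨hy, hi⟩, h i _ _ inf_le_right⟩
  refine ⟨⟨fun V => AddMonoidHom.mk' (D V) fun a b => ?_, fun V a b => ?_, fun V c => ?_,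
    fun V W h a => ?_⟩, fun i => VF.ext fun V a => ?_⟩
  · refine ext V _ _ fun i V' hV' hU' => ?_
    rw [map_add, hD V _ i V' hV' hU', hD V _ i V' hV' hU', hD V _ i V' hV' hU', map_add, map_add]
  · refine ext V _ _ fun i V' hV' hU' => ?_
    change rs hV' (D V (a * b)) = rs hV' (a * D V b + D V a * b)
    rw [map_add, map_mul, map_mul, hD V _ i V' hV' hU', hD V _ i V' hV' hU', hD V _ i V' hV' hU',
      map_mul, (ξ i).2.1]
  · refine ext V _ _ fun i V' hV' hU' => ?_
    change rs hV' (D V _) = _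
    rw [hD V _ i V' hV' hU', rs_cst, (ξ i).2.2.1, map_zero]
  · refine ext W _ _ fun i V' hV' hU' => ?_
    change rs hV' (rs h (D V a)) = rs hV' (D W (rs h a))
    rw [rs_rs, hD V _ i V' _ hU', hD W _ i V' _ hU', rs_rs]
  · have := hD (V.up (le_iSup U i)) a i V.1 le_rfl V.2
    rw [rs_id, rs_id] at this
    exact this

end Family

/-! ### The Picard algebroid of a cocycle -/

section CocycleAlgebroid

theorem form1_zero {k : Type u} [Field k] {Y : Scheme.{u}} [Y.Over (Spec (.of k))] {U : Y.Opens}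
    (A : (forms k Y 1).Sec U) (V : Below U) : formAt A V ![0] = 0 :=
  (A.1 V).map_coord_zero (0 : Fin 1) rfl

theorem form2_zero_right {k : Type u} [Field k] {Y : Scheme.{u}} [Y.Over (Spec (.of k))]
    {U : Y.Opens} (α : (forms k Y 2).Sec U) (V : Below U) (ξ : VF k V.1) :
    formAt α V ![ξ, 0] = 0 :=
  (α.1 V).map_coord_zero (1 : Fin 2) rfl

/-- Functions on a proposition, with pointwise addition. -/
instance propFunAddCommGroup (p : Prop) (A : Type u) [AddCommGroup A] : AddCommGroup (p → A) :=
  let _ : Add (p → A) := ⟨fun f g h => f h + g h⟩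
  let _ : Zero (p → A) := ⟨fun _ => 0⟩
  let _ : Neg (p → A) := ⟨fun f h => -f h⟩
  let _ : Sub (p → A) := ⟨fun f g h => f h - g h⟩
  { add_assoc := fun f g e => funext fun h => add_assoc (f h) (g h) (e h)
    zero_add := fun f => funext fun h => zero_add (f h)
    add_zero := fun f => funext fun h => add_zero (f h)
    neg_add_cancel := fun f => funext fun h => neg_add_cancel (f h)
    add_comm := fun f g => funext fun h => add_comm (f h) (g h)
    sub_eq_add_neg := fun f g => funext fun h => sub_eq_add_neg (f h) (g h)
    nsmul := nsmulRec
    zsmul := zsmulRec }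

variable {k : Type u} [Field k] {Y : Scheme.{u}} [Y.Over (Spec (.of k))] (w : Cocycle k Y)

/-- Sections of the Picard algebroid of a cocycle: a vector field `ξ` and functions `aᵢ` on the
intersections with the members of the cover, with `aᵢ - aⱼ = Aᵢⱼ(ξ)`. -/
def Cocycle.algSec (W : Y.Opens) :
    AddSubgroup (VF k W × (∀ (i : w.I) (V : Below W), V.1 ≤ w.U i → Γ(Y, V.1))) where
  carrier := {x | (∀ i (V V' : Below W) (h : V'.1 ≤ V.1) (hi : V.1 ≤ w.U i),
      rs h (x.2 i V hi) = x.2 i V' (h.trans hi)) ∧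
    ∀ i l (V : Below W) (hi : V.1 ≤ w.U i) (hl : V.1 ≤ w.U l),
      x.2 i V hi - x.2 l V hl = formAt (w.trans i l) ⟨V.1, le_inf hi hl⟩ ![VF.res V.2 x.1]}
  zero_mem' := by
    refine ⟨fun i V V' h hi => map_zero _, fun i l V hi hl => ?_⟩
    exact (sub_self _).trans (form1_zero (w.trans i l) ⟨V.1, le_inf hi hl⟩).symm
  add_mem' := by
    rintro x y ⟨hx1, hx2⟩ ⟨hy1, hy2⟩
    refine ⟨fun i V V' h hi => ?_, fun i l V hi hl => ?_⟩
    · change rs h (x.2 i V hi + y.2 i V hi) = x.2 i V' _ + y.2 i V' _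
      rw [map_add, hx1 i V V' h, hy1 i V V' h]
    · change (x.2 i V hi + y.2 i V hi) - (x.2 l V hl + y.2 l V hl) =
        formAt (w.trans i l) ⟨V.1, le_inf hi hl⟩ ![VF.res V.2 x.1 + VF.res V.2 y.1]
      rw [form1_add, ← hx2 i l V hi hl, ← hy2 i l V hi hl]; ring
  neg_mem' := by
    rintro x ⟨hx1, hx2⟩
    refine ⟨fun i V V' h hi => ?_, fun i l V hi hl => ?_⟩
    · change rs h (-x.2 i V hi) = -x.2 i V' _
      rw [map_neg, hx1 i V V' h]
    · change -x.2 i V hi - -x.2 l V hl =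
        formAt (w.trans i l) ⟨V.1, le_inf hi hl⟩ ![VF.res V.2 (-x.1)]
      have : VF.res V.2 (-x.1) = (-1 : Γ(Y, V.1)) • VF.res V.2 x.1 := by
        rw [map_neg, neg_smul, one_smul]
      rw [this, form1_smul, ← hx2 i l V hi hl]; ring

abbrev Cocycle.AlgSec (W : Y.Opens) : Type u := w.algSec W

variable {w}

theorem Cocycle.AlgSec.ext {W : Y.Opens} {x y : w.AlgSec W} (h : x.1.1 = y.1.1)
    (h' : ∀ i V hi, x.1.2 i V hi = y.1.2 i V hi) : x = y :=
  Subtype.ext (Prod.ext h (funext fun i => funext fun V => funext fun hi => h' i V hi))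

theorem Cocycle.AlgSec.add_snd {W : Y.Opens} (x y : w.AlgSec W) (i) (V : Below W) (hi) :
    (x + y).1.2 i V hi = x.1.2 i V hi + y.1.2 i V hi := rfl

instance (W : Y.Opens) : Module Γ(Y, W) (w.AlgSec W) where
  smul f x := ⟨(f • x.1.1, fun i V hi => rs V.2 f * x.1.2 i V hi), fun i V V' h hi => by
      change rs h (rs V.2 f * x.1.2 i V hi) = rs V'.2 f * x.1.2 i V' _
      rw [map_mul, rs_rs, x.2.1 i V V' h], fun i l V hi hl => by
      change rs V.2 f * x.1.2 i V hi - rs V.2 f * x.1.2 l V hl = formAt (w.trans i l)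
        ⟨V.1, le_inf hi hl⟩ ![VF.res V.2 (f • x.1.1)]
      have : VF.res V.2 (f • x.1.1) = rs V.2 f • VF.res V.2 x.1.1 :=
        (tangentMod k Y).res_smul V.2 f x.1.1
      rw [this, form1_smul, ← x.2.2 i l V hi hl]; ring⟩
  one_smul x := Cocycle.AlgSec.ext (one_smul _ x.1.1) fun i V hi => by
    change rs V.2 1 * x.1.2 i V hi = _; simp
  mul_smul f g x := Cocycle.AlgSec.ext (mul_smul f g x.1.1) fun i V hi => by
    change rs V.2 (f * g) * x.1.2 i V hi = rs V.2 f * (rs V.2 g * x.1.2 i V hi); simp [mul_assoc]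
  smul_zero f := Cocycle.AlgSec.ext (smul_zero f) fun i V hi => by
    change rs V.2 f * 0 = 0; simp
  smul_add f x y := Cocycle.AlgSec.ext (smul_add f x.1.1 y.1.1) fun i V hi => by
    change rs V.2 f * (x.1.2 i V hi + y.1.2 i V hi) =
      rs V.2 f * x.1.2 i V hi + rs V.2 f * y.1.2 i V hi
    ring
  add_smul f g x := Cocycle.AlgSec.ext (add_smul f g x.1.1) fun i V hi => by
    change rs V.2 (f + g) * x.1.2 i V hi = rs V.2 f * x.1.2 i V hi + rs V.2 g * x.1.2 i V hi
    rw [map_add]; ring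
  zero_smul x := Cocycle.AlgSec.ext (zero_smul Γ(Y, W) x.1.1) fun i V hi => by
    change rs V.2 0 * x.1.2 i V hi = 0; simp

theorem Cocycle.AlgSec.smul_snd {W : Y.Opens} (f : Γ(Y, W)) (x : w.AlgSec W) (i) (V : Below W) (hi) :
    (f • x).1.2 i V hi = rs V.2 f * x.1.2 i V hi := rfl

/-- Restriction of sections. -/
def Cocycle.AlgSec.res {W W' : Y.Opens} (h : W' ≤ W) : w.AlgSec W →+ w.AlgSec W' where
  toFun x := ⟨(VF.res h x.1.1, fun i V hi => x.1.2 i (V.up h) hi),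
    fun i V V' => x.2.1 i (V.up h) (V'.up h), fun i l V => x.2.2 i l (V.up h)⟩
  map_zero' := rfl
  map_add' _ _ := rfl

/-- The bracket of two sections. -/
def Cocycle.AlgSec.comm {W : Y.Opens} (x y : w.AlgSec W) : w.AlgSec W :=
  ⟨(x.1.1.comm y.1.1, fun i V hi => x.1.1.1 V (y.1.2 i V hi) - y.1.1.1 V (x.1.2 i V hi) +
      formAt (w.form i) ⟨V.1, hi⟩ ![VF.res V.2 x.1.1, VF.res V.2 y.1.1]), fun i V V' h hi => by
    change rs h (x.1.1.1 V (y.1.2 i V hi) - y.1.1.1 V (x.1.2 i V hi) +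
      formAt (w.form i) ⟨V.1, hi⟩ ![VF.res V.2 x.1.1, VF.res V.2 y.1.1]) =
      x.1.1.1 V' (y.1.2 i V' _) - y.1.1.1 V' (x.1.2 i V' _) +
      formAt (w.form i) ⟨V'.1, h.trans hi⟩ ![VF.res V'.2 x.1.1, VF.res V'.2 y.1.1]
    rw [map_add, map_sub, x.1.1.2.2.2 V V' h, y.1.1.2.2.2 V V' h, y.2.1 i V V' h, x.2.1 i V V' h,
      form2_res (w.form i) ⟨V.1, hi⟩ ⟨V'.1, h.trans hi⟩ h]
    rfl, fun i l V hi hl => by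
    change (x.1.1.1 V (y.1.2 i V hi) - y.1.1.1 V (x.1.2 i V hi) +
      formAt (w.form i) ⟨V.1, hi⟩ ![VF.res V.2 x.1.1, VF.res V.2 y.1.1]) -
      (x.1.1.1 V (y.1.2 l V hl) - y.1.1.1 V (x.1.2 l V hl) +
      formAt (w.form l) ⟨V.1, hl⟩ ![VF.res V.2 x.1.1, VF.res V.2 y.1.1]) =
      formAt (w.trans i l) ⟨V.1, le_inf hi hl⟩ ![(VF.res V.2 x.1.1).comm (VF.res V.2 y.1.1)]
    have h1 := w.d_trans i l ⟨V.1, le_inf hi hl⟩ (VF.res V.2 x.1.1) (VF.res V.2 y.1.1)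
    rw [← x.2.2 i l V hi hl, ← y.2.2 i l V hi hl, form_sub, VF.app_sub, VF.app_sub] at h1
    have e1 : ∀ (z : w.AlgSec W) (f : Γ(Y, V.1)), z.1.1.1 V f = (VF.res V.2 z.1.1).app f :=
      fun _ _ => rfl
    simp only [e1]
    rw [form_res, form_res] at h1
    linear_combination -h1⟩

theorem Cocycle.AlgSec.comm_snd {W : Y.Opens} (x y : w.AlgSec W) (i) (V : Below W) (hi) :
    (x.comm y).1.2 i V hi = (VF.res V.2 x.1.1).app (y.1.2 i V hi) -
      (VF.res V.2 y.1.1).app (x.1.2 i V hi) +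
      formAt (w.form i) ⟨V.1, hi⟩ ![VF.res V.2 x.1.1, VF.res V.2 y.1.1] := rfl

theorem VF.res_add {U V : Y.Opens} (h : V ≤ U) (ξ η : VF k U) :
    VF.res h (ξ + η) = VF.res h ξ + VF.res h η := rfl

theorem VF.res_comm {U V : Y.Opens} (h : V ≤ U) (ξ η : VF k U) :
    VF.res h (ξ.comm η) = (VF.res h ξ).comm (VF.res h η) := rfl

theorem VF.res_smul {U V : Y.Opens} (h : V ≤ U) (f : Γ(Y, U)) (ξ : VF k U) :
    VF.res h (f • ξ) = rs h f • VF.res h ξ := (tangentMod k Y).res_smul h f ξ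

variable (w) in
/-- The bracket as a biadditive map. -/
def Cocycle.algBracket (W : Y.Opens) : w.AlgSec W →+ w.AlgSec W →+ w.AlgSec W :=
  AddMonoidHom.mk' (fun x => AddMonoidHom.mk' (fun y => x.comm y)
      (fun y y' => Cocycle.AlgSec.ext (map_add (VF.bracket W x.1.1) y.1.1 y'.1.1) fun i V hi => by
        simp only [AlgSec.comm_snd, AlgSec.add_snd]
        change _ + formAt (w.form i) ⟨V.1, hi⟩ ![VF.res V.2 x.1.1,
          VF.res V.2 y.1.1 + VF.res V.2 y'.1.1] = _
        rw [form2_add_right, VF.app_add]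
        change _ - ((VF.res V.2 y.1.1).app _ + (VF.res V.2 y'.1.1).app _) + _ = _
        ring))
    (fun x x' => AddMonoidHom.ext fun y => Cocycle.AlgSec.ext
      (DFunLike.congr_fun (map_add (VF.bracket W) x.1.1 x'.1.1) y.1.1) fun i V hi => by
        change ((x + x').comm y).1.2 i V hi = (x.comm y + x'.comm y).1.2 i V hi
        simp only [AlgSec.comm_snd, AlgSec.add_snd]
        change _ + formAt (w.form i) ⟨V.1, hi⟩ ![VF.res V.2 x.1.1 + VF.res V.2 x'.1.1,
          VF.res V.2 y.1.1] = _
        rw [form2_add_left, VF.app_add]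
        change ((VF.res V.2 x.1.1).app _ + (VF.res V.2 x'.1.1).app _) - _ + _ = _
        ring)

theorem Cocycle.AlgSec.comm_self {W : Y.Opens} (x : w.AlgSec W) : x.comm x = 0 :=
  Cocycle.AlgSec.ext ((tangent k Y).bracket_self W x.1.1) fun i V hi => by
    change (x.comm x).1.2 i V hi = 0
    rw [AlgSec.comm_snd, form2_self]; ring

theorem Cocycle.AlgSec.jacobi {W : Y.Opens} (x y z : w.AlgSec W) :
    x.comm (y.comm z) = (x.comm y).comm z + y.comm (x.comm z) :=
  Cocycle.AlgSec.ext ((tangent k Y).jacobi W x.1.1 y.1.1 z.1.1) fun i V hi => by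
    simp only [AlgSec.comm_snd, AlgSec.add_snd]
    have h1 := w.closed i ⟨V.1, hi⟩ (VF.res V.2 x.1.1) (VF.res V.2 y.1.1) (VF.res V.2 z.1.1)
    have e : ∀ x y : w.AlgSec W, VF.res V.2 (x.comm y).1.1 =
      (VF.res V.2 x.1.1).comm (VF.res V.2 y.1.1) := fun _ _ => rfl
    have s1 := form2_swap (w.form i) ⟨V.1, hi⟩ (VF.res V.2 x.1.1)
      ((VF.res V.2 y.1.1).comm (VF.res V.2 z.1.1))
    have s2 := form2_swap (w.form i) ⟨V.1, hi⟩ (VF.res V.2 y.1.1)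
      ((VF.res V.2 x.1.1).comm (VF.res V.2 z.1.1))
    simp only [e, VF.app_add, VF.app_sub, VF.comm_app]
    linear_combination h1 + s1 - s2

theorem Cocycle.AlgSec.leibniz {W : Y.Opens} (x : w.AlgSec W) (f : Γ(Y, W)) (y : w.AlgSec W) :
    x.comm (f • y) = f • x.comm y + x.1.1.app f • y :=
  Cocycle.AlgSec.ext ((tangent k Y).leibniz W x.1.1 f y.1.1) fun i V hi => by
    simp only [AlgSec.comm_snd, AlgSec.add_snd, AlgSec.smul_snd]
    have e : VF.res V.2 (f • y).1.1 = rs V.2 f • VF.res V.2 y.1.1 := VF.res_smul V.2 f y.1.1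
    rw [e, form2_smul_right, VF.app_mul, VF.smul_app, VF.res_app]
    ring

/-- Functions as sections of the algebroid. -/
def Cocycle.AlgSec.ofFun {W : Y.Opens} (f : Γ(Y, W)) : w.AlgSec W :=
  ⟨(0, fun i V _ => rs V.2 f), fun i V V' h _ => rs_rs _ _ _, fun i l V hi hl =>
    (sub_self _).trans (form1_zero (w.trans i l) ⟨V.1, le_inf hi hl⟩).symm⟩

theorem Cocycle.AlgSec.comm_ofFun {W : Y.Opens} (x : w.AlgSec W) (f : Γ(Y, W)) :
    x.comm (.ofFun f) = .ofFun (x.1.1.app f) :=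
  Cocycle.AlgSec.ext (map_zero (VF.bracket W x.1.1)) fun i V hi => by
    change (VF.res V.2 x.1.1).app (rs V.2 f) - (0 : VF k V.1).app (x.1.2 i V hi) +
      formAt (w.form i) ⟨V.1, hi⟩ ![VF.res V.2 x.1.1, 0] = rs V.2 (x.1.1.app f)
    rw [form2_zero_right, VF.res_app, VF.zero_app]; ring

variable (w) in
/-- The Picard algebroid of a cocycle. -/
def Cocycle.alg : UnitalAlgebroid k Y where
  Sec W := w.AlgSec W
  res h := AlgSec.res h
  res_id _ _ := rfl
  res_res _ _ _ := rfl
  res_smul h f x := Cocycle.AlgSec.ext (VF.res_smul h f x.1.1) fun i V hi => by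
    change rs (V.up h).2 f * x.1.2 i (V.up h) hi = rs V.2 (rs h f) * x.1.2 i (V.up h) hi
    rw [rs_rs]
  anchor W := { toFun := fun x => x.1.1, map_add' := fun _ _ => rfl, map_smul' := fun _ _ => rfl }
  anchor_res _ _ := rfl
  bracket W := w.algBracket W
  bracket_res _ _ _ := rfl
  bracket_self W x := x.comm_self
  jacobi W x y z := x.jacobi y z
  leibniz W x f y := x.leibniz f y
  anchor_bracket _ _ _ := rfl
  unit W :=
    { toFun := AlgSec.ofFun
      map_add' := fun f g => Cocycle.AlgSec.ext (add_zero (0 : VF k W)).symm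
        fun i V hi => map_add (rs V.2) f g
      map_smul' := fun f g => Cocycle.AlgSec.ext (smul_zero f).symm
        fun i V hi => map_mul (rs V.2) f g }
  unit_res h f := Cocycle.AlgSec.ext rfl fun i V hi => (rs_rs _ _ _).symm
  anchor_unit _ _ := rfl
  bracket_unit W x f := x.comm_ofFun f

/-- The splitting of the algebroid of a cocycle over a member of the cover. -/
def Cocycle.splitting (i : w.I) : Splitting w.alg (w.U i) where
  app V :=
    { toFun := fun ξ => ⟨(ξ, fun l V' hl =>
          -formAt (w.trans i l) ⟨V'.1, le_inf (V'.2.trans V.2) hl⟩ ![VF.res V'.2 ξ]),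
        fun l V' V'' h hl => by
          rw [map_neg, form1_res (w.trans i l) ⟨V'.1, le_inf (V'.2.trans V.2) hl⟩
            ⟨V''.1, le_inf (V''.2.trans V.2) (h.trans hl)⟩ h]
          rfl,
        fun l l' V' hl hl' => by
          have := congrArg (fun α : (forms k Y 1).Sec (w.U i ⊓ w.U l ⊓ w.U l') =>
            formAt α ⟨V'.1, le_inf (le_inf (V'.2.trans V.2) hl) hl'⟩ ![VF.res V'.2 ξ])
            (w.trans_trans i l l')
          simp only [form_add, form_res] at this
          linear_combination -this⟩
      map_add' := fun ξ η => Cocycle.AlgSec.ext rfl fun l V' hl => by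
        refine (congrArg Neg.neg (form1_add (w.trans i l)
          ⟨V'.1, le_inf (V'.2.trans V.2) hl⟩ (VF.res V'.2 ξ) (VF.res V'.2 η))).trans (neg_add _ _)
      map_smul' := fun f ξ => Cocycle.AlgSec.ext rfl fun l V' hl => by
        change -formAt (w.trans i l) ⟨V'.1, le_inf (V'.2.trans V.2) hl⟩ ![VF.res V'.2 (f • ξ)] =
          rs V'.2 f * -formAt (w.trans i l) ⟨V'.1, le_inf (V'.2.trans V.2) hl⟩ ![VF.res V'.2 ξ]
        rw [VF.res_smul, form1_smul]; ring }
  app_res V W h ξ := rfl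
  anchor_app V ξ := rfl

variable (w) in
theorem Cocycle.represents_alg : Represents w.alg w := by
  refine ⟨w.splitting, fun i V ξ η => ?_, fun i i' V ξ => ?_⟩
  · refine Cocycle.AlgSec.ext (sub_self (ξ.comm η)).symm fun l V' hl => ?_
    change rs V'.2 (formAt (w.form i) V ![ξ, η]) =
      ((VF.res V'.2 ξ).app (-formAt (w.trans i l) ⟨V'.1, le_inf (V'.2.trans V.2) hl⟩ ![VF.res V'.2 η]) -
      (VF.res V'.2 η).app (-formAt (w.trans i l) ⟨V'.1, le_inf (V'.2.trans V.2) hl⟩ ![VF.res V'.2 ξ]) +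
      formAt (w.form l) ⟨V'.1, hl⟩ ![VF.res V'.2 ξ, VF.res V'.2 η]) -
      -formAt (w.trans i l) ⟨V'.1, le_inf (V'.2.trans V.2) hl⟩ ![(VF.res V'.2 ξ).comm (VF.res V'.2 η)]
    have h1 := w.d_trans i l ⟨V'.1, le_inf (V'.2.trans V.2) hl⟩ (VF.res V'.2 ξ) (VF.res V'.2 η)
    rw [form_sub, form_res, form_res] at h1
    rw [form2_res (w.form i) V ⟨V'.1, V'.2.trans V.2⟩ V'.2, VF.app_neg, VF.app_neg]
    linear_combination -h1
  · refine Cocycle.AlgSec.ext (sub_self ξ).symm fun l V' hl => ?_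
    change rs V'.2 (formAt (w.trans i i') V ![ξ]) =
      -formAt (w.trans i' l) ⟨V'.1, _⟩ ![VF.res V'.2 ξ] -
      -formAt (w.trans i l) ⟨V'.1, _⟩ ![VF.res V'.2 ξ]
    have := congrArg (fun α : (forms k Y 1).Sec (w.U i ⊓ w.U i' ⊓ w.U l) =>
      formAt α ⟨V'.1, le_inf (V'.2.trans V.2) hl⟩ ![VF.res V'.2 ξ]) (w.trans_trans i i' l)
    simp only [form_add, form_res] at this
    rw [form1_res (w.trans i i') V ⟨V'.1, V'.2.trans V.2⟩ V'.2]
    linear_combination this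

theorem Cocycle.le_cover (W : Y.Opens) : W ≤ ⨆ i, w.U i := fun y _ => by
  obtain ⟨i, hi⟩ := w.cover y
  exact Opens.mem_iSup.2 ⟨i, hi⟩

variable (w) in
theorem Cocycle.alg_isSheaf : w.alg.toModPresheaf.IsSheaf := by
  refine ModPresheaf.IsSheaf.of_sep (fun W x y h => ?_) fun I U x hx => ?_
  · refine Cocycle.AlgSec.ext (tangentMod_isSep _ _ _ fun p hp => ?_) fun i V hi => rs_ext fun p hp => ?_
    · obtain ⟨V, hV, hpV, e⟩ := h p hp
      exact ⟨V, hV, hpV, congrArg (fun z : w.AlgSec V => z.1.1) e⟩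
    · obtain ⟨V', hV', hpV', e⟩ := h p (V.2 hp)
      refine ⟨V.1 ⊓ V', inf_le_left, ⟨hp, hpV'⟩, ?_⟩
      have e1 := congrArg (fun z : w.AlgSec V' => z.1.2 i ⟨V.1 ⊓ V', inf_le_right⟩
        (inf_le_left.trans hi)) e
      exact (x.2.1 i V ⟨V.1 ⊓ V', inf_le_left.trans V.2⟩ inf_le_left hi).trans
        (e1.trans (y.2.1 i V ⟨V.1 ⊓ V', inf_le_left.trans V.2⟩ inf_le_left hi).symm)
  · replace hx : ∀ i j, AlgSec.res (inf_le_left : U i ⊓ U j ≤ U i) (x i : w.AlgSec (U i)) =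
      AlgSec.res (inf_le_right : U i ⊓ U j ≤ U j) (x j : w.AlgSec (U j)) := hx
    change ∀ i, w.AlgSec (U i) at x
    obtain ⟨ξ, hξ, -⟩ := tangentMod_isSheaf (k := k) I U (fun i => (x i).1.1) fun i j =>
      congrArg (fun z : w.AlgSec (U i ⊓ U j) => z.1.1) (hx i j)
    have hij : ∀ i i' l (V : Y.Opens) (h : V ≤ U i) (h' : V ≤ U i') (hl : V ≤ w.U l),
        (x i).1.2 l ⟨V, h⟩ hl = (x i').1.2 l ⟨V, h'⟩ hl := fun i i' l V h h' hl =>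
      congrArg (fun z : w.AlgSec (U i ⊓ U i') => z.1.2 l ⟨V, le_inf h h'⟩ hl) (hx i i')
    have ha : ∀ l (V : Below (⨆ i, U i)) (hl : V.1 ≤ w.U l), ∃! t : Γ(Y, V.1),
        ∀ i V' (hV' : V' ≤ V.1) (hU' : V' ≤ U i),
          rs hV' t = (x i).1.2 l ⟨V', hU'⟩ (hV'.trans hl) := by
      intro l V hl
      refine funMod_isSheaf.existsUnique_family V.2
        (fun i V' hV' hU' => (x i).1.2 l ⟨V', hU'⟩ (hV'.trans hl)) ?_ ?_
      · intro i V' hV' hU' V'' hh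
        exact (x i).2.1 l ⟨V', hU'⟩ ⟨V'', hh.trans hU'⟩ hh _
      · intro i i' V' hV' hU' hU''
        exact hij i i' l V' hU' hU'' _
    choose a ha hau using ha
    have ext : ∀ (V : Below (⨆ i, U i)) (s t : Γ(Y, V.1)),
        (∀ i V' (hV' : V' ≤ V.1) (_ : V' ≤ U i), rs hV' s = rs hV' t) → s = t := by
      intro V s t h
      refine rs_ext fun y hy => ?_
      obtain ⟨i, hi⟩ := Opens.mem_iSup.1 (V.2 hy)
      exact ⟨V.1 ⊓ U i, inf_le_left, ⟨hy, hi⟩, h i _ _ inf_le_right⟩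
    refine ⟨⟨(ξ, a), fun l V V' h hl => ?_, fun l l' V hl hl' => ?_⟩, fun i =>
      Cocycle.AlgSec.ext (hξ i) fun l V hl => ?_⟩
    · refine ext V' _ _ fun i V'' hV'' hU'' => ?_
      change rs hV'' (rs h (a l V hl)) = rs hV'' (a l V' _)
      rw [rs_rs, ha l V hl i V'' _ hU'', ha l V' _ i V'' _ hU'']
    · refine ext V _ _ fun i V' hV' hU' => ?_
      change rs hV' (a l V hl - a l' V hl') = rs hV' (formAt (w.trans l l') ⟨V.1, _⟩ ![VF.res V.2 ξ])
      rw [map_sub, ha l V hl i V' _ hU', ha l' V hl' i V' _ hU', (x i).2.2,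
        form1_res (w.trans l l') ⟨V.1, le_inf hl hl'⟩ ⟨V', hV'.trans (le_inf hl hl')⟩ hV', ← hξ i]
      rfl
    · have := ha l (V.up (le_iSup U i)) hl i V.1 le_rfl V.2
      rw [rs_id] at this
      exact this

variable (w) in
theorem Cocycle.alg_isPicard : w.alg.IsPicard where
  isSheaf := w.alg_isSheaf
  injective W f g h := by
    refine rs_ext fun y hy => ?_
    obtain ⟨i, hi⟩ := w.cover y
    exact ⟨W ⊓ w.U i, inf_le_left, ⟨hy, hi⟩, congrArg
      (fun z : w.AlgSec W => z.1.2 i ⟨W ⊓ w.U i, inf_le_left⟩ inf_le_right) h⟩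
  exact W x hx := by
    change w.AlgSec W at x
    replace hx : x.1.1 = 0 := hx
    have hz : ∀ i l (V : Below W) (hi : V.1 ≤ w.U i) (hl : V.1 ≤ w.U l),
        x.1.2 i V hi = x.1.2 l V hl := fun i l V hi hl => by
      have h1 := x.2.2 i l V hi hl
      rw [hx, map_zero, form1_zero] at h1
      exact sub_eq_zero.1 h1
    obtain ⟨f, hf, -⟩ := funMod_isSheaf.existsUnique_family (w.le_cover W)
      (fun i V hV hi => x.1.2 i ⟨V, hV⟩ hi) (fun i V hV hU V' hh => x.2.1 i ⟨V, hV⟩ ⟨V', _⟩ hh hU)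
      (fun i l V hV hi hl => hz i l ⟨V, hV⟩ hi hl)
    exact ⟨f, Cocycle.AlgSec.ext hx.symm fun i V hi => hf i V.1 V.2 hi⟩
  surjective W ξ y hy := by
    obtain ⟨i, hi⟩ := w.cover y
    exact ⟨W ⊓ w.U i, inf_le_left, ⟨hy, hi⟩,
      (w.splitting i).app ⟨W ⊓ w.U i, inf_le_right⟩ (VF.res inf_le_left ξ), rfl⟩

end CocycleAlgebroid

/-! ### Trivialized deformations of a Poisson algebra -/

section Star

/-- A `k`-linear antisymmetric biderivation. -/
structure IsBiDer {k A : Type u} [Field k] [CommRing A] (φ : k →+* A) (P : A → A → A) : Prop where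
  swap : ∀ a b, P a b = -P b a
  add_left : ∀ a b c, P (a + b) c = P a c + P b c
  mul_left : ∀ a b c, P (a * b) c = a * P b c + P a c * b
  scalar_left : ∀ c b, P (φ c) b = 0

/-- A `k[h]`-algebra `R` with a `k[h]`-linear bijection to `A[[h]]` for which the product is
`ab + (1/2) h P(a, b)` modulo `h²`. -/
structure StarTriv {k A R : Type u} [Field k] [CommRing A] [Ring R] (φ : k →+* A) (σ : k →+* R)
    (h : R) (P : A → A → A) where
  η : R ≃+ PowerSeries A
  h_comm : ∀ x, h * x = x * h
  η_h : ∀ x, η (h * x) = PowerSeries.X * η x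
  σ_comm : ∀ c x, σ c * x = x * σ c
  η_σ : ∀ c x, η (σ c * x) = PowerSeries.C (φ c) * η x
  mul_coeff_zero : ∀ x y, PowerSeries.coeff 0 (η (x * y)) =
    PowerSeries.coeff 0 (η x) * PowerSeries.coeff 0 (η y)
  mul_coeff_one : ∀ a b, PowerSeries.coeff 1 (η (η.symm (PowerSeries.C a) * η.symm (PowerSeries.C b))) =
    φ (1 / 2) * P a b
  bi : IsBiDer φ P

variable {k A R : Type u} [Field k] [CommRing A] [Ring R] {φ : k →+* A} {σ : k →+* R}
    {h : R} {P : A → A → A}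

namespace IsBiDer

theorem add_right (hP : IsBiDer φ P) (a b c : A) : P a (b + c) = P a b + P a c := by
  rw [hP.swap, hP.add_left, hP.swap a b, hP.swap a c]; ring

theorem mul_right (hP : IsBiDer φ P) (a b c : A) : P a (b * c) = b * P a c + P a b * c := by
  rw [hP.swap, hP.mul_left, hP.swap a b, hP.swap a c]; ring

theorem scalar_mul_left (hP : IsBiDer φ P) (c : k) (a b : A) : P (φ c * a) b = φ c * P a b := by
  rw [hP.mul_left, hP.scalar_left]; ring

theorem zero_left (hP : IsBiDer φ P) (b : A) : P 0 b = 0 := by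
  have := hP.scalar_left 0 b
  rwa [map_zero] at this

theorem zero_right (hP : IsBiDer φ P) (b : A) : P b 0 = 0 := by
  rw [hP.swap, hP.zero_left, neg_zero]

end IsBiDer

theorem two_mul_half [CharZero k] (φ : k →+* A) : 2 * φ (1 / 2) = 1 := by
  have h2 : (2 : A) = φ 2 := (map_ofNat φ 2).symm
  rw [h2, ← map_mul]
  norm_num

namespace StarTriv

variable (t : StarTriv φ σ h P)

/-- The coefficients of an element. -/
def c (n : ℕ) : R →+ A := (PowerSeries.coeff (R := A) n).toAddMonoidHom.comp t.η.toAddMonoidHom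

/-- The section of the reduction. -/
def s : A →+ R := t.η.symm.toAddMonoidHom.comp (PowerSeries.C (R := A)).toAddMonoidHom

theorem c_s_zero (a : A) : t.c 0 (t.s a) = a := by simp [c, s]

theorem c_s_succ (n : ℕ) (a : A) : t.c (n + 1) (t.s a) = 0 := by
  simp [c, s, PowerSeries.coeff_C]

theorem c_h_zero (x : R) : t.c 0 (h * x) = 0 := by simp [c, t.η_h]

theorem c_h_succ (n : ℕ) (x : R) : t.c (n + 1) (h * x) = t.c n x := by
  simp [c, t.η_h, PowerSeries.coeff_succ_X_mul]

theorem h_inj (t : StarTriv φ σ h P) {x y : R} (e : h * x = h * y) : x = y := by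
  refine t.η.injective (PowerSeries.ext fun n => ?_)
  have := congrArg (t.c (n + 1)) e
  rwa [c_h_succ, c_h_succ] at this

theorem exists_div {x : R} (hx : t.c 0 x = 0) : ∃ z, x = h * z := by
  refine ⟨t.η.symm (PowerSeries.mk fun n => t.c (n + 1) x), t.η.injective ?_⟩
  rw [t.η_h, AddEquiv.apply_symm_apply]
  refine PowerSeries.ext fun n => ?_
  cases n with
  | zero => simpa [c] using hx
  | succ n => rw [PowerSeries.coeff_succ_X_mul, PowerSeries.coeff_mk]; rfl

theorem exists_eq (x : R) : ∃ x', x = t.s (t.c 0 x) + h * x' := by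
  obtain ⟨z, hz⟩ := t.exists_div (x := x - t.s (t.c 0 x)) (by rw [map_sub, c_s_zero, sub_self])
  exact ⟨z, by rw [← hz]; abel⟩

theorem c_mul_zero (x y : R) : t.c 0 (x * y) = t.c 0 x * t.c 0 y := t.mul_coeff_zero x y

theorem c_s_mul_s (a b : A) : t.c 1 (t.s a * t.s b) = φ (1 / 2) * P a b := t.mul_coeff_one a b

theorem c_mul_one (x y : R) : t.c 1 (x * y) =
    t.c 0 x * t.c 1 y + t.c 1 x * t.c 0 y + φ (1 / 2) * P (t.c 0 x) (t.c 0 y) := by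
  obtain ⟨x', hx⟩ := t.exists_eq x
  obtain ⟨y', hy⟩ := t.exists_eq y
  have e : x * y = t.s (t.c 0 x) * t.s (t.c 0 y) +
      h * (x' * t.s (t.c 0 y) + t.s (t.c 0 x) * y' + h * (x' * y')) := by
    conv_lhs => rw [hx, hy]
    have h1 : t.s (t.c 0 x) * (h * y') = h * (t.s (t.c 0 x) * y') := by
      rw [← mul_assoc, ← t.h_comm, mul_assoc]
    have h2 : x' * (h * y') = h * (x' * y') := by rw [← mul_assoc, ← t.h_comm, mul_assoc]
    rw [add_mul, mul_add, mul_add, h1, mul_assoc, mul_assoc, h2, mul_add, mul_add]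
    abel
  have ex : t.c 1 x = t.c 0 x' := by
    conv_lhs => rw [hx, map_add, t.c_s_succ, t.c_h_succ, zero_add]
  have ey : t.c 1 y = t.c 0 y' := by
    conv_lhs => rw [hy, map_add, t.c_s_succ, t.c_h_succ, zero_add]
  rw [e, map_add, t.c_s_mul_s, t.c_h_succ, map_add, map_add, t.c_h_zero, t.c_mul_zero,
    t.c_mul_zero, t.c_s_zero, t.c_s_zero, ex, ey]
  ring

theorem c_comm_zero (x y : R) : t.c 0 (x * y - y * x) = 0 := by
  rw [map_sub, c_mul_zero, c_mul_zero]; ring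

theorem c_comm_one [CharZero k] (x y : R) :
    t.c 1 (x * y - y * x) = P (t.c 0 x) (t.c 0 y) := by
  rw [map_sub, c_mul_one, c_mul_one, t.bi.swap (t.c 0 y)]
  linear_combination P (t.c 0 x) (t.c 0 y) * two_mul_half φ

/-- The second order term of the commutator. -/
def κ (a b : A) : A := t.c 2 (t.s a * t.s b - t.s b * t.s a)

theorem c_comm_two [CharZero k] (x y : R) : t.c 2 (x * y - y * x) =
    t.κ (t.c 0 x) (t.c 0 y) + P (t.c 1 x) (t.c 0 y) + P (t.c 0 x) (t.c 1 y) := by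
  obtain ⟨x', hx⟩ := t.exists_eq x
  obtain ⟨y', hy⟩ := t.exists_eq y
  set a := t.c 0 x
  set b := t.c 0 y
  have e : x * y - y * x = (t.s a * t.s b - t.s b * t.s a) +
      h * ((x' * t.s b - t.s b * x') + (t.s a * y' - y' * t.s a) +
        h * (x' * y' - y' * x')) := by
    rw [hx, hy]
    have h1 : ∀ u v : R, u * (h * v) = h * (u * v) := fun u v => by
      rw [← mul_assoc, ← t.h_comm, mul_assoc]
    simp only [add_mul, mul_add, mul_sub, h1, mul_assoc]
    abel
  have ex : t.c 1 x = t.c 0 x' := by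
    rw [hx, map_add, t.c_s_succ, t.c_h_succ, zero_add]
  have ey : t.c 1 y = t.c 0 y' := by
    rw [hy, map_add, t.c_s_succ, t.c_h_succ, zero_add]
  rw [e, map_add, t.c_h_succ, map_add, map_add, t.c_comm_one, t.c_comm_one, t.c_h_succ,
    t.c_comm_zero, t.c_s_zero, t.c_s_zero, ex, ey, κ]
  ring

theorem exists_comm (t : StarTriv φ σ h P) (x y : R) : ∃ z, x * y - y * x = h * z := t.exists_div (t.c_comm_zero x y)

theorem comm_h (t : StarTriv φ σ h P) (x u : R) : x * (h * u) - h * u * x = h * (x * u - u * x) := by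
  rw [mul_sub, ← mul_assoc, ← t.h_comm, mul_assoc, mul_assoc]

theorem c_zero_of_comm [CharZero k] {x y z : R} (e : h * z = x * y - y * x) :
    t.c 0 z = P (t.c 0 x) (t.c 0 y) := by
  rw [← t.c_comm_one, ← e, t.c_h_succ]

theorem c_one_of_comm [CharZero k] {x y z : R} (e : h * z = x * y - y * x) :
    t.c 1 z = t.κ (t.c 0 x) (t.c 0 y) + P (t.c 1 x) (t.c 0 y) + P (t.c 0 x) (t.c 1 y) := by
  rw [← t.c_comm_two, ← e, t.c_h_succ]

theorem jacobi_comm (t : StarTriv φ σ h P) {x y z u v w : R} (hu : h * u = y * z - z * y) (hv : h * v = x * z - z * x)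
    (hw : h * w = x * y - y * x) :
    x * u - u * x = (w * z - z * w) + (y * v - v * y) := by
  apply t.h_inj
  rw [mul_add, ← t.comm_h x u, ← t.comm_h y v, hu, hv]
  have : h * (w * z - z * w) = (x * y - y * x) * z - z * (x * y - y * x) := by
    rw [mul_sub, ← mul_assoc, hw, ← mul_assoc, t.h_comm, mul_assoc, hw]
  rw [this]
  noncomm_ring

theorem jacobi [CharZero k] (t : StarTriv φ σ h P) (a b c : A) : P a (P b c) = P (P a b) c + P b (P a c) := by
  obtain ⟨u, hu⟩ := t.exists_comm (t.s b) (t.s c)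
  obtain ⟨v, hv⟩ := t.exists_comm (t.s a) (t.s c)
  obtain ⟨w, hw⟩ := t.exists_comm (t.s a) (t.s b)
  have := congrArg (t.c 1) (t.jacobi_comm hu.symm hv.symm hw.symm)
  rw [map_add, t.c_comm_one, t.c_comm_one, t.c_comm_one, t.c_zero_of_comm hu.symm,
    t.c_zero_of_comm hv.symm, t.c_zero_of_comm hw.symm] at this
  simpa only [t.c_s_zero] using this

theorem κ_swap (a b : A) : t.κ a b = -t.κ b a := by
  rw [κ, κ, ← map_neg, neg_sub]

theorem κ_jacobi [CharZero k] (a b c : A) :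
    t.κ a (P b c) + P a (t.κ b c) = (t.κ (P a b) c + P (t.κ a b) c) +
      (t.κ b (P a c) + P b (t.κ a c)) := by
  obtain ⟨u, hu⟩ := t.exists_comm (t.s b) (t.s c)
  obtain ⟨v, hv⟩ := t.exists_comm (t.s a) (t.s c)
  obtain ⟨w, hw⟩ := t.exists_comm (t.s a) (t.s b)
  have := congrArg (t.c 2) (t.jacobi_comm hu.symm hv.symm hw.symm)
  rw [map_add, t.c_comm_two, t.c_comm_two, t.c_comm_two, t.c_zero_of_comm hu.symm,
    t.c_zero_of_comm hv.symm, t.c_zero_of_comm hw.symm, t.c_one_of_comm hu.symm,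
    t.c_one_of_comm hv.symm, t.c_one_of_comm hw.symm] at this
  simp only [t.c_s_zero, t.c_s_succ 0, t.bi.zero_left, t.bi.zero_right, add_zero] at this
  linear_combination this

theorem κ_mul_left [CharZero k] (a b c : A) : t.κ (a * b) c = a * t.κ b c + t.κ a c * b := by
  obtain ⟨u, hu⟩ := t.exists_comm (t.s b) (t.s c)
  obtain ⟨v, hv⟩ := t.exists_comm (t.s a) (t.s c)
  have e : t.s a * t.s b * t.s c - t.s c * (t.s a * t.s b) = h * (t.s a * u + v * t.s b) := by
    have h1 : h * (t.s a * u + v * t.s b) =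
        t.s a * (t.s b * t.s c - t.s c * t.s b) + (t.s a * t.s c - t.s c * t.s a) * t.s b := by
      rw [hu, hv, mul_add, ← mul_assoc, t.h_comm, mul_assoc, mul_assoc]
    rw [h1]; noncomm_ring
  have h2 := congrArg (t.c 2) e
  rw [t.c_comm_two, t.c_h_succ, map_add, t.c_mul_one, t.c_mul_one, t.c_mul_one, t.c_mul_zero,
    t.c_one_of_comm hu.symm, t.c_one_of_comm hv.symm, t.c_zero_of_comm hu.symm,
    t.c_zero_of_comm hv.symm] at h2
  simp only [t.c_s_zero, t.c_s_succ 0, t.bi.zero_left, t.bi.zero_right, add_zero, mul_zero,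
    zero_mul, zero_add] at h2
  rw [t.bi.scalar_mul_left] at h2
  linear_combination h2 + φ (1 / 2) * t.jacobi a b c + φ (1 / 2) * t.bi.swap b (P a c)

theorem s_scalar (c : k) (a : A) : t.s (φ c * a) = σ c * t.s a := by
  apply t.η.injective
  rw [t.η_σ]
  simp [s]

theorem κ_isBiDer [CharZero k] : IsBiDer φ t.κ := by
  refine ⟨t.κ_swap, fun a b c => ?_, t.κ_mul_left, fun c b => ?_⟩
  · simp only [κ, map_add, add_mul, mul_add]
    rw [← map_add]
    congr 1
    abel
  · have h1 : t.κ 1 b = 0 := by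
      have := t.κ_mul_left 1 1 b
      simpa using this
    have h2 : t.κ (φ c * 1) b = φ c * t.κ 1 b := by
      have e : t.s (φ c * 1) * t.s b - t.s b * t.s (φ c * 1) =
          σ c * (t.s 1 * t.s b - t.s b * t.s 1) := by
        rw [t.s_scalar, mul_sub, ← mul_assoc (t.s b), ← t.σ_comm, mul_assoc, mul_assoc]
      have e2 : ∀ x, t.c 2 (σ c * x) = φ c * t.c 2 x := fun x => by
        change PowerSeries.coeff 2 (t.η _) = _
        rw [t.η_σ, PowerSeries.coeff_C_mul]; rfl
      rw [κ, e, e2, κ]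
    rw [← mul_one (φ c), h2, h1, mul_zero]

/-! #### Change of the trivialization -/

variable (t' : StarTriv φ σ h P)

/-- The first order difference of two trivializations. -/
def diff : A →+ A := (t.c 1).comp t'.s

theorem c_one_eq (h0 : ∀ x, t.c 0 x = t'.c 0 x) (x : R) :
    t.c 1 x = t'.c 1 x + t.diff t' (t'.c 0 x) := by
  obtain ⟨x', hx⟩ := t'.exists_eq x
  have e1 : t'.c 1 x = t'.c 0 x' := by
    conv_lhs => rw [hx, map_add, t'.c_s_succ, t'.c_h_succ, zero_add]
  conv_lhs => rw [hx, map_add, t.c_h_succ, h0]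
  rw [e1, diff, AddMonoidHom.comp_apply]; ring

theorem isDer_diff [CharZero k] (h0 : ∀ x, t.c 0 x = t'.c 0 x) :
    IsDer φ (RingHom.id A) (t.diff t') := by
  have hmul : ∀ a b, t.diff t' (a * b) = a * t.diff t' b + t.diff t' a * b := fun a b => by
    have h1 := t.c_one_eq t' h0 (t'.s a * t'.s b)
    rw [t'.c_s_mul_s, t.c_mul_one, t'.c_mul_zero, h0, h0, t'.c_s_zero, t'.c_s_zero] at h1
    change _ = a * t.c 1 (t'.s b) + t.c 1 (t'.s a) * b
    linear_combination -h1
  refine ⟨hmul, fun c => ?_⟩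
  have h1 : t.diff t' 1 = 0 := by
    have := hmul 1 1
    simpa using this
  have h2 : t.diff t' (φ c * 1) = φ c * t.diff t' 1 := by
    change t.c 1 (t'.s _) = _ * t.c 1 _
    rw [t'.s_scalar]
    change PowerSeries.coeff 1 (t.η _) = _
    rw [t.η_σ, PowerSeries.coeff_C_mul]; rfl
  rw [← mul_one (φ c), h2, h1, mul_zero]

theorem κ_sub [CharZero k] (h0 : ∀ x, t.c 0 x = t'.c 0 x) (a b : A) : t'.κ a b - t.κ a b =
    P a (t.diff t' b) - P b (t.diff t' a) - t.diff t' (P a b) := by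
  obtain ⟨u, hu⟩ := t.exists_comm (t'.s a) (t'.s b)
  have h1 := t.c_one_of_comm hu.symm
  have h2 := t'.c_one_of_comm hu.symm
  have h3 := t'.c_zero_of_comm hu.symm
  rw [t.c_one_eq t' h0 u, h2, h3] at h1
  simp only [h0, t'.c_s_zero, t'.c_s_succ 0, t.bi.zero_left, t.bi.zero_right, add_zero] at h1
  have e : ∀ a, t.c 1 (t'.s a) = t.diff t' a := fun _ => rfl
  rw [e, e, t.bi.swap (t.diff t' a)] at h1
  linear_combination h1

theorem diff_add (t'' : StarTriv φ σ h P) (h0 : ∀ x, t.c 0 x = t'.c 0 x)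
    (h0' : ∀ x, t'.c 0 x = t''.c 0 x) (a : A) : t.diff t' a + t'.diff t'' a = t.diff t'' a := by
  have h1 := t.c_one_eq t' h0 (t''.s a)
  rw [h0', t''.c_s_zero] at h1
  change _ + t'.c 1 (t''.s a) = t.c 1 (t''.s a)
  rw [h1]; ring

end StarTriv

end Star

/-! ### Hamiltonian vector fields -/

section Hamiltonian

variable {k : Type u} [Field k] {X : Scheme.{u}} [X.Over (Spec (.of k))]

namespace SymplecticForm

variable (ω : SymplecticForm k X) {U V : X.Opens}

/-- The pairing of two vector fields. -/
def pair (ξ η : VF k U) : Γ(X, U) := formAt ω.form ⟨U, le_top⟩ ![ξ, η]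

theorem pair_swap (ξ η : VF k U) : ω.pair ξ η = -ω.pair η ξ := form2_swap _ _ _ _

theorem pair_add_left (ξ ξ' η : VF k U) : ω.pair (ξ + ξ') η = ω.pair ξ η + ω.pair ξ' η :=
  form2_add_left _ _ _ _ _

theorem pair_smul_left (f : Γ(X, U)) (ξ η : VF k U) : ω.pair (f • ξ) η = f * ω.pair ξ η :=
  form2_smul_left _ _ _ _ _

theorem pair_add_right (ξ η η' : VF k U) : ω.pair ξ (η + η') = ω.pair ξ η + ω.pair ξ η' :=
  form2_add_right _ _ _ _ _

theorem pair_smul_right (f : Γ(X, U)) (ξ η : VF k U) : ω.pair ξ (f • η) = f * ω.pair ξ η :=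
  form2_smul_right _ _ _ _ _

theorem pair_zero_left (η : VF k U) : ω.pair 0 η = 0 :=
  (ω.form.1 ⟨U, le_top⟩).map_coord_zero (0 : Fin 2) rfl

theorem pair_zero_right (ξ : VF k U) : ω.pair ξ 0 = 0 := form2_zero_right _ _ _

theorem pair_neg_left (ξ η : VF k U) : ω.pair (-ξ) η = -ω.pair ξ η := by
  have := ω.pair_smul_left (-1) ξ η
  rwa [neg_smul, one_smul, neg_one_mul] at this

theorem pair_res (h : V ≤ U) (ξ η : VF k U) :
    rs h (ω.pair ξ η) = ω.pair (VF.res h ξ) (VF.res h η) :=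
  form2_res ω.form ⟨U, le_top⟩ ⟨V, le_top⟩ h ξ η

theorem pair_sum_right {ι : Type*} (s : Finset ι) (ξ : VF k U) (η : ι → VF k U) :
    ω.pair ξ (∑ i ∈ s, η i) = ∑ i ∈ s, ω.pair ξ (η i) := by
  classical
  induction s using Finset.induction_on with
  | empty => exact ω.pair_zero_right ξ
  | insert a s ha ih => rw [Finset.sum_insert ha, Finset.sum_insert ha, pair_add_right, ih]

theorem contract_ext {ξ ξ' : VF k U}
    (h : ∀ (V : Below U) (η : VF k V.1), ω.pair (VF.res V.2 ξ) η = ω.pair (VF.res V.2 ξ') η) :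
    ξ = ξ' :=
  (ω.nondegenerate U).1 (form1_ext fun V η => h V η)

theorem pair_sharp (f : Γ(X, U)) (h : V ≤ U) (η : VF k V) :
    ω.pair (VF.res h (ω.sharp f)) η = η.app (rs h f) := by
  have := Function.surjInv_eq (ω.nondegenerate U).2 (dFun f)
  exact congrArg (fun α : (forms k X 1).Sec U => formAt α ⟨V, h⟩ ![η]) this

theorem pair_ham (f : Γ(X, U)) (η : VF k U) : ω.pair (ω.ham f) η = -η.app f := by
  have := ω.pair_sharp f le_rfl η
  rw [rs_id] at this
  rw [ham, pair_neg_left]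
  exact congrArg Neg.neg this

theorem eq_ham {f : Γ(X, U)} {ξ : VF k U}
    (h : ∀ (V : Below U) (η : VF k V.1), ω.pair (VF.res V.2 ξ) η = -η.app (rs V.2 f)) :
    ξ = ω.ham f := by
  refine ω.contract_ext fun V η => ?_
  rw [h V η, ham, map_neg, pair_neg_left, pair_sharp]

theorem ham_res (h : V ≤ U) (f : Γ(X, U)) : VF.res h (ω.ham f) = ω.ham (rs h f) := by
  refine ω.eq_ham fun W η => ?_
  change ω.pair (VF.res (W.2.trans h) (-ω.sharp f)) η = _
  rw [map_neg, pair_neg_left, pair_sharp, rs_rs]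

theorem ham_app (f g : Γ(X, U)) : (ω.ham f).app g = ω.poisson f g := by
  have := ω.pair_sharp g le_rfl (ω.sharp f)
  rw [rs_id] at this
  rw [ham, VF.neg_app, ← this]
  exact (ω.pair_swap _ _).symm.trans rfl

theorem poisson_res (h : V ≤ U) (f g : Γ(X, U)) :
    rs h (ω.poisson f g) = ω.poisson (rs h f) (rs h g) := by
  rw [← ham_app, ← ham_app, ← ham_res, VF.res_app]

theorem ham_add (f g : Γ(X, U)) : ω.ham (f + g) = ω.ham f + ω.ham g := by
  refine (ω.eq_ham fun V η => ?_).symm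
  rw [VF.res_add, pair_add_left, ham_res, ham_res, pair_ham, pair_ham, map_add, VF.app_add]; ring

theorem ham_mul (f g : Γ(X, U)) : ω.ham (f * g) = f • ω.ham g + g • ω.ham f := by
  refine (ω.eq_ham fun V η => ?_).symm
  rw [VF.res_add, VF.res_smul, VF.res_smul, pair_add_left, pair_smul_left, pair_smul_left, ham_res,
    ham_res, pair_ham, pair_ham, map_mul, VF.app_mul]; ring

theorem ham_cst (c : k) : ω.ham (cst k U c) = 0 := by
  refine (ω.eq_ham fun V η => ?_).symm
  rw [rs_cst, VF.app_cst, map_zero]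
  rw [pair_zero_left, neg_zero]

theorem poisson_isBiDer : IsBiDer (cst k U) (ω.poisson (U := U)) := by
  refine ⟨fun a b => ω.pair_swap _ _, fun a b c => ?_, fun a b c => ?_, fun c b => ?_⟩
  · rw [← ham_app, ham_add, VF.add_app, ham_app, ham_app]
  · rw [← ham_app, ham_mul, VF.add_app, VF.smul_app, VF.smul_app, ham_app, ham_app]; ring
  · rw [← ham_app, ham_cst, VF.zero_app]

/-- Vector fields in terms of Hamiltonian vector fields of coordinates. -/
theorem eq_sum_ham {m : ℕ} {x : Fin m → Γ(X, U)} (hx : IsCoordOn k U x) (ξ : VF k U) :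
    ξ = ∑ i, (-ω.pair ξ (hx.partial i)) • ω.ham (x i) := by
  refine ω.contract_ext fun V η => ?_
  have e : ∀ η : VF k V.1, ω.pair (VF.res V.2 ξ) η =
      ∑ i, η.app (rs V.2 (x i)) * rs V.2 (ω.pair ξ (hx.partial i)) := fun η => by
    conv_lhs => rw [hx.eq_sum V.2 η]
    rw [pair_sum_right]
    exact Finset.sum_congr rfl fun i _ => by rw [pair_smul_right, pair_res]
  have e' : ω.pair (VF.res V.2 (∑ i, (-ω.pair ξ (hx.partial i)) • ω.ham (x i))) η =
      ∑ i, η.app (rs V.2 (x i)) * rs V.2 (ω.pair ξ (hx.partial i)) := by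
    rw [pair_swap, map_sum, pair_sum_right, ← Finset.sum_neg_distrib]
    refine Finset.sum_congr rfl fun i _ => ?_
    rw [VF.res_smul, pair_smul_right, ω.pair_swap η, ham_res, pair_ham, map_neg]; ring
  rw [e, e']

theorem span_ham {m : ℕ} {x : Fin m → Γ(X, U)} (hx : IsCoordOn k U x) :
    Submodule.span Γ(X, U) (Set.range (ω.ham (U := U))) = ⊤ := by
  refine top_le_iff.1 fun ξ _ => ?_
  rw [ω.eq_sum_ham hx ξ]
  exact Submodule.sum_mem _ fun i _ => Submodule.smul_mem _ _ (Submodule.subset_span ⟨_, rfl⟩)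

end SymplecticForm

end Hamiltonian

/-! ### Identities between forms are checked on Hamiltonian vector fields -/

section LieRinehart

variable {R M : Type u} [CommRing R] [AddCommGroup M] [Module R M]

/-- The calculus of vector fields, up to the Jacobi identity. -/
structure IsLieRinehart (D : M → R → R) (c : M → M → M) : Prop where
  add_act : ∀ ξ η f, D (ξ + η) f = D ξ f + D η f
  smul_act : ∀ f ξ g, D (f • ξ) g = f * D ξ g
  act_add : ∀ ξ f g, D ξ (f + g) = D ξ f + D ξ g
  act_mul : ∀ ξ f g, D ξ (f * g) = f * D ξ g + D ξ f * g
  swap : ∀ ξ η, c ξ η = -c η ξ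
  add_comm : ∀ ξ ξ' η, c (ξ + ξ') η = c ξ η + c ξ' η
  smul_comm : ∀ f ξ η, c (f • ξ) η = f • c ξ η - D η f • ξ

theorem linear_eq_of_span {S : Set M} (hS : Submodule.span R S = ⊤) {A B : M → R}
    (hA : ∀ ξ η, A (ξ + η) = A ξ + A η) (hA' : ∀ f ξ, A (f • ξ) = f * A ξ)
    (hB : ∀ ξ η, B (ξ + η) = B ξ + B η) (hB' : ∀ f ξ, B (f • ξ) = f * B ξ)
    (h : ∀ a ∈ S, A a = B a) (ξ : M) : A ξ = B ξ := by
  have hξ : ξ ∈ Submodule.span R S := hS ▸ Submodule.mem_top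
  induction hξ using Submodule.span_induction with
  | mem x hx => exact h x hx
  | zero => 
    have h1 := hA' 0 0
    have h2 := hB' 0 0
    rw [zero_smul, zero_mul] at h1 h2
    rw [h1, h2]
  | add x y _ _ hx hy => rw [hA, hB, hx, hy]
  | smul f x _ hx => rw [hA', hB', hx]

theorem bilinear_eq_of_span {S : Set M} (hS : Submodule.span R S = ⊤) {A B : M → M → R}
    (hA : ∀ ξ ξ' η, A (ξ + ξ') η = A ξ η + A ξ' η) (hA' : ∀ f ξ η, A (f • ξ) η = f * A ξ η)
    (hB : ∀ ξ ξ' η, B (ξ + ξ') η = B ξ η + B ξ' η) (hB' : ∀ f ξ η, B (f • ξ) η = f * B ξ η)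
    (hAr : ∀ ξ η η', A ξ (η + η') = A ξ η + A ξ η') (hAr' : ∀ f ξ η, A ξ (f • η) = f * A ξ η)
    (hBr : ∀ ξ η η', B ξ (η + η') = B ξ η + B ξ η') (hBr' : ∀ f ξ η, B ξ (f • η) = f * B ξ η)
    (h : ∀ a ∈ S, ∀ b ∈ S, A a b = B a b) (ξ η : M) : A ξ η = B ξ η :=
  linear_eq_of_span hS (A := (A · η)) (B := (B · η)) (fun ξ ξ' => hA ξ ξ' η)
    (fun f ξ => hA' f ξ η) (fun ξ ξ' => hB ξ ξ' η) (fun f ξ => hB' f ξ η)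
    (fun a ha => linear_eq_of_span hS (A := A a) (B := B a) (hAr a) (fun f => hAr' f a) (hBr a)
      (fun f => hBr' f a) (h a ha) η) ξ

namespace IsLieRinehart

variable {D : M → R → R} {c : M → M → M} {S : Set M}

theorem extD_of_span (hD : IsLieRinehart D c) (hS : Submodule.span R S = ⊤) {A : M → R}
    {B : M → M → R} (hA : ∀ ξ η, A (ξ + η) = A ξ + A η) (hA' : ∀ f ξ, A (f • ξ) = f * A ξ)
    (hB : ∀ ξ ξ' η, B (ξ + ξ') η = B ξ η + B ξ' η) (hB' : ∀ f ξ η, B (f • ξ) η = f * B ξ η)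
    (hs : ∀ ξ η, B ξ η = -B η ξ)
    (h : ∀ a ∈ S, ∀ b ∈ S, B a b = D a (A b) - D b (A a) - A (c a b)) (ξ η : M) :
    B ξ η = D ξ (A η) - D η (A ξ) - A (c ξ η) := by
  have hAn : ∀ ξ, A (-ξ) = -A ξ := fun ξ => by
    have := hA' (-1) ξ
    rwa [neg_smul, one_smul, neg_one_mul] at this
  have hl : ∀ ξ ξ' η, D (ξ + ξ') (A η) - D η (A (ξ + ξ')) - A (c (ξ + ξ') η) =
      (D ξ (A η) - D η (A ξ) - A (c ξ η)) + (D ξ' (A η) - D η (A ξ') - A (c ξ' η)) :=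
    fun ξ ξ' η => by
      rw [hD.add_act, hA, hD.act_add, hD.add_comm, hA]; ring
  have hl' : ∀ f ξ η, D (f • ξ) (A η) - D η (A (f • ξ)) - A (c (f • ξ) η) =
      f * (D ξ (A η) - D η (A ξ) - A (c ξ η)) := fun f ξ η => by
    rw [hD.smul_act, hA', hD.act_mul, hD.smul_comm, sub_eq_add_neg (f • _), hA, hAn, hA', hA']
    ring
  have hs' : ∀ ξ η, D ξ (A η) - D η (A ξ) - A (c ξ η) =
      -(D η (A ξ) - D ξ (A η) - A (c η ξ)) := fun ξ η => by
    rw [hD.swap, hAn]; ring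
  refine bilinear_eq_of_span hS hB hB' hl hl' (fun ξ η η' => ?_) (fun f ξ η => ?_)
    (fun ξ η η' => ?_) (fun f ξ η => ?_) h ξ η
  · rw [hs, hB, hs ξ η, hs ξ η']; ring
  · rw [hs, hB', hs ξ η]; ring
  · rw [hs', hl, hs' ξ η, hs' ξ η']; ring
  · rw [hs', hl', hs' ξ η]; ring

theorem closed_of_span (hD : IsLieRinehart D c) (hS : Submodule.span R S = ⊤)
    {B : M → M → R} (hB : ∀ ξ ξ' η, B (ξ + ξ') η = B ξ η + B ξ' η)
    (hB' : ∀ f ξ η, B (f • ξ) η = f * B ξ η) (hs : ∀ ξ η, B ξ η = -B η ξ)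
    (h : ∀ a ∈ S, ∀ b ∈ S, ∀ d ∈ S, D a (B b d) - D b (B a d) + D d (B a b) - B (c a b) d +
      B (c a d) b - B (c b d) a = 0) (ξ η ζ : M) :
    D ξ (B η ζ) - D η (B ξ ζ) + D ζ (B ξ η) - B (c ξ η) ζ + B (c ξ ζ) η - B (c η ζ) ξ = 0 := by
  have hBn : ∀ ξ η, B (-ξ) η = -B ξ η := fun ξ η => by
    have := hB' (-1) ξ η
    rwa [neg_smul, one_smul, neg_one_mul] at this
  have hDn : ∀ ξ f, D ξ (-f) = -D ξ f := fun ξ f => by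
    have h1 := hD.act_add ξ f (-f)
    have h2 := hD.act_add ξ 0 0
    rw [add_neg_cancel] at h1
    rw [add_zero] at h2
    linear_combination -h1 - h2
  have hBr : ∀ ξ η η', B ξ (η + η') = B ξ η + B ξ η' := fun ξ η η' => by
    rw [hs, hB, hs ξ η, hs ξ η']; ring
  have hBr' : ∀ f ξ η, B ξ (f • η) = f * B ξ η := fun f ξ η => by
    rw [hs, hB', hs ξ η]; ring
  let T : M → M → M → R := fun ξ η ζ =>
    D ξ (B η ζ) - D η (B ξ ζ) + D ζ (B ξ η) - B (c ξ η) ζ + B (c ξ ζ) η - B (c η ζ) ξ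
  have hT : ∀ ξ ξ' η ζ, T (ξ + ξ') η ζ = T ξ η ζ + T ξ' η ζ := fun ξ ξ' η ζ => by
    simp only [T, hD.add_act, hB, hBr, hD.act_add, hD.add_comm]; ring
  have hT' : ∀ f ξ η ζ, T (f • ξ) η ζ = f * T ξ η ζ := fun f ξ η ζ => by
    simp only [T, hD.smul_act, hB', hBr', hD.act_mul, hD.smul_comm, sub_eq_add_neg (f • _), hB, hBn]
    ring
  have h12 : ∀ ξ η ζ, T ξ η ζ = -T η ξ ζ := fun ξ η ζ => by
    simp only [T]
    rw [hs ξ η, hDn, hD.swap ξ η, hBn]; ring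
  have h23 : ∀ ξ η ζ, T ξ η ζ = -T ξ ζ η := fun ξ η ζ => by
    simp only [T]
    rw [hs η ζ, hDn, hD.swap η ζ, hBn]; ring
  have h2 : ∀ ξ η η' ζ, T ξ (η + η') ζ = T ξ η ζ + T ξ η' ζ := fun ξ η η' ζ => by
    rw [h12, hT, h12 ξ η, h12 ξ η']; ring
  have h2' : ∀ f ξ η ζ, T ξ (f • η) ζ = f * T ξ η ζ := fun f ξ η ζ => by
    rw [h12, hT', h12 ξ η]; ring
  have z : ∀ f : R, f * 0 = 0 := mul_zero
  exact linear_eq_of_span hS (A := fun ξ => T ξ η ζ) (B := fun _ => 0)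
    (fun ξ ξ' => hT ξ ξ' η ζ) (fun f ξ => hT' f ξ η ζ) (fun _ _ => (add_zero 0).symm)
    (fun f _ => (z f).symm)
    (fun a ha => linear_eq_of_span hS (A := fun η => T a η ζ) (B := fun _ => 0)
      (fun η η' => h2 a η η' ζ) (fun f η => h2' f a η ζ) (fun _ _ => (add_zero 0).symm)
      (fun f _ => (z f).symm)
      (fun b hb => linear_eq_of_span hS (A := fun ζ => T a b ζ) (B := fun _ => 0)
        (fun ζ ζ' => by rw [h23, h2, h23 a b ζ, h23 a b ζ']; ring)
        (fun f ζ => by rw [h23, h2', h23 a b ζ]; ring) (fun _ _ => (add_zero 0).symm)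
        (fun f _ => (z f).symm) (fun d hd => h a ha b hb d hd) ζ) η) ξ

end IsLieRinehart

end LieRinehart

section Tensor

variable {k : Type u} [Field k] {X : Scheme.{u}} [X.Over (Spec (.of k))]

theorem VF.isLieRinehart (U : X.Opens) :
    IsLieRinehart (M := VF k U) (fun ξ f => ξ.app f) (fun ξ η => ξ.comm η) where
  add_act := VF.add_app
  smul_act := fun f ξ g => VF.smul_app ξ f g
  act_add := VF.app_add
  act_mul := VF.app_mul
  swap := fun ξ η => (tangent k X).bracket_swap ξ η
  add_comm := fun ξ ξ' η => DFunLike.congr_fun (map_add (VF.bracket U) ξ ξ') η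
  smul_comm := fun f ξ η => (tangent k X).smul_bracket f ξ η

variable (ω : SymplecticForm k X)

theorem form1_ext_ham (n : ℕ) [SmoothOfRelativeDimension n (X ↘ Spec (.of k))]
    {U : X.Opens} {A B : (forms k X 1).Sec U}
    (h : ∀ (V : Below U) (a : Γ(X, V.1)), formAt A V ![ω.ham a] = formAt B V ![ω.ham a]) :
    A = B := by
  refine form1_ext fun V ξ => rs_ext fun y hy => ?_
  obtain ⟨W, hW, hyW, x, hx⟩ := exists_isCoordOn (k := k) n hy
  refine ⟨W, hW, hyW, ?_⟩
  rw [form1_res A V ⟨W, hW.trans V.2⟩ hW, form1_res B V ⟨W, hW.trans V.2⟩ hW]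
  exact linear_eq_of_span (M := VF k W) (A := fun ξ => formAt A ⟨W, hW.trans V.2⟩ ![ξ])
    (B := fun ξ => formAt B ⟨W, hW.trans V.2⟩ ![ξ]) (ω.span_ham hx) (fun ξ η => form1_add A ⟨W, _⟩ ξ η)
    (fun f ξ => form1_smul A ⟨W, _⟩ f ξ) (fun ξ η => form1_add B ⟨W, _⟩ ξ η)
    (fun f ξ => form1_smul B ⟨W, _⟩ f ξ) (by rintro _ ⟨a, rfl⟩; exact h ⟨W, _⟩ a) _

theorem isExtD_of_ham (n : ℕ) [SmoothOfRelativeDimension n (X ↘ Spec (.of k))]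
    {U : X.Opens} {A : (forms k X 1).Sec U} {α : (forms k X 2).Sec U}
    (h : ∀ (V : Below U) (a b : Γ(X, V.1)), formAt α V ![ω.ham a, ω.ham b] =
      (ω.ham a).app (formAt A V ![ω.ham b]) - (ω.ham b).app (formAt A V ![ω.ham a]) -
        formAt A V ![(ω.ham a).comm (ω.ham b)]) : IsExtD A α := by
  intro V ξ η
  refine rs_ext fun y hy => ?_
  obtain ⟨W, hW, hyW, x, hx⟩ := exists_isCoordOn (k := k) n hy
  refine ⟨W, hW, hyW, ?_⟩
  rw [map_sub, map_sub, ← VF.res_app, ← VF.res_app, form1_res A V ⟨W, hW.trans V.2⟩ hW,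
    form1_res A V ⟨W, hW.trans V.2⟩ hW, form1_res A V ⟨W, hW.trans V.2⟩ hW,
    form2_res α V ⟨W, hW.trans V.2⟩ hW]
  exact (VF.isLieRinehart W).extD_of_span (ω.span_ham hx)
    (A := fun ξ => formAt A ⟨W, hW.trans V.2⟩ ![ξ])
    (B := fun ξ η => formAt α ⟨W, hW.trans V.2⟩ ![ξ, η])
    (fun ξ η => form1_add A ⟨W, _⟩ ξ η) (fun f ξ => form1_smul A ⟨W, _⟩ f ξ)
    (fun ξ η => form2_add_left α ⟨W, _⟩ ξ η) (fun f ξ => form2_smul_left α ⟨W, _⟩ f ξ)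
    (fun ξ η => form2_swap α ⟨W, _⟩ ξ η)
    (by rintro _ ⟨a, rfl⟩ _ ⟨b, rfl⟩; exact h ⟨W, _⟩ a b) (VF.res hW ξ) (VF.res hW η)

theorem isClosedForm_of_ham (n : ℕ) [SmoothOfRelativeDimension n (X ↘ Spec (.of k))]
    {U : X.Opens} {α : (forms k X 2).Sec U}
    (h : ∀ (V : Below U) (a b c : Γ(X, V.1)), (ω.ham a).app (formAt α V ![ω.ham b, ω.ham c]) -
      (ω.ham b).app (formAt α V ![ω.ham a, ω.ham c]) +
      (ω.ham c).app (formAt α V ![ω.ham a, ω.ham b]) -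
      formAt α V ![(ω.ham a).comm (ω.ham b), ω.ham c] +
      formAt α V ![(ω.ham a).comm (ω.ham c), ω.ham b] -
      formAt α V ![(ω.ham b).comm (ω.ham c), ω.ham a] = 0) : IsClosedForm α := by
  intro V ξ η ζ
  refine rs_ext fun y hy => ?_
  obtain ⟨W, hW, hyW, x, hx⟩ := exists_isCoordOn (k := k) n hy
  refine ⟨W, hW, hyW, ?_⟩
  simp only [map_sub, map_add, map_zero, ← VF.res_app, form2_res α V ⟨W, hW.trans V.2⟩ hW]
  exact (VF.isLieRinehart W).closed_of_span (ω.span_ham hx)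
    (B := fun ξ η => formAt α ⟨W, hW.trans V.2⟩ ![ξ, η])
    (fun ξ η => form2_add_left α ⟨W, _⟩ ξ η) (fun f ξ => form2_smul_left α ⟨W, _⟩ f ξ)
    (fun ξ η => form2_swap α ⟨W, _⟩ ξ η)
    (by rintro _ ⟨a, rfl⟩ _ ⟨b, rfl⟩ _ ⟨d, rfl⟩; exact h ⟨W, _⟩ a b d)
    (VF.res hW ξ) (VF.res hW η) (VF.res hW ζ)

/-- The 2-form with prescribed values on Hamiltonian vector fields. -/
theorem exists_form2_of_ham [CharZero k] (n : ℕ) [SmoothOfRelativeDimension n (X ↘ Spec (.of k))]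
    {U : X.Opens}
    (κ : ∀ V : Below U, Γ(X, V.1) → Γ(X, V.1) → Γ(X, V.1))
    (hκ : ∀ V, IsBiDer (cst k V.1) (κ V))
    (hres : ∀ (V W : Below U) (h : W.1 ≤ V.1) a b, rs h (κ V a b) = κ W (rs h a) (rs h b)) :
    ∃ α : (forms k X 2).Sec U, ∀ (V : Below U) (a b : Γ(X, V.1)),
      formAt α V ![ω.ham a, ω.ham b] = κ V a b := by
  let K : ∀ (V : Below U), Γ(X, V.1) → VF k V.1 := fun V b =>
    ⟨fun W => AddMonoidHom.mk' (fun a => -κ (W.up V.2) (rs W.2 b) a) fun a a' => by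
        rw [(hκ _).add_right]; ring, fun W a a' => by
        change -κ (W.up V.2) (rs W.2 b) (a * a') = a * -κ (W.up V.2) (rs W.2 b) a' + 
          -κ (W.up V.2) (rs W.2 b) a * a'
        rw [(hκ _).mul_right]; ring, fun W c => by
        change -κ (W.up V.2) (rs W.2 b) (cst k W.1 c) = 0
        rw [(hκ _).swap, (hκ (W.up V.2)).scalar_left]; ring, fun W W' h a => by
        change rs h (-κ (W.up V.2) (rs W.2 b) a) = -κ (W'.up V.2) (rs W'.2 b) (rs h a)
        rw [map_neg, hres (W.up V.2) (W'.up V.2) h, rs_rs]⟩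
  have hK : ∀ V b a, (K V b).app a = κ V a b := fun V b a => by
    change -κ ((Below.self V.1).up V.2) (rs _ b) a = _
    rw [rs_id, (hκ V).swap a]
  have hKres : ∀ (V W : Below U) (h : W.1 ≤ V.1) b, VF.res h (K V b) = K W (rs h b) :=
    fun V W h b => VF.ext fun V' a => by
      change -κ (V'.up W.2) (rs (V'.2.trans h) b) a = -κ (V'.up W.2) (rs V'.2 (rs h b)) a
      rw [rs_rs]
  have hKadd : ∀ V b b', K V (b + b') = K V b + K V b' := fun V b b' => VF.ext fun W a => by
    change -κ _ _ _ = -κ _ _ _ + -κ _ _ _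
    rw [map_add, (hκ _).add_left]; ring
  have hKmul : ∀ V b b', K V (b * b') = b • K V b' + b' • K V b := fun V b b' =>
    VF.ext fun W a => by
      change -κ _ _ _ = rs _ _ * -κ _ _ _ + rs _ _ * -κ _ _ _
      rw [map_mul, (hκ _).mul_left]; ring
  have hKc : ∀ V c, K V (cst k _ c) = 0 := fun V c => VF.ext fun W a => by
    change -κ (W.up V.2) _ _ = 0
    rw [rs_cst, (hκ (W.up V.2)).scalar_left, neg_zero]
  let L : ∀ (V : Below U), VF k V.1 → VF k V.1 := fun V ξ =>
    ⟨fun W => AddMonoidHom.mk' (fun b => ω.pair (K (W.up V.2) b) (VF.res W.2 ξ)) fun a a' => by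
        rw [hKadd, ω.pair_add_left], fun W a a' => by
        change ω.pair (K (W.up V.2) (a * a')) _ = a * ω.pair (K (W.up V.2) a') (VF.res W.2 ξ) +
          ω.pair (K (W.up V.2) a) (VF.res W.2 ξ) * a'
        rw [hKmul, ω.pair_add_left, ω.pair_smul_left, ω.pair_smul_left]; ring, fun W c => by
        change ω.pair (K (W.up V.2) _) _ = 0
        rw [hKc, ω.pair_zero_left],
        fun W W' h b => by
        change rs h (ω.pair (K (W.up V.2) b) (VF.res W.2 ξ)) =
          ω.pair (K (W'.up V.2) (rs h b)) (VF.res W'.2 ξ)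
        rw [ω.pair_res, hKres (W.up V.2) (W'.up V.2) h]; rfl⟩
  have hL : ∀ V ξ b, (L V ξ).app b = ω.pair (K V b) ξ := fun V ξ b => rfl
  have hLadd : ∀ V ξ ξ', L V (ξ + ξ') = L V ξ + L V ξ' := fun V ξ ξ' => VF.ext fun W b => by
    change ω.pair _ (VF.res W.2 ξ + VF.res W.2 ξ') = ω.pair _ _ + ω.pair _ _
    rw [ω.pair_add_right]
  have hLsmul : ∀ V (f : Γ(X, V.1)) ξ, L V (f • ξ) = f • L V ξ := fun V f ξ =>
    VF.ext fun W b => by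
      change ω.pair _ (VF.res W.2 (f • ξ)) = rs W.2 f * ω.pair _ _
      rw [VF.res_smul, ω.pair_smul_right]
  have hLres : ∀ (V W : Below U) (h : W.1 ≤ V.1) ξ, VF.res h (L V ξ) = L W (VF.res h ξ) :=
    fun V W h ξ => rfl
  have hF : ∀ V a b, ω.pair (L V (ω.ham a)) (ω.ham b) = κ V a b := fun V a b => by
    rw [ω.pair_swap, ω.pair_ham, neg_neg, hL, ω.pair_swap, ω.pair_ham, neg_neg, hK]
  have hswap : ∀ V ξ η, ω.pair (L V ξ) η = -ω.pair (L V η) ξ := by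
    intro V ξ η
    refine rs_ext fun y hy => ?_
    obtain ⟨W, hW, hyW, x, hx⟩ := exists_isCoordOn (k := k) n hy
    refine ⟨W, hW, hyW, ?_⟩
    rw [map_neg, ω.pair_res, ω.pair_res, hLres V ⟨W, hW.trans V.2⟩ hW,
      hLres V ⟨W, hW.trans V.2⟩ hW]
    refine bilinear_eq_of_span (M := VF k W) (ω.span_ham hx) (A := fun ξ η => ω.pair (L ⟨W, hW.trans V.2⟩ ξ) η)
      (B := fun ξ η => -ω.pair (L ⟨W, hW.trans V.2⟩ η) ξ) (fun ξ ξ' η => ?_) (fun f ξ η => ?_)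
      (fun ξ ξ' η => ?_) (fun f ξ η => ?_) (fun ξ ξ' η => ?_) (fun f ξ η => ?_)
      (fun ξ ξ' η => ?_) (fun f ξ η => ?_) ?_ (VF.res hW ξ) (VF.res hW η)
    · rw [hLadd ⟨W, hW.trans V.2⟩, ω.pair_add_left]
    · rw [hLsmul ⟨W, hW.trans V.2⟩, ω.pair_smul_left]
    · rw [ω.pair_add_right, neg_add]
    · rw [ω.pair_smul_right, mul_neg]
    · rw [ω.pair_add_right]
    · rw [ω.pair_smul_right]
    · rw [hLadd ⟨W, hW.trans V.2⟩, ω.pair_add_left, neg_add]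
    · rw [hLsmul ⟨W, hW.trans V.2⟩, ω.pair_smul_left, mul_neg]
    · rintro _ ⟨a, rfl⟩ _ ⟨b, rfl⟩
      rw [hF ⟨W, hW.trans V.2⟩, hF ⟨W, hW.trans V.2⟩, (hκ _).swap]
  refine (exists_form2 (fun V ξ η => ω.pair (L V ξ) η) (fun V ξ ξ' η => ?_) (fun V f ξ η => ?_)
    (fun V ξ => ?_) hswap (fun V W h ξ η => ?_)).imp fun α hα V a b => ?_
  · rw [hLadd, ω.pair_add_left]
  · rw [hLsmul, ω.pair_smul_left]
  · have h1 := hswap V ξ ξ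
    linear_combination cst k V.1 (1 / 2) * h1 - ω.pair (L V ξ) ξ * two_mul_half (cst k V.1)
  · rw [ω.pair_res, hLres V W h]
  · rw [hα, hF]

/-- The 1-form with prescribed values on Hamiltonian vector fields. -/
theorem exists_form1_of_ham {U : X.Opens} (θ : VF k U) :
    ∃ A : (forms k X 1).Sec U, ∀ (V : Below U) (a : Γ(X, V.1)),
      formAt A V ![ω.ham a] = θ.1 V a := by
  refine ⟨contract ((forms k X 2).res le_top ω.form) θ, fun V a => ?_⟩
  change ω.pair (VF.res V.2 θ) (ω.ham a) = _
  rw [ω.pair_swap, ω.pair_ham, neg_neg]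
  rfl

end Tensor

/-! ### The first order class of a deformation quantization -/

section FirstClass

variable {k : Type u} [Field k] {X : Scheme.{u}} [X.Over (Spec (.of k))]
  {Q : QuantData k X} {ω : SymplecticForm k X}

theorem QuantData.res_id {U : X.Opens} (h : U ≤ U) (x : Q.Sec U) : Q.res h x = x := by
  have : (homOfLE h).op = 𝟙 (op U) := rfl
  rw [QuantData.res, this]; simp

theorem QuantData.res_res {U V W : X.Opens} (h : V ≤ U) (h' : W ≤ V) (x : Q.Sec U) :
    Q.res h' (Q.res h x) = Q.res (h'.trans h) x := by
  have : (homOfLE (h'.trans h)).op = (homOfLE h).op ≫ (homOfLE h').op := rfl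
  simp only [QuantData.res, this, Functor.map_comp]
  rfl

theorem QuantData.red_res' {U V : X.Opens} (h : V ≤ U) (x : Q.Sec U) :
    Q.red V (Q.res h x) = rs h (Q.red U x) := Q.red_res h x

theorem QuantData.res_scalar {U V : X.Opens} (h : V ≤ U) (p : PowerSeries k) :
    Q.res h (Q.scalar U p) = Q.scalar V p := Q.res_res _ _ _

theorem QuantData.res_hbar {U V : X.Opens} (h : V ≤ U) : Q.res h (Q.hbar U) = Q.hbar V :=
  Q.res_scalar h _

theorem QuantData.scalar_comm {U : X.Opens} (p : PowerSeries k) (x : Q.Sec U) :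
    Q.scalar U p * x = x * Q.scalar U p := Q.scal_comm U p x

theorem QuantData.red_scalar (U : X.Opens) (p : PowerSeries k) :
    Q.red U (Q.scalar U p) = cst k U (PowerSeries.constantCoeff p) := by
  rw [← rs_cst k (le_top : U ≤ ⊤), ← Q.red_scal]
  exact Q.red_res le_top _

theorem QuantData.red_hbar (U : X.Opens) : Q.red U (Q.hbar U) = 0 := by
  rw [QuantData.hbar, QuantData.red_scalar]; simp

namespace LocalTriv

variable {U U' : X.Opens} (t : LocalTriv Q ω U) (t' : LocalTriv Q ω U')

/-- Restriction of a local trivialization. -/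
def restrict {V : X.Opens} (h : V ≤ U) : LocalTriv Q ω V where
  η W := t.η (W.up h)
  η_res W W' := t.η_res (W.up h) (W'.up h)
  η_scalar W := t.η_scalar (W.up h)
  η_red W := t.η_red (W.up h)
  η_mul W := t.η_mul (W.up h)

/-- A local trivialization over a fixed open. -/
def star (V : Below U) : StarTriv (cst k V.1) ((Q.scalar V.1).comp (PowerSeries.C (R := k)))
    (Q.hbar V.1) (ω.poisson (U := V.1)) where
  η := t.η V
  h_comm x := Q.scalar_comm _ x
  η_h x := by rw [QuantData.hbar, t.η_scalar]; simp
  σ_comm c x := Q.scalar_comm _ x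
  η_σ c x := by
    rw [RingHom.comp_apply, t.η_scalar]; simp
  mul_coeff_zero x y := by
    simp only [PowerSeries.coeff_zero_eq_constantCoeff]
    rw [t.η_red, t.η_red, t.η_red, map_mul]
  mul_coeff_one a b := t.η_mul V a b
  bi := ω.poisson_isBiDer

theorem c_zero (V : Below U) (x : Q.Sec V.1) : (t.star V).c 0 x = Q.red V.1 x := by
  rw [← t.η_red]
  simp [StarTriv.c, star]

theorem c_res (V W : Below U) (h : W.1 ≤ V.1) (m : ℕ) (x : Q.Sec V.1) :
    rs h ((t.star V).c m x) = (t.star W).c m (Q.res h x) := by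
  change _ = PowerSeries.coeff m (t.η W (Q.res h x))
  rw [t.η_res V W h, PowerSeries.coeff_map]
  rfl

theorem s_res (V W : Below U) (h : W.1 ≤ V.1) (a : Γ(X, V.1)) :
    Q.res h ((t.star V).s a) = (t.star W).s (rs h a) := by
  apply (t.η W).injective
  rw [t.η_res V W h]
  change PowerSeries.map (rs h) (t.η V ((t.η V).symm (PowerSeries.C a))) =
    t.η W ((t.η W).symm (PowerSeries.C (rs h a)))
  simp

theorem κ_res (V W : Below U) (h : W.1 ≤ V.1) (a b : Γ(X, V.1)) :
    rs h ((t.star V).κ a b) = (t.star W).κ (rs h a) (rs h b) := by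
  rw [StarTriv.κ, t.c_res V W h, map_sub, map_mul, map_mul, t.s_res V W h, t.s_res V W h]
  rfl

theorem comm_ham [CharZero k] (t : LocalTriv Q ω U) (V : Below U) (a b : Γ(X, V.1)) :
    (ω.ham a).comm (ω.ham b) = ω.ham (ω.poisson a b) := by
  refine VF.ext fun W f => ?_
  rw [VF.val_res, VF.val_res, VF.res_comm, ω.ham_res, ω.ham_res, ω.ham_res, VF.comm_app]
  simp only [ω.ham_app]
  rw [ω.poisson_res, (t.star (W.up V.2)).jacobi]
  ring

/-- The 2-form of a local trivialization. -/
theorem exists_form [CharZero k] (n : ℕ) [SmoothOfRelativeDimension n (X ↘ Spec (.of k))] :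
    ∃ α : (forms k X 2).Sec U, ∀ (V : Below U) (a b : Γ(X, V.1)),
      formAt α V ![ω.ham a, ω.ham b] = (t.star V).κ a b :=
  exists_form2_of_ham ω n (fun V => (t.star V).κ) (fun V => (t.star V).κ_isBiDer)
    fun V W h a b => t.κ_res V W h a b

theorem closed_form [CharZero k] (n : ℕ) [SmoothOfRelativeDimension n (X ↘ Spec (.of k))]
    {α : (forms k X 2).Sec U} (hα : ∀ (V : Below U) (a b : Γ(X, V.1)),
      formAt α V ![ω.ham a, ω.ham b] = (t.star V).κ a b) : IsClosedForm α := by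
  refine isClosedForm_of_ham ω n fun V a b c => ?_
  rw [t.comm_ham V, t.comm_ham V, t.comm_ham V]
  simp only [hα, ω.ham_app]
  have h1 := (t.star V).κ_jacobi a b c
  have h2 := (t.star V).κ_swap a (ω.poisson b c)
  have h3 := (t.star V).κ_swap b (ω.poisson a c)
  have h4 := (ω.poisson_isBiDer (U := V.1)).swap ((t.star V).κ a b) c
  linear_combination h1 - h2 + h3 + h4

theorem c_zero_eq {V : X.Opens} (h : V ≤ U) (h' : V ≤ U') (x : Q.Sec V) :
    (t.star ⟨V, h⟩).c 0 x = (t'.star ⟨V, h'⟩).c 0 x :=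
  (t.c_zero ⟨V, h⟩ x).trans (t'.c_zero ⟨V, h'⟩ x).symm

theorem isDer_diff [CharZero k] {V : X.Opens} (h : V ≤ U) (h' : V ≤ U') :
    IsDer (cst k V) (RingHom.id _) ((t.star ⟨V, h⟩).diff (t'.star ⟨V, h'⟩)) :=
  (t.star ⟨V, h⟩).isDer_diff (t'.star ⟨V, h'⟩) (t.c_zero_eq t' h h')

theorem diff_res {V W : X.Opens} (h : V ≤ U) (h' : V ≤ U') (hh : W ≤ V) (a : Γ(X, V)) :
    rs hh ((t.star ⟨V, h⟩).diff (t'.star ⟨V, h'⟩) a) =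
      (t.star ⟨W, hh.trans h⟩).diff (t'.star ⟨W, hh.trans h'⟩) (rs hh a) := by
  change rs hh ((t.star ⟨V, h⟩).c 1 ((t'.star ⟨V, h'⟩).s a)) =
    (t.star ⟨W, hh.trans h⟩).c 1 ((t'.star ⟨W, hh.trans h'⟩).s (rs hh a))
  rw [t.c_res ⟨V, h⟩ ⟨W, hh.trans h⟩ hh, t'.s_res ⟨V, h'⟩ ⟨W, hh.trans h'⟩ hh]

/-- The vector field that is the first order difference of two local trivializations. -/
def diffVF [CharZero k] : VF k (U ⊓ U') :=
  ⟨fun V => (t.star ⟨V.1, V.2.trans inf_le_left⟩).diff (t'.star ⟨V.1, V.2.trans inf_le_right⟩),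
    fun V => (t.isDer_diff t' (V.2.trans inf_le_left) (V.2.trans inf_le_right)).1,
    fun V => (t.isDer_diff t' (V.2.trans inf_le_left) (V.2.trans inf_le_right)).2,
    fun V _ h a => t.diff_res t' (V.2.trans inf_le_left) (V.2.trans inf_le_right) h a⟩

theorem exists_trans [CharZero k] : ∃ A : (forms k X 1).Sec (U ⊓ U'),
    ∀ (V : Below (U ⊓ U')) (a : Γ(X, V.1)), formAt A V ![ω.ham a] =
      (t.star (V.up inf_le_left)).diff (t'.star (V.up inf_le_right)) a :=
  exists_form1_of_ham ω (t.diffVF t')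

theorem isExtD [CharZero k] (n : ℕ) [SmoothOfRelativeDimension n (X ↘ Spec (.of k))]
    {α : (forms k X 2).Sec U} (hα : ∀ (V : Below U) (a b : Γ(X, V.1)),
      formAt α V ![ω.ham a, ω.ham b] = (t.star V).κ a b)
    {α' : (forms k X 2).Sec U'} (hα' : ∀ (V : Below U') (a b : Γ(X, V.1)),
      formAt α' V ![ω.ham a, ω.ham b] = (t'.star V).κ a b)
    {A : (forms k X 1).Sec (U ⊓ U')} (hA : ∀ (V : Below (U ⊓ U')) (a : Γ(X, V.1)),
      formAt A V ![ω.ham a] =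
        (t.star (V.up inf_le_left)).diff (t'.star (V.up inf_le_right)) a) :
    IsExtD A ((forms k X 2).res inf_le_right α' - (forms k X 2).res inf_le_left α) := by
  refine isExtD_of_ham ω n fun V a b => ?_
  rw [form_sub, form_res, form_res, t.comm_ham (V.up inf_le_left), hα, hα', hA, hA, hA,
    ω.ham_app, ω.ham_app]
  exact (t.star (V.up inf_le_left)).κ_sub (t'.star (V.up inf_le_right))
    (t.c_zero_eq t' (V.2.trans inf_le_left) (V.2.trans inf_le_right)) a b

theorem trans_trans [CharZero k] (n : ℕ) [SmoothOfRelativeDimension n (X ↘ Spec (.of k))]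
    {U'' : X.Opens} (t'' : LocalTriv Q ω U'')
    {A : (forms k X 1).Sec (U ⊓ U')} (hA : ∀ (V : Below (U ⊓ U')) (a : Γ(X, V.1)),
      formAt A V ![ω.ham a] =
        (t.star (V.up inf_le_left)).diff (t'.star (V.up inf_le_right)) a)
    {A' : (forms k X 1).Sec (U' ⊓ U'')} (hA' : ∀ (V : Below (U' ⊓ U'')) (a : Γ(X, V.1)),
      formAt A' V ![ω.ham a] =
        (t'.star (V.up inf_le_left)).diff (t''.star (V.up inf_le_right)) a)
    {A'' : (forms k X 1).Sec (U ⊓ U'')} (hA'' : ∀ (V : Below (U ⊓ U'')) (a : Γ(X, V.1)),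
      formAt A'' V ![ω.ham a] =
        (t.star (V.up inf_le_left)).diff (t''.star (V.up inf_le_right)) a) :
    (forms k X 1).res (inf_le_left : U ⊓ U' ⊓ U'' ≤ U ⊓ U') A +
      (forms k X 1).res (inf_le_inf_right _ inf_le_right : U ⊓ U' ⊓ U'' ≤ U' ⊓ U'') A' =
      (forms k X 1).res (inf_le_inf_right _ inf_le_left : U ⊓ U' ⊓ U'' ≤ U ⊓ U'') A'' := by
  refine form1_ext_ham ω n fun V a => ?_
  rw [form_add, form_res, form_res, form_res]
  have h1 : V.1 ≤ U := V.2.trans (inf_le_left.trans inf_le_left)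
  have h2 : V.1 ≤ U' := V.2.trans (inf_le_left.trans inf_le_right)
  have h3 : V.1 ≤ U'' := V.2.trans inf_le_right
  have e := (t.star ⟨V.1, h1⟩).diff_add (t'.star ⟨V.1, h2⟩) (t''.star ⟨V.1, h3⟩)
    (t.c_zero_eq t' h1 h2) (t'.c_zero_eq t'' h2 h3) a
  exact (congrArg₂ _ (hA ⟨V.1, le_inf h1 h2⟩ a) (hA' ⟨V.1, le_inf h2 h3⟩ a)).trans
    (e.trans (hA'' ⟨V.1, le_inf h1 h3⟩ a).symm)

end LocalTriv

/-- The cocycle `z` is the one given by the local trivializations `t`. -/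
structure IsFirstCocycle (z : Cocycle k X) (t : ∀ i, LocalTriv Q ω (z.U i)) : Prop where
  form : ∀ i (V : Below (z.U i)) (a b : Γ(X, V.1)),
    formAt (z.form i) V ![ω.ham a, ω.ham b] = ((t i).star V).κ a b
  trans : ∀ i j (V : Below (z.U i ⊓ z.U j)) (a : Γ(X, V.1)),
    formAt (z.trans i j) V ![ω.ham a] =
      ((t i).star (V.up inf_le_left)).diff ((t j).star (V.up inf_le_right)) a

theorem IsFirstCocycle.cohomologous [CharZero k] (n : ℕ)
    [SmoothOfRelativeDimension n (X ↘ Spec (.of k))] {z z' : Cocycle k X}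
    {t : ∀ i, LocalTriv Q ω (z.U i)} {t' : ∀ i, LocalTriv Q ω (z'.U i)} (h : IsFirstCocycle z t)
    (h' : IsFirstCocycle z' t') : Cohomologous z z' := by
  choose C hC using fun i j => (t i).exists_trans (t' j)
  exact ⟨C, fun i j => (t i).isExtD (t' j) n (h.form i) (h'.form j) (hC i j),
    fun i i' j => (t i).trans_trans (t i') n (t' j) (h.trans i i') (hC i' j) (hC i j),
    fun i j j' => (t i).trans_trans (t' j) n (t' j') (hC i j) (h'.trans j j') (hC i j')⟩

theorem DefQuant.exists_firstCocycle [CharZero k] (n : ℕ)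
    [SmoothOfRelativeDimension n (X ↘ Spec (.of k))] (Q : DefQuant ω) :
    ∃ (z : Cocycle k X) (t : ∀ i, LocalTriv Q.toQuantData ω (z.U i)), IsFirstCocycle z t ∧
      ∀ i, ∃ x : Fin n → Γ(X, z.U i), IsCoordOn k (z.U i) x := by
  have h1 : ∀ y : X, ∃ U : X.Opens, y ∈ U ∧ Nonempty (LocalTriv Q.toQuantData ω U) ∧
      ∃ x : Fin n → Γ(X, U), IsCoordOn k U x := fun y => by
    obtain ⟨U, hy, ⟨t⟩⟩ := Q.locallyTrivial y
    obtain ⟨V, hV, hyV, x, hx⟩ := exists_isCoordOn (k := k) n hy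
    exact ⟨V, hyV, ⟨t.restrict hV⟩, x, hx⟩
  choose U hU t hx using h1
  replace t := fun y => (t y).some
  choose α hα using fun y => (t y).exists_form n
  choose A hA using fun y y' => (t y).exists_trans (t y')
  exact ⟨⟨X, U, fun y => ⟨y, hU y⟩, α, A, fun y => (t y).closed_form n (hα y),
    fun i j => (t i).isExtD (t j) n (hα i) (hα j) (hA i j),
    fun i j l => (t i).trans_trans (t j) n (t l) (hA i j) (hA j l) (hA i l)⟩, t, ⟨hα, hA⟩, hx⟩

theorem DefQuant.hasFirstClass_iff [CharZero k] (n : ℕ)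
    [SmoothOfRelativeDimension n (X ↘ Spec (.of k))] {Q : DefQuant ω} {z : Cocycle k X}
    {t : ∀ i, LocalTriv Q.toQuantData ω (z.U i)} (h : IsFirstCocycle z t) (c : H2F k X) :
    Q.HasFirstClass c ↔ c = H2F.mk z := by
  constructor
  · rintro ⟨z', t', h1, h2, rfl⟩
    exact Quot.sound (IsFirstCocycle.cohomologous n ⟨h1, h2⟩ h)
  · rintro rfl
    exact ⟨z, t, h.form, h.trans, rfl⟩

end FirstClass

/-! ### Functions and vector fields on a closed subscheme -/

section ClosedSub

variable {k : Type u} [Field k] {X : Scheme.{u}} [X.Over (Spec (.of k))]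
  {Y : Scheme.{u}} [Y.Over (Spec (.of k))] {j : Y ⟶ X}

theorem jres_rs {U V : X.Opens} {W : Y.Opens} (h : V ≤ U) (h' : W ≤ j ⁻¹ᵁ V) (f : Γ(X, U)) :
    jres j h' (rs h f) = jres j (h'.trans (preimage_le j h)) f := by
  have := Scheme.Hom.map_appLE j h' (homOfLE h).op
  exact congrArg (fun g => g.hom f) this

theorem rs_jres {U : X.Opens} {W W' : Y.Opens} (h : W ≤ j ⁻¹ᵁ U) (h' : W' ≤ W) (f : Γ(X, U)) :
    rs h' (jres j h f) = jres j (h'.trans h) f := by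
  have := Scheme.Hom.appLE_map j h (homOfLE h').op
  exact congrArg (fun g => g.hom f) this

theorem jres_cst [j.IsOver (Spec (.of k))] {U : X.Opens} {W : Y.Opens} (h : W ≤ j ⁻¹ᵁ U) (c : k) :
    jres j h (cst k U c) = cst k W c := by
  have h1 : (X ↘ Spec (.of k)).appTop ≫ X.presheaf.map (homOfLE le_top).op ≫ j.appLE U W h =
      (Y ↘ Spec (.of k)).appTop ≫ Y.presheaf.map (homOfLE (le_top : W ≤ ⊤)).op := by
    have h2 : (Y ↘ Spec (.of k)) = j ≫ (X ↘ Spec (.of k)) := (comp_over j (Spec (.of k))).symm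
    have h3 : j ⁻¹ᵁ (⊤ : X.Opens) = ⊤ := rfl
    rw [Scheme.Hom.map_appLE, h2, Scheme.Hom.comp_appTop, Category.assoc]
    congr 1
  exact congrArg (fun g => ((Scheme.ΓSpecIso (.of k)).inv ≫ g).hom c) h1

theorem jres_comp_cst [j.IsOver (Spec (.of k))] {U : X.Opens} {W : Y.Opens} (h : W ≤ j ⁻¹ᵁ U) :
    (jres j h).comp (cst k U) = cst k W := RingHom.ext fun c => jres_cst h c

theorem jres_surjective [IsClosedImmersion j] {U : X.Opens} (hU : IsAffineOpen U) :
    Function.Surjective (jres j (le_refl (j ⁻¹ᵁ U))) := by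
  have := j.app_surjective U hU
  rwa [Scheme.Hom.app_eq_appLE] at this

/-- A closed immersion is an embedding: small neighbourhoods in `Y` are cut out by affine open
subschemes of `X`. -/
theorem exists_nhd [IsClosedImmersion j] {U : X.Opens} {W : Y.Opens} {y : Y} (hy : y ∈ W)
    (hy' : y ∈ j ⁻¹ᵁ U) : ∃ V : X.Opens, V ≤ U ∧ IsAffineOpen V ∧ y ∈ j ⁻¹ᵁ V ∧ j ⁻¹ᵁ V ≤ W := by
  obtain ⟨O, hO, hOW⟩ := (IsClosedImmersion.isClosedEmbedding j).isInducing.isOpen_iff.1 W.2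
  obtain ⟨V, hV, hyV, hA⟩ := exists_affine (Y := X) (U := U ⊓ ⟨O, hO⟩) (y := j y)
    ⟨hy', by have : y ∈ j ⁻¹' O := hOW ▸ hy
             exact this⟩
  refine ⟨V, hV.trans inf_le_left, hA, hyV, fun z hz => ?_⟩
  have : z ∈ j ⁻¹' O := (hV hz).2
  rw [hOW] at this
  exact this

/-- Coordinates on neighbourhoods in `X` and in `Y`. -/
theorem exists_coords [IsClosedImmersion j] (m n : ℕ)
    [SmoothOfRelativeDimension m (X ↘ Spec (.of k))]
    [SmoothOfRelativeDimension n (Y ↘ Spec (.of k))]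
    {U : X.Opens} {W : Y.Opens} {y : Y} (hy : y ∈ W) (hy' : y ∈ j ⁻¹ᵁ U) :
    ∃ V : X.Opens, V ≤ U ∧ y ∈ j ⁻¹ᵁ V ∧ j ⁻¹ᵁ V ≤ W ∧ (∃ x : Fin m → Γ(X, V), IsCoordOn k V x) ∧
      ∃ t : Fin n → Γ(Y, j ⁻¹ᵁ V), IsCoordOn k (j ⁻¹ᵁ V) t := by
  obtain ⟨V₁, h₁, hy₁, x, hx⟩ := exists_isCoordOn (k := k) m (Y := X) (U := U) (y := j y) hy'
  obtain ⟨W₁, hW₁, hyW₁, t, ht⟩ := exists_isCoordOn (k := k) n hy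
  obtain ⟨V, hV, hA, hyV, hVW⟩ := exists_nhd (j := j) (U := V₁) hyW₁ hy₁
  exact ⟨V, hV.trans h₁, hyV, hVW.trans hW₁, ⟨_, hx.restrict hV hA⟩, _,
    ht.restrict hVW (hA.preimage j)⟩

theorem Related.app {U : X.Opens} {W : Y.Opens} {ξ : VF k U} {ξ' : VF k W}
    (h : Related j ξ ξ') (hW : W ≤ j ⁻¹ᵁ U) (f : Γ(X, U)) :
    jres j hW (ξ.app f) = ξ'.app (jres j hW f) := h (Below.self U) (Below.self W) hW f

theorem Related.res {U V : X.Opens} {W W' : Y.Opens} {ξ : VF k U} {ξ' : VF k W}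
    (h : Related j ξ ξ') (hV : V ≤ U) (hW : W' ≤ W) : Related j (VF.res hV ξ) (VF.res hW ξ') :=
  fun P P' e f => h (P.up hV) (P'.up hW) e f

theorem Related.comm {U : X.Opens} {W : Y.Opens} {ξ η : VF k U} {ξ' η' : VF k W}
    (h : Related j ξ ξ') (h' : Related j η η') : Related j (ξ.comm η) (ξ'.comm η') :=
  fun P P' e f => by rw [VF.comm_val, VF.comm_val, map_sub, h, h', h', h]

theorem Related.add {U : X.Opens} {W : Y.Opens} {ξ η : VF k U} {ξ' η' : VF k W}
    (h : Related j ξ ξ') (h' : Related j η η') : Related j (ξ + η) (ξ' + η') :=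
  fun P P' e f => by rw [VF.add_val, VF.add_val, map_add, h, h']

/-- Vector fields are related if they are related on coordinates. -/
theorem IsCoordOn.related [j.IsOver (Spec (.of k))] {U V : X.Opens} {W : Y.Opens} {m : ℕ}
    {x : Fin m → Γ(X, U)} (hx : IsCoordOn k U x) (h : V ≤ U) (hW : W ≤ j ⁻¹ᵁ V) {ξ : VF k V}
    {ξ' : VF k W}
    (e : ∀ i, jres j hW (ξ.app (rs h (x i))) = ξ'.app (jres j (hW.trans (preimage_le j h)) (x i))) :
    Related j ξ ξ' := by
  intro P P' hP f
  refine rs_ext fun y hy => ?_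
  obtain ⟨Q, hQ, hyQ, hA⟩ := exists_affine (Y := X) (U := P.1) (y := j y) (hP hy)
  have hQU : Q ≤ U := hQ.trans (P.2.trans h)
  have hS : P'.1 ⊓ j ⁻¹ᵁ Q ≤ P'.1 := inf_le_left
  have hS' : P'.1 ⊓ j ⁻¹ᵁ Q ≤ j ⁻¹ᵁ Q := inf_le_right
  refine ⟨P'.1 ⊓ j ⁻¹ᵁ Q, hS, ⟨hy, hyQ⟩, ?_⟩
  generalize P'.1 ⊓ j ⁻¹ᵁ Q = S at hS hS'
  rw [ξ'.2.2.2 P' ⟨S, hS.trans P'.2⟩ hS, rs_jres, rs_jres, ← jres_rs hQ hS', ← jres_rs hQ hS',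
    ξ.2.2.2 P ⟨Q, hQ.trans P.2⟩ hQ]
  refine DFunLike.congr_fun (f := (jres j hS').toAddMonoidHom.comp (ξ.1 ⟨Q, hQ.trans P.2⟩))
    (g := (ξ'.1 ⟨S, hS.trans P'.2⟩).comp (jres j hS').toAddMonoidHom)
    ((hx.restrict hQU hA).coord.ext (ψ := jres j hS') ⟨fun a b => ?_, fun c => ?_⟩
      ⟨fun a b => ?_, fun c => ?_⟩ fun i => ?_) (rs hQ f)
  · change jres j hS' (ξ.1 ⟨Q, hQ.trans P.2⟩ (a * b)) = _
    rw [ξ.2.1 ⟨Q, hQ.trans P.2⟩, map_add, map_mul, map_mul]; rfl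
  · change jres j hS' (ξ.1 ⟨Q, hQ.trans P.2⟩ _) = _
    rw [ξ.2.2.1 ⟨Q, hQ.trans P.2⟩, map_zero]
  · change ξ'.1 ⟨S, hS.trans P'.2⟩ (jres j hS' (a * b)) = _
    rw [map_mul, ξ'.2.1 ⟨S, hS.trans P'.2⟩]; rfl
  · change ξ'.1 ⟨S, hS.trans P'.2⟩ (jres j hS' _) = _
    rw [jres_cst, ξ'.2.2.1 ⟨S, hS.trans P'.2⟩]
  · change jres j hS' (ξ.1 ⟨Q, hQ.trans P.2⟩ (rs hQU (x i))) =
      ξ'.1 ⟨S, hS.trans P'.2⟩ (jres j hS' (rs hQU (x i)))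
    have e' := congrArg (rs (hS.trans P'.2)) (e i)
    rw [rs_jres, VF.app, VF.app, ξ'.2.2.2 (Below.self W) ⟨S, hS.trans P'.2⟩ (hS.trans P'.2), rs_jres,
      ← jres_rs (hQ.trans P.2) hS', ξ.2.2.2 (Below.self V) ⟨Q, hQ.trans P.2⟩ (hQ.trans P.2), rs_rs]
      at e'
    rw [jres_rs]
    exact e'

theorem Related.unique [IsClosedImmersion j] {U : X.Opens} {W : Y.Opens} (hW : W ≤ j ⁻¹ᵁ U)
    {ξ : VF k U} {ξ' ξ'' : VF k W} (h : Related j ξ ξ') (h' : Related j ξ ξ'') : ξ' = ξ'' := by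
  refine VF.ext fun P g => rs_ext fun y hy => ?_
  obtain ⟨V, hV, hA, hyV, hVW⟩ := exists_nhd (j := j) (U := U) hy (hW (P.2 hy))
  refine ⟨j ⁻¹ᵁ V, hVW, hyV, ?_⟩
  rw [ξ'.2.2.2 P ⟨j ⁻¹ᵁ V, hVW.trans P.2⟩ hVW, ξ''.2.2.2 P ⟨j ⁻¹ᵁ V, hVW.trans P.2⟩ hVW]
  obtain ⟨f, hf⟩ := jres_surjective hA (rs hVW g)
  rw [← hf, ← h ⟨V, hV⟩ ⟨j ⁻¹ᵁ V, hVW.trans P.2⟩ le_rfl, h' ⟨V, hV⟩ ⟨j ⁻¹ᵁ V, hVW.trans P.2⟩ le_rfl]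

theorem IsCoordOn.exists_related [IsClosedImmersion j] [j.IsOver (Spec (.of k))] {V : X.Opens}
    {m : ℕ} {x : Fin m → Γ(X, V)} (hx : IsCoordOn k V x) (ξ' : VF k (j ⁻¹ᵁ V)) :
    ∃ ξ : VF k V, Related j ξ ξ' := by
  choose c hc using fun i => jres_surjective hx.affine (ξ'.app (jres j le_rfl (x i)))
  refine ⟨hx.vf le_rfl c, hx.related le_rfl le_rfl fun i => ?_⟩
  rw [hx.vf_app, hc]

theorem related_glue [IsClosedImmersion j] {U : X.Opens} {ξ : VF k U}
    (h : ∀ y ∈ j ⁻¹ᵁ U, ∃ V : X.Opens, ∃ hV : V ≤ U, y ∈ j ⁻¹ᵁ V ∧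
      ∃ ξ' : VF k (j ⁻¹ᵁ V), Related j (VF.res hV ξ) ξ') :
    ∃ ξ' : VF k (j ⁻¹ᵁ U), Related j ξ ξ' := by
  obtain ⟨ξ', hξ', -⟩ := tangentMod_isSheaf.existsUnique_glue (M := tangentMod k Y) (U := j ⁻¹ᵁ U)
    (fun W _ (η : VF k W) => ∃ V : X.Opens, ∃ hV : V ≤ U, W = j ⁻¹ᵁ V ∧ Related j (VF.res hV ξ) η)
    (fun y hy => by
      obtain ⟨V, hV, hyV, η, hη⟩ := h y hy
      exact ⟨_, preimage_le j hV, hyV, η, V, hV, rfl, hη⟩) (by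
      rintro W hW η W' hW' η' ⟨V, hV, rfl, hη⟩ ⟨V', hV', rfl, hη'⟩
      exact Related.unique (j := j) (U := V ⊓ V') le_rfl
        (hη.res (inf_le_left : V ⊓ V' ≤ V) inf_le_left)
        (hη'.res (inf_le_right : V ⊓ V' ≤ V') inf_le_right))
  refine ⟨ξ', fun P P' hP f => rs_ext fun y hy => ?_⟩
  obtain ⟨V, hV, hyV, η, hη⟩ := h y (P'.2 hy)
  have e : VF.res (preimage_le j hV) ξ' = η := hξ' _ (preimage_le j hV) η ⟨V, hV, rfl, hη⟩
  have hS : P'.1 ⊓ j ⁻¹ᵁ V ≤ P'.1 := inf_le_left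
  refine ⟨P'.1 ⊓ j ⁻¹ᵁ V, hS, ⟨hy, hyV⟩, ?_⟩
  have hSV : P'.1 ⊓ j ⁻¹ᵁ V ≤ j ⁻¹ᵁ (P.1 ⊓ V) := fun z hz => ⟨hP hz.1, hz.2⟩
  have h1 := hη ⟨P.1 ⊓ V, inf_le_right⟩ ⟨P'.1 ⊓ j ⁻¹ᵁ V, inf_le_right⟩ hSV (rs inf_le_left f)
  rw [← e] at h1
  rw [rs_jres, ξ'.2.2.2 P' ⟨P'.1 ⊓ j ⁻¹ᵁ V, hS.trans P'.2⟩ hS, rs_jres,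
    ← jres_rs (inf_le_left : P.1 ⊓ V ≤ P.1) hSV, ← jres_rs (inf_le_left : P.1 ⊓ V ≤ P.1) hSV,
    ξ.2.2.2 P ⟨P.1 ⊓ V, inf_le_left.trans P.2⟩ inf_le_left]
  exact h1

end ClosedSub

/-! ### Pull-backs of forms and cocycles -/

section Pullback

variable {k : Type u} [Field k] {X : Scheme.{u}} [X.Over (Spec (.of k))]
  {Y : Scheme.{u}} [Y.Over (Spec (.of k))] {j : Y ⟶ X}

theorem exists_lifts [IsClosedImmersion j] [j.IsOver (Spec (.of k))] (m n : ℕ)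
    [SmoothOfRelativeDimension m (X ↘ Spec (.of k))]
    [SmoothOfRelativeDimension n (Y ↘ Spec (.of k))]
    {U : X.Opens} {W : Y.Opens} {y : Y} (hy : y ∈ W) (hy' : y ∈ j ⁻¹ᵁ U) :
    ∃ (V : X.Opens) (_ : V ≤ U) (h : j ⁻¹ᵁ V ≤ W), y ∈ j ⁻¹ᵁ V ∧
      ∀ ξ' : VF k W, ∃ ξ : VF k V, Related j ξ (VF.res h ξ') := by
  obtain ⟨V, hV, hyV, hVW, ⟨x, hx⟩, -⟩ := exists_coords (j := j) (k := k) m n hy hy'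
  exact ⟨V, hV, hVW, hyV, fun ξ' => hx.exists_related _⟩

namespace IsPullbackForm

variable {p : ℕ} {U : X.Opens} {W : Y.Opens} {α α' : (forms k X p).Sec U}
  {β β' : (forms k Y p).Sec W}

theorem res (h : IsPullbackForm j α β) {U' : X.Opens} {W' : Y.Opens} (hU : U' ≤ U) (hW : W' ≤ W) :
    IsPullbackForm j ((forms k X p).res hU α) ((forms k Y p).res hW β) :=
  fun V V' e ξ ξ' hξ => h (V.up hU) (V'.up hW) e ξ ξ' hξ

theorem add (h : IsPullbackForm j α β) (h' : IsPullbackForm j α' β') :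
    IsPullbackForm j (α + α') (β + β') := fun V V' e ξ ξ' hξ => by
  rw [form_add, form_add, map_add, h V V' e ξ ξ' hξ, h' V V' e ξ ξ' hξ]

theorem sub (h : IsPullbackForm j α β) (h' : IsPullbackForm j α' β') :
    IsPullbackForm j (α - α') (β - β') := fun V V' e ξ ξ' hξ => by
  rw [form_sub, form_sub, map_sub, h V V' e ξ ξ' hξ, h' V V' e ξ ξ' hξ]

theorem apply1 {α : (forms k X 1).Sec U} {β : (forms k Y 1).Sec W} (h : IsPullbackForm j α β)
    (V : Below U) (V' : Below W) (e : V'.1 ≤ j ⁻¹ᵁ V.1) {ξ : VF k V.1} {ξ' : VF k V'.1}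
    (hξ : Related j ξ ξ') : jres j e (formAt α V ![ξ]) = formAt β V' ![ξ'] :=
  h V V' e _ _ fun i => by fin_cases i; exact hξ

theorem apply2 {α : (forms k X 2).Sec U} {β : (forms k Y 2).Sec W} (h : IsPullbackForm j α β)
    (V : Below U) (V' : Below W) (e : V'.1 ≤ j ⁻¹ᵁ V.1) {ξ η : VF k V.1} {ξ' η' : VF k V'.1}
    (hξ : Related j ξ ξ') (hη : Related j η η') :
    jres j e (formAt α V ![ξ, η]) = formAt β V' ![ξ', η'] :=
  h V V' e _ _ fun i => by fin_cases i; exacts [hξ, hη]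

theorem unique1 [IsClosedImmersion j] [j.IsOver (Spec (.of k))] (m n : ℕ)
    [SmoothOfRelativeDimension m (X ↘ Spec (.of k))]
    [SmoothOfRelativeDimension n (Y ↘ Spec (.of k))] (hW : W ≤ j ⁻¹ᵁ U)
    {α : (forms k X 1).Sec U} {β β' : (forms k Y 1).Sec W}
    (h : IsPullbackForm j α β) (h' : IsPullbackForm j α β') : β = β' := by
  refine form1_ext fun V' ξ' => rs_ext fun y hy => ?_
  obtain ⟨V, hV, e, hyV, H⟩ := exists_lifts (j := j) (k := k) m n hy (hW (V'.2 hy))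
  obtain ⟨ξ, hξ⟩ := H ξ'
  refine ⟨_, e, hyV, ?_⟩
  rw [form1_res β V' ⟨_, e.trans V'.2⟩ e, form1_res β' V' ⟨_, e.trans V'.2⟩ e,
    ← h.apply1 ⟨V, hV⟩ ⟨_, e.trans V'.2⟩ le_rfl hξ, ← h'.apply1 ⟨V, hV⟩ ⟨_, e.trans V'.2⟩ le_rfl hξ]

theorem isExtD [IsClosedImmersion j] [j.IsOver (Spec (.of k))] (m n : ℕ)
    [SmoothOfRelativeDimension m (X ↘ Spec (.of k))]
    [SmoothOfRelativeDimension n (Y ↘ Spec (.of k))] (hW : W ≤ j ⁻¹ᵁ U)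
    {A : (forms k X 1).Sec U} {B : (forms k Y 1).Sec W}
    {α : (forms k X 2).Sec U} {β : (forms k Y 2).Sec W}
    (h : IsPullbackForm j A B) (h' : IsPullbackForm j α β) (hA : IsExtD A α) : IsExtD B β := by
  intro V' ξ' η'
  refine rs_ext fun y hy => ?_
  obtain ⟨V, hV, e, hyV, H⟩ := exists_lifts (j := j) (k := k) m n hy (hW (V'.2 hy))
  obtain ⟨ξ, hξ⟩ := H ξ'
  obtain ⟨η, hη⟩ := H η'
  refine ⟨_, e, hyV, ?_⟩
  rw [map_sub, map_sub, ← VF.res_app, ← VF.res_app, form2_res β V' ⟨_, e.trans V'.2⟩ e,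
    form1_res B V' ⟨_, e.trans V'.2⟩ e, form1_res B V' ⟨_, e.trans V'.2⟩ e,
    form1_res B V' ⟨_, e.trans V'.2⟩ e, VF.res_comm,
    ← h'.apply2 ⟨V, hV⟩ ⟨_, e.trans V'.2⟩ le_rfl hξ hη,
    ← h.apply1 ⟨V, hV⟩ ⟨_, e.trans V'.2⟩ le_rfl hξ, ← h.apply1 ⟨V, hV⟩ ⟨_, e.trans V'.2⟩ le_rfl hη,
    ← h.apply1 ⟨V, hV⟩ ⟨_, e.trans V'.2⟩ le_rfl (hξ.comm hη), ← hξ.app, ← hη.app,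
    hA ⟨V, hV⟩ ξ η, map_sub, map_sub]

theorem isClosedForm [IsClosedImmersion j] [j.IsOver (Spec (.of k))] (m n : ℕ)
    [SmoothOfRelativeDimension m (X ↘ Spec (.of k))]
    [SmoothOfRelativeDimension n (Y ↘ Spec (.of k))] (hW : W ≤ j ⁻¹ᵁ U)
    {α : (forms k X 2).Sec U} {β : (forms k Y 2).Sec W}
    (h : IsPullbackForm j α β) (hα : IsClosedForm α) : IsClosedForm β := by
  intro V' ξ' η' ζ'
  refine rs_ext fun y hy => ?_
  obtain ⟨V, hV, e, hyV, H⟩ := exists_lifts (j := j) (k := k) m n hy (hW (V'.2 hy))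
  obtain ⟨ξ, hξ⟩ := H ξ'
  obtain ⟨η, hη⟩ := H η'
  obtain ⟨ζ, hζ⟩ := H ζ'
  refine ⟨_, e, hyV, ?_⟩
  have key := fun {ξ η : VF k V} {ξ' η' : VF k (j ⁻¹ᵁ V)} (hξ : Related j ξ ξ')
    (hη : Related j η η') => (h.apply2 ⟨V, hV⟩ ⟨_, e.trans V'.2⟩ le_rfl hξ hη).symm
  simp only [map_sub, map_add, map_zero, ← VF.res_app, form2_res β V' ⟨_, e.trans V'.2⟩ e,
    VF.res_comm]
  rw [key hη hζ, key hξ hζ, key hξ hη, key (hξ.comm hη) hζ, key (hξ.comm hζ) hη,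
    key (hη.comm hζ) hξ, ← hξ.app, ← hη.app, ← hζ.app, ← map_sub, ← map_add, ← map_sub, ← map_add,
    ← map_sub, hα ⟨V, hV⟩ ξ η ζ, map_zero]

end IsPullbackForm

theorem IsCoordOn.exists_pullback1 {U₀ U : X.Opens} {m : ℕ} {x : Fin m → Γ(X, U₀)}
    (hx : IsCoordOn k U₀ x) (hU : U ≤ U₀) {W : Y.Opens} (hW : W ≤ j ⁻¹ᵁ U) (α : (forms k X 1).Sec U) :
    ∃ β : (forms k Y 1).Sec W, IsPullbackForm j α β := by
  let c : Fin m → Γ(X, U) := fun i => formAt α (Below.self U) ![VF.res hU (hx.partial i)]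
  have hWU := hW.trans (preimage_le j hU)
  refine ⟨mkForm1 (fun V' =>
    { toFun := fun ξ => ∑ i, jres j (V'.2.trans hW) (c i) * ξ.app (jres j (V'.2.trans hWU) (x i))
      map_add' := fun ξ η => by
        rw [← Finset.sum_add_distrib]
        exact Finset.sum_congr rfl fun i _ => by rw [VF.add_app, mul_add]
      map_smul' := fun f ξ => by
        rw [RingHom.id_apply, smul_eq_mul, Finset.mul_sum]
        exact Finset.sum_congr rfl fun i _ => by rw [VF.smul_app, mul_left_comm] })
    fun V' V'' h ξ => ?_, fun V V' e ξ ξ' hξ => ?_⟩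
  · change rs h (∑ i, jres j (V'.2.trans hW) (c i) * ξ.app (jres j (V'.2.trans hWU) (x i))) =
      ∑ i, jres j (V''.2.trans hW) (c i) * (VF.res h ξ).app (jres j (V''.2.trans hWU) (x i))
    rw [map_sum]
    refine Finset.sum_congr rfl fun i _ => ?_
    rw [map_mul, rs_jres, ← VF.res_app, rs_jres]
  · obtain ⟨ξ, rfl⟩ : ∃ a, ξ = ![a] := ⟨ξ 0, by funext i; fin_cases i; rfl⟩
    obtain ⟨ξ', rfl⟩ : ∃ a, ξ' = ![a] := ⟨ξ' 0, by funext i; fin_cases i; rfl⟩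
    replace hξ : Related j ξ ξ' := hξ 0
    change _ = ∑ i, jres j (V'.2.trans hW) (c i) * ξ'.app (jres j (V'.2.trans hWU) (x i))
    have h1 : formAt α V ![ξ] =
        ∑ i, rs V.2 (c i) * ξ.app (rs (V.2.trans hU) (x i)) := by
      conv_lhs => rw [hx.eq_sum (V.2.trans hU) ξ]
      have h2 : ∀ s : Finset (Fin m), formAt α V ![∑ i ∈ s, ξ.app (rs (V.2.trans hU) (x i)) •
          VF.res (V.2.trans hU) (hx.partial i)] =
          ∑ i ∈ s, rs V.2 (c i) * ξ.app (rs (V.2.trans hU) (x i)) := by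
        classical
        intro s
        induction s using Finset.induction_on with
        | empty => exact form1_zero α V
        | insert a s ha ih =>
          rw [Finset.sum_insert ha, Finset.sum_insert ha, form1_add, ih, form1_smul, mul_comm,
            form1_res α (Below.self U) V V.2]
          rfl
      exact h2 _
    rw [h1, map_sum]
    refine Finset.sum_congr rfl fun i _ => ?_
    rw [map_mul, jres_rs, hξ.app, jres_rs]

theorem IsCoordOn.exists_pullback2 [CharZero k] {U₀ : X.Opens} {m : ℕ} {x : Fin m → Γ(X, U₀)}
    (hx : IsCoordOn k U₀ x) {W : Y.Opens} (hW : W ≤ j ⁻¹ᵁ U₀)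
    (α : (forms k X 2).Sec U₀) : ∃ β : (forms k Y 2).Sec W, IsPullbackForm j α β := by
  let c : Fin m → Fin m → Γ(X, U₀) := fun i l =>
    formAt α (Below.self U₀) ![hx.partial i, hx.partial l]
  have hc : ∀ i l, c i l = -c l i := fun i l => form2_swap _ _ _ _
  let F : ∀ V' : Below W, VF k V'.1 → VF k V'.1 → Γ(Y, V'.1) := fun V' ξ η =>
    ∑ i, ∑ l, jres j (V'.2.trans hW) (c i l) * (ξ.app (jres j (V'.2.trans hW) (x i)) *
      η.app (jres j (V'.2.trans hW) (x l)))
  have hswap : ∀ V' ξ η, F V' ξ η = -F V' η ξ := fun V' ξ η => by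
    simp only [F]
    rw [Finset.sum_comm, ← Finset.sum_neg_distrib]
    refine Finset.sum_congr rfl fun i _ => ?_
    rw [← Finset.sum_neg_distrib]
    refine Finset.sum_congr rfl fun l _ => ?_
    rw [hc, map_neg]; ring
  refine (exists_form2 F (fun V' ξ ξ' η => ?_) (fun V' f ξ η => ?_) (fun V' ξ => ?_) hswap
    (fun V' V'' h ξ η => ?_)).imp fun β hβ V V' e ξ ξ' hξ => ?_
  · simp only [F, ← Finset.sum_add_distrib]
    exact Finset.sum_congr rfl fun i _ => Finset.sum_congr rfl fun l _ => by
      rw [VF.add_app]; ring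
  · simp only [F, Finset.mul_sum]
    exact Finset.sum_congr rfl fun i _ => Finset.sum_congr rfl fun l _ => by
      rw [VF.smul_app]; ring
  · have h1 := hswap V' ξ ξ
    linear_combination cst k V'.1 (1 / 2) * h1 - F V' ξ ξ * two_mul_half (cst k V'.1)
  · simp only [F, map_sum]
    exact Finset.sum_congr rfl fun i _ => Finset.sum_congr rfl fun l _ => by
      rw [map_mul, map_mul, rs_jres, ← VF.res_app, ← VF.res_app, rs_jres, rs_jres]
  · obtain ⟨a, b, rfl⟩ : ∃ a b, ξ = ![a, b] := ⟨ξ 0, ξ 1, by funext i; fin_cases i <;> rfl⟩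
    obtain ⟨a', b', rfl⟩ : ∃ a b, ξ' = ![a, b] := ⟨ξ' 0, ξ' 1, by funext i; fin_cases i <;> rfl⟩
    have h0 : Related j a a' := hξ 0
    have h1 : Related j b b' := hξ 1
    rw [hβ]
    have hr : ∀ (a b : VF k V.1) (s : Finset (Fin m)), formAt α V ![a, ∑ i ∈ s, b.app (rs V.2 (x i)) •
        VF.res V.2 (hx.partial i)] =
        ∑ i ∈ s, b.app (rs V.2 (x i)) * formAt α V ![a, VF.res V.2 (hx.partial i)] := by
      classical
      intro a b s
      induction s using Finset.induction_on with
      | empty => exact form2_zero_right α V a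
      | insert i s ha ih =>
        rw [Finset.sum_insert ha, Finset.sum_insert ha, form2_add_right, ih, form2_smul_right]
    have hr' : ∀ (a b : VF k V.1), formAt α V ![a, b] =
        ∑ i, b.app (rs V.2 (x i)) * formAt α V ![a, VF.res V.2 (hx.partial i)] := fun a b => by
      rw [← hr a b]
      exact congrArg (fun b => formAt α V ![a, b]) (hx.eq_sum V.2 b)
    rw [form2_swap, hr', ← Finset.sum_neg_distrib, map_sum]
    refine Finset.sum_congr rfl fun i _ => ?_
    rw [form2_swap, hr', mul_neg, neg_neg, Finset.mul_sum, map_sum]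
    refine Finset.sum_congr rfl fun l _ => ?_
    rw [← form2_res α (Below.self U₀) V V.2 (hx.partial i) (hx.partial l), map_mul, map_mul, h0.app,
      h1.app, jres_rs, jres_rs, jres_rs]
    change _ = jres j (V'.2.trans hW) (formAt α (Below.self U₀) ![hx.partial i, hx.partial l]) * _
    ring

/-- The cocycle `w` is the pull-back of the cocycle `z`. -/
structure IsPullbackCocycle (j : Y ⟶ X) (z : Cocycle k X) (w : Cocycle k Y) (e : w.I → z.I) :
    Prop where
  surjective : Function.Surjective e
  U_eq : ∀ i, w.U i = j ⁻¹ᵁ z.U (e i)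
  form : ∀ i, IsPullbackForm j (z.form (e i)) (w.form i)
  trans : ∀ i i', IsPullbackForm j (z.trans (e i) (e i')) (w.trans i i')

theorem IsPullbackCocycle.le {z : Cocycle k X} {w : Cocycle k Y} {e : w.I → z.I}
    (h : IsPullbackCocycle j z w e) (i : w.I) : w.U i ≤ j ⁻¹ᵁ z.U (e i) := (h.U_eq i).le

theorem exists_pullbackCocycle [CharZero k] [IsClosedImmersion j] [j.IsOver (Spec (.of k))] (m n : ℕ)
    [SmoothOfRelativeDimension m (X ↘ Spec (.of k))]
    [SmoothOfRelativeDimension n (Y ↘ Spec (.of k))] (z : Cocycle k X)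
    (hz : ∀ i, ∃ x : Fin m → Γ(X, z.U i), IsCoordOn k (z.U i) x) :
    ∃ (w : Cocycle k Y) (e : w.I → z.I), IsPullbackCocycle j z w e := by
  choose x hx using hz
  choose β hβ using fun i => (hx i).exists_pullback2 (j := j) (le_refl (j ⁻¹ᵁ z.U i)) (z.form i)
  choose B hB using fun i i' => (hx i).exists_pullback1 (j := j) (U := z.U i ⊓ z.U i') inf_le_left
    (W := j ⁻¹ᵁ z.U i ⊓ j ⁻¹ᵁ z.U i') (fun _ h => h) (z.trans i i')
  refine ⟨⟨z.I, fun i => j ⁻¹ᵁ z.U i, fun y => z.cover (j y), β, B, fun i => ?_, fun i i' => ?_,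
    fun i i' l => ?_⟩, id, Function.surjective_id, fun _ => rfl, hβ, hB⟩
  · exact (hβ i).isClosedForm m n le_rfl (z.closed i)
  · exact (hB i i').isExtD m n (fun _ h => h)
      (((hβ i').res inf_le_right inf_le_right).sub ((hβ i).res inf_le_left inf_le_left))
      (z.d_trans i i')
  · refine IsPullbackForm.unique1 (j := j) m n (U := z.U i ⊓ z.U i' ⊓ z.U l)
      (W := j ⁻¹ᵁ z.U i ⊓ j ⁻¹ᵁ z.U i' ⊓ j ⁻¹ᵁ z.U l) (fun _ h => h)
      (((hB i i').res inf_le_left inf_le_left).add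
        ((hB i' l).res (inf_le_inf_right _ inf_le_right) (inf_le_inf_right _ inf_le_right))) ?_
    rw [z.trans_trans]
    exact (hB i l).res (inf_le_inf_right _ inf_le_left) (inf_le_inf_right _ inf_le_left)

end Pullback

/-! ### Hamiltonian vector fields of functions that vanish on a Lagrangian subvariety -/

section Lagrangian

/-- A linear map between free modules of the same rank is injective if it is surjective. -/
theorem injective_of_surjective_pi {B : Type u} [CommRing B] {n : ℕ}
    (f : (Fin (2 * n) → B) →ₗ[B] (Fin n ⊕ Fin n → B)) (hf : Function.Surjective f) :
    Function.Injective f := by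
  let e : Fin n ⊕ Fin n ≃ Fin (2 * n) := finSumFinEquiv.trans (finCongr (two_mul n).symm)
  let e' : (Fin n ⊕ Fin n → B) ≃ₗ[B] (Fin (2 * n) → B) := LinearEquiv.funCongrLeft B B e.symm
  have h := OrzechProperty.injective_of_surjective_endomorphism (e'.toLinearMap.comp f)
    (e'.surjective.comp hf)
  exact fun a b hab => h (congrArg e' hab)

variable {k : Type u} [Field k] {X : Scheme.{u}} [X.Over (Spec (.of k))]
  {Y : Scheme.{u}} [Y.Over (Spec (.of k))] {j : Y ⟶ X} {ω : SymplecticForm k X}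

theorem IsIsotropic.pair_eq_zero (hω : IsIsotropic j ω) {U : X.Opens} {W : Y.Opens}
    (hW : W ≤ j ⁻¹ᵁ U) {ξ η : VF k U} {ξ' η' : VF k W} (h : Related j ξ ξ') (h' : Related j η η') :
    jres j hW (ω.pair ξ η) = 0 :=
  IsPullbackForm.apply2 hω ⟨U, le_top⟩ ⟨W, le_top⟩ hW h h'

theorem SymplecticForm.pair_eq_sum (ω : SymplecticForm k X) {V : X.Opens} {m : ℕ}
    {x : Fin m → Γ(X, V)} (hx : IsCoordOn k V x) (ξ η : VF k V) :
    ω.pair ξ η = ∑ i, ξ.app (x i) * ω.pair (hx.partial i) η := by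
  conv_lhs => rw [hx.eq_sum le_rfl ξ]
  rw [ω.pair_swap, ω.pair_sum_right, ← Finset.sum_neg_distrib]
  refine Finset.sum_congr rfl fun i _ => ?_
  rw [ω.pair_smul_right, ω.pair_swap η, rs_id]
  change -(_ * -ω.pair (hx.partial i) η) = _
  ring

theorem SymplecticForm.app_eq_pair (ω : SymplecticForm k X) {V : X.Opens} (ξ : VF k V)
    (g : Γ(X, V)) : ξ.app g = ω.pair ξ (ω.ham g) := by
  rw [ω.pair_swap, ω.pair_ham, neg_neg]

theorem exists_related_ham_of_coords [IsClosedImmersion j] [j.IsOver (Spec (.of k))]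
    (hω : IsIsotropic j ω) {n : ℕ} {V : X.Opens} {x : Fin (2 * n) → Γ(X, V)} (hx : IsCoordOn k V x)
    {t : Fin n → Γ(Y, j ⁻¹ᵁ V)} (ht : IsCoordOn k (j ⁻¹ᵁ V) t) {f : Γ(X, V)}
    (hf : jres j (le_refl (j ⁻¹ᵁ V)) f = 0) :
    ∃ ξ' : VF k (j ⁻¹ᵁ V), Related j (ω.ham f) ξ' := by
  let ρ := jres j (le_refl (j ⁻¹ᵁ V))
  choose τ hτ using fun l => hx.exists_related (ht.partial l)
  choose a ha using fun l => jres_surjective (j := j) hx.affine (t l)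
  have hτf : ∀ l g, ρ ((τ l).app g) = (ht.partial l).app (ρ g) := fun l g => (hτ l).app le_rfl g
  have hτa : ∀ l m, ρ ((τ l).app (a m)) = if m = l then 1 else 0 := fun l m => by
    rw [hτf, ← ht.partial_app l m]
    exact congrArg _ (ha m)
  have hττ : ∀ l m, ρ (ω.pair (τ l) (τ m)) = 0 := fun l m =>
    hω.pair_eq_zero le_rfl (hτ l) (hτ m)
  let Θ : (Fin (2 * n) → Γ(Y, j ⁻¹ᵁ V)) →ₗ[Γ(Y, j ⁻¹ᵁ V)] (Fin n ⊕ Fin n → Γ(Y, j ⁻¹ᵁ V)) :=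
    LinearMap.pi fun s => ∑ i, (Sum.elim (fun l => ρ (ω.pair (hx.partial i) (τ l)))
      (fun m => ρ ((hx.partial i).app (a m))) s) • LinearMap.proj i
  let v : VF k V → Fin (2 * n) → Γ(Y, j ⁻¹ᵁ V) := fun ξ i => ρ (ξ.app (x i))
  have hΘl : ∀ ξ l, Θ (v ξ) (Sum.inl l) = ρ (ω.pair ξ (τ l)) := fun ξ l => by
    rw [ω.pair_eq_sum hx, map_sum]
    simp only [Θ, LinearMap.pi_apply, LinearMap.sum_apply, LinearMap.smul_apply, Sum.elim_inl,
      LinearMap.proj_apply, smul_eq_mul]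
    exact Finset.sum_congr rfl fun i _ => by rw [map_mul, mul_comm]
  have hΘr : ∀ ξ m, Θ (v ξ) (Sum.inr m) = ρ (ξ.app (a m)) := fun ξ m => by
    rw [hx.app_eq_sum le_rfl, map_sum]
    simp only [Θ, LinearMap.pi_apply, LinearMap.sum_apply, LinearMap.smul_apply, Sum.elim_inr,
      LinearMap.proj_apply, smul_eq_mul]
    exact Finset.sum_congr rfl fun i _ => by rw [map_mul, mul_comm, rs_id]; rfl
  have hsum : ∀ (c : Fin n → Γ(Y, j ⁻¹ᵁ V)) (ξ : Fin n → VF k V) s,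
      Θ (∑ l, c l • v (ξ l)) s = ∑ l, c l * Θ (v (ξ l)) s := fun c ξ s => by
    rw [map_sum, Finset.sum_apply]
    exact Finset.sum_congr rfl fun l _ => by rw [map_smul]; rfl
  have hsurj : Function.Surjective Θ := by
    intro p
    let c : Fin n → Γ(Y, j ⁻¹ᵁ V) := fun l => -p (Sum.inl l)
    let b : Fin n → Γ(Y, j ⁻¹ᵁ V) := fun m =>
      p (Sum.inr m) - Θ (∑ l, c l • v (ω.ham (a l))) (Sum.inr m)
    refine ⟨∑ l, c l • v (ω.ham (a l)) + ∑ l, b l • v (τ l), funext fun s => ?_⟩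
    rw [map_add, Pi.add_apply, hsum b]
    rcases s with l | m
    · rw [hsum c]
      have h1 : ∀ i, c i * Θ (v (ω.ham (a i))) (Sum.inl l) = if i = l then p (Sum.inl l) else 0 := by
        intro i
        rw [hΘl, ω.pair_ham, map_neg, hτa]
        split_ifs with h
        · rw [h]; simp [c]
        · simp
      have h2 : ∀ i, b i * Θ (v (τ i)) (Sum.inl l) = 0 := fun i => by
        rw [hΘl, hττ, mul_zero]
      simp only [h1, h2]
      simp
    · have h2 : ∀ i, b i * Θ (v (τ i)) (Sum.inr m) = if i = m then b m else 0 := by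
        intro i
        rw [hΘr, hτa]
        by_cases h : m = i
        · subst h; simp
        · rw [if_neg h, if_neg (Ne.symm h), mul_zero]
      simp only [h2]
      simp [b]
  have hinj := injective_of_surjective_pi Θ hsurj
  let c : Fin n → Γ(Y, j ⁻¹ᵁ V) := fun l => ρ ((ω.ham f).app (a l))
  have hv : v (ω.ham f) = ∑ l, c l • v (τ l) := by
    refine hinj (funext fun s => ?_)
    rw [hsum]
    rcases s with l | m
    · rw [hΘl, ω.pair_ham, map_neg, hτf]
      have h0 : ρ f = 0 := hf
      rw [h0, VF.app_zero, neg_zero]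
      refine (Finset.sum_eq_zero fun i _ => ?_).symm
      rw [hΘl, hττ, mul_zero]
    · rw [hΘr, Finset.sum_eq_single m]
      · rw [hΘr, hτa, if_pos rfl, mul_one]
      · intro i _ hi
        rw [hΘr, hτa, if_neg (Ne.symm hi), mul_zero]
      · simp
  refine ⟨∑ l, c l • ht.partial l, hx.related le_rfl le_rfl fun i => ?_⟩
  have h1 := congrFun hv i
  rw [Finset.sum_apply] at h1
  rw [rs_id, VF.sum_app]
  refine h1.trans (Finset.sum_congr rfl fun l _ => ?_)
  rw [VF.smul_app, ← hτf]
  rfl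

/-- The Hamiltonian vector field of a function that vanishes on `Y` is tangent to `Y`. -/
theorem IsIsotropic.exists_related_ham [IsClosedImmersion j] [j.IsOver (Spec (.of k))]
    (hω : IsIsotropic j ω) (n : ℕ) [SmoothOfRelativeDimension (2 * n) (X ↘ Spec (.of k))]
    [SmoothOfRelativeDimension n (Y ↘ Spec (.of k))] {U : X.Opens} {f : Γ(X, U)}
    (hf : jres j (le_refl (j ⁻¹ᵁ U)) f = 0) :
    ∃ ξ' : VF k (j ⁻¹ᵁ U), Related j (ω.ham f) ξ' := by
  refine related_glue fun y hy => ?_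
  obtain ⟨V, hV, hyV, -, ⟨x, hx⟩, t, ht⟩ := exists_coords (j := j) (k := k) (2 * n) n hy hy
  refine ⟨V, hV, hyV, ?_⟩
  rw [ω.ham_res]
  refine exists_related_ham_of_coords hω hx ht ?_
  rw [jres_rs, ← rs_jres le_rfl (preimage_le j hV), hf, map_zero]

theorem exists_ham_of_coords [IsClosedImmersion j] [j.IsOver (Spec (.of k))]
    (hω : IsIsotropic j ω) {m n : ℕ} {V : X.Opens} {x : Fin m → Γ(X, V)} (hx : IsCoordOn k V x)
    {t : Fin n → Γ(Y, j ⁻¹ᵁ V)} (ht : IsCoordOn k (j ⁻¹ᵁ V) t) (ξ' : VF k (j ⁻¹ᵁ V)) :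
    ∃ f : Γ(X, V), jres j (le_refl (j ⁻¹ᵁ V)) f = 0 ∧ Related j (ω.ham f) ξ' := by
  let ρ := jres j (le_refl (j ⁻¹ᵁ V))
  have hρ : ρ.comp (cst k V) = cst k (j ⁻¹ᵁ V) := jres_comp_cst le_rfl
  obtain ⟨ξ, hξ⟩ := hx.exists_related ξ'
  have hsum : ∀ η : VF k V, ρ (ω.pair ξ η) = ∑ i, ρ (ω.pair ξ (hx.partial i)) * ρ (η.app (x i)) := by
    intro η
    rw [ω.pair_swap, ω.pair_eq_sum hx, ← Finset.sum_neg_distrib, map_sum]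
    refine Finset.sum_congr rfl fun i _ => ?_
    rw [ω.pair_swap ξ, map_neg, map_mul, map_neg]; ring
  obtain ⟨f, hf, hfx⟩ := IsCoord.exists_conormal (φ := cst k V) (x := x) (ψ := ρ)
    (jres_surjective hx.affine) (t := t) (by rw [hρ]; exact ht.coord)
    (fun i => -ρ (ω.pair ξ (hx.partial i))) (fun δ hδ => by
      rw [hρ] at hδ
      obtain ⟨η', hη'⟩ := ht.exists_vf le_rfl fun l => δ (t l)
      have hδη : δ = η'.1 (Below.self _) := ht.coord.ext hδ (η'.isDer (Below.self _)) fun l => by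
        rw [← hη' l, rs_id]; rfl
      obtain ⟨η, hη⟩ := hx.exists_related η'
      have h1 := hsum η
      rw [hω.pair_eq_zero le_rfl hξ hη] at h1
      rw [← neg_eq_zero, ← Finset.sum_neg_distrib]
      refine Eq.trans (Finset.sum_congr rfl fun i _ => ?_) h1.symm
      rw [neg_mul, neg_neg, hδη]
      exact congrArg _ (hη.app le_rfl (x i)).symm)
  refine ⟨f, hf, hx.related le_rfl le_rfl fun i => ?_⟩
  have key : ∀ η : VF k V, ρ (ω.pair (ω.ham f) η) = ρ (ω.pair ξ η) := fun η => by
    have h2 := hfx (ρ.toAddMonoidHom.comp (η.1 (Below.self V))) ⟨fun a b => by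
      change ρ (η.1 (Below.self V) (a * b)) = _
      rw [η.2.1 (Below.self V), map_add, map_mul, map_mul]; rfl, fun c => by
      change ρ (η.1 (Below.self V) _) = 0
      rw [η.2.2.1 (Below.self V), map_zero]⟩
    rw [ω.pair_ham, map_neg]
    have h3 : ρ (η.app f) = ∑ i, -ρ (ω.pair ξ (hx.partial i)) * ρ (η.app (x i)) := h2
    rw [h3, ← Finset.sum_neg_distrib, hsum]
    exact Finset.sum_congr rfl fun i _ => by rw [neg_mul, neg_neg]
  rw [rs_id, ← hξ.app le_rfl, ω.app_eq_pair, ω.app_eq_pair]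
  exact key _

/-- Every vector field on `Y` is locally the restriction of the Hamiltonian vector field of a
function that vanishes on `Y`. -/
theorem IsIsotropic.exists_ham [IsClosedImmersion j] [j.IsOver (Spec (.of k))]
    (hω : IsIsotropic j ω) (n : ℕ) [SmoothOfRelativeDimension (2 * n) (X ↘ Spec (.of k))]
    [SmoothOfRelativeDimension n (Y ↘ Spec (.of k))] {U : X.Opens} {W : Y.Opens} {y : Y} (hy : y ∈ W)
    (hy' : y ∈ j ⁻¹ᵁ U) (ξ' : VF k W) :
    ∃ (V : X.Opens) (_ : V ≤ U) (h : j ⁻¹ᵁ V ≤ W), y ∈ j ⁻¹ᵁ V ∧ IsAffineOpen V ∧ ∃ f : Γ(X, V),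
      jres j (le_refl (j ⁻¹ᵁ V)) f = 0 ∧ Related j (ω.ham f) (VF.res h ξ') := by
  obtain ⟨V, hV, hyV, hVW, ⟨x, hx⟩, t, ht⟩ := exists_coords (j := j) (k := k) (2 * n) n hy hy'
  exact ⟨V, hV, hVW, hyV, hx.affine, exists_ham_of_coords hω hx ht _⟩

/-- A function that vanishes on `Y` together with its Hamiltonian vector field is locally in the
square of the ideal of `Y`. -/
theorem mem_sq_of_related_zero [IsClosedImmersion j] [j.IsOver (Spec (.of k))]
    [Smooth (X ↘ Spec (.of k))] [Smooth (Y ↘ Spec (.of k))] {m : ℕ} {V : X.Opens}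
    {x : Fin m → Γ(X, V)} (hx : IsCoordOn k V x) {f : Γ(X, V)}
    (hf : jres j (le_refl (j ⁻¹ᵁ V)) f = 0) (h : Related j (ω.ham f) (0 : VF k (j ⁻¹ᵁ V))) :
    f ∈ RingHom.ker (jres j (le_refl (j ⁻¹ᵁ V))) ^ 2 := by
  let ρ := jres j (le_refl (j ⁻¹ᵁ V))
  have hρ : ρ.comp (cst k V) = cst k (j ⁻¹ᵁ V) := jres_comp_cst le_rfl
  refine hx.coord.mem_sq (jres_surjective hx.affine) (cst_formallySmooth hx.affine) (by
    rw [hρ]; exact cst_formallySmooth (hx.affine.preimage j)) hf fun δ hδ => ?_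
  have h1 : ∀ η : VF k V, ρ (η.app f) = 0 := fun η => by
    have := ω.pair_ham f η
    rw [ω.pair_eq_sum hx] at this
    rw [← neg_eq_zero, ← map_neg, ← this, map_sum]
    refine Finset.sum_eq_zero fun i _ => ?_
    rw [map_mul, h.app le_rfl, VF.zero_app, zero_mul]
  let D : Γ(X, V) →+ Γ(Y, j ⁻¹ᵁ V) :=
    ∑ i, (AddMonoidHom.mulLeft (δ (x i))).comp (ρ.toAddMonoidHom.comp ((hx.partial i).1 (Below.self V)))
  have hD : ∀ a, D a = ∑ i, δ (x i) * ρ ((hx.partial i).app a) := fun a => by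
    simp only [D, AddMonoidHom.finsetSum_apply]
    rfl
  have e : δ = D := hx.coord.ext hδ ⟨fun a b => by
    rw [hD, hD, hD, Finset.mul_sum, Finset.sum_mul, ← Finset.sum_add_distrib]
    refine Finset.sum_congr rfl fun i _ => ?_
    rw [VF.app_mul, map_add, map_mul, map_mul]
    change _ = ρ a * _ + _ * ρ b
    ring, fun c => by
    rw [hD]
    refine Finset.sum_eq_zero fun i _ => ?_
    rw [VF.app_cst, map_zero, mul_zero]⟩ fun l => by
      rw [hD]
      simp only [hx.partial_app]
      rw [Finset.sum_eq_single l]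
      · simp
      · intro i _ hi
        rw [if_neg (Ne.symm hi), map_zero, mul_zero]
      · simp
  rw [e, hD]
  exact Finset.sum_eq_zero fun i _ => by rw [h1, mul_zero]

end Lagrangian

/-! ### The Picard algebroid of a deformation quantization -/

section Tor

theorem StarTriv.c_scalar_mul {k A R : Type u} [Field k] [CommRing A] [Ring R] {φ : k →+* A}
    {σ : k →+* R} {h : R} {P : A → A → A} (t : StarTriv φ σ h P) (m : ℕ) (c : k) (x : R) :
    t.c m (σ c * x) = φ c * t.c m x := by
  change PowerSeries.coeff m (t.η _) = _ * PowerSeries.coeff m (t.η _)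
  rw [t.η_σ, PowerSeries.coeff_C_mul]

theorem StarTriv.c_one_symm {k A R : Type u} [Field k] [CharZero k] [CommRing A] [Ring R]
    {φ : k →+* A} {σ : k →+* R} {h : R} {P : A → A → A} (t : StarTriv φ σ h P) (x y : R) :
    t.c 1 (σ (1 / 2) * (x * y + y * x)) = t.c 0 x * t.c 1 y + t.c 1 x * t.c 0 y := by
  rw [t.c_scalar_mul, map_add, t.c_mul_one, t.c_mul_one, t.bi.swap (t.c 0 x)]
  linear_combination (t.c 0 x * t.c 1 y + t.c 1 x * t.c 0 y) * two_mul_half φ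

variable {k : Type u} [Field k] {X : Scheme.{u}} [X.Over (Spec (.of k))]
  {Y : Scheme.{u}} [Y.Over (Spec (.of k))]

theorem Cocycle.AlgSec.ext_of_le {w : Cocycle k Y} {W : Y.Opens} {x y : w.AlgSec W} (i : w.I)
    (hi : W ≤ w.U i) (h : x.1.1 = y.1.1) (h' : x.1.2 i (Below.self W) hi = y.1.2 i (Below.self W) hi) :
    x = y := by
  refine Cocycle.AlgSec.ext h fun l V hl => ?_
  have h1 := x.2.2 i l V (V.2.trans hi) hl
  have h2 := y.2.2 i l V (V.2.trans hi) hl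
  have h3 := congrArg (rs V.2) h'
  rw [x.2.1 i (Below.self W) V V.2 hi, y.2.1 i (Below.self W) V V.2 hi] at h3
  rw [← h] at h2
  linear_combination h2 - h1 + h3

variable (j : Y ⟶ X) (Q : QuantData k X) (ω : SymplecticForm k X)

/-- A deformation quantization with a cocycle of its first order class, the pull-back of this
cocycle to `Y`, and the consequences of the hypothesis that `Y` is Lagrangian. -/
structure LagDatum where
  z : Cocycle k X
  t : ∀ i, LocalTriv Q ω (z.U i)
  first : IsFirstCocycle z t
  w : Cocycle k Y
  e : w.I → z.I
  pull : IsPullbackCocycle j z w e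
  tangent : ∀ {U : X.Opens} {f : Γ(X, U)}, jres j (le_refl (j ⁻¹ᵁ U)) f = 0 →
    ∃ ξ' : VF k (j ⁻¹ᵁ U), Related j (ω.ham f) ξ'
  unique : ∀ {U : X.Opens} {ξ : VF k U} {ξ' ξ'' : VF k (j ⁻¹ᵁ U)}, Related j ξ ξ' →
    Related j ξ ξ'' → ξ' = ξ''
  lift : ∀ {U : X.Opens} {W : Y.Opens} {y : Y}, y ∈ W → y ∈ j ⁻¹ᵁ U → ∀ ξ' : VF k W,
    ∃ (V : X.Opens) (_ : V ≤ U) (h : j ⁻¹ᵁ V ≤ W), y ∈ j ⁻¹ᵁ V ∧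
      Function.Surjective (jres j (le_refl (j ⁻¹ᵁ V))) ∧ ∃ f : Γ(X, V),
      jres j (le_refl (j ⁻¹ᵁ V)) f = 0 ∧ Related j (ω.ham f) (VF.res h ξ')
  sq : ∀ {U : X.Opens} {f : Γ(X, U)}, jres j (le_refl (j ⁻¹ᵁ U)) f = 0 →
    Related j (ω.ham f) (0 : VF k (j ⁻¹ᵁ U)) → ∀ y ∈ U, ∃ (V : X.Opens) (h : V ≤ U), y ∈ V ∧
      rs h f ∈ RingHom.ker (jres j (le_refl (j ⁻¹ᵁ V))) ^ 2

variable {j Q ω}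

theorem exists_lagDatum [CharZero k] [IsClosedImmersion j] [j.IsOver (Spec (.of k))]
    (hω : IsIsotropic j ω) (n : ℕ) [SmoothOfRelativeDimension (2 * n) (X ↘ Spec (.of k))]
    [SmoothOfRelativeDimension n (Y ↘ Spec (.of k))] (Q : DefQuant ω) :
    Nonempty (LagDatum j Q.toQuantData ω) := by
  obtain ⟨z, t, hz, hx⟩ := Q.exists_firstCocycle (2 * n)
  obtain ⟨w, e, hw⟩ := exists_pullbackCocycle (j := j) (2 * n) n z hx
  have : Smooth (X ↘ Spec (.of k)) := SmoothOfRelativeDimension.smooth (2 * n) _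
  have : Smooth (Y ↘ Spec (.of k)) := SmoothOfRelativeDimension.smooth n _
  refine ⟨⟨z, t, hz, w, e, hw, fun hf => hω.exists_related_ham n hf,
    fun h h' => h.unique le_rfl h', fun hy hy' ξ' => ?_, fun {U f} hf h y hy => ?_⟩⟩
  · obtain ⟨V, hV, hVW, hyV, hA, f, hf⟩ := hω.exists_ham n hy hy' ξ'
    exact ⟨V, hV, hVW, hyV, jres_surjective hA, f, hf⟩
  · obtain ⟨V, hV, hyV, x, hx⟩ := exists_isCoordOn (k := k) (2 * n) hy
    refine ⟨V, hV, hyV, mem_sq_of_related_zero (ω := ω) hx ?_ ?_⟩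
    · rw [jres_rs, ← rs_jres le_rfl (preimage_le j hV), hf, map_zero]
    · rw [← ω.ham_res]
      exact h.res hV (preimage_le j hV)

theorem le_preimage_inf {V : Y.Opens} {U U' : X.Opens} (h : V ≤ j ⁻¹ᵁ U) (h' : V ≤ j ⁻¹ᵁ U') :
    V ≤ j ⁻¹ᵁ (U ⊓ U') := fun _ hy => ⟨h hy, h' hy⟩

theorem QuantData.jres_red (U : X.Opens) (x : Q.ideal j U) :
    jres j (le_refl (j ⁻¹ᵁ U)) (Q.red U x.1) = 0 := x.2

theorem QuantData.mem_ideal {U : X.Opens} {x : Q.Sec U} :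
    x ∈ Q.ideal j U ↔ jres j (le_refl (j ⁻¹ᵁ U)) (Q.red U x) = 0 := Iff.rfl

theorem QuantData.res_mem_ideal {U V : X.Opens} (h : V ≤ U) (x : Q.ideal j U) :
    Q.res h x.1 ∈ Q.ideal j V := by
  rw [QuantData.mem_ideal, Q.red_res', jres_rs, ← rs_jres le_rfl (preimage_le j h), Q.jres_red,
    map_zero]

namespace LagDatum

variable (D : LagDatum j Q ω)

/-- The restriction to `Y` of the Hamiltonian vector field of a section of the ideal. -/
def tan {U : X.Opens} (x : Q.ideal j U) : VF k (j ⁻¹ᵁ U) := (D.tangent (Q.jres_red U x)).choose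

theorem related_tan {U : X.Opens} (x : Q.ideal j U) : Related j (ω.ham (Q.red U x.1)) (D.tan x) :=
  (D.tangent (Q.jres_red U x)).choose_spec

theorem tan_eq {U : X.Opens} {x : Q.ideal j U} {ξ' : VF k (j ⁻¹ᵁ U)}
    (h : Related j (ω.ham (Q.red U x.1)) ξ') : D.tan x = ξ' := D.unique (D.related_tan x) h

theorem tan_add {U : X.Opens} (x y : Q.ideal j U) : D.tan (x + y) = D.tan x + D.tan y := by
  refine D.tan_eq ?_
  have : Q.red U (x + y).1 = Q.red U x.1 + Q.red U y.1 := map_add _ _ _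
  rw [this, ω.ham_add]
  exact (D.related_tan x).add (D.related_tan y)

theorem tan_res {U V : X.Opens} (h : V ≤ U) (x : Q.ideal j U) (y : Q.ideal j V)
    (hy : y.1 = Q.res h x.1) : D.tan y = VF.res (preimage_le j h) (D.tan x) := by
  refine D.tan_eq ?_
  rw [hy, Q.red_res', ← ω.ham_res]
  exact (D.related_tan x).res h _

/-- The trivialization with index `i` over an open `P`. -/
def triv {P : X.Opens} (i : D.w.I) (hP : P ≤ D.z.U (D.e i)) :
    StarTriv (cst k P) ((Q.scalar P).comp (PowerSeries.C (R := k))) (Q.hbar P)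
      (ω.poisson (U := P)) := (D.t (D.e i)).star ⟨P, hP⟩

theorem triv_c_zero {P : X.Opens} (i : D.w.I) (hP : P ≤ D.z.U (D.e i)) (x : Q.Sec P) :
    (D.triv i hP).c 0 x = Q.red P x := (D.t (D.e i)).c_zero ⟨P, hP⟩ x

theorem triv_c_res {P P' : X.Opens} (i : D.w.I) (hP : P ≤ D.z.U (D.e i)) (h : P' ≤ P) (m : ℕ)
    (x : Q.Sec P) : rs h ((D.triv i hP).c m x) = (D.triv i (h.trans hP)).c m (Q.res h x) :=
  (D.t (D.e i)).c_res ⟨P, hP⟩ ⟨P', h.trans hP⟩ h m x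

/-- The coefficient of `h` of a section of the ideal, restricted to `Y`. -/
def coef {U : X.Opens} (i : D.w.I) (V : Below (j ⁻¹ᵁ U)) (hi : V.1 ≤ D.w.U i) :
    Q.Sec U →+ Γ(Y, V.1) :=
  (jres j (le_preimage_inf V.2 (hi.trans (D.pull.le i)))).toAddMonoidHom.comp
      (((D.triv i (inf_le_right : U ⊓ D.z.U (D.e i) ≤ _)).c 1).comp
        (Q.res (inf_le_left : U ⊓ D.z.U (D.e i) ≤ U)).toAddMonoidHom)

theorem coef_eq {U : X.Opens} (i : D.w.I) (V : Below (j ⁻¹ᵁ U)) (hi : V.1 ≤ D.w.U i) {P : X.Opens}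
    (hU : P ≤ U) (hP : P ≤ D.z.U (D.e i)) (hV : V.1 ≤ j ⁻¹ᵁ P) (x : Q.Sec U) :
    D.coef i V hi x = jres j hV ((D.triv i hP).c 1 (Q.res hU x)) := by
  have h1 := D.triv_c_res i (inf_le_right : U ⊓ D.z.U (D.e i) ≤ _) (le_inf hU hP) 1
    (Q.res (inf_le_left : U ⊓ D.z.U (D.e i) ≤ U) x)
  rw [Q.res_res] at h1
  rw [← h1, jres_rs]
  rfl

/-- The class of a section of the ideal in the algebroid. -/
def cls {U : X.Opens} : Q.ideal j U →+ D.w.AlgSec (j ⁻¹ᵁ U) :=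
  AddMonoidHom.mk' (fun x => ⟨(D.tan x, fun i V hi => D.coef i V hi x.1), fun i V V' h hi => by
      change rs h (D.coef i V hi x.1) = D.coef i V' _ x.1
      rw [D.coef_eq i V hi (inf_le_left : U ⊓ D.z.U (D.e i) ≤ U) inf_le_right
        (le_preimage_inf V.2 (hi.trans (D.pull.le i))), D.coef_eq i V' (h.trans hi)
        (inf_le_left : U ⊓ D.z.U (D.e i) ≤ U) inf_le_right
        (le_preimage_inf V'.2 ((h.trans hi).trans (D.pull.le i))), rs_jres], fun i l V hi hl => by
      change D.coef i V hi x.1 - D.coef l V hl x.1 = _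
      have h1 : U ⊓ (D.z.U (D.e i) ⊓ D.z.U (D.e l)) ≤ U := inf_le_left
      have h2 : U ⊓ (D.z.U (D.e i) ⊓ D.z.U (D.e l)) ≤ D.z.U (D.e i) ⊓ D.z.U (D.e l) := inf_le_right
      have hV : V.1 ≤ j ⁻¹ᵁ (U ⊓ (D.z.U (D.e i) ⊓ D.z.U (D.e l))) :=
        le_preimage_inf V.2 (le_preimage_inf (hi.trans (D.pull.le i)) (hl.trans (D.pull.le l)))
      generalize U ⊓ (D.z.U (D.e i) ⊓ D.z.U (D.e l)) = P at h1 h2 hV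
      rw [D.coef_eq i V hi h1 (h2.trans inf_le_left) hV,
        D.coef_eq l V hl h1 (h2.trans inf_le_right) hV, ← map_sub]
      have h3 := (D.triv i (h2.trans inf_le_left)).c_one_eq (D.triv l (h2.trans inf_le_right))
        (fun x => (D.triv_c_zero i _ x).trans (D.triv_c_zero l _ x).symm) (Q.res h1 x.1)
      rw [h3, add_sub_cancel_left, D.triv_c_zero]
      have h4 := D.first.trans (D.e i) (D.e l) ⟨P, h2⟩ (Q.red P (Q.res h1 x.1))
      refine (congrArg (jres j hV) h4.symm).trans ?_
      refine (D.pull.trans i l).apply1 ⟨P, h2⟩ ⟨V.1, le_inf hi hl⟩ hV ?_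
      rw [Q.red_res', ← ω.ham_res]
      exact (D.related_tan x).res h1 V.2⟩)
    fun x y => Cocycle.AlgSec.ext (D.tan_add x y) fun i V hi => map_add (D.coef i V hi) x.1 y.1

theorem cls_snd {U : X.Opens} (x : Q.ideal j U) (i : D.w.I) (V : Below (j ⁻¹ᵁ U))
    (hi : V.1 ≤ D.w.U i) : (D.cls x).1.2 i V hi = D.coef i V hi x.1 := rfl

theorem cls_res {U V : X.Opens} (h : V ≤ U) (x : Q.ideal j U) (y : Q.ideal j V)
    (hy : y.1 = Q.res h x.1) : D.cls y = Cocycle.AlgSec.res (preimage_le j h) (D.cls x) := by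
  refine Cocycle.AlgSec.ext (D.tan_res h x y hy) fun i W hi => ?_
  change D.coef i W hi y.1 = D.coef i (W.up (preimage_le j h)) hi x.1
  rw [D.coef_eq i W hi (inf_le_left : V ⊓ D.z.U (D.e i) ≤ V) inf_le_right
    (le_preimage_inf W.2 (hi.trans (D.pull.le i))), hy, Q.res_res]
  exact (D.coef_eq i (W.up (preimage_le j h)) hi (inf_le_left.trans h : V ⊓ D.z.U (D.e i) ≤ U)
    inf_le_right (le_preimage_inf W.2 (hi.trans (D.pull.le i))) x.1).symm

/-- Two sections of the algebroid agree if they agree over a member of the cover. -/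
theorem exists_nhd (U : X.Opens) {y : X} (hy : y ∈ U) :
    ∃ (i : D.w.I), y ∈ U ⊓ D.z.U (D.e i) := by
  obtain ⟨l, hl⟩ := D.z.cover y
  obtain ⟨i, rfl⟩ := D.pull.surjective l
  exact ⟨i, hy, hl⟩

theorem red_of_comm [CharZero k] (D : LagDatum j Q ω) {U : X.Opens} {x y z : Q.Sec U}
    (e : Q.hbar U * z = x * y - y * x) : Q.red U z = ω.poisson (Q.red U x) (Q.red U y) := by
  refine rs_ext fun p hp => ?_
  obtain ⟨i, hi⟩ := D.exists_nhd U hp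
  refine ⟨_, inf_le_left, hi, ?_⟩
  have e' := congrArg (Q.res (inf_le_left : U ⊓ D.z.U (D.e i) ≤ U)) e
  rw [map_mul, map_sub, map_mul, map_mul, Q.res_hbar] at e'
  have := (D.triv i (inf_le_right : U ⊓ D.z.U (D.e i) ≤ _)).c_zero_of_comm e'
  rw [D.triv_c_zero, D.triv_c_zero, D.triv_c_zero, Q.red_res', Q.red_res', Q.red_res',
    ← ω.poisson_res] at this
  exact this

theorem ham_poisson [CharZero k] (D : LagDatum j Q ω) {U : X.Opens} (a b : Γ(X, U)) :
    ω.ham (ω.poisson a b) = (ω.ham a).comm (ω.ham b) := by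
  refine tangentMod_isSep _ _ _ fun p hp => ?_
  obtain ⟨i, hi⟩ := D.exists_nhd U hp
  refine ⟨_, inf_le_left, hi, ?_⟩
  change VF.res _ _ = VF.res _ _
  rw [VF.res_comm, ω.ham_res, ω.ham_res, ω.ham_res, ω.poisson_res]
  exact ((D.t (D.e i)).comm_ham ⟨U ⊓ D.z.U (D.e i), inf_le_right⟩ _ _).symm

theorem jres_poisson {U : X.Opens} (x : Q.ideal j U) {W : Y.Opens} (h : W ≤ j ⁻¹ᵁ U) (g : Γ(X, U)) :
    jres j h (ω.poisson (Q.red U x.1) g) = (D.tan x).1 ⟨W, h⟩ (jres j h g) := by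
  rw [← ω.ham_app]
  exact D.related_tan x (Below.self U) ⟨W, h⟩ h g

theorem related_ham_mul {U : X.Opens} {f g : Γ(X, U)} (hf : jres j (le_refl (j ⁻¹ᵁ U)) f = 0)
    {ξ' : VF k (j ⁻¹ᵁ U)} (hξ : Related j (ω.ham f) ξ') :
    Related j (ω.ham (g * f)) (jres j (le_refl (j ⁻¹ᵁ U)) g • ξ') := by
  intro P P' hP a
  rw [ω.ham_mul, VF.add_val, VF.smul_val, VF.smul_val, VF.smul_val, map_add, map_mul, map_mul,
    hξ P P' hP, jres_rs, jres_rs, rs_jres, ← rs_jres le_rfl (hP.trans (preimage_le j P.2)) f, hf,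
    map_zero, zero_mul, add_zero]

theorem cls_bracket [CharZero k] {U : X.Opens} (x y z : Q.ideal j U)
    (e : Q.hbar U * z.1 = x.1 * y.1 - y.1 * x.1) : (D.cls x).comm (D.cls y) = D.cls z := by
  refine Cocycle.AlgSec.ext (D.tan_eq ?_).symm fun i V hi => ?_
  · rw [D.red_of_comm e, D.ham_poisson]
    exact (D.related_tan x).comm (D.related_tan y)
  · have h1 : U ⊓ D.z.U (D.e i) ≤ U := inf_le_left
    have h2 : U ⊓ D.z.U (D.e i) ≤ D.z.U (D.e i) := inf_le_right
    have hV : V.1 ≤ j ⁻¹ᵁ (U ⊓ D.z.U (D.e i)) := le_preimage_inf V.2 (hi.trans (D.pull.le i))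
    generalize U ⊓ D.z.U (D.e i) = P at h1 h2 hV
    rw [Cocycle.AlgSec.comm_snd, cls_snd, cls_snd, cls_snd, D.coef_eq i V hi h1 h2 hV,
      D.coef_eq i V hi h1 h2 hV, D.coef_eq i V hi h1 h2 hV]
    have e' := congrArg (Q.res h1) e
    rw [map_mul, map_sub, map_mul, map_mul, Q.res_hbar] at e'
    have h3 := (D.triv i h2).c_one_of_comm e'
    have hx := D.jres_poisson ⟨_, Q.res_mem_ideal h1 x⟩ hV ((D.triv i h2).c 1 (Q.res h1 y.1))
    have hy := D.jres_poisson ⟨_, Q.res_mem_ideal h1 y⟩ hV ((D.triv i h2).c 1 (Q.res h1 x.1))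
    rw [D.tan_res h1 x _ rfl] at hx
    rw [D.tan_res h1 y _ rfl] at hy
    have hs := (ω.poisson_isBiDer (U := P)).swap ((D.triv i h2).c 1 (Q.res h1 x.1))
      (Q.red P (Q.res h1 y.1))
    have hκ := D.first.form (D.e i) ⟨P, h2⟩ (Q.red P (Q.res h1 x.1)) (Q.red P (Q.res h1 y.1))
    have hκ' := (D.pull.form i).apply2 ⟨P, h2⟩ ⟨V.1, hi⟩ hV
      ((D.related_tan ⟨_, Q.res_mem_ideal h1 x⟩).res le_rfl hV)
      ((D.related_tan ⟨_, Q.res_mem_ideal h1 y⟩).res le_rfl hV)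
    rw [D.tan_res h1 x _ rfl, D.tan_res h1 y _ rfl] at hκ'
    have hκ'' := (congrArg (jres j hV) hκ).symm.trans hκ'
    rw [h3, D.triv_c_zero, D.triv_c_zero, hs, map_add, map_add, map_neg]
    refine Eq.trans ?_ (congrArg₂ _ (congrArg₂ _ hκ''.symm (congrArg Neg.neg hy.symm)) hx.symm)
    change (D.tan x).1 V _ - (D.tan y).1 V _ + formAt (D.w.form i) ⟨V.1, hi⟩
      ![VF.res V.2 (D.tan x), VF.res V.2 (D.tan y)] = formAt (D.w.form i) ⟨V.1, hi⟩
      ![VF.res V.2 (D.tan x), VF.res V.2 (D.tan y)] + -(D.tan y).1 V _ + (D.tan x).1 V _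
    ring

end LagDatum

end Tor

section Tor

variable {k : Type u} [Field k] {X : Scheme.{u}} [X.Over (Spec (.of k))]
  {Y : Scheme.{u}} [Y.Over (Spec (.of k))] {j : Y ⟶ X} {Q : QuantData k X} {ω : SymplecticForm k X}

namespace LagDatum

variable (D : LagDatum j Q ω)

theorem related_zero {U : X.Opens} : Related j (ω.ham (0 : Γ(X, U))) (0 : VF k (j ⁻¹ᵁ U)) := by
  have : ω.ham (0 : Γ(X, U)) = 0 := by
    have := ω.ham_cst (U := U) 0
    rwa [map_zero] at this
  rw [this]
  exact fun P P' h f => map_zero _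

theorem exists_fun {U : X.Opens} {W : Y.Opens} {y : Y} (hy : y ∈ W) (hy' : y ∈ j ⁻¹ᵁ U)
    (g : Γ(Y, W)) : ∃ (V : X.Opens) (_ : V ≤ U) (h : j ⁻¹ᵁ V ≤ W) (i : D.w.I)
      (_ : V ≤ D.z.U (D.e i)), y ∈ j ⁻¹ᵁ V ∧ ∃ F : Q.Sec V,
        jres j (le_refl (j ⁻¹ᵁ V)) (Q.red V F) = rs h g := by
  obtain ⟨i, hi⟩ := D.exists_nhd U (y := j y) hy'
  obtain ⟨V, hV, h, hyV, hs, -⟩ := D.lift (U := U ⊓ D.z.U (D.e i)) hy hi 0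
  obtain ⟨f, hf⟩ := hs (rs h g)
  refine ⟨V, hV.trans inf_le_left, h, i, hV.trans inf_le_right, hyV,
    (D.triv i (hV.trans inf_le_right)).s f, ?_⟩
  rw [← D.triv_c_zero i (hV.trans inf_le_right), StarTriv.c_s_zero, hf]

theorem exists_comm {V : X.Opens} (i : D.w.I) (hi : V ≤ D.z.U (D.e i)) (x y : Q.Sec V) :
    ∃ z, Q.hbar V * z = x * y - y * x := by
  obtain ⟨z, hz⟩ := (D.triv i hi).exists_comm x y
  exact ⟨z, hz.symm⟩

theorem mem_ideal_of_comm [CharZero k] (D : LagDatum j Q ω) {U : X.Opens} (x y : Q.ideal j U)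
    {z : Q.Sec U} (e : Q.hbar U * z = x.1 * y.1 - y.1 * x.1) : z ∈ Q.ideal j U := by
  rw [QuantData.mem_ideal, D.red_of_comm e, D.jres_poisson x le_rfl, Q.jres_red]
  exact map_zero _

theorem cls_snd_eq_zero [CharZero k] (D : LagDatum j Q ω) {U : X.Opens} (x y : Q.ideal j U)
    (i : D.w.I) (V : Below (j ⁻¹ᵁ U)) (hi : V.1 ≤ D.w.U i) : D.coef i V hi (x.1 * y.1) = 0 := by
  have hz : ∀ x : Q.ideal j U, jres j V.2 (Q.red U x.1) = 0 := fun x => by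
    rw [← rs_jres le_rfl V.2, Q.jres_red, map_zero]
  rw [D.coef_eq i V hi (inf_le_left : U ⊓ D.z.U (D.e i) ≤ U) inf_le_right
    (le_preimage_inf V.2 (hi.trans (D.pull.le i))), map_mul, StarTriv.c_mul_one, D.triv_c_zero,
    D.triv_c_zero, Q.red_res', Q.red_res', ← ω.poisson_res, map_add, map_add, map_mul, map_mul,
    map_mul, jres_rs, jres_rs, jres_rs, hz, hz, D.jres_poisson x V.2, hz, map_zero]
  ring

theorem idealSq_le [CharZero k] (D : LagDatum j Q ω) {U : X.Opens} {x : Q.Sec U}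
    (hx : x ∈ Q.idealSq j U) : ∃ h : x ∈ Q.ideal j U, D.cls ⟨x, h⟩ = 0 := by
  have h1 : Q.idealSq j U ≤ (D.cls (U := U)).ker.map (Q.ideal j U).toAddSubgroup.subtype := by
    rw [QuantData.idealSq, AddSubgroup.closure_le]
    rintro _ ⟨a, ha, b, hb, rfl⟩
    refine ⟨⟨a * b, (Q.ideal j U).mul_mem_left a hb⟩, ?_, rfl⟩
    refine Cocycle.AlgSec.ext (D.tan_eq ?_) fun i V hi => D.cls_snd_eq_zero ⟨a, ha⟩ ⟨b, hb⟩ i V hi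
    have h2 := related_ham_mul (j := j) (g := Q.red U a) hb (D.related_tan ⟨b, hb⟩)
    have h3 : jres j (le_refl (j ⁻¹ᵁ U)) (Q.red U a) = 0 := ha
    have h4 : (0 : Γ(Y, j ⁻¹ᵁ U)) • D.tan ⟨b, hb⟩ = 0 := zero_smul Γ(Y, j ⁻¹ᵁ U) (D.tan ⟨b, hb⟩)
    rw [h3, h4, ← map_mul] at h2
    exact h2
  obtain ⟨⟨y, hy⟩, hy', rfl⟩ := h1 hx
  exact ⟨hy, hy'⟩

theorem exists_mem_idealSq [CharZero k] (D : LagDatum j Q ω) {U : X.Opens} (x : Q.ideal j U)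
    (hx : D.cls x = 0) {y : X} (hy : y ∈ U) :
    ∃ (V : X.Opens) (h : V ≤ U), y ∈ V ∧ Q.res h x.1 ∈ Q.idealSq j V := by
  obtain ⟨i, hi⟩ := D.exists_nhd U hy
  have h0 : Related j (ω.ham (Q.red U x.1)) (0 : VF k (j ⁻¹ᵁ U)) := by
    have h1 := D.related_tan x
    have h2 : D.tan x = 0 := congrArg (fun a : D.w.AlgSec (j ⁻¹ᵁ U) => a.1.1) hx
    rwa [h2] at h1
  have hP : U ⊓ D.z.U (D.e i) ≤ U := inf_le_left
  obtain ⟨V, hV, hyV, hsq⟩ := D.sq (U := U ⊓ D.z.U (D.e i)) (f := rs hP (Q.red U x.1)) (by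
    rw [jres_rs, ← rs_jres le_rfl (preimage_le j hP), Q.jres_red, map_zero]) (by
    rw [← ω.ham_res]
    exact h0.res hP (preimage_le j hP)) y hi
  have hVU := hV.trans hP
  have hVi : V ≤ D.z.U (D.e i) := hV.trans inf_le_right
  have hVw : j ⁻¹ᵁ V ≤ D.w.U i := by rw [D.pull.U_eq]; exact preimage_le j hVi
  refine ⟨V, hVU, hyV, ?_⟩
  let s := (D.triv i hVi).s
  have hs : ∀ f : Γ(X, V), jres j (le_refl (j ⁻¹ᵁ V)) f = 0 → s f ∈ Q.ideal j V := fun f hf => by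
    rw [QuantData.mem_ideal, ← D.triv_c_zero i hVi, StarTriv.c_s_zero, hf]
  have key : ∀ f : Γ(X, V), f ∈ RingHom.ker (jres j (le_refl (j ⁻¹ᵁ V))) ^ 2 →
      ∃ b ∈ Q.idealSq j V, Q.red V b = f := by
    intro f hf
    rw [pow_two] at hf
    refine Submodule.mul_induction_on hf (fun a ha b hb => ?_) fun a b ha hb => ?_
    · refine ⟨s a * s b, AddSubgroup.subset_closure ⟨_, hs a ha, _, hs b hb, rfl⟩, ?_⟩
      rw [map_mul, ← D.triv_c_zero i hVi, ← D.triv_c_zero i hVi, StarTriv.c_s_zero,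
        StarTriv.c_s_zero]
    · obtain ⟨a', ha', rfl⟩ := ha
      obtain ⟨b', hb', rfl⟩ := hb
      exact ⟨a' + b', AddSubgroup.add_mem _ ha' hb', map_add _ _ _⟩
  obtain ⟨b, hb, hbx⟩ := key _ hsq
  obtain ⟨hb', hb0⟩ := D.idealSq_le hb
  obtain ⟨g, hg⟩ := (D.triv i hVi).exists_div (x := Q.res hVU x.1 - b) (by
    rw [map_sub, D.triv_c_zero, D.triv_c_zero, hbx, Q.red_res', rs_rs, sub_self])
  have hgI : g ∈ Q.ideal j V := by
    have h1 : D.cls (⟨Q.res hVU x.1, Q.res_mem_ideal hVU x⟩ - ⟨b, hb'⟩ : Q.ideal j V) = 0 := by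
      rw [map_sub, hb0, D.cls_res hVU x _ rfl, hx, map_zero, sub_zero]
    have h2 : D.coef i (Below.self (j ⁻¹ᵁ V)) hVw (Q.res hVU x.1 - b) = 0 :=
      congrArg (fun a : D.w.AlgSec (j ⁻¹ᵁ V) => a.1.2 i (Below.self (j ⁻¹ᵁ V)) hVw) h1
    rw [D.coef_eq i (Below.self (j ⁻¹ᵁ V)) hVw le_rfl hVi le_rfl, Q.res_id, hg, StarTriv.c_h_succ,
      D.triv_c_zero] at h2
    exact h2
  have hh : Q.hbar V ∈ Q.ideal j V := by
    rw [QuantData.mem_ideal, Q.red_hbar, map_zero]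
  rw [← sub_add_cancel (Q.res hVU x.1) b, hg]
  exact AddSubgroup.add_mem _ (AddSubgroup.subset_closure ⟨_, hh, _, hgI, rfl⟩) hb

theorem exists_cls {W : Y.Opens} (l : D.w.AlgSec W) {y : Y} (hy : y ∈ W) :
    ∃ (U : X.Opens) (h : j ⁻¹ᵁ U ≤ W), y ∈ j ⁻¹ᵁ U ∧
      ∃ x : Q.ideal j U, D.cls x = Cocycle.AlgSec.res h l := by
  obtain ⟨i, hi⟩ := D.w.cover y
  obtain ⟨V, hV, h, hyV, hs, f, hf, hfl⟩ := D.lift (U := D.z.U (D.e i)) hy (D.pull.le i hi) l.1.1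
  have hVw : j ⁻¹ᵁ V ≤ D.w.U i := by rw [D.pull.U_eq]; exact preimage_le j hV
  obtain ⟨g, hg⟩ := hs (l.1.2 i ⟨_, h⟩ hVw)
  let t := D.triv i hV
  have hx : Q.red V (t.s f + Q.hbar V * t.s g) = f := by
    rw [← D.triv_c_zero i hV, map_add, StarTriv.c_h_zero, StarTriv.c_s_zero, add_zero]
  refine ⟨V, h, hyV, ⟨t.s f + Q.hbar V * t.s g, ?_⟩, Cocycle.AlgSec.ext_of_le i hVw
    (D.tan_eq ?_) ?_⟩
  · rw [QuantData.mem_ideal, hx, hf]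
  · rw [hx]
    exact hfl
  · change D.coef i (Below.self (j ⁻¹ᵁ V)) hVw _ = l.1.2 i ⟨_, h⟩ hVw
    rw [D.coef_eq i (Below.self (j ⁻¹ᵁ V)) hVw le_rfl hV le_rfl, Q.res_id, ← hg, map_add,
      StarTriv.c_s_succ, StarTriv.c_h_succ, zero_add, StarTriv.c_s_zero]

theorem cls_smul [CharZero k] (D : LagDatum j Q ω) {U : X.Opens} (f : Q.Sec U) (x y : Q.ideal j U)
    (e : y.1 = Q.scalar U (PowerSeries.C (1 / 2)) * (f * x.1 + x.1 * f)) :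
    jres j (le_refl (j ⁻¹ᵁ U)) (Q.red U f) • D.cls x = D.cls y := by
  have hr : Q.red U y.1 = Q.red U f * Q.red U x.1 := by
    rw [e, map_mul, map_add, map_mul, map_mul, Q.red_scalar, PowerSeries.constantCoeff_C]
    linear_combination (Q.red U f * Q.red U x.1) * two_mul_half (cst k U)
  refine Cocycle.AlgSec.ext (D.tan_eq ?_).symm fun i V hi => ?_
  · rw [hr]
    exact related_ham_mul x.2 (D.related_tan x)
  · have h1 : U ⊓ D.z.U (D.e i) ≤ U := inf_le_left
    have h2 : U ⊓ D.z.U (D.e i) ≤ D.z.U (D.e i) := inf_le_right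
    have hV : V.1 ≤ j ⁻¹ᵁ (U ⊓ D.z.U (D.e i)) := le_preimage_inf V.2 (hi.trans (D.pull.le i))
    generalize U ⊓ D.z.U (D.e i) = P at h1 h2 hV
    rw [Cocycle.AlgSec.smul_snd, cls_snd, cls_snd, D.coef_eq i V hi h1 h2 hV,
      D.coef_eq i V hi h1 h2 hV, e, map_mul (Q.res h1),
      map_add (Q.res h1), map_mul (Q.res h1), map_mul (Q.res h1), Q.res_scalar]
    have h3 := (D.triv i h2).c_one_symm (Q.res h1 f) (Q.res h1 x.1)
    rw [D.triv_c_zero, D.triv_c_zero] at h3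
    have h5 : jres j hV (Q.red P (Q.res h1 x.1)) = 0 := by
      rw [Q.red_res', jres_rs, ← rs_jres le_rfl V.2, Q.jres_red, map_zero]
    have h6 : rs V.2 (jres j (le_refl (j ⁻¹ᵁ U)) (Q.red U f)) = jres j hV (Q.red P (Q.res h1 f)) := by
      rw [Q.red_res', jres_rs, rs_jres]
    refine Eq.trans ?_ (congrArg (jres j hV) h3.symm)
    rw [h6, map_add, map_mul, map_mul, h5, mul_zero, add_zero]

theorem cls_anchor [CharZero k] (D : LagDatum j Q ω) {U : X.Opens} (x : Q.ideal j U)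
    {f g : Q.Sec U} (e : Q.hbar U * g = x.1 * f - f * x.1) :
    (D.tan x).app (jres j le_rfl (Q.red U f)) = jres j le_rfl (Q.red U g) := by
  rw [D.red_of_comm e, D.jres_poisson x le_rfl]
  rfl

/-- The quotient of the ideal by its square. -/
def torAlgebroid [CharZero k] : TorAlgebroid j Q where
  alg := D.w.alg
  isSheaf := D.w.alg_isSheaf
  q U := D.cls
  q_res h x y e := D.cls_res h x y e
  q_surjective W l y hy := D.exists_cls l hy
  q_eq_zero U x := by
    refine ⟨fun hx y hy => D.exists_mem_idealSq x hx hy, fun hx => ?_⟩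
    refine D.w.alg_isSheaf.isSep _ _ _ fun y hy => ?_
    obtain ⟨V, hV, hyV, h⟩ := hx (j y) hy
    obtain ⟨h', h0⟩ := D.idealSq_le h
    refine ⟨j ⁻¹ᵁ V, preimage_le j hV, hyV, ?_⟩
    exact (D.cls_res hV x ⟨_, h'⟩ rfl).symm.trans (h0.trans (map_zero _).symm)
  q_bracket U x y z e := D.cls_bracket x y z e
  q_smul U f x y e := D.cls_smul f x y e
  q_anchor U x f g e := D.cls_anchor x e
  q_unit U f x e := by
    refine Cocycle.AlgSec.ext (D.tan_eq ?_).symm fun i V hi => ?_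
    · rw [e, map_mul, Q.red_hbar, zero_mul]
      exact related_zero
    · change rs V.2 _ = D.coef i V hi x.1
      rw [D.coef_eq i V hi (inf_le_left : U ⊓ D.z.U (D.e i) ≤ U) inf_le_right
        (le_preimage_inf V.2 (hi.trans (D.pull.le i))), e, map_mul, Q.res_hbar, StarTriv.c_h_succ,
        D.triv_c_zero, Q.red_res', jres_rs, rs_jres]

end LagDatum

end Tor

/-! ### Uniqueness of the Picard algebroid of a deformation quantization -/

section TorUnique

variable {k : Type u} [Field k] {X : Scheme.{u}} [X.Over (Spec (.of k))]
  {Y : Scheme.{u}} [Y.Over (Spec (.of k))] {j : Y ⟶ X} {Q : QuantData k X} {ω : SymplecticForm k X}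

/-- An isomorphism of Lie algebroids under `𝒪_Y`, as a pair of mutually inverse morphisms. -/
structure UnitalAlgebroid.Iso (L L' : UnitalAlgebroid k Y) where
  hom : LieAlgebroid.Hom L.toLieAlgebroid L'.toLieAlgebroid
  inv : LieAlgebroid.Hom L'.toLieAlgebroid L.toLieAlgebroid
  hom_inv : ∀ U x, inv.app U (hom.app U x) = x
  inv_hom : ∀ U x, hom.app U (inv.app U x) = x
  hom_unit : ∀ U f, hom.app U (L.unit U f) = L'.unit U f

namespace UnitalAlgebroid.Iso

variable {L L' : UnitalAlgebroid k Y} (φ : L.Iso L')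

theorem inv_unit (U : Y.Opens) (f : Γ(Y, U)) : φ.inv.app U (L'.unit U f) = L.unit U f := by
  rw [← φ.hom_unit, φ.hom_inv]

theorem isPicard (φ : L.Iso L') (hL : L.toModPresheaf.IsSheaf) (h : L'.IsPicard) : L.IsPicard where
  isSheaf := hL
  injective U f g e := h.injective U (by rw [← φ.hom_unit, e, φ.hom_unit])
  exact U x hx := by
    obtain ⟨f, hf⟩ := h.exact U (φ.hom.app U x) (by rw [φ.hom.anchor_app, hx])
    exact ⟨f, by rw [← φ.inv_unit, hf, φ.hom_inv]⟩
  surjective U ξ y hy := by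
    obtain ⟨V, hV, hyV, x, hx⟩ := h.surjective U ξ y hy
    exact ⟨V, hV, hyV, φ.inv.app V x, by rw [φ.inv.anchor_app, hx]⟩

/-- The transport of a splitting along an isomorphism. -/
def splitting {U : Y.Opens} (s : Splitting L' U) : Splitting L U where
  app V := (φ.inv.app V.1).comp (s.app V)
  app_res V W hh ξ := by
    change φ.inv.app W.1 (s.app W (VF.res hh ξ)) = L.res hh (φ.inv.app V.1 (s.app V ξ))
    exact (congrArg (φ.inv.app W.1) (s.app_res V W hh ξ)).trans (φ.inv.app_res hh _)
  anchor_app V ξ := by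
    change L.anchor V.1 (φ.inv.app V.1 (s.app V ξ)) = ξ
    exact (φ.inv.anchor_app V.1 _).trans (s.anchor_app V ξ)

theorem represents (φ : L.Iso L') {w : Cocycle k Y} (h : Represents L' w) : Represents L w := by
  obtain ⟨s, h1, h2⟩ := h
  refine ⟨fun i => φ.splitting (s i), fun i V ξ η => ?_, fun i l V ξ => ?_⟩
  · change _ = L.bracket V.1 (φ.inv.app V.1 ((s i).app V ξ)) (φ.inv.app V.1 ((s i).app V η)) -
      φ.inv.app V.1 ((s i).app V (ξ.comm η))
    have h3 := congrArg (φ.inv.app V.1) (h1 i V ξ η)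
    rw [map_sub, φ.inv.app_bracket, φ.inv_unit] at h3
    exact h3
  · change _ = φ.inv.app V.1 ((s l).app (V.up inf_le_right) ξ) -
      φ.inv.app V.1 ((s i).app (V.up inf_le_left) ξ)
    have h3 := congrArg (φ.inv.app V.1) (h2 i l V ξ)
    rw [map_sub, φ.inv_unit] at h3
    exact h3

end UnitalAlgebroid.Iso

namespace LagDatum

/-- The anchor of the algebroid of a deformation quantization. -/
theorem anchor_q [CharZero k] (D : LagDatum j Q ω) (T : TorAlgebroid j Q) {U : X.Opens}
    (x : Q.ideal j U) : T.alg.anchor _ (T.q U x) = D.tan x := by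
  refine VF.ext fun P a => rs_ext fun y hy => ?_
  obtain ⟨V, hV, h, i, hi, hyV, F, hF⟩ := D.exists_fun hy (P.2 hy) a
  refine ⟨j ⁻¹ᵁ V, h, hyV, ?_⟩
  obtain ⟨g, hg⟩ := D.exists_comm i hi (Q.res hV x.1) F
  let x' : Q.ideal j V := ⟨Q.res hV x.1, Q.res_mem_ideal hV x⟩
  have h1 := T.q_anchor V x' F g hg
  rw [← D.cls_anchor x' hg, hF] at h1
  rw [(T.alg.anchor _ (T.q U x)).2.2.2 P ⟨j ⁻¹ᵁ V, h.trans P.2⟩ h,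
    (D.tan x).2.2.2 P ⟨j ⁻¹ᵁ V, h.trans P.2⟩ h]
  rw [T.q_res hV x x' rfl, T.alg.anchor_res, D.tan_res hV x x' rfl] at h1
  exact h1

/-- Sections of two quotients of the ideal with a common representative. -/
def SameClass (T T' : TorAlgebroid j Q) (W : Y.Opens) (x : T.alg.Sec W) (x' : T'.alg.Sec W) : Prop :=
  ∃ (U : X.Opens) (h : W ≤ j ⁻¹ᵁ U) (e : Q.ideal j U),
    x = T.alg.res h (T.q U e) ∧ x' = T'.alg.res h (T'.q U e)

theorem q_eq (T : TorAlgebroid j Q) {U P : X.Opens} (h : P ≤ U) (e : Q.ideal j U) :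
    T.q P ⟨Q.res h e.1, Q.res_mem_ideal h e⟩ = T.alg.res (preimage_le j h) (T.q U e) :=
  T.q_res h e _ rfl

theorem sameClass_unique (D : LagDatum j Q ω) (T T' : TorAlgebroid j Q) {W : Y.Opens}
    {x : T.alg.Sec W} {x' x'' : T'.alg.Sec W} (h : SameClass T T' W x x')
    (h' : SameClass T T' W x x'') : x' = x'' := by
  obtain ⟨U, hU, e, rfl, rfl⟩ := h
  obtain ⟨U', hU', e', h2, rfl⟩ := h'
  refine T'.isSheaf.isSep _ _ _ fun y hy => ?_
  obtain ⟨P, hP, hPW, hyP, -⟩ := D.lift (U := U ⊓ U') hy ⟨hU hy, hU' hy⟩ 0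
  refine ⟨j ⁻¹ᵁ P, hPW, hyP, ?_⟩
  have h3 := congrArg (T.alg.res hPW) h2
  rw [T.alg.res_res, T.alg.res_res] at h3
  have h4 := (q_eq T (hP.trans inf_le_left) e).trans
    (h3.trans (q_eq T (hP.trans inf_le_right) e').symm)
  have h5 : T'.q P ⟨_, Q.res_mem_ideal (hP.trans inf_le_left) e⟩ =
      T'.q P ⟨_, Q.res_mem_ideal (hP.trans inf_le_right) e'⟩ := by
    rw [← sub_eq_zero, ← map_sub] at h4 ⊢
    exact (T'.q_eq_zero P _).2 ((T.q_eq_zero P _).1 h4)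
  rw [T'.alg.res_res, T'.alg.res_res]
  exact (q_eq T' (hP.trans inf_le_left) e).symm.trans
    (h5.trans (q_eq T' (hP.trans inf_le_right) e'))

theorem SameClass.res {T T' : TorAlgebroid j Q} {W V : Y.Opens} {x : T.alg.Sec W}
    {x' : T'.alg.Sec W} (h : SameClass T T' W x x') (hV : V ≤ W) :
    SameClass T T' V (T.alg.res hV x) (T'.alg.res hV x') := by
  obtain ⟨U, hU, e, rfl, rfl⟩ := h
  exact ⟨U, hV.trans hU, e, T.alg.res_res _ _ _, T'.alg.res_res _ _ _⟩

theorem SameClass.of_q {T T' : TorAlgebroid j Q} {U : X.Opens} (e : Q.ideal j U) :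
    SameClass T T' (j ⁻¹ᵁ U) (T.q U e) (T'.q U e) :=
  ⟨U, le_rfl, e, (T.alg.res_id _ _).symm, (T'.alg.res_id _ _).symm⟩

/-- Two sections with representatives have representatives over a common small open subscheme. -/
theorem SameClass.exists_two (D : LagDatum j Q ω) {T T' : TorAlgebroid j Q} {W : Y.Opens}
    {x z : T.alg.Sec W} {x' z' : T'.alg.Sec W} (h : SameClass T T' W x x')
    (h' : SameClass T T' W z z') (f : Γ(Y, W)) {y : Y} (hy : y ∈ W) :
    ∃ (P : X.Opens) (hP : j ⁻¹ᵁ P ≤ W) (i : D.w.I) (_ : P ≤ D.z.U (D.e i)), y ∈ j ⁻¹ᵁ P ∧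
      ∃ (e e' : Q.ideal j P) (F : Q.Sec P), jres j (le_refl (j ⁻¹ᵁ P)) (Q.red P F) = rs hP f ∧
        T.alg.res hP x = T.q P e ∧ T'.alg.res hP x' = T'.q P e ∧
        T.alg.res hP z = T.q P e' ∧ T'.alg.res hP z' = T'.q P e' := by
  obtain ⟨U, hU, e, rfl, rfl⟩ := h
  obtain ⟨U', hU', e', rfl, rfl⟩ := h'
  obtain ⟨P, hP, hPW, i, hi, hyP, F, hF⟩ := D.exists_fun (U := U ⊓ U') hy ⟨hU hy, hU' hy⟩ f
  refine ⟨P, hPW, i, hi, hyP, ⟨_, Q.res_mem_ideal (hP.trans inf_le_left) e⟩,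
    ⟨_, Q.res_mem_ideal (hP.trans inf_le_right) e'⟩, F, hF, ?_, ?_, ?_, ?_⟩
  · rw [T.alg.res_res, q_eq T (hP.trans inf_le_left) e]
  · rw [T'.alg.res_res, q_eq T' (hP.trans inf_le_left) e]
  · rw [T.alg.res_res, q_eq T (hP.trans inf_le_right) e']
  · rw [T'.alg.res_res, q_eq T' (hP.trans inf_le_right) e']

theorem exists_torHom [CharZero k] (D : LagDatum j Q ω) (T T' : TorAlgebroid j Q) :
    ∃ φ : LieAlgebroid.Hom T.alg.toLieAlgebroid T'.alg.toLieAlgebroid,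
      ∀ (U : X.Opens) (e : Q.ideal j U), φ.app _ (T.q U e) = T'.q U e := by
  obtain ⟨φ, hφ⟩ := exists_hom_of_local (L := T.alg.toLieAlgebroid) (L' := T'.alg.toLieAlgebroid)
    T'.isSheaf (SameClass T T') (fun h x x' hx => hx.res h) (fun W x y hy => by
      obtain ⟨U, h, hyU, e, he⟩ := T.q_surjective W x y hy
      exact ⟨j ⁻¹ᵁ U, h, hyU, T'.q U e, he ▸ SameClass.of_q e⟩)
    (fun W x x' x'' h h' => D.sameClass_unique T T' h h')
    (fun W x x' z z' h h' y hy => by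
      obtain ⟨P, hP, i, hi, hyP, e, e', F, hF, h1, h2, h3, h4⟩ := h.exists_two D h' 0 hy
      refine ⟨_, hP, hyP, ?_⟩
      rw [map_add, map_add, h1, h2, h3, h4, ← map_add, ← map_add]
      exact SameClass.of_q _)
    (fun W f x x' h y hy => by
      obtain ⟨P, hP, i, hi, hyP, e, -, F, hF, h1, h2, -⟩ := h.exists_two D h f hy
      refine ⟨_, hP, hyP, ?_⟩
      let e' : Q.ideal j P := ⟨Q.scalar P (PowerSeries.C (1 / 2)) * (F * e.1 + e.1 * F), by
        refine (Q.ideal j P).mul_mem_left _ ((Q.ideal j P).add_mem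
          ((Q.ideal j P).mul_mem_left _ e.2) ?_)
        rw [QuantData.mem_ideal, map_mul, map_mul, Q.jres_red, zero_mul]⟩
      have e1 := T.q_smul P F e e' rfl
      have e2 := T'.q_smul P F e e' rfl
      rw [T.alg.res_smul, T'.alg.res_smul, h1, h2, ← hF, e1, e2]
      exact SameClass.of_q _)
    (fun W x x' z z' h h' y hy => by
      obtain ⟨P, hP, i, hi, hyP, e, e', F, hF, h1, h2, h3, h4⟩ := h.exists_two D h' 0 hy
      refine ⟨_, hP, hyP, ?_⟩
      obtain ⟨g, hg⟩ := D.exists_comm i hi e.1 e'.1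
      have e1 := T.q_bracket P e e' ⟨g, D.mem_ideal_of_comm e e' hg⟩ hg
      have e2 := T'.q_bracket P e e' ⟨g, D.mem_ideal_of_comm e e' hg⟩ hg
      rw [T.alg.bracket_res, T'.alg.bracket_res, h1, h2, h3, h4, e1, e2]
      exact SameClass.of_q _)
    (fun W x x' h => by
      obtain ⟨U, hU, e, rfl, rfl⟩ := h
      rw [T.alg.anchor_res, T'.alg.anchor_res, D.anchor_q T, D.anchor_q T'])
    tangentMod_isSep
  exact ⟨φ, fun U e => hφ _ _ _ fun y hy => ⟨_, le_rfl, hy, (SameClass.of_q e).res le_rfl⟩⟩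

theorem torHom_id (T : TorAlgebroid j Q)
    (φ : LieAlgebroid.Hom T.alg.toLieAlgebroid T.alg.toLieAlgebroid)
    (h : ∀ (U : X.Opens) (e : Q.ideal j U), φ.app _ (T.q U e) = T.q U e) (W : Y.Opens)
    (x : T.alg.Sec W) : φ.app W x = x := by
  refine T.isSheaf.isSep _ _ _ fun y hy => ?_
  obtain ⟨U, hU, hyU, e, he⟩ := T.q_surjective W x y hy
  exact ⟨_, hU, hyU, by rw [← φ.app_res, ← he, h]⟩

/-- Composition of morphisms of Lie algebroids. -/
def _root_.LagQuant.LieAlgebroid.Hom.comp {L L' L'' : LieAlgebroid k Y} (ψ : LieAlgebroid.Hom L' L'')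
    (φ : LieAlgebroid.Hom L L') : LieAlgebroid.Hom L L'' where
  app U := (ψ.app U).comp (φ.app U)
  app_res h x := by rw [LinearMap.comp_apply, φ.app_res, ψ.app_res]; rfl
  anchor_app U x := by rw [LinearMap.comp_apply, ψ.anchor_app, φ.anchor_app]
  app_bracket U x y := by
    rw [LinearMap.comp_apply, φ.app_bracket, ψ.app_bracket]; rfl

theorem nonempty_iso [CharZero k] (D : LagDatum j Q ω) (T T' : TorAlgebroid j Q) :
    Nonempty (T.alg.Iso T'.alg) := by
  obtain ⟨φ, hφ⟩ := D.exists_torHom T T'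
  obtain ⟨ψ, hψ⟩ := D.exists_torHom T' T
  refine ⟨φ, ψ, torHom_id T (ψ.comp φ) fun U e => ?_, torHom_id T' (φ.comp ψ) fun U e => ?_,
    fun W f => T'.isSheaf.isSep _ _ _ fun y hy => ?_⟩
  · change ψ.app _ (φ.app _ _) = _
    rw [hφ, hψ]
  · change φ.app _ (ψ.app _ _) = _
    rw [hψ, hφ]
  · obtain ⟨V, -, hV, i, hi, hyV, F, hF⟩ := D.exists_fun (U := ⊤) hy trivial f
    refine ⟨j ⁻¹ᵁ V, hV, hyV, ?_⟩
    have hI : Q.hbar V * F ∈ Q.ideal j V := by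
      rw [QuantData.mem_ideal, map_mul, Q.red_hbar, zero_mul, map_zero]
    have h1 := T.q_unit V F ⟨_, hI⟩ rfl
    have h2 := T'.q_unit V F ⟨_, hI⟩ rfl
    rw [← φ.app_res, T.alg.unit_res, T'.alg.unit_res, ← hF, h1, h2, hφ]

theorem isPicard [CharZero k] (D : LagDatum j Q ω) (T : TorAlgebroid j Q) : T.alg.IsPicard :=
  (D.nonempty_iso T D.torAlgebroid).some.isPicard T.isSheaf D.w.alg_isPicard

theorem represents [CharZero k] (D : LagDatum j Q ω) (T : TorAlgebroid j Q) :
    Represents T.alg D.w :=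
  (D.nonempty_iso T D.torAlgebroid).some.represents D.w.represents_alg

theorem isPullbackClass (D : LagDatum j Q ω) : IsPullbackClass j (H2F.mk D.z) (H2F.mk D.w) :=
  ⟨D.z, D.w, D.e, rfl, rfl, D.pull.le, D.pull.form, D.pull.trans⟩

end LagDatum

end TorUnique

/-! ### Alternating forms of top degree -/

section TopForms

variable {R M : Type u} [CommRing R] [AddCommGroup M] [Module R M] {p : ℕ}

theorem sum_update_eq_trace (b : Module.Basis (Fin p) R M) (T : M →ₗ[R] M)
    (α : M [⋀^Fin p]→ₗ[R] R) (m : Fin p → M) :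
    ∑ i, α (Function.update m i (T (m i))) = LinearMap.trace R M T * α m := by
  have h : altDeriv (0 : R →+ R) (by simp) T.toAddMonoidHom (by simp) α =
      (-LinearMap.trace R M T) • α := by
    refine b.ext_alternating fun v hv => ?_
    obtain ⟨σ, rfl⟩ : ∃ σ : Equiv.Perm (Fin p), v = σ :=
      ⟨Equiv.ofBijective v (Finite.injective_iff_bijective.1 hv), rfl⟩
    have h1 : ∀ i, α (Function.update (fun i => b (σ i)) i (T (b (σ i)))) =
        b.repr (T (b (σ i))) (σ i) * α (fun i => b (σ i)) := by
      intro i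
      conv_lhs => rw [← b.sum_repr (T (b (σ i)))]
      rw [α.map_update_sum, Finset.sum_eq_single (σ i)]
      · rw [α.map_update_smul, smul_eq_mul, Function.update_eq_self_iff.2 rfl]
      · intro l _ hl
        rw [α.map_update_smul]
        have h2 : α (Function.update (fun i => b (σ i)) i (b l)) = 0 := by
          refine α.map_eq_zero_of_eq _ (i := i) (j := σ.symm l) ?_ ?_
          · rw [Function.update_self, Function.update_of_ne]
            · simp
            · rintro rfl; simp at hl
          · rintro rfl; simp at hl
        rw [h2, smul_zero]
      · simp
    change (0 : R) - ∑ i, α (Function.update (fun i => b (σ i)) i (T (b (σ i)))) =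
      (-LinearMap.trace R M T) * α (fun i => b (σ i))
    simp only [h1, ← Finset.sum_mul]
    rw [Equiv.sum_comp σ (fun l => b.repr (T (b l)) l), LinearMap.trace_eq_matrix_trace R b,
      Matrix.trace]
    simp only [Matrix.diag_apply, LinearMap.toMatrix_apply]
    ring
  have h2 := congrArg (fun β : M [⋀^Fin p]→ₗ[R] R => β m) h
  change (0 : R) - ∑ i, α (Function.update m i (T (m i))) = -LinearMap.trace R M T * α m at h2
  linear_combination -h2

theorem sum_update_smul (b : Module.Basis (Fin p) R M) (l : M →ₗ[R] R) (x : M)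
    (α : M [⋀^Fin p]→ₗ[R] R) (m : Fin p → M) :
    ∑ i, l (m i) * α (Function.update m i x) = l x * α m := by
  have h := sum_update_eq_trace b (l.smulRight x) α m
  simp only [LinearMap.smulRight_apply, α.map_update_smul, smul_eq_mul] at h
  rw [h, LinearMap.trace_eq_matrix_trace R b, Matrix.trace]
  congr 1
  conv_rhs => rw [← b.sum_repr x]
  simp only [Matrix.diag_apply, LinearMap.toMatrix_apply, LinearMap.smulRight_apply, map_smul,
    map_sum, Finsupp.smul_apply, smul_eq_mul]
  exact Finset.sum_congr rfl fun i _ => mul_comm _ _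

/-- Two operators on alternating forms commute up to the operator of the commutator. -/
theorem sum_update_comm (D D' : M →+ M) (α : M [⋀^Fin p]→ₗ[R] R) (m : Fin p → M) :
    ∑ i, ∑ l, α (Function.update (Function.update m i (D (m i))) l
        (D' (Function.update m i (D (m i)) l))) -
      ∑ i, ∑ l, α (Function.update (Function.update m i (D' (m i))) l
        (D (Function.update m i (D' (m i)) l))) =
    ∑ i, α (Function.update m i (D' (D (m i)) - D (D' (m i)))) := by
  have h : ∀ (A B : M →+ M), ∑ i, ∑ l, α (Function.update (Function.update m i (A (m i))) l
      (B (Function.update m i (A (m i)) l))) = ∑ i, α (Function.update m i (B (A (m i)))) +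
      ∑ i, ∑ l, if l = i then 0 else
        α (Function.update (Function.update m i (A (m i))) l (B (m l))) := by
    intro A B
    rw [← Finset.sum_add_distrib]
    refine Finset.sum_congr rfl fun i _ => ?_
    have : ∀ l, α (Function.update (Function.update m i (A (m i))) l
        (B (Function.update m i (A (m i)) l))) =
        (if l = i then α (Function.update m i (B (A (m i)))) else 0) +
        if l = i then 0 else
          α (Function.update (Function.update m i (A (m i))) l (B (m l))) := by
      intro l
      by_cases hl : l = i
      · subst hl; simp
      · simp [hl]
    simp only [this, Finset.sum_add_distrib, Finset.sum_ite_eq', Finset.mem_univ, if_true]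
  rw [h, h, Finset.sum_comm (f := fun i l => if l = i then 0 else
    α (Function.update (Function.update m i (D' (m i))) l (D (m l))))]
  have h2 : ∀ i l : Fin p, (if i = l then 0 else
      α (Function.update (Function.update m l (D' (m l))) i (D (m i)))) = if l = i then 0 else
      α (Function.update (Function.update m i (D (m i))) l (D' (m l))) := by
    intro i l
    by_cases hl : l = i
    · simp [hl]
    · rw [if_neg hl, if_neg (Ne.symm hl), Function.update_comm (Ne.symm hl)]
  simp only [h2, α.map_update_sub, Finset.sum_sub_distrib]
  abel

section AltDeriv

variable {ξ ξ' : R →+ R} {D D' : M →+ M} (hξ : ∀ a b, ξ (a * b) = a * ξ b + ξ a * b)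
  (hξ' : ∀ a b, ξ' (a * b) = a * ξ' b + ξ' a * b) (hD : ∀ (f : R) m, D (f • m) = f • D m + ξ f • m)
  (hD' : ∀ (f : R) m, D' (f • m) = f • D' m + ξ' f • m) (α : M [⋀^Fin p]→ₗ[R] R) (m : Fin p → M)

theorem altDeriv_apply : altDeriv ξ hξ D hD α m = ξ (α m) - ∑ i, α (Function.update m i (D (m i))) :=
  rfl

theorem altDeriv_add (h h') : altDeriv (ξ + ξ') h (D + D') h' α m =
    altDeriv ξ hξ D hD α m + altDeriv ξ' hξ' D' hD' α m := by
  simp only [altDeriv_apply, AddMonoidHom.add_apply, α.map_update_add, Finset.sum_add_distrib]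
  ring

theorem altDeriv_comm (h h') :
    altDeriv (ξ.comp ξ' - ξ'.comp ξ) h (D.comp D' - D'.comp D) h' α m =
      altDeriv ξ hξ D hD (altDeriv ξ' hξ' D' hD' α) m -
        altDeriv ξ' hξ' D' hD' (altDeriv ξ hξ D hD α) m := by
  have key := sum_update_comm D D' α m
  simp only [altDeriv_apply, AddMonoidHom.sub_apply, AddMonoidHom.comp_apply, map_sub, map_sum,
    Finset.sum_sub_distrib, α.map_update_sub] at key ⊢
  linear_combination -key

theorem altDeriv_scalar (f : R) (h h') :
    altDeriv 0 h (DistribSMul.toAddMonoidHom M f) h' α m = -((p : R) * f) * α m := by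
  simp only [altDeriv_apply, DistribSMul.toAddMonoidHom_apply, α.map_update_smul,
    Function.update_eq_self, smul_eq_mul, Finset.sum_const, Finset.card_univ, Fintype.card_fin,
    nsmul_eq_mul, AddMonoidHom.zero_apply]
  ring

theorem altDeriv_twist (f : R) (h : ∀ a, ξ' a = f * ξ a) (l : M →ₗ[R] R) (x : M)
    (h' : ∀ m, D' m = f • D m - l m • x) (b : Module.Basis (Fin p) R M) :
    altDeriv ξ' hξ' D' hD' α m = f * altDeriv ξ hξ D hD α m + l x * α m := by
  have key := sum_update_smul b l x α m
  simp only [altDeriv_apply, h, h', α.map_update_sub, α.map_update_smul, Finset.sum_sub_distrib,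
    smul_eq_mul, ← Finset.mul_sum]
  linear_combination key

theorem altDeriv_smul (f : R) (h : ∀ a, ξ' a = f * ξ a) (h' : ∀ m, D' m = f • D m) :
    altDeriv ξ' hξ' D' hD' α m = f * altDeriv ξ hξ D hD α m := by
  simp only [altDeriv_apply, h, h', α.map_update_smul, smul_eq_mul, ← Finset.mul_sum]
  ring

end AltDeriv

end TopForms

/-! ### Local frames -/

section Frames

variable {Y : Scheme.{u}}

/-- The sections `b` form a frame of `M` over `U`. -/
def IsFrame (M : ModPresheaf Y) (U : Y.Opens) {r : ℕ} (b : Fin r → M.Sec U) : Prop :=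
  ∀ (V : Y.Opens) (h : V ≤ U), LinearIndependent Γ(Y, V) (fun i => M.res h (b i)) ∧
    Submodule.span Γ(Y, V) (Set.range fun i => M.res h (b i)) = ⊤

/-- Locally free presheaves of modules. -/
def LocFree (M : ModPresheaf Y) (r : ℕ) : Prop :=
  ∀ y : Y, ∃ U : Y.Opens, y ∈ U ∧ ∃ b : Fin r → M.Sec U, IsFrame M U b

variable {M : ModPresheaf Y} {U : Y.Opens} {r : ℕ} {b : Fin r → M.Sec U}

theorem IsFrame.res (hb : IsFrame M U b) {V : Y.Opens} (h : V ≤ U) :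
    IsFrame M V (fun i => M.res h (b i)) := fun W h' => by
  simp only [M.res_res]
  exact hb W (h'.trans h)

theorem LocFree.exists_frame (hM : LocFree M r) {W : Y.Opens} {y : Y} (hy : y ∈ W) :
    ∃ U ≤ W, y ∈ U ∧ ∃ b : Fin r → M.Sec U, IsFrame M U b := by
  obtain ⟨U, hyU, b, hb⟩ := hM y
  exact ⟨W ⊓ U, inf_le_left, ⟨hy, hyU⟩, _, hb.res inf_le_right⟩

/-- The basis of sections over a smaller open given by a frame. -/
def IsFrame.basis (hb : IsFrame M U b) {V : Y.Opens} (h : V ≤ U) :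
    Module.Basis (Fin r) Γ(Y, V) (M.Sec V) :=
  Module.Basis.mk (hb V h).1 (hb V h).2.ge

theorem IsFrame.basis_apply (hb : IsFrame M U b) {V : Y.Opens} (h : V ≤ U) (i : Fin r) :
    hb.basis h i = M.res h (b i) := by
  rw [IsFrame.basis, Module.Basis.mk_apply]

theorem IsFrame.repr_res (hb : IsFrame M U b) {V W : Y.Opens} (h : V ≤ U) (h' : W ≤ V)
    (m : M.Sec V) (i : Fin r) :
    (hb.basis (h'.trans h)).repr (M.res h' m) i = rs h' ((hb.basis h).repr m i) := by
  have h1 : M.res h' m =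
      ∑ i, rs h' ((hb.basis h).repr m i) • hb.basis (h'.trans h) i := by
    conv_lhs => rw [← (hb.basis h).sum_repr m]
    simp only [map_sum, M.res_smul, hb.basis_apply, M.res_res]
  rw [h1, Module.Basis.repr_sum_self]

theorem IsFrame.of_unique {e : M.Sec U}
    (h : ∀ (V : Y.Opens) (hV : V ≤ U) (m : M.Sec V), ∃! f : Γ(Y, V), m = f • M.res hV e) :
    IsFrame M U (fun _ : Fin 1 => e) := by
  refine fun V hV => ⟨?_, top_le_iff.1 fun m _ => ?_⟩
  · refine Fintype.linearIndependent_iff.2 fun g hg i => ?_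
    obtain rfl := Subsingleton.elim i 0
    refine (h V hV 0).unique ?_ (zero_smul _ _).symm
    simpa using hg.symm
  · obtain ⟨f, rfl, -⟩ := h V hV m
    exact Submodule.smul_mem _ _ (Submodule.subset_span ⟨0, rfl⟩)

/-- The volume form of a frame. -/
def IsFrame.vol (hb : IsFrame M U b) : (alt r M).Sec U :=
  ⟨fun V => (hb.basis V.2).det, fun V W h m => by
    rw [Module.Basis.det_apply, Module.Basis.det_apply, RingHom.map_det]
    congr 1
    ext i l
    exact (hb.repr_res V.2 h (m l) i).symm⟩

theorem IsFrame.eq_smul_vol (hb : IsFrame M U b) {V : Y.Opens} (hV : V ≤ U) (α : (alt r M).Sec V) :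
    α = α.1 (Below.self V) (fun i => M.res hV (b i)) • (alt r M).res hV hb.vol := by
  refine Subtype.ext (funext fun W => ?_)
  have h2 := (α.1 W).eq_smul_basis_det (hb.basis (W.2.trans hV))
  refine h2.trans ?_
  change _ = rs W.2 _ • (hb.basis (W.2.trans hV)).det
  rw [α.2 (Below.self V) W W.2]
  congr 2
  funext i
  rw [hb.basis_apply, M.res_res]

theorem IsFrame.vol_frame (hb : IsFrame M U b) {V : Y.Opens} (hV : V ≤ U) :
    hb.vol.1 ⟨V, hV⟩ (fun i => M.res hV (b i)) = 1 := by
  have : (fun i => M.res hV (b i)) = hb.basis hV := funext fun i => (hb.basis_apply hV i).symm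
  rw [this]
  exact (hb.basis hV).det_self

theorem IsFrame.alt (hb : IsFrame M U b) : IsFrame (LagQuant.alt r M) U (fun _ : Fin 1 => hb.vol) := by
  refine IsFrame.of_unique fun V hV α => ⟨_, hb.eq_smul_vol hV α, fun f hf => ?_⟩
  change f = α.1 (Below.self V) (fun i => M.res hV (b i))
  rw [hf]
  change _ = rs le_rfl f * hb.vol.1 ⟨V, hV⟩ (fun i => M.res hV (b i))
  rw [hb.vol_frame hV, rs_id, mul_one]

theorem LocFree.alt (hM : LocFree M r) : LocFree (LagQuant.alt r M) 1 := fun y => by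
  obtain ⟨U, hy, b, hb⟩ := hM y
  exact ⟨U, hy, _, hb.alt⟩

theorem LocFree.det (hM : LocFree M r) : LocFree (LagQuant.det r M) 1 := hM.alt.alt

theorem alt_isSep (p : ℕ) (M : ModPresheaf Y) : (alt p M).IsSep := by
  intro U α β h
  refine Subtype.ext (funext fun V => AlternatingMap.ext fun m => rs_ext fun y hy => ?_)
  obtain ⟨V', hV', hyV', e⟩ := h y (V.2 hy)
  refine ⟨V.1 ⊓ V', inf_le_left, ⟨hy, hyV'⟩, ?_⟩
  have e1 := congrArg (fun γ : (alt p M).Sec V' => γ.1 ⟨V.1 ⊓ V', inf_le_right⟩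
    (fun i => M.res inf_le_left (m i))) e
  exact (α.2 V ⟨V.1 ⊓ V', inf_le_left.trans V.2⟩ inf_le_left m).trans
    (e1.trans (β.2 V ⟨V.1 ⊓ V', inf_le_left.trans V.2⟩ inf_le_left m).symm)

end Frames

section TangentFrame

variable {k : Type u} [Field k] {Y : Scheme.{u}} [Y.Over (Spec (.of k))]

theorem IsCoordOn.isFrame {U : Y.Opens} {m : ℕ} {x : Fin m → Γ(Y, U)} (hx : IsCoordOn k U x) :
    IsFrame (tangentMod k Y) U hx.partial := by
  refine fun V h => ⟨?_, top_le_iff.1 fun ξ _ => ?_⟩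
  · refine Fintype.linearIndependent_iff.2 fun g hg i => ?_
    have h1 : (∑ l, g l • VF.res h (hx.partial l) : VF k V).app (rs h (x i)) = 0 :=
      congrArg (fun ξ : VF k V => ξ.app (rs h (x i))) hg
    simp only [VF.sum_app, VF.smul_app, VF.res_app, hx.partial_app] at h1
    simpa using h1
  · have h1 := hx.eq_sum h ξ
    change ξ ∈ _
    rw [h1]
    exact Submodule.sum_mem _ fun i _ => Submodule.smul_mem _ _ (Submodule.subset_span ⟨i, rfl⟩)

theorem tangentMod_locFree (n : ℕ) [SmoothOfRelativeDimension n (Y ↘ Spec (.of k))] :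
    LocFree (tangentMod k Y) n := fun y => by
  obtain ⟨V, -, hy, x, hx⟩ := exists_isCoordOn (k := k) n (Opens.mem_top y)
  exact ⟨V, hy, _, hx.isFrame⟩

end TangentFrame

/-! ### Atiyah algebroids of line bundles and vector bundles -/

section Atiyah

variable {k : Type u} [Field k] {Y : Scheme.{u}} [Y.Over (Spec (.of k))] {M : ModPresheaf Y}

theorem atiyah_unit_injective {r : ℕ} (hr : 0 < r) (hM : LocFree M r) (U : Y.Opens) :
    Function.Injective ((atiyah k M).unit U) := by
  intro f g h
  refine rs_ext fun y hy => ?_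
  obtain ⟨V, hV, hyV, b, hb⟩ := hM.exists_frame hy
  refine ⟨V, hV, hyV, ?_⟩
  have h1 : rs hV f • b ⟨0, hr⟩ = rs hV g • b ⟨0, hr⟩ :=
    congrArg (fun D : At k M U => D.op ⟨V, hV⟩ (b ⟨0, hr⟩)) h
  have h2 : hb.basis le_rfl ⟨0, hr⟩ = b ⟨0, hr⟩ := by rw [hb.basis_apply, M.res_id]
  rw [← h2] at h1
  have h3 := congrArg (fun m => (hb.basis le_rfl).repr m ⟨0, hr⟩) h1
  simpa using h3

theorem atiyah_line_exact (hsep : M.IsSep) (hM : LocFree M 1) (U : Y.Opens) (D : At k M U)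
    (hD : D.vf = 0) : ∃ f, (atiyah k M).unit U f = D := by
  have hlin : ∀ (V : Below U) (f : Γ(Y, V.1)) (m : M.Sec V.1), D.op V (f • m) = f • D.op V m :=
    fun V f m => by
      rw [D.op_smul, hD]
      change _ + (0 : Γ(Y, V.1)) • m = _
      rw [zero_smul, add_zero]
  let R : ∀ V : Y.Opens, V ≤ U → Γ(Y, V) → Prop := fun V hV g => ∀ (W : Y.Opens) (h : W ≤ V)
    (m : M.Sec W), D.op ⟨W, h.trans hV⟩ m = rs h g • m
  have hex : ∀ y ∈ U, ∃ (V : Y.Opens) (hV : V ≤ U), y ∈ V ∧ ∃ g, R V hV g := fun y hy => by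
    obtain ⟨V, hV, hyV, b, hb⟩ := hM.exists_frame hy
    refine ⟨V, hV, hyV, (hb.basis le_rfl).repr (D.op ⟨V, hV⟩ (b 0)) 0, fun W h m => ?_⟩
    rw [← hb.repr_res le_rfl h, D.op_res ⟨V, hV⟩ ⟨W, h.trans hV⟩ h]
    have h1 := (hb.basis h).sum_repr m
    have h2 := (hb.basis h).sum_repr (D.op ⟨W, h.trans hV⟩ (M.res h (b 0)))
    rw [Fin.sum_univ_one, hb.basis_apply] at h1 h2
    conv_lhs => rw [← h1, hlin, ← h2]
    conv_rhs => rw [← h1]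
    rw [smul_comm]
  obtain ⟨f, hf, -⟩ := existsUnique_fun R hex (by
    intro V hV g V' hV' g' h h'
    refine atiyah_unit_injective (k := k) one_pos hM _ (At.ext (fun W m => ?_) rfl)
    change rs W.2 (rs _ g) • m = rs W.2 (rs _ g') • m
    rw [rs_rs, rs_rs, ← h W.1 (W.2.trans inf_le_left), ← h' W.1 (W.2.trans inf_le_right)])
  refine ⟨f, At.ext (fun V m => hsep _ _ _ fun y hy => ?_) hD.symm⟩
  obtain ⟨V', hV', hyV', g, hg⟩ := hex y (V.2 hy)
  refine ⟨V.1 ⊓ V', inf_le_left, ⟨hy, hyV'⟩, ?_⟩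
  change M.res _ (rs V.2 f • m) = _
  have e := hf V' hV' g hg
  rw [D.op_res V ⟨V.1 ⊓ V', inf_le_left.trans V.2⟩, M.res_smul, rs_rs]
  refine Eq.trans ?_ (hg (V.1 ⊓ V') inf_le_right (M.res inf_le_left m)).symm
  rw [← e, rs_rs]

/-- The connection of a frame. -/
theorem IsFrame.exists_splitting {r : ℕ} {U : Y.Opens} {b : Fin r → M.Sec U} (hb : IsFrame M U b) :
    ∃ s : Splitting (atiyah k M) U, ∀ (V : Below U) (ξ : VF k V.1) (i : Fin r),
      At.op (s.app V ξ) (Below.self V.1) (M.res V.2 (b i)) = 0 := by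
  let c : ∀ {V : Y.Opens} (h : V ≤ U), M.Sec V →ₗ[Γ(Y, V)] (Fin r →₀ Γ(Y, V)) :=
    fun h => (hb.basis h).repr.toLinearMap
  have hc : ∀ {V : Y.Opens} (h : V ≤ U) (m : M.Sec V), m = ∑ i, c h m i • M.res h (b i) :=
    fun h m => by
      conv_lhs => rw [← (hb.basis h).sum_repr m]
      simp only [hb.basis_apply]
      rfl
  let F : ∀ (V : Below U) (ξ : VF k V.1), At k M V.1 := fun V ξ =>
    ⟨(fun W => AddMonoidHom.mk'
        (fun m => ∑ i, ξ.1 W (c (W.2.trans V.2) m i) • M.res (W.2.trans V.2) (b i)) fun m m' => by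
          simp only [map_add, Finsupp.add_apply, add_smul, Finset.sum_add_distrib], ξ), by
      refine ⟨fun W f m => ?_, fun W W' h m => ?_⟩
      · change ∑ i, ξ.1 W (c _ (f • m) i) • M.res (W.2.trans V.2) (b i) =
          f • ∑ i, ξ.1 W (c _ m i) • M.res (W.2.trans V.2) (b i) + ξ.1 W f • m
        conv_rhs => rw [hc (W.2.trans V.2) m]
        simp only [map_smul, Finsupp.smul_apply, smul_eq_mul, ξ.2.1, add_smul,
          Finset.sum_add_distrib, Finset.smul_sum, mul_smul]
        rw [← hc (W.2.trans V.2) m]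
      · change M.res h (∑ i, ξ.1 W (c _ m i) • M.res (W.2.trans V.2) (b i)) =
          ∑ i, ξ.1 W' (c _ (M.res h m) i) • M.res (W'.2.trans V.2) (b i)
        rw [map_sum]
        refine Finset.sum_congr rfl fun i _ => ?_
        rw [M.res_smul, M.res_res, ξ.2.2.2 W W' h]
        exact congrArg (fun g => ξ.1 W' g • M.res (W'.2.trans V.2) (b i))
          (hb.repr_res (W.2.trans V.2) h m i).symm⟩
  refine ⟨⟨fun V => { toFun := F V, map_add' := fun ξ η => ?_, map_smul' := fun f ξ => ?_ },
    fun V W h ξ => rfl, fun V ξ => rfl⟩, fun V ξ i => ?_⟩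
  · refine At.ext (fun W m => ?_) rfl
    change ∑ i : Fin r, (ξ.1 W (c (W.2.trans V.2) m i) + η.1 W (c (W.2.trans V.2) m i)) •
      M.res (W.2.trans V.2) (b i) = ∑ i, ξ.1 W (c (W.2.trans V.2) m i) • M.res (W.2.trans V.2) (b i) +
        ∑ i, η.1 W (c (W.2.trans V.2) m i) • M.res (W.2.trans V.2) (b i)
    simp only [add_smul, Finset.sum_add_distrib]
  · refine At.ext (fun W m => ?_) rfl
    change ∑ i : Fin r, (rs W.2 f * ξ.1 W (c (W.2.trans V.2) m i)) • M.res (W.2.trans V.2) (b i) =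
      rs W.2 f • ∑ i, ξ.1 W (c (W.2.trans V.2) m i) • M.res (W.2.trans V.2) (b i)
    simp only [mul_smul, Finset.smul_sum]
  · change ∑ l, ξ.1 (Below.self V.1) (c _ (M.res V.2 (b i)) l) • M.res _ (b l) = 0
    refine Finset.sum_eq_zero fun l _ => ?_
    have h1 : c V.2 (M.res V.2 (b i)) l = if i = l then 1 else 0 := by
      change (hb.basis V.2).repr _ l = _
      rw [← hb.basis_apply, Module.Basis.repr_self, Finsupp.single_apply]
    have h2 : ξ.1 (Below.self V.1) (if i = l then 1 else 0 : Γ(Y, V.1)) = 0 := by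
      split_ifs
      · have := ξ.2.2.1 (Below.self V.1) 1
        rwa [map_one] at this
      · exact map_zero _
    have h3 := (congrArg (fun g => ξ.1 (Below.self V.1) g) h1).trans h2
    exact (congrArg (fun g => g • M.res V.2 (b l)) h3).trans (zero_smul _ _)

theorem atiyah_exists_splitting {r : ℕ} (hM : LocFree M r) (y : Y) :
    ∃ U : Y.Opens, y ∈ U ∧ Nonempty (Splitting (atiyah k M) U) := by
  obtain ⟨U, hy, b, hb⟩ := hM y
  exact ⟨U, hy, ⟨hb.exists_splitting.choose⟩⟩

theorem atiyah_isSep (hM : M.IsSep) : (atiyah k M).toModPresheaf.IsSep := by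
  intro U D D' h
  refine At.ext (fun V m => hM _ _ _ fun y hy => ?_) (tangentMod_isSep _ _ _ fun y hy => ?_)
  · obtain ⟨V', hV', hyV', e⟩ := h y (V.2 hy)
    refine ⟨V.1 ⊓ V', inf_le_left, ⟨hy, hyV'⟩, ?_⟩
    have e1 := congrArg (fun D : At k M V' => D.op ⟨V.1 ⊓ V', inf_le_right⟩
      (M.res inf_le_left m)) e
    exact (D.op_res V ⟨V.1 ⊓ V', inf_le_left.trans V.2⟩ inf_le_left m).trans
      (e1.trans (D'.op_res V ⟨V.1 ⊓ V', inf_le_left.trans V.2⟩ inf_le_left m).symm)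
  · obtain ⟨V', hV', hyV', e⟩ := h y hy
    exact ⟨V', hV', hyV', congrArg (fun D : At k M V' => D.vf) e⟩

theorem atiyah_isSheaf (hM : M.IsSheaf) : (atiyah k M).toModPresheaf.IsSheaf := by
  refine ModPresheaf.IsSheaf.of_sep (atiyah_isSep hM.isSep) fun I U (δ : ∀ i, At k M (U i)) hδ => ?_
  obtain ⟨ξ, hξ, -⟩ := tangentMod_isSheaf (k := k) I U (fun i => (δ i).vf) fun i i' =>
    congrArg (fun D : At k M (U i ⊓ U i') => D.vf) (hδ i i')
  have hij : ∀ i i' (V : Y.Opens) (h : V ≤ U i) (h' : V ≤ U i') (m : M.Sec V),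
      (δ i).op ⟨V, h⟩ m = (δ i').op ⟨V, h'⟩ m := fun i i' V h h' m =>
    congrArg (fun D : At k M (U i ⊓ U i') => D.op ⟨V, le_inf h h'⟩ m) (hδ i i')
  have hD : ∀ (V : Below (⨆ i, U i)) (m : M.Sec V.1), ∃! t : M.Sec V.1,
      ∀ i V' (hV' : V' ≤ V.1) (hU' : V' ≤ U i), M.res hV' t = (δ i).op ⟨V', hU'⟩ (M.res hV' m) := by
    intro V m
    refine hM.existsUnique_family V.2
      (fun i V' hV' hU' => (δ i).op ⟨V', hU'⟩ (M.res hV' m)) ?_ ?_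
    · intro i V' hV' hU' V'' hh
      refine ((δ i).op_res ⟨V', hU'⟩ ⟨V'', hh.trans hU'⟩ hh _).trans ?_
      rw [M.res_res]
    · intro i i' V' hV' hU' hU''
      exact hij i i' V' hU' hU'' _
  choose D hD hDu using hD
  have ext : ∀ (V : Below (⨆ i, U i)) (s t : M.Sec V.1),
      (∀ i V' (hV' : V' ≤ V.1) (_ : V' ≤ U i), M.res hV' s = M.res hV' t) → s = t := by
    intro V s t h
    refine hM.isSep _ _ _ fun y hy => ?_
    obtain ⟨i, hi⟩ := Opens.mem_iSup.1 (V.2 hy)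
    exact ⟨V.1 ⊓ U i, inf_le_left, ⟨hy, hi⟩, h i _ _ inf_le_right⟩
  have hξ' : ∀ i (V : Below (⨆ i, U i)) V' (hV' : V' ≤ V.1) (hU' : V' ≤ U i) f,
      rs hV' ((show VF k (⨆ i, U i) from ξ).1 V f) = (δ i).vf.1 ⟨V', hU'⟩ (rs hV' f) := by
    intro i V V' hV' hU' f
    refine ((show VF k (⨆ i, U i) from ξ).2.2.2 V ⟨V', hV'.trans V.2⟩ hV' f).trans ?_
    exact congrArg (fun η : VF k (U i) => η.1 ⟨V', hU'⟩ (rs hV' f)) (hξ i)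
  refine ⟨⟨(fun V => AddMonoidHom.mk' (D V) fun a b => ?_, ξ), fun V f m => ?_,
    fun V W h m => ?_⟩, fun i => At.ext (fun V m => ?_) (hξ i)⟩
  · refine ext V _ _ fun i V' hV' hU' => ?_
    rw [map_add, hD V _ i V' hV' hU', hD V _ i V' hV' hU', hD V _ i V' hV' hU', map_add, map_add]
  · refine ext V _ _ fun i V' hV' hU' => ?_
    change M.res hV' (D V (f • m)) =
      M.res hV' (f • D V m + (show VF k (⨆ i, U i) from ξ).1 V f • m)
    rw [map_add, M.res_smul, M.res_smul, hD V _ i V' hV' hU', hD V _ i V' hV' hU',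
      hξ' i V V' hV' hU', M.res_smul, At.op_smul]
  · refine ext W _ _ fun i V' hV' hU' => ?_
    change M.res hV' (M.res h (D V m)) = M.res hV' (D W (M.res h m))
    rw [M.res_res, hD V _ i V' _ hU', hD W _ i V' _ hU', M.res_res]
  · have := hD (V.up (le_iSup U i)) m i V.1 le_rfl V.2
    rw [M.res_id, M.res_id] at this
    exact this

end Atiyah

/-! ### Determinants and Lie derivatives -/

section Alt

variable {k : Type u} [Field k] {Y : Scheme.{u}} [Y.Over (Spec (.of k))] {M : ModPresheaf Y}
  {U : Y.Opens} {p : ℕ}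

theorem altAct_ext {D : At k (alt p M) U} {D' : At k (alt p M) U} (h' : D.vf = D'.vf)
    (h : ∀ (V : Below U) (α : (alt p M).Sec V.1) (W : Below V.1) (m : Fin p → M.Sec W.1),
      (D.op V α).1 W m = (D'.op V α).1 W m) : D = D' :=
  At.ext (fun V α => Subtype.ext (funext fun W => AlternatingMap.ext fun m => h V α W m)) h'

theorem altAct_add (D D' : At k M U) : altAct p (D + D') = altAct p D + altAct p D' :=
  altAct_ext rfl fun V α W m => altDeriv_add (D.vf.2.1 (W.up V.2)) (D'.vf.2.1 (W.up V.2))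
    (D.op_smul (W.up V.2)) (D'.op_smul (W.up V.2)) (α.1 W) m ((D + D').vf.2.1 (W.up V.2))
    ((D + D').op_smul (W.up V.2))

theorem altAct_smul (f : Γ(Y, U)) (D : At k M U) : altAct p (f • D) = f • altAct p D := by
  refine altAct_ext rfl fun V α W m => ?_
  have h := altDeriv_smul (D.vf.2.1 (W.up V.2)) ((f • D).vf.2.1 (W.up V.2))
    (D.op_smul (W.up V.2)) ((f • D).op_smul (W.up V.2)) (α.1 W) m (rs (W.2.trans V.2) f)
    (fun _ => rfl) fun _ => rfl
  rw [← rs_rs V.2 W.2] at h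
  exact h

theorem altAct_comm (D D' : At k M U) : altAct p (D.comm D') = (altAct p D).comm (altAct p D') :=
  altAct_ext rfl fun V α W m => altDeriv_comm (D.vf.2.1 (W.up V.2)) (D'.vf.2.1 (W.up V.2))
    (D.op_smul (W.up V.2)) (D'.op_smul (W.up V.2)) (α.1 W) m ((D.comm D').vf.2.1 (W.up V.2))
    ((D.comm D').op_smul (W.up V.2))

theorem altAct_scalar (f : Γ(Y, U)) :
    altAct p (At.scalar f : At k M U) = At.scalar (-((p : Γ(Y, U)) * f)) := by
  refine altAct_ext rfl fun V α W m => ?_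
  have h := altDeriv_scalar (α.1 W) m (rs (W.2.trans V.2) f) ((0 : VF k U).2.1 (W.up V.2))
    ((At.scalar f : At k M U).op_smul (W.up V.2))
  refine h.trans ?_
  change _ = rs W.2 (rs V.2 (-((p : Γ(Y, U)) * f))) * α.1 W m
  rw [rs_rs, map_neg, map_mul, map_natCast]

theorem toDet_scalar (r : ℕ) (f : Γ(Y, U)) :
    toDet r (At.scalar f : At k M U) = At.scalar ((r : Γ(Y, U)) * f) := by
  rw [toDet, altAct_scalar]
  refine (altAct_scalar _).trans (congrArg _ ?_)
  push_cast
  ring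

end Alt

section Lie

variable {k : Type u} [Field k] {Y : Scheme.{u}} [Y.Over (Spec (.of k))] {U : Y.Opens} (n : ℕ)

/-- The vector field `ξ` acting on vector fields. -/
def adVF (ξ : VF k U) : At k (tangentMod k Y) U :=
  ⟨(fun V => VF.bracket V.1 (VF.res V.2 ξ), ξ), by
    refine ⟨fun V f η => ?_, fun V W h η => rfl⟩
    have := (tangent k Y).leibniz V.1 (VF.res V.2 ξ) f η
    exact this⟩

theorem lieDer_eq (ξ : VF k U) : lieDer n ξ = altAct n (adVF ξ) := rfl

theorem adVF_add (ξ η : VF k U) : adVF (ξ + η) = adVF ξ + adVF η :=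
  At.ext (fun V ζ => DFunLike.congr_fun (map_add (VF.bracket V.1) (VF.res V.2 ξ) (VF.res V.2 η)) ζ) rfl

theorem adVF_comm (ξ η : VF k U) : adVF (ξ.comm η) = (adVF ξ).comm (adVF η) := by
  refine At.ext (fun V ζ => ?_) rfl
  have h := (tangent k Y).jacobi V.1 (VF.res V.2 ξ) (VF.res V.2 η) ζ
  exact (sub_eq_of_eq_add h).symm

theorem lieDer_add (ξ η : VF k U) : lieDer n (ξ + η) = lieDer n ξ + lieDer n η := by
  rw [lieDer_eq, adVF_add, altAct_add]
  rfl

theorem lieDer_comm (ξ η : VF k U) : lieDer n (ξ.comm η) = (lieDer n ξ).comm (lieDer n η) := by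
  rw [lieDer_eq, adVF_comm, altAct_comm]
  rfl

theorem VF.smul_comm' (f : Γ(Y, U)) (ξ η : VF k U) :
    (f • ξ).comm η = f • ξ.comm η - η.app f • ξ := by
  refine VF.ext fun P a => ?_
  change rs P.2 f * ξ.1 P (η.1 P a) - η.1 P (rs P.2 f * ξ.1 P a) =
    rs P.2 f * (ξ.1 P (η.1 P a) - η.1 P (ξ.1 P a)) - rs P.2 (η.app f) * ξ.1 P a
  have h2 : rs P.2 (η.app f) = η.1 P (rs P.2 f) := η.2.2.2 (Below.self _) P P.2 _
  rw [η.2.1, h2]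
  ring

theorem lieDer_smul [SmoothOfRelativeDimension n (Y ↘ Spec (.of k))] (f : Γ(Y, U)) (ξ : VF k U) :
    lieDer n (f • ξ) = f • lieDer n ξ + At.scalar (ξ.app f) := by
  refine At.ext (fun V α => alt_isSep _ _ _ _ _ fun y hy => ?_) (add_zero _).symm
  obtain ⟨V', hV', hyV', b, hb⟩ := (tangentMod_locFree (k := k) n).exists_frame hy
  refine ⟨V', hV', hyV', Subtype.ext (funext fun W => AlternatingMap.ext fun m => ?_)⟩
  have h := W.2.trans (hV'.trans V.2)
  let l : (tangentMod k Y).Sec W.1 →ₗ[Γ(Y, W.1)] Γ(Y, W.1) :=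
    { toFun := fun η => VF.app η (rs h f)
      map_add' := fun η η' => rfl
      map_smul' := fun g η => VF.smul_app _ _ _ }
  have key := altDeriv_twist (ξ.2.1 (W.up (hV'.trans V.2))) ((f • ξ).2.1 (W.up (hV'.trans V.2)))
    ((adVF ξ).op_smul (W.up (hV'.trans V.2))) ((adVF (f • ξ)).op_smul (W.up (hV'.trans V.2)))
    ((show altSec n (tangentMod k Y) V.1 from α).1 (W.up hV')) m (rs h f)
    (fun a => rfl) l (VF.res h ξ)
    (fun η => (congrArg (fun ζ : VF k W.1 => ζ.comm η) (VF.res_smul h f ξ)).trans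
      (VF.smul_comm' (rs h f) (VF.res h ξ) η)) (hb.basis W.2)
  have h4 : l (VF.res h ξ) = rs h (ξ.app f) := VF.res_app h ξ f
  rw [h4, ← rs_rs V.2 (W.2.trans hV') f, ← rs_rs V.2 (W.2.trans hV') (ξ.app f)] at key
  exact key

end Lie

/-! ### Twisting the action of functions on a Lie algebroid -/

section Twist

variable {k : Type u} [Field k] {Y : Scheme.{u}} [Y.Over (Spec (.of k))]

/-- The sections of an algebroid, with the twisted action of functions. -/
def TwSec (L : UnitalAlgebroid k Y) (_ : k) (U : Y.Opens) : Type u := L.Sec U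

variable (L : UnitalAlgebroid k Y) (c : k)

instance (U : Y.Opens) : AddCommGroup (TwSec L c U) := inferInstanceAs (AddCommGroup (L.Sec U))

/-- The twisted product. -/
def twMul {U : Y.Opens} (f : Γ(Y, U)) (x : L.Sec U) : L.Sec U :=
  f • x + L.unit U (cst k U c * (L.anchor U x).app f)

variable {L c} {U : Y.Opens}

theorem twMul_add (f : Γ(Y, U)) (x y : L.Sec U) :
    twMul L c f (x + y) = twMul L c f x + twMul L c f y := by
  simp only [twMul, smul_add, map_add, VF.add_app, mul_add]
  abel

theorem add_twMul (f g : Γ(Y, U)) (x : L.Sec U) :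
    twMul L c (f + g) x = twMul L c f x + twMul L c g x := by
  simp only [twMul, add_smul, map_add, VF.app_add, mul_add]
  abel

theorem mul_twMul (f g : Γ(Y, U)) (x : L.Sec U) :
    twMul L c (f * g) x = twMul L c f (twMul L c g x) := by
  have h : L.anchor U (twMul L c g x) = g • L.anchor U x := by
    rw [twMul, map_add, L.anchor_unit, add_zero, map_smul]
  have h2 : f • L.unit U (cst k U c * (L.anchor U x).app g) =
      L.unit U (f * (cst k U c * (L.anchor U x).app g)) := by
    rw [← smul_eq_mul f, map_smul]
  rw [twMul, twMul, h, twMul, smul_add, h2, add_assoc, ← map_add, mul_smul, VF.app_mul, VF.smul_app]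
  congr 2
  ring

theorem twMul_unit (f g : Γ(Y, U)) : twMul L c f (L.unit U g) = L.unit U (f * g) := by
  rw [twMul, L.anchor_unit, VF.zero_app, mul_zero, map_zero, add_zero, ← smul_eq_mul, map_smul]

theorem anchor_twMul (f : Γ(Y, U)) (x : L.Sec U) :
    L.anchor U (twMul L c f x) = f • L.anchor U x := by
  rw [twMul, map_add, L.anchor_unit, add_zero, map_smul]

theorem res_twMul {V : Y.Opens} (h : V ≤ U) (f : Γ(Y, U)) (x : L.Sec U) :
    L.res h (twMul L c f x) = twMul L c (rs h f) (L.res h x) := by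
  rw [twMul, twMul, map_add, L.res_smul, L.unit_res, map_mul, rs_cst, L.anchor_res, VF.res_app]

theorem bracket_twMul (x : L.Sec U) (f : Γ(Y, U)) (y : L.Sec U) :
    L.bracket U x (twMul L c f y) =
      twMul L c f (L.bracket U x y) + twMul L c ((L.anchor U x).app f) y := by
  rw [twMul, twMul, twMul, map_add, L.leibniz, L.bracket_unit, L.anchor_bracket, VF.app_cst_mul,
    VF.comm_app, mul_sub, map_sub]
  abel

instance : Module Γ(Y, U) (TwSec L c U) where
  smul f x := twMul L c f (show L.Sec U from x)
  one_smul x := by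
    have h : (L.anchor U x).app 1 = 0 := by
      have := VF.app_cst (L.anchor U x) (1 : k)
      rwa [map_one] at this
    change (1 : Γ(Y, U)) • (show L.Sec U from x) + L.unit U (cst k U c * (L.anchor U x).app 1) = x
    rw [h, mul_zero, map_zero, add_zero, one_smul]
  mul_smul f g x := mul_twMul f g x
  smul_zero f := by
    have h := twMul_add (c := c) f (0 : L.Sec U) 0
    rw [add_zero] at h
    exact left_eq_add.1 h
  smul_add f x y := twMul_add f x y
  add_smul f g x := add_twMul f g x
  zero_smul x := by
    have h := add_twMul (c := c) (0 : Γ(Y, U)) 0 (show L.Sec U from x)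
    rw [add_zero] at h
    exact left_eq_add.1 h

variable (L c) in
/-- The Lie algebroid `L` with the action of functions `f * x = f x + c x̄(f)`. -/
def UnitalAlgebroid.twist : UnitalAlgebroid k Y where
  Sec U := TwSec L c U
  res h := L.res h
  res_id := L.res_id
  res_res := L.res_res
  res_smul h f x := res_twMul h f x
  anchor U := { toFun := L.anchor U, map_add' := map_add _, map_smul' := anchor_twMul }
  anchor_res := L.anchor_res
  bracket := L.bracket
  bracket_res := L.bracket_res
  bracket_self := L.bracket_self
  jacobi := L.jacobi
  leibniz U x f y := bracket_twMul x f y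
  anchor_bracket := L.anchor_bracket
  unit U :=
    { toFun := L.unit U
      map_add' := map_add _
      map_smul' := fun f g => (twMul_unit f g).symm }
  unit_res := L.unit_res
  anchor_unit := L.anchor_unit
  bracket_unit := L.bracket_unit

theorem UnitalAlgebroid.IsPicard.twist (h : L.IsPicard) : (L.twist c).IsPicard where
  isSheaf := h.isSheaf
  injective := h.injective
  exact := h.exact
  surjective := h.surjective

end Twist

/-! ### The sum with half the Atiyah algebroid of the canonical bundle -/

section Plus

variable {k : Type u} [Field k] {Y : Scheme.{u}} [Y.Over (Spec (.of k))]

theorem forms_locFree (n : ℕ) [SmoothOfRelativeDimension n (Y ↘ Spec (.of k))] :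
    LocFree (forms k Y n) 1 := (tangentMod_locFree n).alt

theorem exists_represents_line {M : ModPresheaf Y} (hM : M.IsSep) (hl : LocFree M 1) :
    ∃ z : Cocycle k Y, Represents (atiyah k M) z :=
  exists_represents (atiyah_unit_injective one_pos hl) (atiyah_line_exact hM hl)
    (atiyah_exists_splitting hl)

theorem UnitalAlgebroid.bracket_add_unit (A : UnitalAlgebroid k Y) {U : Y.Opens} (x y : A.Sec U)
    (f g : Γ(Y, U)) : A.bracket U (x + A.unit U f) (y + A.unit U g) =
      A.bracket U x y + A.unit U ((A.anchor U x).app g - (A.anchor U y).app f) := by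
  simp only [map_add, AddMonoidHom.add_apply, A.bracket_unit, map_sub]
  rw [A.bracket_swap (A.unit U f) y, A.bracket_unit, A.anchor_unit, VF.zero_app, map_zero, add_zero]
  abel

variable (k Y) in
/-- The difference of a section of `L(K_Y)` and a Lie derivative is a function. -/
theorem exists_lieDiff (n : ℕ) [SmoothOfRelativeDimension n (Y ↘ Spec (.of k))] :
    ∃ φ : ∀ (U : Y.Opens), At k (forms k Y n) U → Γ(Y, U),
      (∀ U D, D = lieDer n D.vf + At.scalar (φ U D)) ∧
      ∀ U D f, D = lieDer n D.vf + At.scalar f → φ U D = f := by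
  have h : ∀ (U : Y.Opens) (D : At k (forms k Y n) U), ∃ f, At.scalar f = D - lieDer n D.vf :=
    fun U D => atiyah_line_exact (alt_isSep n _) (forms_locFree n) U (D - lieDer n D.vf)
      (sub_self D.vf)
  choose φ hφ using h
  refine ⟨φ, fun U D => ?_, fun U D f hf => ?_⟩
  · rw [hφ]
    abel
  · refine atiyah_unit_injective (k := k) one_pos (forms_locFree (k := k) n) U ?_
    change At.scalar (φ U D) = At.scalar f
    rw [hφ, sub_eq_iff_eq_add', ← hf]

/-- The algebroid `L + (1/2) L(K_Y)` exists. -/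
theorem nonempty_combination [CharZero k] (n : ℕ)
    [SmoothOfRelativeDimension n (Y ↘ Spec (.of k))] {L : UnitalAlgebroid k Y} (hL : L.IsPicard) :
    Nonempty (Combination 1 (1 / 2 : k) L (atiyah k (forms k Y n))) := by
  obtain ⟨φ, hφ, hφu⟩ := exists_lieDiff k Y n
  let A := atiyah k (forms k Y n)
  let G := fibProd L.toLieAlgebroid A.toLieAlgebroid
  let s : ∀ U, G.Sec U → L.Sec U := fun U x =>
    x.1.1 + L.unit U (cst k U (1 / 2) * φ U x.1.2)
  have hvf : ∀ U (x : G.Sec U), At.vf x.1.2 = L.anchor U x.1.1 := fun U x => x.2.symm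
  have hscal : ∀ (U : Y.Opens) (f g : Γ(Y, U)), (At.scalar f + At.scalar g : At k (forms k Y n) U) =
      At.scalar (f + g) := fun U f g => (map_add (A.unit U) f g).symm
  have hadd : ∀ U (x y : G.Sec U), φ U (x + y).1.2 = φ U x.1.2 + φ U y.1.2 := by
    intro U x y
    refine hφu U _ _ ?_
    change (show At k (forms k Y n) U from x.1.2) + (show At k (forms k Y n) U from y.1.2) =
      lieDer n (At.vf x.1.2 + At.vf y.1.2) + _
    conv_lhs => rw [hφ U x.1.2, hφ U y.1.2]
    rw [lieDer_add, ← hscal]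
    exact add_add_add_comm _ _ _ _
  have hsmul : ∀ U (f : Γ(Y, U)) (x : G.Sec U), φ U (f • x).1.2 =
      f * φ U x.1.2 - (L.anchor U x.1.1).app f := by
    intro U f x
    refine hφu U _ _ ?_
    change f • (show At k (forms k Y n) U from x.1.2) = lieDer n (f • At.vf x.1.2) + _
    conv_lhs => rw [hφ U x.1.2]
    have h1 : f • (At.scalar (φ U x.1.2) : At k (forms k Y n) U) = At.scalar (f * φ U x.1.2) :=
      (map_smul (A.unit U) f (φ U x.1.2)).symm
    rw [lieDer_smul, smul_add, h1, hvf, add_assoc, hscal]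
    congr 2
    ring
  have hbr : ∀ U (x y : G.Sec U), φ U (G.bracket U x y).1.2 =
      (L.anchor U x.1.1).app (φ U y.1.2) - (L.anchor U y.1.1).app (φ U x.1.2) := by
    intro U x y
    refine hφu U _ _ ?_
    have h1 := A.bracket_add_unit (lieDer n (At.vf x.1.2)) (lieDer n (At.vf y.1.2)) (φ U x.1.2)
      (φ U y.1.2)
    have h2 := congrArg₂ (fun a b : A.Sec U => A.bracket U a b) (hφ U x.1.2) (hφ U y.1.2)
    have h3 : A.bracket U (lieDer n (At.vf x.1.2)) (lieDer n (At.vf y.1.2)) =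
        lieDer n ((At.vf x.1.2).comm (At.vf y.1.2)) := (lieDer_comm n _ _).symm
    refine (h2.trans h1).trans ?_
    rw [h3, ← hvf, ← hvf]
    rfl
  have hres : ∀ {U V : Y.Opens} (h : V ≤ U) (x : G.Sec U),
      φ V (G.res h x).1.2 = rs h (φ U x.1.2) := by
    intro U V h x
    refine hφu V _ _ ?_
    have h1 := congrArg (A.res h) (hφ U x.1.2)
    refine (h1.trans (map_add (A.res h) (lieDer n (At.vf x.1.2)) (A.unit U (φ U x.1.2)))).trans ?_
    exact congrArg (fun a => A.res h (lieDer n (At.vf x.1.2)) + a) (A.unit_res h _)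
  refine ⟨⟨L.twist (-(1 / 2)), hL.twist, ⟨fun U =>
    { toFun := s U, map_add' := fun x y => ?_, map_smul' := fun f x => ?_ }, fun {U V} h x => ?_,
    fun U x => ?_, fun U x y => ?_⟩, fun U a b => ?_⟩⟩
  · change x.1.1 + y.1.1 + L.unit U (_ * φ U (x + y).1.2) =
      (x.1.1 + L.unit U _) + (y.1.1 + L.unit U _)
    rw [hadd, mul_add, map_add]
    abel
  · change f • x.1.1 + L.unit U (_ * φ U (f • x).1.2) =
      twMul L (-(1 / 2)) f (x.1.1 + L.unit U (cst k U (1 / 2) * φ U x.1.2))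
    rw [hsmul, twMul_add, twMul_unit, twMul, add_assoc, ← map_add]
    congr 2
    rw [map_neg]
    ring
  · change L.res h x.1.1 + L.unit V (_ * φ V (G.res h x).1.2) = L.res h (x.1.1 + L.unit U _)
    rw [hres, map_add, L.unit_res, map_mul (rs h), rs_cst]
  · change L.anchor U (x.1.1 + L.unit U _) = L.anchor U x.1.1
    rw [map_add, L.anchor_unit, add_zero]
  · change L.bracket U x.1.1 y.1.1 + L.unit U (_ * φ U (G.bracket U x y).1.2) =
      L.bracket U (x.1.1 + L.unit U _) (y.1.1 + L.unit U _)
    rw [hbr]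
    rw [L.bracket_add_unit, VF.app_cst_mul, VF.app_cst_mul, mul_sub]
  · change L.unit U a + L.unit U (_ * φ U (At.scalar b)) = L.unit U _
    have h1 : φ U (At.scalar b) = b := hφu U _ _ (by
      have : lieDer n (0 : VF k U) = 0 := by
        have := lieDer_add n (0 : VF k U) 0
        rw [add_zero] at this
        exact left_eq_add.1 this
      change At.scalar b = lieDer n (0 : VF k U) + _
      rw [this, zero_add])
    rw [h1, ← map_add, map_one, one_mul]

theorem Cocycle.formAt_smul_add (c : k) (z w : Cocycle k Y) (i : z.I × w.I)
    (V : Below (z.U i.1 ⊓ w.U i.2)) (ξ η : VF k V.1) :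
    formAt (((z.smul c).add w).form i) V ![ξ, η] =
      cst k V.1 c * formAt (z.form i.1) (V.up inf_le_left) ![ξ, η] +
        formAt (w.form i.2) (V.up inf_le_right) ![ξ, η] := by
  change formAt ((forms k Y 2).res (inf_le_left : z.U i.1 ⊓ w.U i.2 ≤ z.U i.1)
      (cst k (z.U i.1) c • z.form i.1) +
    (forms k Y 2).res (inf_le_right : z.U i.1 ⊓ w.U i.2 ≤ w.U i.2) (w.form i.2)) V ![ξ, η] = _
  rw [form_add, form_res, form_res, form_smul, rs_cst]

theorem Cocycle.formAt_trans_smul_add (c : k) (z w : Cocycle k Y) (i l : z.I × w.I)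
    (V : Below (z.U i.1 ⊓ w.U i.2 ⊓ (z.U l.1 ⊓ w.U l.2))) (ξ : VF k V.1) :
    formAt (((z.smul c).add w).trans i l) V ![ξ] =
      cst k V.1 c * formAt (z.trans i.1 l.1)
          ⟨V.1, V.2.trans (inf₄_left (z.U i.1) (w.U i.2) (z.U l.1) (w.U l.2))⟩ ![ξ] +
        formAt (w.trans i.2 l.2)
          ⟨V.1, V.2.trans (inf₄_right (z.U i.1) (w.U i.2) (z.U l.1) (w.U l.2))⟩ ![ξ] := by
  change formAt ((forms k Y 1).res (inf₄_left (z.U i.1) (w.U i.2) (z.U l.1) (w.U l.2))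
      (cst k (z.U i.1 ⊓ z.U l.1) c • z.trans i.1 l.1) +
    (forms k Y 1).res (inf₄_right (z.U i.1) (w.U i.2) (z.U l.1) (w.U l.2)) (w.trans i.2 l.2)) V ![ξ] = _
  rw [form_add, form_res, form_res, form_smul, rs_cst]

/-- The class of a sum of Picard algebroids. -/
theorem Combination.represents {c : k} {L A : UnitalAlgebroid k Y} (P : Combination 1 c L A)
    {w z : Cocycle k Y} (hw : Represents L w) (hz : Represents A z) :
    Represents P.alg ((z.smul c).add w) := by
  obtain ⟨s, hs1, hs2⟩ := hw
  obtain ⟨t, ht1, ht2⟩ := hz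
  let G := fibProd L.toLieAlgebroid A.toLieAlgebroid
  let σ : ∀ (i : z.I × w.I) (V : Below (z.U i.1 ⊓ w.U i.2)), VF k V.1 →ₗ[Γ(Y, V.1)] G.Sec V.1 :=
    fun i V =>
    { toFun := fun ξ => ⟨((s i.2).app (V.up inf_le_right) ξ, (t i.1).app (V.up inf_le_left) ξ),
        ((s i.2).anchor_app (V.up inf_le_right) ξ).trans
          ((t i.1).anchor_app (V.up inf_le_left) ξ).symm⟩
      map_add' := fun ξ η => Subtype.ext (Prod.ext (map_add _ _ _) (map_add _ _ _))
      map_smul' := fun f ξ => Subtype.ext (Prod.ext (map_smul _ _ _) (map_smul _ _ _)) }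
  have key : ∀ (U : Y.Opens) (x : G.Sec U) (a b : Γ(Y, U)), L.unit U a = x.1.1 →
      A.unit U b = x.1.2 → P.alg.unit U (cst k U c * b + a) = P.s.app U x := by
    intro U x a b ha hb
    have h := P.s_unit U a b
    rw [map_one, one_mul] at h
    rw [add_comm, ← h]
    exact congrArg _ (Subtype.ext (Prod.ext ha hb))
  have key2 : ∀ (U : Y.Opens) (x x' : G.Sec U) (a b : Γ(Y, U)), L.unit U a = x.1.1 - x'.1.1 →
      A.unit U b = x.1.2 - x'.1.2 → P.alg.unit U (cst k U c * b + a) = P.s.app U x - P.s.app U x' :=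
    fun U x x' a b ha hb => (key U (x - x') a b ha hb).trans (map_sub _ _ _)
  refine ⟨fun i => ⟨fun V => (P.s.app V.1).comp (σ i V), fun V W h ξ => ?_, fun V ξ => ?_⟩,
    fun i V ξ η => ?_, fun i l V ξ => ?_⟩
  · refine Eq.trans ?_ (P.s.app_res h (σ i V ξ))
    exact congrArg (P.s.app W.1) (Subtype.ext (Prod.ext ((s i.2).app_res (V.up inf_le_right) (W.up inf_le_right) h ξ)
      ((t i.1).app_res (V.up inf_le_left) (W.up inf_le_left) h ξ)))
  · exact (P.s.anchor_app V.1 (σ i V ξ)).trans ((s i.2).anchor_app (V.up inf_le_right) ξ)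
  · refine (congrArg _ (Cocycle.formAt_smul_add c z w i V ξ η)).trans ?_
    refine (key V.1 (G.bracket V.1 (σ i V ξ) (σ i V η) - σ i V (ξ.comm η)) _ _
      (hs1 i.2 (V.up inf_le_right) ξ η) (ht1 i.1 (V.up inf_le_left) ξ η)).trans ?_
    exact (map_sub (P.s.app V.1) _ _).trans
      (congrArg (· - P.s.app V.1 (σ i V (ξ.comm η))) (P.s.app_bracket V.1 (σ i V ξ) (σ i V η)))
  · have hl := V.2.trans (inf₄_left (z.U i.1) (w.U i.2) (z.U l.1) (w.U l.2))
    have hr := V.2.trans (inf₄_right (z.U i.1) (w.U i.2) (z.U l.1) (w.U l.2))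
    exact (congrArg _ (Cocycle.formAt_trans_smul_add c z w i l V ξ)).trans (key2 V.1 (σ l ⟨V.1, V.2.trans inf_le_right⟩ ξ)
      (σ i ⟨V.1, V.2.trans inf_le_left⟩ ξ) _ _ (hs2 i.2 l.2 ⟨V.1, hr⟩ ξ) (ht2 i.1 l.1 ⟨V.1, hl⟩ ξ))

end Plus

/-! ### The first order operators of a quantized module -/

section QuantModule

variable {k : Type u} [Field k] {X : Scheme.{u}} [X.Over (Spec (.of k))]
  {Y : Scheme.{u}} [Y.Over (Spec (.of k))] {j : Y ⟶ X} {Q : QuantData k X}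

section Restrict

variable {F : SheafOfModules.{u} Q.sheaf} {U V W : X.Opens}

theorem fres_smul (h : V ≤ U) (a : Q.Sec U) (e : F.val.obj (op U)) :
    fres F h (a • e) = Q.res h a • fres F h e :=
  F.val.map_smul (homOfLE h).op a e

theorem fres_fres (h : V ≤ U) (h' : W ≤ V) (e : F.val.obj (op U)) :
    fres F h' (fres F h e) = fres F (h'.trans h) e :=
  (F.val.map_comp_apply (homOfLE h).op (homOfLE h').op e).symm

theorem fres_id (h : U ≤ U) (e : F.val.obj (op U)) : fres F h e = e := by
  have h1 : (homOfLE h).op = 𝟙 (op U) := rfl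
  rw [fres, h1, F.val.map_id]
  rfl

theorem fres_sub (h : V ≤ U) (e e' : F.val.obj (op U)) :
    fres F h (e - e') = fres F h e - fres F h e' := map_sub (F.val.map (homOfLE h).op).hom e e'

end Restrict

namespace QuantModule

variable {E : Y.Modules} {m : ℕ} (F : QuantModule j Q E m)

abbrev Sec (U : X.Opens) : Type u := F.F.val.obj (op U)

variable {F} {U : X.Opens}

theorem red_hbar_smul (e : F.Sec U) : F.red U (Q.hbar U • e) = 0 :=
  (F.red_eq_zero U _).2 fun x hx => ⟨U, le_rfl, hx, fres F.F le_rfl e, by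
    rw [fres_smul, Q.res_hbar]⟩

theorem red_eq_zero_of_hbar (hm : 2 ≤ m) {e : F.Sec U} (he : Q.hbar U • e = 0) : F.red U e = 0 := by
  refine (F.red_eq_zero U e).2 fun x hx => ?_
  obtain ⟨V, hV, hxV, e', h⟩ := F.flat U e he x hx
  refine ⟨V, hV, hxV, Q.hbar V ^ (m - 2) • e', ?_⟩
  rw [h, smul_smul, ← pow_succ']
  congr 2
  omega

theorem red_eq_of_hbar (hm : 2 ≤ m) {e e' : F.Sec U} (he : Q.hbar U • e = Q.hbar U • e') :
    F.red U e = F.red U e' := by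
  rw [← sub_eq_zero, ← map_sub]
  exact red_eq_zero_of_hbar hm (by rw [smul_sub, he, sub_self])

theorem hbar_smul_comm (a : Q.Sec U) (e : F.Sec U) :
    a • Q.hbar U • e = Q.hbar U • a • e := by
  rw [smul_smul, smul_smul, QuantData.hbar, Q.scalar_comm]

theorem red_ideal_smul (x : Q.ideal j U) (e : F.Sec U) : F.red U (x.1 • e) = 0 := by
  rw [F.red_smul, Q.jres_red]
  exact zero_smul _ _

/-- The operator `x : F/hF → hF/h²F` is well defined. -/
theorem red_eq_of_red_eq (hm : 2 ≤ m) (x : Q.ideal j U) {e₁ e₂ e₁' e₂' : F.Sec U}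
    (h₁ : x.1 • e₁ = Q.hbar U • e₁') (h₂ : x.1 • e₂ = Q.hbar U • e₂') (h : F.red U e₁ = F.red U e₂) :
    F.red U e₁' = F.red U e₂' := by
  refine (of_isSheaf E).isSep _ _ _ fun y hy => ?_
  obtain ⟨V, hV, hyV, g, hg⟩ := (F.red_eq_zero U (e₁ - e₂)).1 (by rw [map_sub, h, sub_self]) (j y) hy
  refine ⟨j ⁻¹ᵁ V, preimage_le j hV, hyV, ?_⟩
  rw [← F.red_res hV, ← F.red_res hV, ← sub_eq_zero, ← map_sub]
  have h3 : F.red V (fres F.F hV e₁' - fres F.F hV e₂') = F.red V (Q.res hV x.1 • g) := by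
    refine red_eq_of_hbar hm ?_
    rw [← hbar_smul_comm, ← hg, fres_sub, smul_sub, smul_sub, ← fres_smul, ← fres_smul, h₁, h₂,
      fres_smul, fres_smul, Q.res_hbar]
  exact h3.trans (red_ideal_smul ⟨_, Q.res_mem_ideal hV x⟩ g)

theorem exists_lift [IsClosedImmersion j] (F : QuantModule j Q E m) (x : Q.ideal j U) {W : Y.Opens}
    (s : (ModPresheaf.of E).Sec W) {y : Y} (hy : y ∈ W) (hyU : y ∈ j ⁻¹ᵁ U) :
    ∃ (V : X.Opens) (hV : V ≤ U) (h : j ⁻¹ᵁ V ≤ W), y ∈ j ⁻¹ᵁ V ∧ ∃ e e' : F.Sec V,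
      Q.res hV x.1 • e = Q.hbar V • e' ∧ F.red V e = (ModPresheaf.of E).res h s := by
  obtain ⟨V, hV, -, hyV, hVW⟩ := LagQuant.exists_nhd hy hyU
  obtain ⟨V', hV', hyV', e, he⟩ := F.red_surjective V ((ModPresheaf.of E).res hVW s) (j y) hyV
  rw [ModPresheaf.res_res] at he
  obtain ⟨P, hP, hyP, e', h⟩ := (F.red_eq_zero V' _).1
    (red_ideal_smul ⟨_, Q.res_mem_ideal (hV'.trans hV) x⟩ e) (j y) hyV'
  refine ⟨P, hP.trans (hV'.trans hV), (preimage_le j (hP.trans hV')).trans hVW, hyP,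
    fres F.F hP e, e', ?_, ?_⟩
  · rw [← h, fres_smul, Q.res_res]
  · rw [F.red_res, he, ModPresheaf.res_res]

/-- The sections `s` and `t` of `E` are induced by `e` and `e'` with `x e = h e'`. -/
def OpRel (F : QuantModule j Q E m) (x : Q.ideal j U) (W : Y.Opens)
    (s t : (ModPresheaf.of E).Sec W) : Prop :=
  ∃ (V : X.Opens) (hV : V ≤ U) (h : W ≤ j ⁻¹ᵁ V) (e e' : F.Sec V),
    Q.res hV x.1 • e = Q.hbar V • e' ∧ s = (ModPresheaf.of E).res h (F.red V e) ∧
      t = (ModPresheaf.of E).res h (F.red V e')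

theorem OpRel.res {x : Q.ideal j U} {W : Y.Opens} {s t : (ModPresheaf.of E).Sec W}
    (r : F.OpRel x W s t) {W' : Y.Opens} (hW : W' ≤ W) :
    F.OpRel x W' ((ModPresheaf.of E).res hW s) ((ModPresheaf.of E).res hW t) := by
  obtain ⟨V, hV, h, e, e', he, rfl, rfl⟩ := r
  exact ⟨V, hV, hW.trans h, e, e', he, ModPresheaf.res_res _ _ _ _, ModPresheaf.res_res _ _ _ _⟩

theorem OpRel.unique [IsClosedImmersion j] (hm : 2 ≤ m) {x : Q.ideal j U} {W : Y.Opens}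
    {s t t' : (ModPresheaf.of E).Sec W} (r : F.OpRel x W s t) (r' : F.OpRel x W s t') : t = t' := by
  refine (of_isSheaf E).isSep _ _ _ fun y hy => ?_
  obtain ⟨V₁, hV₁, h₁, e₁, e₁', he₁, hs₁, rfl⟩ := r
  obtain ⟨V₂, hV₂, h₂, e₂, e₂', he₂, hs₂, rfl⟩ := r'
  obtain ⟨P, hP, -, hyP, hPW⟩ := LagQuant.exists_nhd (U := V₁ ⊓ V₂) hy ⟨h₁ hy, h₂ hy⟩
  refine ⟨j ⁻¹ᵁ P, hPW, hyP, ?_⟩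
  have hP₁ := hP.trans inf_le_left
  have hP₂ := hP.trans inf_le_right
  rw [ModPresheaf.res_res, ModPresheaf.res_res, ← F.red_res hP₁, ← F.red_res hP₂]
  refine red_eq_of_red_eq hm ⟨_, Q.res_mem_ideal (hP₁.trans hV₁) x⟩ (e₁ := fres F.F hP₁ e₁)
    (e₂ := fres F.F hP₂ e₂) ?_ ?_ ?_
  · change Q.res _ x.1 • _ = _
    rw [← Q.res_res hV₁ hP₁, ← fres_smul, he₁, fres_smul, Q.res_hbar]
  · change Q.res _ x.1 • _ = _
    rw [← Q.res_res hV₂ hP₂, ← fres_smul, he₂, fres_smul, Q.res_hbar]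
  · rw [F.red_res, F.red_res]
    have h3 := congrArg ((ModPresheaf.of E).res hPW) (hs₁.symm.trans hs₂)
    rwa [ModPresheaf.res_res, ModPresheaf.res_res] at h3

theorem exists_opRel [IsClosedImmersion j] (F : QuantModule j Q E m) (x : Q.ideal j U) {W : Y.Opens}
    (hW : W ≤ j ⁻¹ᵁ U) (s : (ModPresheaf.of E).Sec W) {y : Y} (hy : y ∈ W) :
    ∃ (W' : Y.Opens) (h : W' ≤ W), y ∈ W' ∧ ∃ t, F.OpRel x W' ((ModPresheaf.of E).res h s) t := by
  obtain ⟨V, hV, h, hyV, e, e', he, hs⟩ := F.exists_lift x s hy (hW hy)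
  exact ⟨j ⁻¹ᵁ V, h, hyV, _, V, hV, le_rfl, e, e', he,
    by rw [ModPresheaf.res_id, hs], rfl⟩

theorem exists_op [IsClosedImmersion j] (hm : 2 ≤ m) (F : QuantModule j Q E m) (x : Q.ideal j U)
    {W : Y.Opens} (hW : W ≤ j ⁻¹ᵁ U) (s : (ModPresheaf.of E).Sec W) :
    ∃ t : (ModPresheaf.of E).Sec W, ∀ (V : Y.Opens) (h : V ≤ W) (r),
      F.OpRel x V ((ModPresheaf.of E).res h s) r → (ModPresheaf.of E).res h t = r := by
  refine ((of_isSheaf E).existsUnique_glue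
    (fun V h r => F.OpRel x V ((ModPresheaf.of E).res h s) r)
    (fun y hy => F.exists_opRel x hW s hy) ?_).exists
  intro V h r V' h' r' hr hr'
  have h1 := hr.res (inf_le_left : V ⊓ V' ≤ V)
  have h2 := hr'.res (inf_le_right : V ⊓ V' ≤ V')
  rw [ModPresheaf.res_res] at h1 h2
  exact h1.unique hm h2

/-- The section `D` of `L(E)` is the operator `x : F/hF → hF/h²F`. -/
structure IsOp (F : QuantModule j Q E m) (T : TorAlgebroid j Q) (x : Q.ideal j U)
    (D : At k (ModPresheaf.of E) (j ⁻¹ᵁ U)) : Prop where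
  vf : D.vf = T.alg.anchor _ (T.q U x)
  op : ∀ (V : X.Opens) (hV : V ≤ U) (e e' : F.Sec V), Q.res hV x.1 • e = Q.hbar V • e' →
    D.op ⟨j ⁻¹ᵁ V, preimage_le j hV⟩ (F.red V e) = F.red V e'

theorem at_ext [IsClosedImmersion j] (F : QuantModule j Q E m) (x : Q.ideal j U)
    {D D' : At k (ModPresheaf.of E) (j ⁻¹ᵁ U)} (hvf : D.vf = D'.vf)
    (h : ∀ (V : X.Opens) (hV : V ≤ U) (e e' : F.Sec V), Q.res hV x.1 • e = Q.hbar V • e' →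
      D.op ⟨j ⁻¹ᵁ V, preimage_le j hV⟩ (F.red V e) =
        D'.op ⟨j ⁻¹ᵁ V, preimage_le j hV⟩ (F.red V e)) : D = D' := by
  refine At.ext (fun W s => (of_isSheaf E).isSep _ _ _ fun y hy => ?_) hvf
  obtain ⟨V, hV, hVW, hyV, e, e', he, hs⟩ := F.exists_lift x s hy (W.2 hy)
  refine ⟨j ⁻¹ᵁ V, hVW, hyV, ?_⟩
  rw [D.op_res W ⟨j ⁻¹ᵁ V, preimage_le j hV⟩ hVW, D'.op_res W ⟨j ⁻¹ᵁ V, preimage_le j hV⟩ hVW, ← hs]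
  exact h V hV e e' he

theorem IsOp.unique [IsClosedImmersion j] {T : TorAlgebroid j Q} {x : Q.ideal j U}
    {D D' : At k (ModPresheaf.of E) (j ⁻¹ᵁ U)} (h : F.IsOp T x D) (h' : F.IsOp T x D') : D = D' :=
  F.at_ext x (h.vf.trans h'.vf.symm) fun V hV e e' he =>
    (h.op V hV e e' he).trans (h'.op V hV e e' he).symm

theorem IsOp.res {T : TorAlgebroid j Q} {x : Q.ideal j U}
    {D : At k (ModPresheaf.of E) (j ⁻¹ᵁ U)} (h : F.IsOp T x D) {V : X.Opens} (hV : V ≤ U) :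
    F.IsOp T ⟨Q.res hV x.1, Q.res_mem_ideal hV x⟩ (At.res (preimage_le j hV) D) where
  vf := by
    rw [LagDatum.q_eq T hV x, T.alg.anchor_res, ← h.vf]
    rfl
  op P hP e e' he := h.op P (hP.trans hV) e e' (by rwa [← Q.res_res hV hP])

theorem exists_isOp [CharZero k] [IsClosedImmersion j] {ω : SymplecticForm k X}
    (D : LagDatum j Q ω) (T : TorAlgebroid j Q) (hm : 2 ≤ m)
    (F : QuantModule j Q E m) (x : Q.ideal j U) : ∃ D, F.IsOp T x D := by
  choose A hA using fun (W : Below (j ⁻¹ᵁ U)) (s : (ModPresheaf.of E).Sec W.1) =>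
    exists_op hm F x W.2 s
  have hA' : ∀ (W V : Below (j ⁻¹ᵁ U)) (h : V.1 ≤ W.1) (s : (ModPresheaf.of E).Sec W.1)
      (r : (ModPresheaf.of E).Sec V.1), F.OpRel x V.1 ((ModPresheaf.of E).res h s) r →
      (ModPresheaf.of E).res h (A W s) = r := fun W V h s r hr => hA W s V.1 h r hr
  have hop : ∀ (V : X.Opens) (hV : V ≤ U) (e e' : F.Sec V), Q.res hV x.1 • e = Q.hbar V • e' →
      A ⟨j ⁻¹ᵁ V, preimage_le j hV⟩ (F.red V e) = F.red V e' := by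
    intro V hV e e' he
    have h1 := hA ⟨j ⁻¹ᵁ V, preimage_le j hV⟩ (F.red V e) (j ⁻¹ᵁ V) le_rfl (F.red V e')
      ⟨V, hV, le_rfl, e, e', he, rfl, (ModPresheaf.res_id _ _ _).symm⟩
    rwa [ModPresheaf.res_id] at h1
  have hres : ∀ (W V : Below (j ⁻¹ᵁ U)) (h : V.1 ≤ W.1) s,
      (ModPresheaf.of E).res h (A W s) = A V ((ModPresheaf.of E).res h s) := by
    intro W V h s
    refine (of_isSheaf E).isSep _ _ _ fun y hy => ?_
    obtain ⟨W', hW', hyW', t, ht⟩ := F.exists_opRel x V.2 ((ModPresheaf.of E).res h s) hy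
    refine ⟨W', hW', hyW', ?_⟩
    rw [hA V _ W' hW' t ht, ModPresheaf.res_res]
    rw [ModPresheaf.res_res] at ht
    exact hA W _ W' _ t ht
  have hadd : ∀ (W : Below (j ⁻¹ᵁ U)) s s', A W (s + s') = A W s + A W s' := by
    intro W s s'
    refine (of_isSheaf E).isSep _ _ _ fun y hy => ?_
    obtain ⟨V, hV, hVW, hyV, e₁, e₁', he₁, hs₁⟩ := F.exists_lift x s hy (W.2 hy)
    obtain ⟨V', hV', hVW', hyV', e₂, e₂', he₂, hs₂⟩ := F.exists_lift ⟨_, Q.res_mem_ideal hV x⟩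
      ((ModPresheaf.of E).res hVW s') hyV hyV
    rw [ModPresheaf.res_res] at hs₂
    rw [Q.res_res] at he₂
    refine ⟨j ⁻¹ᵁ V', hVW'.trans hVW, hyV', ?_⟩
    have he₁' : Q.res (hV'.trans hV) x.1 • fres F.F hV' e₁ = Q.hbar V' • fres F.F hV' e₁' := by
      rw [← Q.res_res hV hV', ← fres_smul, he₁, fres_smul, Q.res_hbar]
    have hs₁' : F.red V' (fres F.F hV' e₁) = (ModPresheaf.of E).res (hVW'.trans hVW) s := by
      rw [F.red_res, hs₁, ModPresheaf.res_res]
    let V'' : Below (j ⁻¹ᵁ U) := ⟨j ⁻¹ᵁ V', preimage_le j (hV'.trans hV)⟩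
    rw [map_add, hres W V'' (hVW'.trans hVW), hres W V'' (hVW'.trans hVW),
      hres W V'' (hVW'.trans hVW), map_add, ← hs₁', ← hs₂, ← map_add, hop _ _ _ _ he₁',
      hop _ _ _ _ he₂, ← map_add]
    exact hop _ _ _ _ (by rw [smul_add, smul_add, he₁', he₂])
  have hsmul : ∀ (W : Below (j ⁻¹ᵁ U)) f s, A W (f • s) =
      f • A W s + (T.alg.anchor _ (T.q U x)).1 W f • s := by
    intro W f s
    refine (of_isSheaf E).isSep _ _ _ fun y hy => ?_
    obtain ⟨V, hV, hVW, i, hi, hyV, G, hG⟩ := D.exists_fun hy (W.2 hy) f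
    obtain ⟨V', hV', hVW', hyV', e, e', he, hs⟩ := F.exists_lift ⟨_, Q.res_mem_ideal hV x⟩
      ((ModPresheaf.of E).res hVW s) hyV hyV
    rw [ModPresheaf.res_res] at hs
    rw [Q.res_res] at he
    obtain ⟨z, hz⟩ := D.exists_comm i (hV'.trans hi) (Q.res (hV'.trans hV) x.1) (Q.res hV' G)
    let V'' : Below (j ⁻¹ᵁ U) := ⟨j ⁻¹ᵁ V', preimage_le j (hV'.trans hV)⟩
    have hG' : jres j (le_refl (j ⁻¹ᵁ V')) (Q.red V' (Q.res hV' G)) = rs (hVW'.trans hVW) f := by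
      rw [Q.red_res', jres_rs, ← rs_jres le_rfl hVW', hG, rs_rs]
    have hz' := T.q_anchor V' ⟨_, Q.res_mem_ideal (hV'.trans hV) x⟩ (Q.res hV' G) z hz
    rw [hG', LagDatum.q_eq T (hV'.trans hV) x, T.alg.anchor_res] at hz'
    refine ⟨j ⁻¹ᵁ V', hVW'.trans hVW, hyV', ?_⟩
    rw [map_add, hres W V'' (hVW'.trans hVW), ModPresheaf.res_smul, ModPresheaf.res_smul,
      ModPresheaf.res_smul, hres W V'' (hVW'.trans hVW), ← hs, hop _ _ _ _ he,
      (T.alg.anchor _ (T.q U x)).2.2.2 W V'' (hVW'.trans hVW)]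
    have h1 : rs (hVW'.trans hVW) f • F.red V' e = F.red V' (Q.res hV' G • e) := by
      rw [F.red_smul, hG']
    rw [h1, hop V' (hV'.trans hV) _ (Q.res hV' G • e' + z • e), map_add, F.red_smul, F.red_smul, hG', ← hz']
    · rfl
    · rw [smul_add, ← hbar_smul_comm, ← he, smul_smul, smul_smul, smul_smul, hz, ← add_smul]
      congr 1
      abel
  exact ⟨⟨(fun W => AddMonoidHom.mk' (A W) (hadd W), T.alg.anchor _ (T.q U x)), hsmul, hres⟩, rfl, hop⟩

end QuantModule

end QuantModule

/-! ### The algebra of the operators of a quantized module -/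

section OpAlgebra

variable {k : Type u} [Field k] {X : Scheme.{u}} [X.Over (Spec (.of k))]
  {Y : Scheme.{u}} [Y.Over (Spec (.of k))] {j : Y ⟶ X} {Q : QuantData k X}

namespace QuantModule

variable {E : Y.Modules} {m : ℕ} {F : QuantModule j Q E m} {T : TorAlgebroid j Q} {U : X.Opens}

theorem exists_div (F : QuantModule j Q E m) (x : Q.ideal j U) {V : X.Opens} (hV : V ≤ U)
    (e : F.Sec V) {y : X} (hy : y ∈ V) : ∃ (P : X.Opens) (hP : P ≤ V), y ∈ P ∧
      ∃ a : F.Sec P, Q.res (hP.trans hV) x.1 • fres F.F hP e = Q.hbar P • a := by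
  obtain ⟨P, hP, hyP, a, h⟩ := (F.red_eq_zero V _).1
    (red_ideal_smul ⟨_, Q.res_mem_ideal hV x⟩ e) y hy
  exact ⟨P, hP, hyP, a, by rw [← h, fres_smul, Q.res_res]⟩

theorem IsOp.of_exists (hm : 2 ≤ m) {x : Q.ideal j U} {D : At k (ModPresheaf.of E) (j ⁻¹ᵁ U)}
    (hvf : D.vf = T.alg.anchor _ (T.q U x))
    (h : ∀ (V : X.Opens) (hV : V ≤ U) (e : F.Sec V), ∀ y ∈ j ⁻¹ᵁ V, ∃ (P : X.Opens) (hP : P ≤ V),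
      y ∈ j ⁻¹ᵁ P ∧ ∃ a : F.Sec P, Q.res (hP.trans hV) x.1 • fres F.F hP e = Q.hbar P • a ∧
        D.op ⟨j ⁻¹ᵁ P, preimage_le j (hP.trans hV)⟩ (F.red P (fres F.F hP e)) = F.red P a) :
    F.IsOp T x D := by
  refine ⟨hvf, fun V hV e e' he => (of_isSheaf E).isSep _ _ _ fun y hy => ?_⟩
  obtain ⟨P, hP, hyP, a, ha, hD⟩ := h V hV e y hy
  refine ⟨j ⁻¹ᵁ P, preimage_le j hP, hyP, ?_⟩
  rw [D.op_res ⟨j ⁻¹ᵁ V, preimage_le j hV⟩ ⟨j ⁻¹ᵁ P, preimage_le j (hP.trans hV)⟩ (preimage_le j hP),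
    ← F.red_res hP, ← F.red_res hP, hD]
  refine red_eq_of_hbar hm ?_
  rw [← ha, ← Q.res_res hV hP, ← fres_smul, he, fres_smul, Q.res_hbar]

variable {x x' : Q.ideal j U} {D D' : At k (ModPresheaf.of E) (j ⁻¹ᵁ U)}

/-- Two sections of the ideal divide a section of a quantized module simultaneously. -/
theorem exists_div_two (F : QuantModule j Q E m) (x x' : Q.ideal j U) {V : X.Opens} (hV : V ≤ U)
    (e e' : F.Sec V) {y : X} (hy : y ∈ V) : ∃ (P : X.Opens) (hP : P ≤ V), y ∈ P ∧
      ∃ a a' : F.Sec P, Q.res (hP.trans hV) x.1 • fres F.F hP e = Q.hbar P • a ∧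
        Q.res (hP.trans hV) x'.1 • fres F.F hP e' = Q.hbar P • a' := by
  obtain ⟨P, hP, hyP, a, ha⟩ := F.exists_div x hV e hy
  obtain ⟨P', hP', hyP', a', ha'⟩ := F.exists_div x' (hP.trans hV) (fres F.F hP e') hyP
  refine ⟨P', hP'.trans hP, hyP', fres F.F hP' a, a', ?_, ?_⟩
  · rw [← Q.res_res (hP.trans hV) hP', ← fres_fres hP hP', ← fres_smul, ha, fres_smul, Q.res_hbar]
  · rw [← fres_fres hP hP', ha']

theorem IsOp.op_div (h : F.IsOp T x D) {V P : X.Opens} (hV : V ≤ U) (hP : P ≤ V) {e : F.Sec V}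
    {a : F.Sec P} (ha : Q.res (hP.trans hV) x.1 • fres F.F hP e = Q.hbar P • a) :
    D.op ⟨j ⁻¹ᵁ P, preimage_le j (hP.trans hV)⟩ (F.red P (fres F.F hP e)) = F.red P a :=
  h.op P (hP.trans hV) _ _ ha

theorem IsOp.add (hm : 2 ≤ m) (h : F.IsOp T x D) (h' : F.IsOp T x' D') :
    F.IsOp T (x + x') (D + D') := by
  refine IsOp.of_exists hm ?_ fun V hV e y hy => ?_
  · rw [At.add_vf, h.vf, h'.vf, map_add, map_add]
  · obtain ⟨P, hP, hyP, a, a', ha, ha'⟩ := F.exists_div_two x x' hV e e hy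
    refine ⟨P, hP, hyP, a + a', ?_, ?_⟩
    · change Q.res _ (x.1 + x'.1) • _ = _
      rw [map_add (Q.res (hP.trans hV)), add_smul, ha, ha', smul_add]
    · rw [At.add_op, h.op_div hV hP ha, h'.op_div hV hP ha', map_add]

theorem IsOp.smul (hm : 2 ≤ m) (h : F.IsOp T x D) (f : Q.Sec U)
    (hvf : T.alg.anchor _ (T.q U ⟨f * x.1, (Q.ideal j U).mul_mem_left f x.2⟩) =
      jres j (le_refl (j ⁻¹ᵁ U)) (Q.red U f) • T.alg.anchor _ (T.q U x)) :
    F.IsOp T ⟨f * x.1, (Q.ideal j U).mul_mem_left f x.2⟩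
      (jres j (le_refl (j ⁻¹ᵁ U)) (Q.red U f) • D) := by
  refine IsOp.of_exists hm ?_ fun V hV e y hy => ?_
  · rw [At.smul_vf, h.vf, hvf]
  · obtain ⟨P, hP, hyP, a, ha⟩ := F.exists_div x hV e hy
    refine ⟨P, hP, hyP, Q.res (hP.trans hV) f • a, ?_, ?_⟩
    · change Q.res _ (f * x.1) • _ = _
      rw [map_mul (Q.res (hP.trans hV)), mul_smul, ha, hbar_smul_comm]
    · rw [At.smul_op, h.op_div hV hP ha, F.red_smul, rs_jres, Q.red_res', jres_rs]

theorem isOp_hbar (hm : 2 ≤ m) (f : Q.Sec U) (hx : x.1 = Q.hbar U * f) :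
    F.IsOp T x (At.scalar (jres j (le_refl (j ⁻¹ᵁ U)) (Q.red U f))) := by
  refine IsOp.of_exists hm ?_ fun V hV e y hy => ⟨V, le_rfl, hy, Q.res hV f • e, ?_, ?_⟩
  · rw [← T.q_unit U f x hx, T.alg.anchor_unit]
    rfl
  · change Q.res hV x.1 • _ = _
    rw [hx, map_mul (Q.res hV), Q.res_hbar, mul_smul]
    exact congrArg (fun e => Q.hbar V • Q.res hV f • e) (fres_id _ e)
  · rw [F.red_smul, Q.red_res', jres_rs, F.red_res, ModPresheaf.res_id]
    change rs (preimage_le j hV) (jres j (le_refl (j ⁻¹ᵁ U)) (Q.red U f)) • F.red V e = _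
    rw [rs_jres]

theorem exists_div_sq (F : QuantModule j Q E m) {V₀ V : X.Opens} (hV : V ≤ V₀) {z : Q.Sec V₀}
    (hz : z ∈ Q.idealSq j V₀) (e : F.Sec V) {y : X} (hy : y ∈ V) :
    ∃ (P : X.Opens) (hP : P ≤ V), y ∈ P ∧
      ∃ a : F.Sec P, Q.res (hP.trans hV) z • fres F.F hP e = Q.hbar P • a ∧ F.red P a = 0 := by
  refine AddSubgroup.closure_induction (p := fun z _ => ∃ (P : X.Opens) (hP : P ≤ V), y ∈ P ∧
      ∃ a : F.Sec P, Q.res (hP.trans hV) z • fres F.F hP e = Q.hbar P • a ∧ F.red P a = 0)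
    ?_ ?_ ?_ ?_ hz
  · rintro _ ⟨a, ha, b, hb, rfl⟩
    obtain ⟨P, hP, hyP, c, hc⟩ := F.exists_div ⟨b, hb⟩ hV e hy
    refine ⟨P, hP, hyP, Q.res (hP.trans hV) a • c, ?_, ?_⟩
    · rw [map_mul (Q.res (hP.trans hV)), mul_smul, hc, hbar_smul_comm]
    · exact red_ideal_smul ⟨_, Q.res_mem_ideal (hP.trans hV) ⟨a, ha⟩⟩ c
  · exact ⟨V, le_rfl, hy, 0, by rw [map_zero (Q.res _), zero_smul, smul_zero], map_zero _⟩
  · rintro z z' - - ⟨P, hP, hyP, a, ha, ha0⟩ ⟨P', hP', hyP', a', ha', ha0'⟩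
    refine ⟨P ⊓ P', inf_le_left.trans hP, ⟨hyP, hyP'⟩,
      fres F.F inf_le_left a + fres F.F inf_le_right a', ?_, ?_⟩
    · rw [map_add (Q.res _), add_smul, smul_add, ← Q.res_hbar (inf_le_left : P ⊓ P' ≤ P), ← fres_smul,
        ← ha, Q.res_hbar, ← Q.res_hbar (inf_le_right : P ⊓ P' ≤ P'), ← fres_smul, ← ha', fres_smul,
        fres_smul, fres_fres, fres_fres, Q.res_res, Q.res_res]
    · rw [map_add, F.red_res, F.red_res, ha0, ha0', map_zero, map_zero, add_zero]
  · rintro z - ⟨P, hP, hyP, a, ha, ha0⟩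
    refine ⟨P, hP, hyP, -a, ?_, ?_⟩
    · rw [map_neg (Q.res _), neg_smul, ha, smul_neg]
    · rw [map_neg, ha0, neg_zero]

theorem IsOp.of_q_eq (hm : 2 ≤ m) (h : F.IsOp T x D) (hx : T.q U x = T.q U x') : F.IsOp T x' D := by
  refine IsOp.of_exists hm (by rw [h.vf, hx]) fun V hV e y hy => ?_
  have h0 : T.q U (x - x') = 0 := by rw [map_sub, hx, sub_self]
  obtain ⟨V', hV', hyV', hsq⟩ := (T.q_eq_zero U _).1 h0 (j y) (hV hy)
  have hVV : V ⊓ V' ≤ V := inf_le_left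
  obtain ⟨P, hP, hyP, a, ha⟩ := F.exists_div x (hVV.trans hV) (fres F.F hVV e) (y := j y) ⟨hy, hyV'⟩
  rw [fres_fres] at ha
  obtain ⟨P', hP', hyP', c, hc, hc0⟩ := F.exists_div_sq (hP.trans inf_le_right) hsq
    (fres F.F (hP.trans hVV) e) hyP
  rw [fres_fres, Q.res_res] at hc
  have ha' : Q.res (hP'.trans (hP.trans (hVV.trans hV))) x.1 •
      fres F.F (hP'.trans (hP.trans hVV)) e = Q.hbar P' • fres F.F hP' a := by
    rw [← Q.res_hbar hP', ← fres_smul, ← ha, fres_smul, Q.res_res, fres_fres]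
  refine ⟨P', hP'.trans (hP.trans hVV), hyP', fres F.F hP' a - c, ?_, ?_⟩
  · rw [smul_sub, ← ha', ← hc, ← sub_smul, ← map_sub (Q.res _)]
    congr 2
    change x'.1 = x.1 - (x.1 - x'.1)
    abel
  · rw [map_sub, hc0, sub_zero]
    exact h.op_div hV _ ha'

theorem IsOp.bracket {F : QuantModule j Q E 2} {F' : QuantModule j Q E 3} (hF : F.IsExtension F')
    (h : F.IsOp T x D) (h' : F.IsOp T x' D') {z : Q.ideal j U}
    (hz : Q.hbar U * z.1 = x.1 * x'.1 - x'.1 * x.1) : F.IsOp T z (D.comm D') := by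
  obtain ⟨τ, hτ, hτs, hτ0⟩ := hF
  have hτr : ∀ {V P : X.Opens} (hP : P ≤ V) (e : F'.Sec V),
      τ.val.app (.op P) (fres F'.F hP e) = fres F.F hP (τ.val.app (.op V) e) := fun hP e =>
    PresheafOfModules.naturality_apply τ.val (homOfLE hP).op e
  have hτm : ∀ {V : X.Opens} (a : Q.Sec V) (e : F'.Sec V),
      τ.val.app (.op V) (a • e) = a • τ.val.app (.op V) e := fun a e => map_smul _ a e
  refine IsOp.of_exists le_rfl ?_ fun V hV e y hy => ?_
  · rw [At.comm_vf, h.vf, h'.vf, ← T.alg.anchor_bracket, T.q_bracket U x x' z hz]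
  · obtain ⟨V₁, hV₁, hyV₁, e₁, he₁⟩ := hτs V e (j y) hy
    obtain ⟨P, hP, hyP, a, b, ha, hb⟩ := F'.exists_div_two x x' (hV₁.trans hV) e₁ e₁ hyV₁
    obtain ⟨P', hP', hyP', d, c, hd, hc⟩ := F'.exists_div_two x' x (hP.trans (hV₁.trans hV)) a b hyP
    have hPU := hP.trans (hV₁.trans hV)
    have hPU' := hP'.trans hPU
    have hz1 : Q.hbar P' • (Q.res hPU' z.1 • fres F'.F (hP'.trans hP) e₁ - Q.hbar P' • (c - d)) =
        0 := by
      have h1 : Q.hbar P' * Q.res hPU' z.1 =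
          Q.res hPU' x.1 * Q.res hPU' x'.1 - Q.res hPU' x'.1 * Q.res hPU' x.1 := by
        rw [← Q.res_hbar hPU', ← map_mul (Q.res hPU'), hz, map_sub (Q.res hPU'),
          map_mul (Q.res hPU'), map_mul (Q.res hPU')]
      have h2 : ∀ (w : Q.Sec U) {u v : F'.Sec P}, Q.res hPU w • u = Q.hbar P • v →
          Q.res hPU' w • fres F'.F hP' u = Q.hbar P' • fres F'.F hP' v := fun w u v e => by
        rw [← Q.res_res hPU hP', ← fres_smul, e, fres_smul, Q.res_hbar]
      have h3 := h2 _ ha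
      have h4 := h2 _ hb
      rw [fres_fres] at h3 h4
      rw [smul_sub, smul_smul, h1, sub_smul, mul_smul, mul_smul, h3, h4, hbar_smul_comm,
        hbar_smul_comm, hc, hd, smul_sub, smul_sub, sub_self]
    obtain ⟨R, hR, hyR, g, hg⟩ := F'.flat P' _ hz1 (j y) hyP'
    have hRP := hR.trans hP'
    have hRU := hRP.trans hPU
    have key : ∀ (w : Q.Sec U) {S : X.Opens} (hS : S ≤ U) (hR : R ≤ S) {u v : F'.Sec S},
        Q.res hS w • u = Q.hbar S • v → Q.res hRU w • τ.val.app (.op R) (fres F'.F hR u) =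
          Q.hbar R • τ.val.app (.op R) (fres F'.F hR v) := fun w S hS hR u v e => by
      rw [← hτm, ← hτm, ← Q.res_res hS hR, ← fres_smul, e, fres_smul, Q.res_hbar]
    have he : fres F.F (hRP.trans (hP.trans hV₁)) e =
        τ.val.app (.op R) (fres F'.F hRP (fres F'.F hP e₁)) := by
      rw [hτr, hτr, he₁, fres_fres, fres_fres]
    have ka := key x.1 hPU hRP ha
    have kb := key x'.1 hPU hRP hb
    have kc := key x.1 (hP'.trans hPU) hR hc
    have kd := key x'.1 (hP'.trans hPU) hR hd
    rw [fres_fres] at kc kd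
    refine ⟨R, hRP.trans (hP.trans hV₁), hyR,
      τ.val.app (.op R) (fres F'.F hR c) - τ.val.app (.op R) (fres F'.F hR d) +
        Q.hbar R • τ.val.app (.op R) g, ?_, ?_⟩
    · have h5 : Q.res hRU z.1 • fres F'.F hRP (fres F'.F hP e₁) =
          Q.hbar R • (fres F'.F hR c - fres F'.F hR d) + Q.hbar R ^ 2 • g := by
        rw [← hg, fres_sub, fres_smul, fres_smul, Q.res_hbar, Q.res_res, fres_fres, fres_fres,
          fres_sub]
        abel
      rw [he, ← hτm, h5, map_add, hτm, hτm, map_sub, smul_add, pow_two, mul_smul]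
    · rw [At.comm_op, he, h.op R hRU _ _ ka, h'.op R hRU _ _ kb, h.op R hRU _ _ kc,
        h'.op R hRU _ _ kd, map_add, red_hbar_smul, add_zero, map_sub]

end QuantModule

end OpAlgebra

/-! ### The module structure induced by a quantized module -/

section LieLift

variable {k : Type u} [Field k] {Y : Scheme.{u}} [Y.Over (Spec (.of k))] {n : ℕ} {c : k}
  {L A : UnitalAlgebroid k Y} (P : Combination 1 c L A) {W : Y.Opens}

/-- A flat splitting of the anchor which is a first order operator, like the Lie derivative. -/
structure LieAction (A : UnitalAlgebroid k Y) where
  app : ∀ U, VF k U → A.Sec U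
  res : ∀ {U V : Y.Opens} (h : V ≤ U) (ξ : VF k U), A.res h (app U ξ) = app V (VF.res h ξ)
  add : ∀ {U : Y.Opens} (ξ η : VF k U), app U (ξ + η) = app U ξ + app U η
  anchor : ∀ {U : Y.Opens} (ξ : VF k U), A.anchor U (app U ξ) = ξ
  comm : ∀ {U : Y.Opens} (ξ η : VF k U), A.bracket U (app U ξ) (app U η) = app U (ξ.comm η)
  smul : ∀ {U : Y.Opens} (f : Γ(Y, U)) (ξ : VF k U),
    f • app U ξ + A.unit U (ξ.app f) = app U (f • ξ)

/-- The Lie derivative on forms of top degree. -/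
def lieAction (n : ℕ) [SmoothOfRelativeDimension n (Y ↘ Spec (.of k))] :
    LieAction (atiyah k (forms k Y n)) where
  app _ ξ := lieDer n ξ
  res _ _ := rfl
  add := lieDer_add n
  anchor _ := rfl
  comm ξ η := (lieDer_comm n ξ η).symm
  smul f ξ := (lieDer_smul n f ξ).symm

theorem LieAction.zero (d : LieAction A) (U : Y.Opens) : d.app U 0 = 0 := by
  have h := d.add (0 : VF k U) 0
  rw [add_zero] at h
  exact left_eq_add.1 h

theorem fibProd_ext {L₁ L₂ : LieAlgebroid k Y} {x y : (fibProd L₁ L₂).Sec W} (h₁ : x.1.1 = y.1.1)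
    (h₂ : x.1.2 = y.1.2) : x = y := Subtype.ext (Prod.ext h₁ h₂)

/-- A section of an algebroid together with its Lie derivative. -/
def LieAction.fib (d : LieAction A) (l : L.Sec W) :
    (fibProd L.toLieAlgebroid A.toLieAlgebroid).Sec W :=
  ⟨(l, d.app W (L.anchor _ l)), (d.anchor _).symm⟩

namespace Combination

/-- The map `l ↦ s(l, Lie l)`. -/
def lift (d : LieAction A) (l : L.Sec W) : P.alg.Sec W := P.s.app W (d.fib l)

variable {d : LieAction A}

theorem lift_res {V : Y.Opens} (h : V ≤ W) (l : L.Sec W) :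
    P.alg.res h (P.lift d l) = P.lift d (L.res h l) := by
  refine (P.s.app_res h (d.fib l)).symm.trans (congrArg (P.s.app V) (fibProd_ext rfl ?_))
  change A.res h (d.app W (L.anchor W l)) = d.app V (L.anchor V (L.res h l))
  rw [L.anchor_res, d.res]

theorem lift_add (l l' : L.Sec W) : P.lift d (l + l') = P.lift d l + P.lift d l' := by
  refine Eq.trans (congrArg (P.s.app W) (?_ : d.fib (l + l') = d.fib l + d.fib l'))
    (map_add (P.s.app W) (d.fib l) (d.fib l'))
  refine fibProd_ext rfl ?_
  change d.app W (L.anchor W (l + l')) = d.app W (L.anchor W l) + d.app W (L.anchor W l')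
  rw [map_add, d.add]

theorem lift_bracket (l l' : L.Sec W) :
    P.alg.bracket W (P.lift d l) (P.lift d l') = P.lift d (L.bracket W l l') := by
  refine (P.s.app_bracket W (d.fib l) (d.fib l')).symm.trans
    (congrArg (P.s.app W) (fibProd_ext rfl ?_))
  change A.bracket W (d.app W (L.anchor W l)) (d.app W (L.anchor W l')) =
    d.app W (L.anchor W (L.bracket W l l'))
  rw [L.anchor_bracket, d.comm]

theorem anchor_lift (l : L.Sec W) : P.alg.anchor W (P.lift d l) = L.anchor W l :=
  P.s.anchor_app W (d.fib l)

theorem lift_unit (g : Γ(Y, W)) : P.lift d (L.unit W g) = P.alg.unit W g := by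
  have h := P.s_unit W g 0
  rw [map_one, one_mul, mul_zero, add_zero] at h
  refine Eq.trans (congrArg (P.s.app W) ?_) h
  refine fibProd_ext rfl ?_
  change d.app W (L.anchor W (L.unit W g)) = A.unit W 0
  rw [L.anchor_unit, map_zero, d.zero]

theorem smul_lift (f : Γ(Y, W)) (l : L.Sec W) :
    f • P.lift d l + P.alg.unit W (cst k W c * (L.anchor W l).app f) = P.lift d (f • l) := by
  have h := P.s_unit W 0 ((L.anchor W l).app f)
  rw [mul_zero, zero_add] at h
  rw [← h]
  refine (congrArg (· + _) (map_smul (P.s.app W) f (d.fib l)).symm).trans ?_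
  refine (map_add (P.s.app W) _ _).symm.trans (congrArg (P.s.app W) (fibProd_ext ?_ ?_))
  · change f • l + L.unit W 0 = f • l
    rw [map_zero, add_zero]
  · change f • d.app W (L.anchor W l) + A.unit W ((L.anchor W l).app f) =
      d.app W (L.anchor W (f • l))
    rw [map_smul, d.smul]

theorem lift_sub (l l' : L.Sec W) : P.lift d (l - l') = P.lift d l - P.lift d l' :=
  map_sub (AddMonoidHom.mk' (P.lift d) P.lift_add) l l'

theorem lift_injective (hL : L.IsPicard) {l l' : L.Sec W} (h : P.lift d l = P.lift d l') : l = l' := by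
  have h1 : L.anchor W (l - l') = 0 := by
    rw [map_sub, ← P.anchor_lift (d := d), ← P.anchor_lift (d := d), h, sub_self]
  obtain ⟨g, hg⟩ := hL.exact W _ h1
  have h2 : P.alg.unit W g = P.alg.unit W 0 := by
    rw [← P.lift_unit (d := d), hg, P.lift_sub, h, sub_self, map_zero]
  rw [P.isPicard.injective W h2, map_zero] at hg
  exact (sub_eq_zero.1 hg.symm)

theorem exists_lift (d : LieAction A) (hL : L.IsPicard) (p : P.alg.Sec W) {y : Y} (hy : y ∈ W) :
    ∃ (V : Y.Opens) (h : V ≤ W), y ∈ V ∧ ∃ l : L.Sec V, P.lift d l = P.alg.res h p := by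
  obtain ⟨V, h, hyV, l, hl⟩ := hL.surjective W (P.alg.anchor W p) y hy
  obtain ⟨g, hg⟩ := P.isPicard.exact V (P.alg.res h p - P.lift d l) (by
    rw [map_sub, P.alg.anchor_res, P.anchor_lift, hl, sub_self])
  exact ⟨V, h, hyV, l + L.unit V g, by rw [P.lift_add, P.lift_unit, hg]; abel⟩

end Combination

end LieLift

section Induced

variable {k : Type u} [Field k] {X : Scheme.{u}} [X.Over (Spec (.of k))]
  {Y : Scheme.{u}} [Y.Over (Spec (.of k))] {j : Y ⟶ X} {n : ℕ}
  [SmoothOfRelativeDimension n (Y ↘ Spec (.of k))]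

theorem smul_lift_q [j.IsOver (Spec (.of k))]
    [CharZero k] {Q : QuantData k X} {T : TorAlgebroid j Q} (P : PlusAlgebroid n T) {U : X.Opens}
    (x : Q.ideal j U) (f z : Q.Sec U) (hz : Q.hbar U * z = x.1 * f - f * x.1) :
    jres j (le_refl (j ⁻¹ᵁ U)) (Q.red U f) • P.lift (lieAction n) (T.q U x) =
      P.lift (lieAction n) (T.q U ⟨f * x.1, (Q.ideal j U).mul_mem_left f x.2⟩) := by
  have hy : Q.scalar U (PowerSeries.C (1 / 2)) * (f * x.1 + x.1 * f) ∈ Q.ideal j U := by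
    refine (Q.ideal j U).mul_mem_left _ ((Q.ideal j U).add_mem
      ((Q.ideal j U).mul_mem_left _ x.2) ?_)
    rw [QuantData.mem_ideal, map_mul, map_mul, Q.jres_red, zero_mul]
  have hw : Q.hbar U * (Q.scalar U (PowerSeries.C (1 / 2)) * z) ∈ Q.ideal j U := by
    rw [QuantData.mem_ideal, map_mul, Q.red_hbar, zero_mul, map_zero]
  have h1 := P.smul_lift (d := lieAction n) (jres j (le_refl (j ⁻¹ᵁ U)) (Q.red U f)) (T.q U x)
  have h2 := T.q_unit U (Q.scalar U (PowerSeries.C (1 / 2)) * z) ⟨_, hw⟩ rfl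
  rw [map_mul, Q.red_scalar, PowerSeries.constantCoeff_C, map_mul, jres_cst] at h2
  rw [T.q_anchor U x f z hz, T.q_smul U f x ⟨_, hy⟩ rfl, ← P.lift_unit (d := lieAction n), h2] at h1
  rw [eq_sub_of_add_eq h1, ← P.lift_sub, ← map_sub]
  refine congrArg (fun w => P.lift (lieAction n) (T.q U w)) (Subtype.ext ?_)
  change Q.scalar U (PowerSeries.C (1 / 2)) * (f * x.1 + x.1 * f) -
    Q.hbar U * (Q.scalar U (PowerSeries.C (1 / 2)) * z) = f * x.1
  have h3 : Q.hbar U * (Q.scalar U (PowerSeries.C (1 / 2)) * z) =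
      Q.scalar U (PowerSeries.C (1 / 2)) * (Q.hbar U * z) := by
    rw [← mul_assoc, ← Q.scalar_comm, mul_assoc]
  have h4 : Q.scalar U (PowerSeries.C (1 / 2)) + Q.scalar U (PowerSeries.C (1 / 2)) = 1 := by
    rw [← map_add, ← map_add, add_halves, map_one, map_one]
  rw [h3, hz, ← mul_sub]
  have h5 : f * x.1 + x.1 * f - (x.1 * f - f * x.1) = f * x.1 + f * x.1 := by abel
  rw [h5, mul_add, ← add_mul, h4, one_mul]

theorem LieAlgebroid.Hom.ext {L L' : LieAlgebroid k Y} {φ ψ : LieAlgebroid.Hom L L'}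
    (h : ∀ U x, φ.app U x = ψ.app U x) : φ = ψ := by
  obtain ⟨φ, _, _, _⟩ := φ
  obtain ⟨ψ, _, _, _⟩ := ψ
  have : φ = ψ := funext fun U => LinearMap.ext (h U)
  subst this
  rfl

theorem ModuleStructure.ext {L : UnitalAlgebroid k Y} {M : ModPresheaf Y} {γ δ : ModuleStructure L M}
    (h : ∀ U x, γ.hom.app U x = δ.hom.app U x) : γ = δ := by
  obtain ⟨γ, _⟩ := γ
  obtain ⟨δ, _⟩ := δ
  have : γ = δ := LieAlgebroid.Hom.ext h
  subst this
  rfl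

namespace QuantModule

variable {Q : QuantData k X} {T : TorAlgebroid j Q} (P : PlusAlgebroid n T) {E : Y.Modules} {m : ℕ}
  (F : QuantModule j Q E m)

/-- The section `D` of `L(E)` is the action of the section `p` of `L⁺(𝒪_h)`, and both come from a
section of the ideal. -/
def ActRel (W : Y.Opens) (p : P.alg.Sec W) (D : At k (ModPresheaf.of E) W) : Prop :=
  ∃ (U : X.Opens) (h : W ≤ j ⁻¹ᵁ U) (x : Q.ideal j U) (D₀ : At k (ModPresheaf.of E) (j ⁻¹ᵁ U)),
    F.IsOp T x D₀ ∧ p = P.alg.res h (P.lift (lieAction n) (T.q U x)) ∧ D = At.res h D₀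

variable {P F}

theorem ActRel.res {W V : Y.Opens} {p : P.alg.Sec W} {D : At k (ModPresheaf.of E) W}
    (r : F.ActRel P W p D) (h : V ≤ W) : F.ActRel P V (P.alg.res h p) (At.res h D) := by
  obtain ⟨U, hU, x, D₀, hx, rfl, rfl⟩ := r
  exact ⟨U, h.trans hU, x, D₀, hx, P.alg.res_res _ _ _, rfl⟩

theorem ActRel.of_isOp {U : X.Opens} {x : Q.ideal j U} {D₀ : At k (ModPresheaf.of E) (j ⁻¹ᵁ U)}
    (h : F.IsOp T x D₀) : F.ActRel P (j ⁻¹ᵁ U) (P.lift (lieAction n) (T.q U x)) D₀ :=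
  ⟨U, le_rfl, x, D₀, h, (P.alg.res_id _ _).symm, rfl⟩

theorem ActRel.exists_two [IsClosedImmersion j] {ω : SymplecticForm k X} (D : LagDatum j Q ω)
    {W : Y.Opens} {p p' : P.alg.Sec W}
    {A A' : At k (ModPresheaf.of E) W} (r : F.ActRel P W p A) (r' : F.ActRel P W p' A')
    (f : Γ(Y, W)) {y : Y} (hy : y ∈ W) :
    ∃ (V : X.Opens) (hV : j ⁻¹ᵁ V ≤ W) (i : D.w.I) (_ : V ≤ D.z.U (D.e i)), y ∈ j ⁻¹ᵁ V ∧
      ∃ (x x' : Q.ideal j V) (G : Q.Sec V), jres j (le_refl (j ⁻¹ᵁ V)) (Q.red V G) = rs hV f ∧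
        P.alg.res hV p = P.lift (lieAction n) (T.q V x) ∧ F.IsOp T x (At.res hV A) ∧
        P.alg.res hV p' = P.lift (lieAction n) (T.q V x') ∧ F.IsOp T x' (At.res hV A') := by
  obtain ⟨U, hU, x, D₀, hx, rfl, rfl⟩ := r
  obtain ⟨U', hU', x', D₀', hx', rfl, rfl⟩ := r'
  obtain ⟨V, hV, hVW, i, hi, hyV, G, hG⟩ := D.exists_fun (U := U ⊓ U') hy ⟨hU hy, hU' hy⟩ f
  refine ⟨V, hVW, i, hi, hyV, ⟨_, Q.res_mem_ideal (hV.trans inf_le_left) x⟩,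
    ⟨_, Q.res_mem_ideal (hV.trans inf_le_right) x'⟩, G, hG, ?_, hx.res (hV.trans inf_le_left), ?_,
    hx'.res (hV.trans inf_le_right)⟩
  · rw [P.alg.res_res, P.lift_res, ← LagDatum.q_eq T (hV.trans inf_le_left) x]
  · rw [P.alg.res_res, P.lift_res, ← LagDatum.q_eq T (hV.trans inf_le_right) x']

theorem ActRel.unique [CharZero k] [IsClosedImmersion j] {ω : SymplecticForm k X}
    (D : LagDatum j Q ω) (hm : 2 ≤ m) {W : Y.Opens} {p : P.alg.Sec W}
    {A A' : At k (ModPresheaf.of E) W} (r : F.ActRel P W p A) (r' : F.ActRel P W p A') : A = A' := by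
  refine (atiyah_isSheaf (of_isSheaf E)).isSep _ _ _ fun y hy => ?_
  obtain ⟨V, hV, i, hi, hyV, x, x', G, hG, h1, h2, h3, h4⟩ := r.exists_two D r' 0 hy
  exact ⟨j ⁻¹ᵁ V, hV, hyV,
    (h2.of_q_eq hm (P.lift_injective (d := lieAction n) (D.isPicard T) (h1.symm.trans h3))).unique h4⟩

theorem exists_moduleStructure [CharZero k] [IsClosedImmersion j] [j.IsOver (Spec (.of k))]
    {ω : SymplecticForm k X} (D : LagDatum j Q ω) (P : PlusAlgebroid n T)
    {F : QuantModule j Q E 2} {F' : QuantModule j Q E 3} (hF : F.IsExtension F') :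
    ∃ γ : ModuleStructure P.alg (ModPresheaf.of E),
      ∀ (U : X.Opens) (x : Q.ideal j U) (D₀ : At k (ModPresheaf.of E) (j ⁻¹ᵁ U)), F.IsOp T x D₀ →
        γ.hom.app _ (P.lift (lieAction n) (T.q U x)) = D₀ := by
  obtain ⟨φ, hφ⟩ := exists_hom_of_local (L := P.alg.toLieAlgebroid)
    (L' := (atiyah k (ModPresheaf.of E)).toLieAlgebroid)
    (atiyah_isSheaf (of_isSheaf E)) (F.ActRel P) (fun h p A r => r.res h)
    (fun W p y hy => by
      obtain ⟨V, hV, hyV, l, hl⟩ := P.exists_lift (lieAction n) (D.isPicard T) p hy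
      obtain ⟨U, hU, hyU, x, hx⟩ := T.q_surjective V l y hyV
      obtain ⟨D₀, hD₀⟩ := F.exists_isOp D T le_rfl x
      refine ⟨j ⁻¹ᵁ U, hU.trans hV, hyU, D₀, ?_⟩
      rw [← P.alg.res_res hV hU, ← hl, P.lift_res, ← hx]
      exact ActRel.of_isOp hD₀)
    (fun W p A A' r r' => r.unique D le_rfl r')
    (fun W p A p' A' r r' y hy => by
      obtain ⟨V, hV, i, hi, hyV, x, x', G, hG, h1, h2, h3, h4⟩ := r.exists_two D r' 0 hy
      refine ⟨_, hV, hyV, ?_⟩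
      rw [map_add, h1, h3, ← P.lift_add, ← map_add]
      exact ActRel.of_isOp (h2.add le_rfl h4))
    (fun W f p A r y hy => by
      obtain ⟨V, hV, i, hi, hyV, x, -, G, hG, h1, h2, -⟩ := r.exists_two D r f hy
      refine ⟨_, hV, hyV, ?_⟩
      obtain ⟨z, hz⟩ := D.exists_comm i hi x.1 G
      have h3 := smul_lift_q P x G z hz
      have h4 := congrArg (P.alg.anchor _) h3
      rw [map_smul, P.anchor_lift, P.anchor_lift] at h4
      have h5 := h2.smul le_rfl G h4.symm
      have h6 : At.res hV (f • A) = rs hV f • At.res hV A :=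
        (atiyah k (ModPresheaf.of E)).res_smul hV f A
      have h7 := ActRel.of_isOp (P := P) h5
      rw [← h3, hG] at h7
      rw [P.alg.res_smul, h1]
      exact h6 ▸ h7)
    (fun W p A p' A' r r' y hy => by
      obtain ⟨V, hV, i, hi, hyV, x, x', G, hG, h1, h2, h3, h4⟩ := r.exists_two D r' 0 hy
      refine ⟨_, hV, hyV, ?_⟩
      obtain ⟨z, hz⟩ := D.exists_comm i hi x.1 x'.1
      have h5 := T.q_bracket V x x' ⟨z, D.mem_ideal_of_comm x x' hz⟩ hz
      rw [P.alg.bracket_res, h1, h3, P.lift_bracket, h5]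
      exact ActRel.of_isOp (h2.bracket hF h4 hz))
    (fun W p A r => by
      obtain ⟨U, hU, x, D₀, hx, rfl, rfl⟩ := r
      rw [P.alg.anchor_res, P.anchor_lift, ← hx.vf]
      rfl)
    tangentMod_isSep
  refine ⟨⟨φ, fun W f => hφ W _ _ fun y hy => ?_⟩, fun U x D₀ hx =>
    hφ _ _ _ fun y hy => ⟨_, le_rfl, hy, (ActRel.of_isOp hx).res le_rfl⟩⟩
  obtain ⟨V, -, hV, i, hi, hyV, G, hG⟩ := D.exists_fun (U := ⊤) hy trivial f
  refine ⟨j ⁻¹ᵁ V, hV, hyV, ?_⟩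
  have hI : Q.hbar V * G ∈ Q.ideal j V := by
    rw [QuantData.mem_ideal, map_mul, Q.red_hbar, zero_mul, map_zero]
  have h1 := ActRel.of_isOp (P := P)
    (isOp_hbar (T := T) (F := F) (x := ⟨_, hI⟩) le_rfl G rfl)
  rw [← T.q_unit V G ⟨_, hI⟩ rfl, P.lift_unit, hG, ← P.alg.unit_res] at h1
  have h2 := (atiyah k (ModPresheaf.of E)).unit_res hV f
  exact (congrArg (F.ActRel P _ _) h2).mpr h1

theorem existsUnique_isInduced [CharZero k] [IsClosedImmersion j] [j.IsOver (Spec (.of k))]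
    {ω : SymplecticForm k X} (D : LagDatum j Q ω) (P : PlusAlgebroid n T)
    {F : QuantModule j Q E 2} {F' : QuantModule j Q E 3} (hF : F.IsExtension F') :
    ∃! γ : ModuleStructure P.alg (ModPresheaf.of E), IsInduced F γ := by
  obtain ⟨γ, hγ⟩ := exists_moduleStructure D P hF
  refine ⟨γ, fun U x e e' he => ?_, fun γ' hγ' => ModuleStructure.ext fun W p => ?_⟩
  · obtain ⟨D₀, hD₀⟩ := F.exists_isOp D T le_rfl x
    have h1 := hD₀.op U le_rfl e e' (by rwa [Q.res_id])
    rw [← hγ U x D₀ hD₀] at h1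
    exact h1
  · refine (atiyah_isSheaf (of_isSheaf E)).isSep _ _ _ fun y hy => ?_
    obtain ⟨V, hV, hyV, l, hl⟩ := P.exists_lift (lieAction n) (D.isPicard T) p hy
    obtain ⟨U, hU, hyU, x, hx⟩ := T.q_surjective V l y hyV
    refine ⟨j ⁻¹ᵁ U, hU.trans hV, hyU, ?_⟩
    have h0 : P.alg.res (hU.trans hV) p = P.lift (lieAction n) (T.q U x) := by
      rw [← P.alg.res_res hV hU, ← hl, P.lift_res, ← hx]
    obtain ⟨D₀, hD₀⟩ := F.exists_isOp D T le_rfl x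
    have h3 : γ'.hom.app _ (P.lift (lieAction n) (T.q U x)) = D₀ := by
      refine F.at_ext x ?_ fun P' hP' e e' he => ?_
      · exact (γ'.hom.anchor_app _ _).trans ((P.anchor_lift _).trans hD₀.vf.symm)
      · rw [hD₀.op P' hP' e e' he]
        have h4 := hγ' P' ⟨_, Q.res_mem_ideal hP' x⟩ e e' he
        have h5 : P.lift (lieAction n) (T.q P' ⟨_, Q.res_mem_ideal hP' x⟩) =
            P.alg.res (preimage_le j hP') (P.lift (lieAction n) (T.q U x)) := by
          rw [P.lift_res, ← LagDatum.q_eq T hP' x]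
        have h6 := γ'.hom.app_res (preimage_le j hP') (P.lift (lieAction n) (T.q U x))
        have h7 := congrArg (fun A : At k (ModPresheaf.of E) (j ⁻¹ᵁ P') => A.act (F.red P' e))
          ((congrArg (γ'.hom.app (j ⁻¹ᵁ P')) h5).trans h6)
        exact h7.symm.trans h4
    refine (γ'.hom.app_res (hU.trans hV) p).symm.trans (Eq.trans ?_ (γ.hom.app_res (hU.trans hV) p))
    refine (congrArg (γ'.hom.app _) h0).trans (Eq.trans ?_ (congrArg (γ.hom.app _) h0).symm)
    exact h3.trans (hγ U x D₀ hD₀).symm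

end QuantModule

end Induced

/-! ### The Atiyah algebroid of a vector bundle and of its projectivization -/

section Proj

variable {k : Type u} [Field k] {Y : Scheme.{u}} [Y.Over (Spec (.of k))] {M : ModPresheaf Y}
  {U : Y.Opens}

variable (k) in
/-- Endomorphisms as differential operators of order zero. -/
def endToAt (a : endSec M U) : At k M U :=
  ⟨(fun V => (a.1 V).toAddMonoidHom, 0), fun V f m => by
    change a.1 V (f • m) = f • a.1 V m + (0 : Γ(Y, V.1)) • m
    rw [map_smul, zero_smul, add_zero], a.2⟩

/-- The endomorphism given by a differential operator of order zero. -/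
def At.toEnd (D : At k M U) (h : D.vf = 0) : endSec M U :=
  ⟨fun V =>
    { toFun := D.op V
      map_add' := map_add _
      map_smul' := fun f m => by
        rw [D.op_smul, h]
        change _ + (0 : Γ(Y, V.1)) • m = _
        rw [zero_smul, add_zero]
        rfl }, D.2.2⟩

theorem endToAt_injective : Function.Injective (endToAt k : endSec M U → At k M U) := fun a b h =>
  Subtype.ext (funext fun V => LinearMap.ext fun m =>
    congrArg (fun D : At k M U => D.op V m) h)

theorem endToAt_toEnd (D : At k M U) (h : D.vf = 0) : endToAt k (D.toEnd h) = D :=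
  At.ext (fun _ _ => rfl) h.symm

theorem endMod_isSep (k : Type u) [Field k] {Y : Scheme.{u}} [Y.Over (Spec (.of k))]
    {M : ModPresheaf Y} (hM : M.IsSep) : (endMod M).IsSep := by
  intro U a b h
  refine endToAt_injective (k := k) (atiyah_isSep hM U _ _ fun y hy => ?_)
  obtain ⟨V, hV, hyV, e⟩ := h y hy
  exact ⟨V, hV, hyV, congrArg (endToAt k) e⟩

theorem endMod_isSheaf (k : Type u) [Field k] {Y : Scheme.{u}} [Y.Over (Spec (.of k))]
    {M : ModPresheaf Y} (hM : M.IsSheaf) : (endMod M).IsSheaf := by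
  refine ModPresheaf.IsSheaf.of_sep (endMod_isSep k hM.isSep) fun I U a ha => ?_
  obtain ⟨D, hD, -⟩ := atiyah_isSheaf (k := k) hM I U (fun i => endToAt k (a i)) fun i l =>
    congrArg (endToAt k) (ha i l)
  have hvf : At.vf (show At k M (⨆ i, U i) from D) = 0 := by
    refine tangentMod_isSep _ _ _ fun y hy => ?_
    obtain ⟨i, hi⟩ := Opens.mem_iSup.1 hy
    exact ⟨U i, le_iSup U i, hi, congrArg At.vf (hD i)⟩
  refine ⟨At.toEnd D hvf, fun i => endToAt_injective (k := k) ?_⟩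
  refine Eq.trans ?_ (hD i)
  exact congrArg (At.res (le_iSup U i)) (endToAt_toEnd _ hvf)

theorem projAtiyah_isSep (hM : M.IsSep) : (projAtiyah k M).toModPresheaf.IsSep := by
  intro U p q h
  refine Subtype.ext (atiyah_isSep (endMod_isSep k hM) U _ _ fun y hy => ?_)
  obtain ⟨V, hV, hyV, e⟩ := h y hy
  exact ⟨V, hV, hyV, congrArg Subtype.val e⟩

theorem mem_patSec_of_local (hM : M.IsSep) (D : At k (endMod M) U)
    (h : ∀ y ∈ U, ∃ (V : Y.Opens) (h : V ≤ U), y ∈ V ∧ At.res h D ∈ patSec (k := k) M V) :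
    D ∈ patSec (k := k) M U := by
  intro V a b
  refine endMod_isSep k hM _ _ _ fun y hy => ?_
  obtain ⟨V', hV', hyV', e⟩ := h y (V.2 hy)
  refine ⟨V.1 ⊓ V', inf_le_left, ⟨hy, hyV'⟩, ?_⟩
  let W : Below U := ⟨V.1 ⊓ V', inf_le_left.trans V.2⟩
  have h1 := e ⟨V.1 ⊓ V', inf_le_right⟩ ((endMod M).res inf_le_left a) ((endMod M).res inf_le_left b)
  have r := fun c => D.op_res V W inf_le_left c
  refine (r _).trans (h1.trans ?_)
  refine Eq.trans ?_ (map_add ((endMod M).res (inf_le_left : V.1 ⊓ V' ≤ V.1)) _ _).symm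
  refine congrArg₂ (· + ·) ?_ ?_
  · exact congrArg (fun c => endMul c ((endMod M).res inf_le_left b)) (r a).symm
  · exact congrArg (fun c => endMul ((endMod M).res inf_le_left a) c) (r b).symm

theorem projAtiyah_isSheaf (hM : M.IsSheaf) : (projAtiyah k M).toModPresheaf.IsSheaf := by
  refine ModPresheaf.IsSheaf.of_sep (projAtiyah_isSep hM.isSep) fun I U p hp => ?_
  obtain ⟨D, hD, -⟩ := atiyah_isSheaf (k := k) (endMod_isSheaf k hM) I U
    (fun i => (show patSec (k := k) M (U i) from p i).1) fun i l => congrArg Subtype.val (hp i l)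
  refine ⟨⟨D, mem_patSec_of_local hM.isSep _ fun y hy => ?_⟩, fun i => Subtype.ext (hD i)⟩
  obtain ⟨i, hi⟩ := Opens.mem_iSup.1 hy
  refine ⟨U i, le_iSup U i, hi, ?_⟩
  have h1 := hD i
  have h2 : At.res (le_iSup U i) D = (show patSec (k := k) M (U i) from p i).1 := h1
  rw [h2]
  exact (show patSec (k := k) M (U i) from p i).2

theorem projAtiyah_ext {p q : patSec (k := k) M U} (hvf : p.1.vf = q.1.vf)
    (h : ∀ (V : Below U) (a : endSec M V.1) (W : Below V.1) (m : M.Sec W.1),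
      (show endSec M V.1 from p.1.op V a).1 W m = (show endSec M V.1 from q.1.op V a).1 W m) :
    p = q :=
  Subtype.ext (At.ext (fun V a => Subtype.ext (funext fun W => LinearMap.ext (h V a W))) hvf)

variable (k M) in
/-- The morphism `L(M) → L(P(M))`. -/
def toProjHom : LieAlgebroid.Hom (atiyah k M).toLieAlgebroid (projAtiyah k M) where
  app U :=
    { toFun := toProj
      map_add' := fun D D' => projAtiyah_ext rfl fun V a W m => by
        change (D.op (W.up V.2) (a.1 W m) + D'.op (W.up V.2) (a.1 W m)) -
          a.1 W (D.op (W.up V.2) m + D'.op (W.up V.2) m) =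
          (D.op (W.up V.2) (a.1 W m) - a.1 W (D.op (W.up V.2) m)) +
          (D'.op (W.up V.2) (a.1 W m) - a.1 W (D'.op (W.up V.2) m))
        rw [map_add]
        abel
      map_smul' := fun f D => projAtiyah_ext rfl fun V a W m => by
        change rs (W.2.trans V.2) f • At.op D (W.up V.2) (a.1 W m) -
          a.1 W (rs (W.2.trans V.2) f • At.op D (W.up V.2) m) =
          rs W.2 (rs V.2 f) • (At.op D (W.up V.2) (a.1 W m) - a.1 W (At.op D (W.up V.2) m))
        rw [map_smul, smul_sub, rs_rs] }
  app_res h D := rfl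
  anchor_app U D := rfl
  app_bracket U D D' := projAtiyah_ext rfl fun V a W m => by
    let d := At.op D (W.up V.2)
    let d' := At.op D' (W.up V.2)
    change (d (d' (a.1 W m)) - d' (d (a.1 W m))) - a.1 W (d (d' m) - d' (d m)) =
      ((d (d' (a.1 W m) - a.1 W (d' m))) - (d' (a.1 W (d m)) - a.1 W (d' (d m)))) -
      ((d' (d (a.1 W m) - a.1 W (d m))) - (d (a.1 W (d' m)) - a.1 W (d (d' m))))
    simp only [map_sub]
    abel

theorem toDet_add (r : ℕ) (D D' : At k M U) : toDet r (D + D') = toDet r D + toDet r D' := by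
  rw [toDet, altAct_add, altAct_add]
  rfl

theorem toDet_smul (r : ℕ) (f : Γ(Y, U)) (D : At k M U) : toDet r (f • D) = f • toDet r D := by
  rw [toDet, altAct_smul, altAct_smul]
  rfl

theorem toDet_comm (r : ℕ) (D D' : At k M U) :
    toDet r (D.comm D') = (toDet r D).comm (toDet r D') := by
  rw [toDet, altAct_comm, altAct_comm]
  rfl

variable (k M) in
/-- The morphism `L(M) → L(det M)`. -/
def toDetHom (r : ℕ) :
    LieAlgebroid.Hom (atiyah k M).toLieAlgebroid (atiyah k (det r M)).toLieAlgebroid where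
  app U :=
    { toFun := toDet r
      map_add' := toDet_add r
      map_smul' := toDet_smul r }
  app_res h D := rfl
  anchor_app U D := rfl
  app_bracket U D D' := toDet_comm r D D'

theorem toProj_scalar (f : Γ(Y, U)) : toProj (At.scalar f : At k M U) = 0 :=
  projAtiyah_ext rfl fun V a W m => by
    change rs (W.2.trans V.2) f • a.1 W m - a.1 W (rs (W.2.trans V.2) f • m) = 0
    rw [map_smul, sub_self]

/-- The endomorphism `x ↦ bᵢ^*(x) m` for a frame `b`. -/
def IsFrame.single {r : ℕ} {b : Fin r → M.Sec U} (hb : IsFrame M U b) (i : Fin r) (V : Below U)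
    (m : M.Sec V.1) : (endMod M).Sec V.1 :=
  ⟨fun W => ((hb.basis (W.2.trans V.2)).coord i).smulRight (M.res W.2 m), fun W W' h x => by
    change M.res h ((hb.basis (W.2.trans V.2)).repr x i • M.res W.2 m) =
      (hb.basis (W'.2.trans V.2)).repr (M.res h x) i • M.res W'.2 m
    rw [M.res_smul, M.res_res, hb.repr_res (W.2.trans V.2) h x]⟩

namespace IsFrame

variable {r : ℕ} {b : Fin r → M.Sec U} (hb : IsFrame M U b) (i : Fin r)

theorem single_apply (V : Below U) (m : M.Sec V.1) (W : Below V.1) (x : M.Sec W.1) :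
    (hb.single i V m).1 W x = (hb.basis (W.2.trans V.2)).repr x i • M.res W.2 m := rfl

theorem single_frame (V : Below U) (m : M.Sec V.1) :
    (hb.single i V m).1 (Below.self V.1) (M.res V.2 (b i)) = m := by
  rw [hb.single_apply, ← hb.basis_apply (V.2), M.res_id, Module.Basis.repr_self,
    Finsupp.single_eq_same, one_smul]

theorem single_add (V : Below U) (m m' : M.Sec V.1) :
    hb.single i V (m + m') = hb.single i V m + hb.single i V m' :=
  Subtype.ext (funext fun W => LinearMap.ext fun x => by
    refine (hb.single_apply i V _ W x).trans ?_
    rw [map_add, smul_add]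
    rfl)

theorem single_smul (V : Below U) (f : Γ(Y, V.1)) (m : M.Sec V.1) :
    hb.single i V (f • m) = f • hb.single i V m :=
  Subtype.ext (funext fun W => LinearMap.ext fun x => by
    refine (hb.single_apply i V _ W x).trans ?_
    rw [M.res_smul, smul_comm]
    rfl)

theorem single_res (V W : Below U) (h : W.1 ≤ V.1) (m : M.Sec V.1) :
    (endMod M).res h (hb.single i V m) = hb.single i W (M.res h m) :=
  Subtype.ext (funext fun W' => LinearMap.ext fun x => by
    refine Eq.trans ?_ (hb.single_apply i W _ W' x).symm
    rw [M.res_res]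
    rfl)

theorem single_mul (V : Below U) (a : (endMod M).Sec V.1) (m : M.Sec V.1) :
    hb.single i V (a.1 (Below.self V.1) m) = endMul a (hb.single i V m) :=
  Subtype.ext (funext fun W => LinearMap.ext fun x => by
    refine (hb.single_apply i V _ W x).trans ?_
    rw [a.2 (Below.self V.1) W W.2, ← map_smul]
    rfl)

/-- The operator `m ↦ p(m ⊗ bᵢ^*)(bᵢ)` given by a derivation `p` of the endomorphisms. -/
def ofProj (p : patSec (k := k) M U) : At k M U :=
  ⟨(fun V => AddMonoidHom.mk' (fun m =>
      (show endSec M V.1 from p.1.op V (hb.single i V m)).1 (Below.self V.1) (M.res V.2 (b i)))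
      fun m m' => by
        rw [hb.single_add, map_add]
        rfl, p.1.vf), fun V f m => by
      change (show endSec M V.1 from p.1.op V (hb.single i V (f • m))).1 (Below.self V.1)
        (M.res V.2 (b i)) = f • (show endSec M V.1 from p.1.op V (hb.single i V m)).1
          (Below.self V.1) (M.res V.2 (b i)) + p.1.vf.1 V f • m
      have h1 : p.1.op V (hb.single i V (f • m)) =
          f • p.1.op V (hb.single i V m) + p.1.vf.1 V f • hb.single i V m := by
        rw [hb.single_smul, p.1.op_smul]
      refine (congrArg (fun c : endSec M V.1 => c.1 (Below.self V.1) (M.res V.2 (b i))) h1).trans ?_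
      exact congrArg₂ (fun x y : M.Sec V.1 => x + y)
        (congrArg (fun g : Γ(Y, V.1) => g • (show endSec M V.1 from p.1.op V (hb.single i V m)).1
          (Below.self V.1) (M.res V.2 (b i))) (rs_id le_rfl f))
        (congrArg₂ (fun (g : Γ(Y, V.1)) (x : M.Sec V.1) => g • x) (rs_id le_rfl _)
          (hb.single_frame i V m)),
      fun V W h m => by
      change M.res h ((show endSec M V.1 from p.1.op V (hb.single i V m)).1 (Below.self V.1)
        (M.res V.2 (b i))) = (show endSec M W.1 from p.1.op W (hb.single i W (M.res h m))).1
          (Below.self W.1) (M.res W.2 (b i))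
      rw [← hb.single_res i V W h, ← p.1.op_res V W h]
      refine ((show endSec M V.1 from p.1.op V (hb.single i V m)).2 (Below.self V.1)
        ⟨W.1, h⟩ h _).trans ?_
      rw [M.res_res]
      rfl⟩

theorem toProj_ofProj (p : patSec (k := k) M U) : toProj (hb.ofProj i p) = p := by
  refine projAtiyah_ext rfl fun V a W m => ?_
  let W' : Below U := W.up V.2
  let a' : (endMod M).Sec W.1 := (endMod M).res W.2 a
  have h1 : (hb.ofProj i p).op W' (a.1 W m) =
      (show endSec M W.1 from p.1.op W' a').1 (Below.self W.1) m +
        a.1 W ((hb.ofProj i p).op W' m) := by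
    change (show endSec M W.1 from p.1.op W' (hb.single i W' (a'.1 (Below.self W.1) m))).1
      (Below.self W.1) (M.res W'.2 (b i)) = _
    rw [hb.single_mul i W' a' m, p.2 W' a' (hb.single i W' m)]
    change (show endSec M W.1 from p.1.op W' a').1 (Below.self W.1)
      ((hb.single i W' m).1 (Below.self W.1) (M.res W'.2 (b i))) + _ = _
    rw [hb.single_frame i W' m]
    rfl
  have h2 : (show endSec M W.1 from p.1.op W' a').1 (Below.self W.1) m =
      (show endSec M V.1 from p.1.op V a).1 W m :=
    congrArg (fun c : endSec M W.1 => c.1 (Below.self W.1) m) (p.1.op_res V W' W.2 a).symm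
  refine (sub_eq_of_eq_add ?_ : (hb.ofProj i p).op W' (a.1 W m) -
    a.1 W ((hb.ofProj i p).op W' m) = _)
  rw [h1, h2]

end IsFrame

end Proj

/-! ### Module structures, determinants and projective connections -/

section DetProj

variable {k : Type u} [Field k] {Y : Scheme.{u}} [Y.Over (Spec (.of k))] {M : ModPresheaf Y}
  {U : Y.Opens} {r : ℕ}

theorem cst_inv_natCast_mul [CharZero k] (hr : 0 < r) (f : Γ(Y, U)) :
    (r : Γ(Y, U)) * (cst k U (r : k)⁻¹ * f) = f := by
  rw [← mul_assoc, ← map_natCast (cst k U), ← map_mul,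
    mul_inv_cancel₀ (Nat.cast_ne_zero.2 hr.ne'), map_one, one_mul]

theorem natCast_mul_cancel (k : Type u) [Field k] [CharZero k] {Y : Scheme.{u}}
    [Y.Over (Spec (.of k))] {U : Y.Opens} {r : ℕ} (hr : 0 < r) {f g : Γ(Y, U)}
    (h : (r : Γ(Y, U)) * f = r * g) : f = g := by
  have h1 := congrArg (cst k U (r : k)⁻¹ * ·) h
  simp only [mul_left_comm (cst k U (r : k)⁻¹)] at h1
  rwa [cst_inv_natCast_mul hr, cst_inv_natCast_mul hr] at h1

/-- An operator commuting with all endomorphisms is a scalar. -/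
theorem IsFrame.exists_scalar {b : Fin r → M.Sec U} (hb : IsFrame M U b) (i : Fin r)
    {N : At k M U} (hN : N.vf = 0) (hp : toProj N = 0) : ∃ f, N = At.scalar f := by
  refine ⟨(hb.basis le_rfl).repr (N.op (Below.self U) (b i)) i, At.ext (fun V m => ?_) hN⟩
  have h1 : N.op V ((hb.single i V m).1 (Below.self V.1) (M.res V.2 (b i))) -
      (hb.single i V m).1 (Below.self V.1) (N.op V (M.res V.2 (b i))) = 0 :=
    congrArg (fun p : patSec (k := k) M U =>
      (show endSec M V.1 from p.1.op V (hb.single i V m)).1 (Below.self V.1) (M.res V.2 (b i))) hp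
  rw [hb.single_frame, sub_eq_zero, hb.single_apply, M.res_id, ← N.op_res (Below.self U) V V.2] at h1
  rw [h1]
  exact congrArg (· • m) (hb.repr_res le_rfl V.2 _ i)

theorem toProj_sub (D D' : At k M U) : toProj (D - D') = toProj D - toProj D' :=
  map_sub ((toProjHom k M).app U) D D'

theorem toDet_sub (r : ℕ) (D D' : At k M U) : toDet r (D - D') = toDet r D - toDet r D' :=
  map_sub ((toDetHom k M r).app U) D D'

/-- A differential operator is determined by its actions on the determinant and on the
endomorphisms. -/
theorem eq_of_toDet_of_toProj [CharZero k] (hM : M.IsSep) (hl : LocFree M r) (hr : 0 < r)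
    {D D' : At k M U} (h : toDet r D = toDet r D') (h' : toProj D = toProj D') : D = D' := by
  rw [← sub_eq_zero, ← toDet_sub] at h
  rw [← sub_eq_zero, ← toProj_sub] at h'
  rw [← sub_eq_zero]
  refine atiyah_isSep hM U _ _ fun y hy => ?_
  obtain ⟨V, hV, hyV, b, hb⟩ := hl.exists_frame hy
  refine ⟨V, hV, hyV, ?_⟩
  have hvf : (At.res hV (D - D')).vf = 0 :=
    congrArg (fun A : At k (det r M) U => VF.res hV A.vf) h
  have h1 : toProj (At.res hV (D - D')) = 0 := congrArg ((projAtiyah k M).res hV) h'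
  have h2 : toDet r (At.res hV (D - D')) = 0 := congrArg (At.res hV) h
  obtain ⟨f, hf⟩ := hb.exists_scalar ⟨0, hr⟩ hvf h1
  rw [hf, toDet_scalar] at h2
  have h3 := atiyah_unit_injective (k := k) one_pos hl.det V
    (h2.trans (map_zero ((atiyah k (det r M)).unit V)).symm)
  have h4 := natCast_mul_cancel k hr (h3.trans (mul_zero _).symm)
  exact hf.trans ((congrArg At.scalar h4).trans (map_zero ((atiyah k M).unit V)))

/-- Actions on the determinant and on the endomorphisms come locally from a differential
operator. -/
theorem exists_toDet_toProj [CharZero k] (hl : LocFree M r) (hr : 0 < r) (δ : At k (det r M) U)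
    (p : patSec (k := k) M U) (h : δ.vf = p.1.vf) {y : Y} (hy : y ∈ U) :
    ∃ (V : Y.Opens) (hV : V ≤ U), y ∈ V ∧ ∃ D : At k M V, toDet r D = At.res hV δ ∧
      toProj D = (projAtiyah k M).res hV p := by
  obtain ⟨V, hV, hyV, b, hb⟩ := hl.exists_frame hy
  let p' : patSec (k := k) M V := (projAtiyah k M).res hV p
  let D := hb.ofProj ⟨0, hr⟩ p'
  obtain ⟨g, hg⟩ := atiyah_line_exact (k := k) (alt_isSep 1 (alt r M)) hl.det V
    (At.res hV δ - toDet r D) (sub_eq_zero.2 (congrArg (VF.res hV) h))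
  refine ⟨V, hV, hyV, D + At.scalar (cst k V (r : k)⁻¹ * g), ?_, ?_⟩
  · rw [toDet_add, toDet_scalar, cst_inv_natCast_mul hr]
    exact (eq_add_of_sub_eq' hg.symm).symm
  · refine (map_add ((toProjHom k M).app V) D _).trans ?_
    refine (congrArg₂ (· + ·) (hb.toProj_ofProj _ p') (toProj_scalar _)).trans ?_
    exact add_zero _

variable {L B : UnitalAlgebroid k Y}

/-- A morphism of Picard algebroids which is invertible on functions is bijective. -/
theorem bijective_of_unit [CharZero k] (hL : L.IsPicard) (hB : B.toModPresheaf.IsSep)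
    (hinj : ∀ U, Function.Injective (B.unit U))
    (hex : ∀ U (x : B.Sec U), B.anchor U x = 0 → ∃ f, B.unit U f = x)
    (φ : LieAlgebroid.Hom L.toLieAlgebroid B.toLieAlgebroid) (hr : 0 < r)
    (hφ : ∀ U f, φ.app U (L.unit U f) = B.unit U (r * f)) (U : Y.Opens) :
    Function.Bijective (φ.app U) := by
  have inj : ∀ U, Function.Injective (φ.app U) := fun U => by
    refine (injective_iff_map_eq_zero _).2 fun x hx => ?_
    obtain ⟨f, rfl⟩ := hL.exact U x (by rw [← φ.anchor_app, hx, map_zero])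
    rw [hφ, ← map_zero (B.unit U)] at hx
    rw [natCast_mul_cancel k hr ((hinj U hx).trans (mul_zero _).symm), map_zero]
  refine ⟨inj U, fun b => ?_⟩
  obtain ⟨t, ht, -⟩ := hL.isSheaf.existsUnique_glue (U := U)
    (fun V h x => φ.app V x = B.res h b) (fun y hy => by
      obtain ⟨V, h, hyV, x, hx⟩ := hL.surjective U (B.anchor U b) y hy
      obtain ⟨g, hg⟩ := hex V (B.res h b - φ.app V x) (by
        rw [map_sub, B.anchor_res, φ.anchor_app, hx, sub_self])
      refine ⟨V, h, hyV, x + L.unit V (cst k V (r : k)⁻¹ * g), ?_⟩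
      rw [map_add, hφ, cst_inv_natCast_mul hr, hg]
      abel)
    (fun V h x V' h' x' hx hx' => inj _ (by
      rw [φ.app_res, φ.app_res, hx, hx', B.res_res, B.res_res]))
  refine ⟨t, hB _ _ _ fun y hy => ?_⟩
  obtain ⟨V, h, hyV, x, hx⟩ := hL.surjective U (B.anchor U b) y hy
  obtain ⟨g, hg⟩ := hex V (B.res h b - φ.app V x) (by
    rw [map_sub, B.anchor_res, φ.anchor_app, hx, sub_self])
  have h1 : φ.app V (x + L.unit V (cst k V (r : k)⁻¹ * g)) = B.res h b := by
    rw [map_add, hφ, cst_inv_natCast_mul hr, hg]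
    abel
  exact ⟨V, h, hyV, by rw [← φ.app_res, ht V h _ h1, h1]⟩

theorem DetIso.ext {φ ψ : DetIso L r M} (h : ∀ U x, φ.hom.app U x = ψ.hom.app U x) : φ = ψ := by
  obtain ⟨φ, _, _⟩ := φ
  obtain ⟨ψ, _, _⟩ := ψ
  have : φ = ψ := LieAlgebroid.Hom.ext h
  subst this
  rfl

/-- The isomorphism with the Atiyah algebroid of the determinant given by a module structure. -/
def ModuleStructure.detIso [CharZero k] (hL : L.IsPicard) (hl : LocFree M r) (hr : 0 < r)
    (γ : ModuleStructure L M) : DetIso L r M where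
  hom := (toDetHom k M r).comp γ.hom
  hom_unit U f := (congrArg (toDet r) (γ.hom_unit U f)).trans (toDet_scalar r f)
  bijective := bijective_of_unit hL (atiyah_isSep (alt_isSep 1 _))
    (atiyah_unit_injective one_pos hl.det) (atiyah_line_exact (alt_isSep 1 _) hl.det)
    ((toDetHom k M r).comp γ.hom) hr
    fun U f => (congrArg (toDet r) (γ.hom_unit U f)).trans (toDet_scalar r f)

theorem ModuleStructure.exists_connection (hL : L.IsPicard) (hM : M.IsSheaf)
    (γ : ModuleStructure L M) : ∃ τ : FlatProjConnection k M, ∀ (U : Y.Opens) (x : L.Sec U),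
      τ.app U (L.anchor U x) = toProj (γ.hom.app U x) := by
  let π := (toProjHom k M).comp γ.hom
  have hπ : ∀ (U : Y.Opens) (x x' : L.Sec U), L.anchor U x = L.anchor U x' →
      π.app U x = π.app U x' := fun U x x' h => by
    obtain ⟨f, hf⟩ := hL.exact U (x - x') (by rw [map_sub, h, sub_self])
    rw [← sub_eq_zero, ← map_sub, ← hf]
    exact (congrArg toProj (γ.hom_unit U f)).trans (toProj_scalar f)
  obtain ⟨τ, hτ⟩ := exists_hom_of_local (L := tangent k Y) (L' := projAtiyah k M)
    (projAtiyah_isSheaf hM) (fun W ξ p => ∃ x : L.Sec W, L.anchor W x = ξ ∧ π.app W x = p)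
    (fun h ξ p ⟨x, hx, hp⟩ => ⟨L.res h x, (L.anchor_res h x).trans (congrArg (VF.res h) hx),
      (π.app_res h x).trans (congrArg _ hp)⟩)
    (fun W ξ y hy => by
      obtain ⟨V, h, hyV, x, hx⟩ := hL.surjective W ξ y hy
      exact ⟨V, h, hyV, _, x, hx, rfl⟩)
    (fun W ξ p p' ⟨x, hx, hp⟩ ⟨x', hx', hp'⟩ => by
      rw [← hp, ← hp', hπ W x x' (hx.trans hx'.symm)])
    (fun W ξ p η q ⟨x, hx, hp⟩ ⟨x', hx', hq⟩ y hy => ⟨W, le_rfl, hy, L.res le_rfl (x + x'), by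
      rw [L.anchor_res, map_add, hx, hx']
      rfl, by rw [π.app_res, map_add, hp, hq]⟩)
    (fun W f ξ p ⟨x, hx, hp⟩ y hy => ⟨W, le_rfl, hy, L.res le_rfl (f • x), by
      rw [L.anchor_res, map_smul, hx]
      rfl, by rw [π.app_res, map_smul, hp]⟩)
    (fun W ξ p η q ⟨x, hx, hp⟩ ⟨x', hx', hq⟩ y hy =>
      ⟨W, le_rfl, hy, L.res le_rfl (L.bracket W x x'), by
        rw [L.anchor_res, L.anchor_bracket, hx, hx']
        rfl, by rw [π.app_res, π.app_bracket, hp, hq]⟩)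
    (fun W ξ p ⟨x, hx, hp⟩ => by
      rw [← hp, π.anchor_app, hx]
      rfl)
    tangentMod_isSep
  refine ⟨τ, fun U x => hτ _ _ _ fun y hy => ⟨U, le_rfl, hy, L.res le_rfl x, L.anchor_res _ _,
    π.app_res _ _⟩⟩

theorem exists_moduleStructure_of_det_of_proj [CharZero k] (hM : M.IsSheaf) (hl : LocFree M r)
    (hr : 0 < r) (θ : DetIso L r M) (τ : FlatProjConnection k M) :
    ∃ γ : ModuleStructure L M, ∀ (U : Y.Opens) (x : L.Sec U),
      toDet r (γ.hom.app U x) = θ.hom.app U x ∧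
        toProj (γ.hom.app U x) = τ.app U (L.anchor U x) := by
  let R : ∀ W : Y.Opens, L.Sec W → At k M W → Prop := fun W x D =>
    toDet r D = θ.hom.app W x ∧ toProj D = τ.app W (L.anchor W x)
  have hres : ∀ {W V : Y.Opens} (h : V ≤ W) (x : L.Sec W) (D : At k M W), R W x D →
      R V (L.res h x) (At.res h D) := fun h x D hD => by
    refine ⟨?_, ?_⟩
    · exact (congrArg (At.res h) hD.1).trans (θ.hom.app_res h x).symm
    · rw [L.anchor_res]
      exact (congrArg ((projAtiyah k M).res h) hD.2).trans (τ.app_res h _).symm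
  have hex : ∀ (W : Y.Opens) (x : L.Sec W), ∀ y ∈ W, ∃ (V : Y.Opens) (h : V ≤ W), y ∈ V ∧
      ∃ D, R V (L.res h x) D := fun W x y hy => by
    obtain ⟨V, h, hyV, D, h1, h2⟩ := exists_toDet_toProj hl hr (θ.hom.app W x)
      (τ.app W (L.anchor W x)) ((θ.hom.anchor_app W x).trans (τ.anchor_app W _).symm) hy
    refine ⟨V, h, hyV, D, h1.trans (θ.hom.app_res h x).symm, h2.trans ?_⟩
    rw [L.anchor_res]
    exact (τ.app_res h _).symm
  obtain ⟨φ, hφ⟩ := exists_hom_of_local (L := L.toLieAlgebroid) (L' := (atiyah k M).toLieAlgebroid)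
    (atiyah_isSheaf hM) R hres hex
    (fun W x D D' h h' => eq_of_toDet_of_toProj hM.isSep hl hr (h.1.trans h'.1.symm)
      (h.2.trans h'.2.symm))
    (fun W x D z D' h h' y hy => ⟨W, le_rfl, hy, hres _ _ _ ⟨by
        rw [map_add, ← h.1, ← h'.1]
        exact toDet_add r D D', by
        rw [map_add]
        exact (map_add ((toProjHom k M).app W) D D').trans ((congrArg₂ (· + ·) h.2 h'.2).trans
          (map_add (τ.app W) (L.anchor W x) (L.anchor W z)).symm)⟩⟩)
    (fun W f x D h y hy => ⟨W, le_rfl, hy, hres _ _ _ ⟨by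
        rw [map_smul, ← h.1]
        exact toDet_smul r f D, by
        rw [map_smul]
        exact (map_smul ((toProjHom k M).app W) f D).trans ((congrArg (f • ·) h.2).trans
          (map_smul (τ.app W) f (L.anchor W x)).symm)⟩⟩)
    (fun W x D z D' h h' y hy => ⟨W, le_rfl, hy, hres _ _ _ ⟨by
        rw [θ.hom.app_bracket, ← h.1, ← h'.1]
        exact toDet_comm r D D', by
        rw [L.anchor_bracket]
        refine Eq.trans ?_ (τ.app_bracket W _ _).symm
        rw [← h.2, ← h'.2]
        exact (toProjHom k M).app_bracket W D D'⟩⟩)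
    (fun W x D h => (congrArg At.vf h.1).trans (θ.hom.anchor_app W x))
    tangentMod_isSep
  have key : ∀ (W : Y.Opens) (x : L.Sec W) (D : At k M W), R W x D → φ.app W x = D :=
    fun W x D h => hφ W x D fun y hy => ⟨W, le_rfl, hy, hres _ _ _ h⟩
  refine ⟨⟨φ, fun W f => key W _ _ ⟨?_, ?_⟩⟩, fun U x => ⟨?_, ?_⟩⟩
  · exact (toDet_scalar r f).trans (θ.hom_unit W f).symm
  · rw [L.anchor_unit]
    exact (toProj_scalar f).trans (map_zero (τ.app W)).symm
  · refine atiyah_isSep (alt_isSep 1 _) U _ _ fun y hy => ?_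
    obtain ⟨V, h, hyV, D, hD⟩ := hex U x y hy
    refine ⟨V, h, hyV, ?_⟩
    refine (congrArg (toDet r) (φ.app_res h x).symm).trans ?_
    rw [key V _ D hD, hD.1]
    exact θ.hom.app_res h x
  · refine projAtiyah_isSep hM.isSep U _ _ fun y hy => ?_
    obtain ⟨V, h, hyV, D, hD⟩ := hex U x y hy
    refine ⟨V, h, hyV, ?_⟩
    refine (congrArg toProj (φ.app_res h x).symm).trans ?_
    rw [key V _ D hD, hD.2, L.anchor_res]
    exact τ.app_res h _

/-- A module structure is the same as an isomorphism with the Atiyah algebroid of the determinant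
and a flat projective connection. -/
theorem exists_moduleStructure_equiv [CharZero k] (hL : L.IsPicard) (hM : M.IsSheaf)
    (hl : LocFree M r) (hr : 0 < r) :
    ∃ Φ : ModuleStructure L M ≃ DetIso L r M × FlatProjConnection k M,
      ∀ (γ : ModuleStructure L M) (U : Y.Opens) (x : L.Sec U),
        (Φ γ).1.hom.app U x = toDet r (γ.hom.app U x) ∧
        (Φ γ).2.app U (L.anchor U x) = toProj (γ.hom.app U x) := by
  choose τ hτ using fun γ : ModuleStructure L M => γ.exists_connection hL hM
  refine ⟨Equiv.ofBijective (fun γ => (γ.detIso hL hl hr, τ γ)) ⟨fun γ γ' h => ?_, fun ⟨θ, t⟩ => ?_⟩,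
    fun γ U x => ⟨rfl, hτ γ U x⟩⟩
  · refine ModuleStructure.ext fun U x => eq_of_toDet_of_toProj hM.isSep hl hr ?_ ?_
    · exact congrArg (fun θ : DetIso L r M => θ.hom.app U x) (Prod.ext_iff.1 h).1
    · have h2 : τ γ = τ γ' := (Prod.ext_iff.1 h).2
      exact (hτ γ U x).symm.trans ((congrArg (fun t => t.app U (L.anchor U x)) h2).trans (hτ γ' U x))
  · obtain ⟨γ, hγ⟩ := exists_moduleStructure_of_det_of_proj hM hl hr θ t
    refine ⟨γ, Prod.ext (DetIso.ext fun U x => (hγ U x).1) (LieAlgebroid.Hom.ext fun U ξ => ?_)⟩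
    refine projAtiyah_isSep hM.isSep U _ _ fun y hy => ?_
    obtain ⟨V, h, hyV, x, hx⟩ := hL.surjective U ξ y hy
    refine ⟨V, h, hyV, ?_⟩
    have h1 := (hτ γ V x).trans (hγ V x).2
    rw [hx] at h1
    exact ((τ γ).app_res h ξ).symm.trans (h1.trans (t.app_res h ξ))

end DetProj

end LagQuant

end

open LagQuant in
theorem mainTheorem3 {k : Type u} [Field k] [CharZero k] {X Y : Scheme.{u}}
    [X.Over (Spec (.of k))] [Y.Over (Spec (.of k))] (n : ℕ)
    [SmoothOfRelativeDimension (2 * n) (X ↘ Spec (.of k))]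
    [SmoothOfRelativeDimension n (Y ↘ Spec (.of k))]
    (j : Y ⟶ X) [IsClosedImmersion j] [j.IsOver (Spec (.of k))]
    (ω : SymplecticForm k X) (hω : IsIsotropic j ω) (Q : DefQuant ω)
    (r : ℕ) (hr : 0 < r) (E : Y.Modules) (hE : IsVectorBundle E r) :
    Nonempty (TorAlgebroid j Q.toQuantData) ∧
    ∀ T : TorAlgebroid j Q.toQuantData, T.alg.IsPicard ∧ Nonempty (PlusAlgebroid n T) ∧
    ∀ P : PlusAlgebroid n T,
      (∀ F : QuantModule j Q.toQuantData E 2,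
        (∃ F' : QuantModule j Q.toQuantData E 3, F.IsExtension F') →
          ∃! γ : ModuleStructure P.alg (ModPresheaf.of E), IsInduced F γ) ∧
      (∃ (ω₁ : H2F k X) (jω₁ c₁K : H2F k Y),
        (∀ c, Q.HasFirstClass c ↔ c = ω₁) ∧
        IsPullbackClass j ω₁ jω₁ ∧
        (∀ c, HasClass T.alg c ↔ c = jω₁) ∧
        (∀ c, HasClass (atiyah k (forms k Y n)) c ↔ c = c₁K) ∧
        (∀ c, HasClass P.alg c ↔ c = (1 / 2 : k) • c₁K + jω₁)) ∧
      ∃ Φ : ModuleStructure P.alg (ModPresheaf.of E) ≃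
          DetIso P.alg r (ModPresheaf.of E) × FlatProjConnection k (ModPresheaf.of E),
        ∀ (γ : ModuleStructure P.alg (ModPresheaf.of E)) (U : Y.Opens) (x : P.alg.Sec U),
          (Φ γ).1.hom.app U x = toDet r (γ.hom.app U x) ∧
          (Φ γ).2.app U (P.alg.anchor U x) = toProj (γ.hom.app U x) := by
  obtain ⟨D⟩ := exists_lagDatum hω n Q
  obtain ⟨zK, hzK⟩ := exists_represents_line (k := k) (alt_isSep n _) (forms_locFree (k := k) (Y := Y) n)
  refine ⟨⟨D.torAlgebroid⟩, fun T => ⟨D.isPicard T, nonempty_combination n (D.isPicard T),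
    fun P => ⟨fun F ⟨F', hF⟩ => QuantModule.existsUnique_isInduced D P hF,
      ⟨H2F.mk D.z, H2F.mk D.w, H2F.mk zK, ?_, D.isPullbackClass, ?_, ?_, ?_⟩,
      exists_moduleStructure_equiv P.isPicard (of_isSheaf E) hE hr⟩⟩⟩
  · exact fun c => DefQuant.hasFirstClass_iff (2 * n) D.first c
  · exact fun c => (D.represents T).hasClass_iff (D.isPicard T).injective (D.isPicard T).exact c
  · exact fun c => hzK.hasClass_iff (atiyah_unit_injective one_pos (forms_locFree (k := k) n))
      (atiyah_line_exact (alt_isSep n _) (forms_locFree (k := k) n)) c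
  · exact fun c => (P.represents (D.represents T) hzK).hasClass_iff P.isPicard.injective
      P.isPicard.exact c
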